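/- **Singular twisted virtual braids.** Let $STVB_n$ be the monoid of singular twisted virtual braids on $n$ strands, i.e. the monoid with generators $\sigma_i,\sigma_i^{-1},v_i,\tau_i$ ($1\le i\le n-1$; positive, negative, virtual and singular crossing of the $i$-th and $(i+1)$-st strand) and $\gamma_i$ ($1\le i\le n$; a bar on the $i$-th strand) and the relations (for all indices for which they make sense) $\sigma_i\sigma_i^{-1}=\sigma_i^{-1}\sigma_i=v_i^2=\gamma_i^2=e$; $x_iy_j=y_jx_i$ for $|i-j|>1$ and $x,y\in\{\sigma,v,\tau\}$; $\gamma_i\gamma_j=\gamma_j\gamma_i$; $x_i\gamma_j=\gamma_jx_i$ for $j\ne i,i+1$ and $x\in\{\sigma,v,\tau\}$; $\sigma_i\sigma_{i+1}\sigma_i=\sigma_{i+1}\sigma_i\sigma_{i+1}$; $v_ix_{i+1}v_i=v_{i+1}x_iv_{i+1}$ for $x\in\{\sigma,v,\tau\}$; $\gamma_{i+1}v_i=v_i\gamma_i$; $v_ix_iv_i=\gamma_{i+1}\gamma_ix_i\gamma_i\gamma_{i+1}$ for $x\in\{\sigma,\tau\}$; $\sigma_i\tau_i=\tau_i\sigma_i$;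 $\sigma_i\sigma_{i+1}\tau_i=\tau_{i+1}\sigma_i\sigma_{i+1}$. Braids are read from top to bottom, all strands are oriented downwards, and in $\sigma_i$ the strand that comes from the upper right passes over. Let $\iota:STVB_n\to STVB_{n+1}$ add a trivial strand on the right. **Links.** An oriented singular twisted link diagram is a generic immersion of finitely many oriented circles in the plane whose double points are marked as real (with over/under information), virtual or singular crossings, with finitely many bars on the curves. Two diagrams are isotopic if they are related by planar isotopy and a finite sequence of the following moves, with all orientations: the classical Reidemeister moves; the virtual ones (removal of a virtual kink or a virtual bigon; a virtual strand passes across a virtual, real or singular crossing); a bar passes through a virtual crossing; two adjacent bars on a strand cancel; a real or singular crossing with a bar on each of its four ends is replaced by the same crossing between two virtual crossings ($\gamma_{i+1}\gamma_ix_i\gamma_i\gamma_{i+1}\leftrightarrow v_ix_iv_i$); a strand passes over or under a singular crossing; a real crossing passes through a singular crossing ($\sigma_i^{\pm1}\tau_i\leftrightarrow\tau_i\sigma_i^{\pm1}$). The closure of a braid joins the bottom end of each position to the top end of the same position by parallel arcs on the right of the braid, without crossings or bars. **$L_v$-moves.** For $1\le p\le n+1$ put $r_p=v_pv_{p+1}\cdots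 v_n$ and $l_p=v_n\cdots v_{p+1}v_p$ in $STVB_{n+1}$ (empty products for $p=n+1$), and for $\alpha,\beta\in STVB_n$, $K\in STVB_{n+1}$ and $1\le j,p\le n+1$ put $$P_{j,p}(\alpha,K,\beta)=r_j\,\iota(\alpha)\,l_p\,K\,r_p\,\iota(\beta)\,l_j\in STVB_{n+1}.$$ (A strand of $\alpha\beta$ is cut between $\alpha$ and $\beta$ and its ends are pulled to the bottom and the top at position $j$, the new strand crossing everything virtually outside $K$.) The moves are, for all $n$, $\alpha,\beta$ and all admissible $j,i$: * ST1 (virtual and real $L_v$-moves): $\alpha\beta\leftrightarrow P_{j,i+1}(\alpha,K,\beta)$ with $K=v_i$ or $K=\sigma_i^{\pm1}$, $1\le i\le n$; * ST2 (right and left under-threaded moves): $\alpha\beta\leftrightarrow P_{j,i+2}(\alpha,\sigma_{i+1}^{-1}v_i\sigma_{i+1},\beta)$ and $\alpha\beta\leftrightarrow P_{j,i}(\alpha,\sigma_iv_{i+1}\sigma_i^{-1},\beta)$, $1\le i\le n-1$; * ST3 (right and left $rs$-threaded moves): $P_{j,i+2}(\alpha,\tau_{i+1}v_i\sigma_{i+1}^{\pm1},\beta)\leftrightarrow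 P_{j,i+2}(\alpha,\sigma_{i+1}^{\pm1}v_i\tau_{i+1},\beta)$ and $P_{j,i}(\alpha,\tau_iv_{i+1}\sigma_i^{\pm1},\beta)\leftrightarrow P_{j,i}(\alpha,\sigma_i^{\pm1}v_{i+1}\tau_i,\beta)$, with equal signs on both sides of a move, $1\le i\le n-1$; * ST4 (singular, real and twist conjugation): $\tau_i\alpha\leftrightarrow\alpha\tau_i$, $\ \sigma_i^{\pm1}\alpha\leftrightarrow\alpha\sigma_i^{\pm1}$, $\ \gamma_i\alpha\leftrightarrow\alpha\gamma_i$. Two singular twisted virtual braids, possibly of different degrees, are $L_v$-equivalent if they are related by a finite sequence of these moves (braid isotopy being equality in the monoids $STVB_n$). **Theorem.** Two singular twisted virtual braids $a\in STVB_m$ and $b\in STVB_n$ have isotopic closures if and only if they are $L_v$-equivalent. -/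

import Mathlib

namespace SingTwist

/-! ### Singular twisted virtual braids

Strands are numbered from `0`, so a generator between the strands `i` and `i + 1` of a braid on `n`
strands needs `i + 1 < n`, and a bar on the strand `i` needs `i < n`. Braids are read from top to
bottom, and a product is read from left to right. -/

/-- The standard generators of the monoid of singular twisted virtual braids on `n` strands. -/
inductive Gen (n : ℕ) : Type
  /-- the positive real crossing of the strands `i`, `i + 1` -/
  | sigma (i : ℕ) (h : i + 1 < n)
  /-- the negative real crossing of the strands `i`, `i + 1` -/
  | sigmaInv (i : ℕ) (h : i + 1 < n)
  /-- the virtual crossing of the strands `i`, `i + 1` -/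
  | virt (i : ℕ) (h : i + 1 < n)
  /-- the singular crossing of the strands `i`, `i + 1` -/
  | tau (i : ℕ) (h : i + 1 < n)
  /-- a bar on the strand `i` -/
  | gamma (i : ℕ) (h : i < n)

/-- `|i - j| > 1`. -/
def Far (i j : ℕ) : Prop := i + 1 < j ∨ j + 1 < i

open Gen in
/-- The defining relations of the monoid of singular twisted virtual braids on `n` strands. -/
inductive BraidRel (n : ℕ) : List (Gen n) → List (Gen n) → Prop
  | sigma_far (i j hi hj) : Far i j →
      BraidRel n [sigma i hi, sigma j hj] [sigma j hj, sigma i hi]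
  | sigma_braid (i hi hj) :
      BraidRel n [sigma i hi, sigma (i + 1) hj, sigma i hi]
        [sigma (i + 1) hj, sigma i hi, sigma (i + 1) hj]
  | virt_sq (i hi) : BraidRel n [virt i hi, virt i hi] []
  | virt_far (i j hi hj) : Far i j →
      BraidRel n [virt i hi, virt j hj] [virt j hj, virt i hi]
  | virt_braid (i hi hj) :
      BraidRel n [virt i hi, virt (i + 1) hj, virt i hi]
        [virt (i + 1) hj, virt i hi, virt (i + 1) hj]
  | sigma_virt_far (i j hi hj) : Far i j →
      BraidRel n [sigma i hi, virt j hj] [virt j hj, sigma i hi]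
  | virt_sigma_virt (i hi hj) :
      BraidRel n [virt i hi, sigma (i + 1) hj, virt i hi]
        [virt (i + 1) hj, sigma i hi, virt (i + 1) hj]
  | gamma_sq (i hi) : BraidRel n [gamma i hi, gamma i hi] []
  | gamma_comm (i j hi hj) : BraidRel n [gamma i hi, gamma j hj] [gamma j hj, gamma i hi]
  | gamma_virt_far (i j hi hj) : j ≠ i → j ≠ i + 1 →
      BraidRel n [gamma j hj, virt i hi] [virt i hi, gamma j hj]
  | sigma_gamma_far (i j hi hj) : j ≠ i → j ≠ i + 1 →
      BraidRel n [sigma i hi, gamma j hj] [gamma j hj, sigma i hi]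
  | gamma_virt (i hi hj hk) :
      BraidRel n [gamma (i + 1) hj, virt i hi] [virt i hi, gamma i hk]
  | sigma_twist (i hi hj hk) :
      BraidRel n [virt i hi, sigma i hi, virt i hi]
        [gamma (i + 1) hj, gamma i hk, sigma i hi, gamma i hk, gamma (i + 1) hj]
  | sigma_inv (i hi) : BraidRel n [sigma i hi, sigmaInv i hi] []
  | inv_sigma (i hi) : BraidRel n [sigmaInv i hi, sigma i hi] []
  | tau_far (i j hi hj) : Far i j →
      BraidRel n [tau i hi, tau j hj] [tau j hj, tau i hi]
  | sigma_tau_far (i j hi hj) : Far i j →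
      BraidRel n [sigma i hi, tau j hj] [tau j hj, sigma i hi]
  | sigma_tau (i hi) : BraidRel n [sigma i hi, tau i hi] [tau i hi, sigma i hi]
  | sigma_sigma_tau (i hi hj) :
      BraidRel n [sigma i hi, sigma (i + 1) hj, tau i hi]
        [tau (i + 1) hj, sigma i hi, sigma (i + 1) hj]
  | tau_virt_far (i j hi hj) : Far i j →
      BraidRel n [tau i hi, virt j hj] [virt j hj, tau i hi]
  | virt_tau_virt (i hi hj) :
      BraidRel n [virt i hi, tau (i + 1) hj, virt i hi]
        [virt (i + 1) hj, tau i hi, virt (i + 1) hj]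
  | tau_gamma_far (i j hi hj) : j ≠ i → j ≠ i + 1 →
      BraidRel n [tau i hi, gamma j hj] [gamma j hj, tau i hi]
  | tau_twist (i hi hj hk) :
      BraidRel n [virt i hi, tau i hi, virt i hi]
        [gamma (i + 1) hj, gamma i hk, tau i hi, gamma i hk, gamma (i + 1) hj]

/-- The defining relations, on the free monoid. -/
def braidRels (n : ℕ) (a b : FreeMonoid (Gen n)) : Prop := BraidRel n a.toList b.toList

/-- The monoid of singular twisted virtual braids on `n` strands. -/
abbrev STVB (n : ℕ) : Type := PresentedMonoid (braidRels n)

/-- The braid of a generator. -/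
def STVB.of {n : ℕ} (g : Gen n) : STVB n := PresentedMonoid.of (braidRels n) g

/-- A generator of degree `n`, with a trivial strand added on the right. -/
def Gen.widen {n : ℕ} : Gen n → Gen (n + 1)
  | .sigma i h => .sigma i (h.trans n.lt_succ_self)
  | .sigmaInv i h => .sigmaInv i (h.trans n.lt_succ_self)
  | .virt i h => .virt i (h.trans n.lt_succ_self)
  | .tau i h => .tau i (h.trans n.lt_succ_self)
  | .gamma i h => .gamma i (h.trans n.lt_succ_self)

theorem BraidRel.widen {n : ℕ} {a b : List (Gen n)} (h : BraidRel n a b) :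
    BraidRel (n + 1) (a.map Gen.widen) (b.map Gen.widen) := by
  cases h with
  | sigma_tau i => exact .sigma_tau i _
  | _ => constructor <;> assumption

theorem lift_widen_eq {n : ℕ} (a : FreeMonoid (Gen n)) :
    FreeMonoid.lift (fun g : Gen n => STVB.of g.widen) a =
      PresentedMonoid.mk (braidRels (n + 1)) (FreeMonoid.ofList (a.toList.map Gen.widen)) := by
  induction a using FreeMonoid.recOn with
  | one => rfl
  | of_mul x xs ih => rw [map_mul, ih]; rfl

/-- Adding a trivial strand on the right of a braid. -/
def STVB.widen (n : ℕ) : STVB n →* STVB (n + 1) :=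
  PresentedMonoid.lift (fun g : Gen n => STVB.of g.widen) fun a b h => by
    rw [lift_widen_eq, lift_widen_eq]
    exact PresentedMonoid.mk_eq_mk_of_rel (BraidRel.widen h)

/-! ### Singular twisted link diagrams

An oriented diagram in the plane, in general position with respect to the height, is read from top
to bottom as a word of elementary layers, each of which contains one local maximum, one local
minimum, one crossing or one bar, together with vertical strands. -/

/-- The decoration of a double point. The two real crossings are told apart by the branch that
passes over: the one that comes from the upper left, or the one that comes from the upper right. -/
inductive Crossing : Type
  | leftOver | rightOver | virtual | singular

/-- The same double point, seen after a quarter turn of the plane. -/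
def Crossing.turn : Crossing → Crossing
  | .leftOver => .rightOver
  | .rightOver => .leftOver
  | .virtual => .virtual
  | .singular => .singular

/-- The other real crossing on the same two branches. -/
def Crossing.switch : Crossing → Crossing := Crossing.turn

/-- A double point is real (classical) if it is one of the two over / under crossings. -/
def Crossing.IsReal (c : Crossing) : Prop := c = .leftOver ∨ c = .rightOver

/-- An elementary layer. The number `i` is the number of vertical strands on its left.
The orientation of a strand is `true` if it runs down and `false` if it runs up. -/
inductive Layer : Type
  /-- a local maximum, whose left leg has orientation `o` -/
  | birth (i : ℕ) (o : Bool)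
  /-- a local minimum -/
  | death (i : ℕ)
  /-- a double point of the strands `i` and `i + 1` -/
  | cross (i : ℕ) (c : Crossing)
  /-- a bar on the strand `i` -/
  | bar (i : ℕ)

/-- The layer leads from the list of the orientations of the strands above it
to the list of the orientations of the strands below it. -/
inductive Layer.Leads : Layer → List Bool → List Bool → Prop
  | birth (l r : List Bool) (o : Bool) : Leads (.birth l.length o) (l ++ r) (l ++ o :: (!o) :: r)
  | death (l r : List Bool) (o : Bool) : Leads (.death l.length) (l ++ o :: (!o) :: r) (l ++ r)
  | cross (l r : List Bool) (c : Crossing) (x y : Bool) :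
      Leads (.cross l.length c) (l ++ x :: y :: r) (l ++ y :: x :: r)
  | bar (l r : List Bool) (x : Bool) : Leads (.bar l.length) (l ++ x :: r) (l ++ x :: r)

/-- The layers fit together, and lead from the upper orientations to the lower ones. -/
inductive Leads : List Layer → List Bool → List Bool → Prop
  | nil (s : List Bool) : Leads [] s s
  | cons {e : Layer} {w : List Layer} {s t u : List Bool} :
      e.Leads s t → Leads w t u → Leads (e :: w) s u

/-- An oriented singular twisted link diagram. -/
def Diagram : Type := {w : List Layer // Leads w [] []}

/-- The position of a layer. -/
def Layer.pos : Layer → ℕ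
  | .birth i _ => i
  | .death i => i
  | .cross i _ => i
  | .bar i => i

/-- The layer, moved by `k` strands to the right. -/
def Layer.shift (k : ℕ) : Layer → Layer
  | .birth i o => .birth (i + k) o
  | .death i => .death (i + k)
  | .cross i c => .cross (i + k) c
  | .bar i => .bar (i + k)

/-- The number of ends of the elementary piece of a layer on its upper boundary. -/
def Layer.top : Layer → ℕ
  | .birth _ _ => 0
  | .death _ => 2
  | .cross _ _ => 2
  | .bar _ => 1

/-- The number of ends of the elementary piece of a layer on its lower boundary. -/
def Layer.bottom : Layer → ℕ
  | .birth _ _ => 2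
  | .death _ => 0
  | .cross _ _ => 2
  | .bar _ => 1

open Layer Crossing in
/-- The local moves: isotopy of the plane, and the Reidemeister moves for singular twisted link
diagrams. The orientations of the strands are arbitrary. -/
inductive LocalMove : List Layer → List Layer → Prop
  -- planar isotopy: two pieces side by side exchange their heights
  -- (`f` stands for the right-hand piece, its position being counted from the left-hand one)
  | exchange (e f : Layer) :
      LocalMove [e, f.shift (e.pos + e.bottom)] [f.shift (e.pos + e.top), e]
  -- planar isotopy: a maximum and a minimum on the same strand cancel
  | zigzag_left (i o) : LocalMove [birth i o, death (i + 1)] []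
  | zigzag_right (i o) : LocalMove [birth (i + 1) o, death i] []
  -- planar isotopy: a double point or a bar passes through a maximum or a minimum
  | birth_cross (i o c) :
      LocalMove [birth i o, cross (i + 1) c] [birth (i + 1) o, cross i c.turn]
  | cross_death (i c) :
      LocalMove [cross (i + 1) c, death i] [cross i c.turn, death (i + 1)]
  | birth_bar (i o) : LocalMove [birth i o, bar i] [birth i o, bar (i + 1)]
  | bar_death (i) : LocalMove [bar i, death i] [bar (i + 1), death i]
  -- classical Reidemeister moves
  | real_kink_right (i o c) : c.IsReal →
      LocalMove [birth (i + 1) o, cross i c, death (i + 1)] []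
  | real_kink_left (i o c) : c.IsReal →
      LocalMove [birth i o, cross (i + 1) c, death i] []
  | real_bigon (i c) : c.IsReal → LocalMove [cross i c, cross i c.switch] []
  | real_triangle (i c) : c.IsReal →
      LocalMove [cross i c, cross (i + 1) c, cross i c] [cross (i + 1) c, cross i c, cross (i + 1) c]
  -- virtual moves
  | virtual_kink_right (i o) :
      LocalMove [birth (i + 1) o, cross i virtual, death (i + 1)] []
  | virtual_kink_left (i o) :
      LocalMove [birth i o, cross (i + 1) virtual, death i] []
  | virtual_bigon (i) : LocalMove [cross i virtual, cross i virtual] []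
  -- a virtual strand passes across a double point of any kind
  | virtual_triangle (i c) :
      LocalMove [cross i virtual, cross (i + 1) c, cross i virtual]
        [cross (i + 1) virtual, cross i c, cross (i + 1) virtual]
  -- moves with bars
  | bar_virtual_left (i) : LocalMove [bar i, cross i virtual] [cross i virtual, bar (i + 1)]
  | bar_virtual_right (i) : LocalMove [bar (i + 1), cross i virtual] [cross i virtual, bar i]
  | bar_bar (i) : LocalMove [bar i, bar i] []
  -- a real or singular crossing with bars on its four ends
  | bar_twist (i c) : c ≠ virtual →
      LocalMove [bar (i + 1), bar i, cross i c, bar i, bar (i + 1)]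
        [cross i virtual, cross i c, cross i virtual]
  -- a strand passes over or under a singular crossing
  | singular_triangle (i c) : c.IsReal →
      LocalMove [cross i c, cross (i + 1) c, cross i singular]
        [cross (i + 1) singular, cross i c, cross (i + 1) c]
  -- a real crossing passes through a singular crossing
  | singular_flip (i c) : c.IsReal →
      LocalMove [cross i c, cross i singular] [cross i singular, cross i c]

/-- Two diagrams differ by one local move, applied somewhere in the diagram. -/
def Diagram.Step (D D' : Diagram) : Prop :=
  ∃ A B L R : List Layer, LocalMove L R ∧ D.1 = A ++ L ++ B ∧ D'.1 = A ++ R ++ B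

/-- Singular twisted links: the classes of the diagrams under the equivalence relation that is
generated by the local moves. -/
def Link : Type := Quot Diagram.Step

/-- The link of a diagram. -/
def Diagram.link (D : Diagram) : Link := Quot.mk _ D

/-! ### The closure of a braid -/

/-- The layer of a generator. In the positive real crossing of two downward strands the
strand from the upper right passes over. -/
def Gen.layer {n : ℕ} : Gen n → Layer
  | .sigma i _ => .cross i .rightOver
  | .sigmaInv i _ => .cross i .leftOver
  | .virt i _ => .cross i .virtual
  | .tau i _ => .cross i .singular
  | .gamma i _ => .bar i

/-- `n` nested local maxima, the left legs running down. -/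
def births (n : ℕ) : List Layer := (List.range n).map fun i => Layer.birth i true

/-- `n` nested local minima. -/
def deaths (n : ℕ) : List Layer := (List.range n).reverse.map Layer.death

/-- The word of the closure of a braid diagram: the bottom ends of the strands are joined to the
top ends by `n` parallel strands which run up on the right of the braid. -/
def closureWord {n : ℕ} (w : List (Gen n)) : List Layer :=
  births n ++ w.map Gen.layer ++ deaths n

theorem Leads.append {v w : List Layer} {s t u : List Bool} (h : Leads v s t) (h' : Leads w t u) :
    Leads (v ++ w) s u := by
  induction h with
  | nil => exact h'
  | cons e _ ih => exact .cons e (ih h')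

/-- The orientations of the `2n` strands at the levels of the braid. -/
def level (n : ℕ) : List Bool := List.replicate n true ++ List.replicate n false

theorem level_succ (n : ℕ) :
    level (n + 1) = List.replicate n true ++ true :: (!true) :: List.replicate n false := by
  simp only [level, List.replicate_succ' (n := n) (a := true), List.replicate_succ (a := false)]
  simp

theorem leads_births (n : ℕ) : Leads (births n) [] (level n) := by
  induction n with
  | zero => exact .nil _
  | succ n ih =>
    have h : births (n + 1) = births n ++ [Layer.birth n true] := by
      simp [births, List.range_succ]
    rw [h]
    refine ih.append (.cons ?_ (.nil _))
    have := Layer.Leads.birth (List.replicate n true) (List.replicate n false) true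
    rw [← level_succ, List.length_replicate] at this
    exact this

theorem leads_deaths (n : ℕ) : Leads (deaths n) (level n) [] := by
  induction n with
  | zero => exact .nil _
  | succ n ih =>
    have h : deaths (n + 1) = Layer.death n :: deaths n := by
      simp [deaths, List.range_succ]
    rw [h]
    refine .cons ?_ ih
    have := Layer.Leads.death (List.replicate n true) (List.replicate n false) true
    rw [← level_succ, List.length_replicate] at this
    exact this

theorem Gen.leads {n : ℕ} (g : Gen n) : g.layer.Leads (level n) (level n) := by
  have key : ∀ (i : ℕ) (c : Crossing), i + 1 < n →
      (Layer.cross i c).Leads (level n) (level n) := by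
    intro i c h
    obtain ⟨k, rfl⟩ : ∃ k, n = i + 2 + k := ⟨n - (i + 2), by omega⟩
    have := Layer.Leads.cross (List.replicate i true)
      (List.replicate k true ++ List.replicate (i + 2 + k) false) c true true
    have e : level (i + 2 + k) = List.replicate i true ++ true :: true ::
        (List.replicate k true ++ List.replicate (i + 2 + k) false) := by
      rw [level, List.replicate_add, List.replicate_add]
      simp [List.replicate_succ, List.append_assoc]
    rw [← e, List.length_replicate] at this
    exact this
  cases g with
  | sigma i h => exact key i _ h
  | sigmaInv i h => exact key i _ h
  | virt i h => exact key i _ h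
  | tau i h => exact key i _ h
  | gamma i h =>
    obtain ⟨k, rfl⟩ : ∃ k, n = i + 1 + k := ⟨n - (i + 1), by omega⟩
    have := Layer.Leads.bar (List.replicate i true)
      (List.replicate k true ++ List.replicate (i + 1 + k) false) true
    have e : level (i + 1 + k) = List.replicate i true ++ true ::
        (List.replicate k true ++ List.replicate (i + 1 + k) false) := by
      rw [level, List.replicate_add, List.replicate_add]
      simp [List.replicate_succ, List.append_assoc]
    rw [← e, List.length_replicate] at this
    exact this

theorem leads_closureWord {n : ℕ} (w : List (Gen n)) : Leads (closureWord w) [] [] := by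
  refine ((leads_births n).append ?_).append (leads_deaths n)
  induction w with
  | nil => exact .nil _
  | cons g w ih => exact .cons g.leads ih

/-- The closure of a braid diagram. -/
def closureDiagram {n : ℕ} (w : List (Gen n)) : Diagram := ⟨closureWord w, leads_closureWord w⟩

theorem far_cases {i j : ℕ} (h : Far i j) (c d : Crossing) :
    LocalMove [.cross i c, .cross j d] [.cross j d, .cross i c] ∨
      LocalMove [.cross j d, .cross i c] [.cross i c, .cross j d] := by
  rcases h with h | h
  · obtain ⟨k, rfl⟩ : ∃ k, j = k + (i + 2) := ⟨j - (i + 2), by omega⟩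
    exact .inl (.exchange (.cross i c) (.cross k d))
  · obtain ⟨k, rfl⟩ : ∃ k, i = k + (j + 2) := ⟨i - (j + 2), by omega⟩
    exact .inr (.exchange (.cross j d) (.cross k c))

theorem far_bar_cases {i j : ℕ} (h : j ≠ i) (h' : j ≠ i + 1) (c : Crossing) :
    LocalMove [.cross i c, .bar j] [.bar j, .cross i c] ∨
      LocalMove [.bar j, .cross i c] [.cross i c, .bar j] := by
  rcases lt_or_gt_of_ne h with h | h
  · obtain ⟨k, rfl⟩ : ∃ k, i = k + (j + 1) := ⟨i - (j + 1), by omega⟩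
    exact .inr (.exchange (.bar j) (.cross k c))
  · obtain ⟨k, rfl⟩ : ∃ k, j = k + (i + 2) := ⟨j - (i + 2), by omega⟩
    exact .inl (.exchange (.cross i c) (.bar k))

theorem BraidRel.localMove {n : ℕ} {a b : List (Gen n)} (h : BraidRel n a b) :
    LocalMove (a.map Gen.layer) (b.map Gen.layer) ∨
      LocalMove (b.map Gen.layer) (a.map Gen.layer) ∨ a = b := by
  have sw : ∀ {p q r : Prop}, p ∨ q → p ∨ q ∨ r := by tauto
  have sw' : ∀ {p q r : Prop}, q ∨ p → p ∨ q ∨ r := by tauto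
  cases h with
  | sigma_far i j hi hj h => exact sw (far_cases h _ _)
  | sigma_braid i => exact .inl (.real_triangle i _ (.inr rfl))
  | virt_sq i => exact .inl (.virtual_bigon i)
  | virt_far i j hi hj h => exact sw (far_cases h _ _)
  | virt_braid i => exact .inl (.virtual_triangle i _)
  | sigma_virt_far i j hi hj h => exact sw (far_cases h _ _)
  | virt_sigma_virt i => exact .inl (.virtual_triangle i _)
  | gamma_sq i => exact .inl (.bar_bar i)
  | gamma_comm i j =>
    rcases lt_trichotomy i j with h | rfl | h
    · obtain ⟨k, rfl⟩ : ∃ k, j = k + (i + 1) := ⟨j - (i + 1), by omega⟩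
      exact .inl (.exchange (.bar i) (.bar k))
    · exact .inr (.inr rfl)
    · obtain ⟨k, rfl⟩ : ∃ k, i = k + (j + 1) := ⟨i - (j + 1), by omega⟩
      exact .inr (.inl (.exchange (.bar j) (.bar k)))
  | gamma_virt_far i j hi hj h h' => exact sw' (far_bar_cases h h' _)
  | sigma_gamma_far i j hi hj h h' => exact sw (far_bar_cases h h' _)
  | gamma_virt i => exact .inl (.bar_virtual_right i)
  | sigma_twist i => exact .inr (.inl (.bar_twist i _ (by simp)))
  | sigma_inv i => exact .inl (.real_bigon i _ (.inr rfl))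
  | inv_sigma i => exact .inl (.real_bigon i _ (.inl rfl))
  | tau_far i j hi hj h => exact sw (far_cases h _ _)
  | sigma_tau_far i j hi hj h => exact sw (far_cases h _ _)
  | sigma_tau i => exact .inl (.singular_flip i _ (.inr rfl))
  | sigma_sigma_tau i => exact .inl (.singular_triangle i _ (.inr rfl))
  | tau_virt_far i j hi hj h => exact sw (far_cases h _ _)
  | virt_tau_virt i => exact .inl (.virtual_triangle i _)
  | tau_gamma_far i j hi hj h h' => exact sw (far_bar_cases h h' _)
  | tau_twist i => exact .inr (.inl (.bar_twist i _ (by simp)))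

theorem closureDiagram_link_eq {n : ℕ} {a b : List (Gen n)} (h : BraidRel n a b)
    (x y : List (Gen n)) :
    (closureDiagram (x ++ a ++ y)).link = (closureDiagram (x ++ b ++ y)).link := by
  have e : ∀ c : List (Gen n), closureWord (x ++ c ++ y) =
      (births n ++ x.map Gen.layer) ++ c.map Gen.layer ++ (y.map Gen.layer ++ deaths n) := by
    intro c
    simp [closureWord]
  rcases h.localMove with h | h | rfl
  · exact Quot.sound ⟨_, _, _, _, h, e a, e b⟩
  · exact (Quot.sound ⟨_, _, _, _, h, e b, e a⟩).symm
  · rfl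

/-- The congruence of having the same closure in every context. -/
def closureCon (n : ℕ) : Con (FreeMonoid (Gen n)) where
  r a b := ∀ x y : List (Gen n), (closureDiagram (x ++ a.toList ++ y)).link =
    (closureDiagram (x ++ b.toList ++ y)).link
  iseqv := ⟨fun _ _ _ => rfl, fun h x y => (h x y).symm, fun h h' x y => (h x y).trans (h' x y)⟩
  mul' := by
    intro a b c d h h' x y
    have h1 := h x (c.toList ++ y)
    have h2 := h' (x ++ b.toList) y
    simp only [FreeMonoid.toList_mul, List.append_assoc] at h1 h2 ⊢
    exact h1.trans h2

/-- The closure of a singular twisted virtual braid, a singular twisted link. -/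
def STVB.closure {n : ℕ} : STVB n → Link :=
  Quotient.lift (fun a : FreeMonoid (Gen n) => (closureDiagram a.toList).link) fun a b h => by
    have hle : conGen (braidRels n) ≤ closureCon n :=
      Con.conGen_le.2 fun a b h x y => closureDiagram_link_eq h x y
    have := hle h [] []
    simpa using this

/-! ### `L_v`-moves -/

/-- The generator `σ_i` (`true`) or its inverse (`false`). -/
def realGen {n : ℕ} (e : Bool) (i : ℕ) (h : i + 1 < n) : STVB n :=
  match e with
  | true => STVB.of (.sigma i h)
  | false => STVB.of (.sigmaInv i h)

/-- The generator `v_i`. -/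
def virtGen {n : ℕ} (i : ℕ) (h : i + 1 < n) : STVB n := STVB.of (.virt i h)

/-- The generator `τ_i`. -/
def tauGen {n : ℕ} (i : ℕ) (h : i + 1 < n) : STVB n := STVB.of (.tau i h)

/-- The generator `γ_i`. -/
def gammaGen {n : ℕ} (i : ℕ) (h : i < n) : STVB n := STVB.of (.gamma i h)

/-- `v_p v_{p+1} ⋯ v_{n-1}` on `n + 1` strands: the strand at `p` runs to the rightmost position
and crosses the others virtually. -/
def runRight (n p : ℕ) : STVB (n + 1) :=
  (((List.finRange n).filter fun q => p ≤ q.val).map fun q =>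
    virtGen q.val (Nat.succ_lt_succ q.isLt)).prod

/-- `v_{n-1} ⋯ v_{p+1} v_p` on `n + 1` strands: the rightmost strand runs to the position `p`
and crosses the others virtually. -/
def runLeft (n p : ℕ) : STVB (n + 1) :=
  (((List.finRange n).filter fun q => p ≤ q.val).reverse.map fun q =>
    virtGen q.val (Nat.succ_lt_succ q.isLt)).prod

/-- A strand of the braid `α * β` is cut between `α` and `β`, and its two ends are pulled to the
bottom and to the top, so that a new pair of ends arises, both in the position `j`.
The new strand crosses the rest of the braid virtually, except in the piece `K`, which stands at
the place of the cut; there the new strand comes from the position `p` and goes to the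
position `p`. -/
def pulled {n : ℕ} (j p : ℕ) (α K β : STVB (n + 1)) : STVB (n + 1) :=
  runRight n j * α * (runLeft n p * K * runRight n p) * β * runLeft n j

/-- The `L_v`-moves on singular twisted virtual braids, of all degrees. -/
inductive LvMove : (Σ n, STVB n) → (Σ n, STVB n) → Prop
  /-- the virtual move of type 1: the strand `i` is cut, with an in-box virtual crossing -/
  | virtual_one {n : ℕ} (α β : STVB n) (j i : ℕ) (hj : j ≤ n) (hi : i + 1 < n + 1) :
      LvMove ⟨n, α * β⟩
        ⟨n + 1, pulled j (i + 1) (STVB.widen n α) (virtGen i hi) (STVB.widen n β)⟩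
  /-- the real moves of type 1, with an in-box real crossing of either sign -/
  | real_one {n : ℕ} (e : Bool) (α β : STVB n) (j i : ℕ) (hj : j ≤ n) (hi : i + 1 < n + 1) :
      LvMove ⟨n, α * β⟩
        ⟨n + 1, pulled j (i + 1) (STVB.widen n α) (realGen e i hi) (STVB.widen n β)⟩
  /-- the right move of type 2: the strand `i` is cut, and its virtual kink is pulled
  to the right under the thread `i + 1` -/
  | under_right {n : ℕ} (α β : STVB n) (j i : ℕ) (hj : j ≤ n) (hi : i + 1 < n + 1)
      (hi' : i + 1 + 1 < n + 1) :
      LvMove ⟨n, α * β⟩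
        ⟨n + 1, pulled j (i + 2) (STVB.widen n α)
          (realGen false (i + 1) hi' * virtGen i hi * realGen true (i + 1) hi')
          (STVB.widen n β)⟩
  /-- the left move of type 2: the strand `i + 1` is cut, and its virtual kink is pulled
  to the left under the thread `i` -/
  | under_left {n : ℕ} (α β : STVB n) (j i : ℕ) (hj : j ≤ n) (hi : i + 1 < n + 1)
      (hi' : i + 1 + 1 < n + 1) :
      LvMove ⟨n, α * β⟩
        ⟨n + 1, pulled j i (STVB.widen n α)
          (realGen true i hi * virtGen (i + 1) hi' * realGen false i hi)
          (STVB.widen n β)⟩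
  /-- the right moves of type 3: as in type 2, the kink having one singular and one real crossing
  with the thread, which are exchanged -/
  | rs_right {n : ℕ} (e : Bool) (α β : STVB n) (j i : ℕ) (hj : j ≤ n) (hi : i + 1 < n + 1)
      (hi' : i + 1 + 1 < n + 1) :
      LvMove
        ⟨n + 1, pulled j (i + 2) (STVB.widen n α)
          (tauGen (i + 1) hi' * virtGen i hi * realGen e (i + 1) hi') (STVB.widen n β)⟩
        ⟨n + 1, pulled j (i + 2) (STVB.widen n α)
          (realGen e (i + 1) hi' * virtGen i hi * tauGen (i + 1) hi') (STVB.widen n β)⟩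
  /-- the left moves of type 3 -/
  | rs_left {n : ℕ} (e : Bool) (α β : STVB n) (j i : ℕ) (hj : j ≤ n) (hi : i + 1 < n + 1)
      (hi' : i + 1 + 1 < n + 1) :
      LvMove
        ⟨n + 1, pulled j i (STVB.widen n α)
          (tauGen i hi * virtGen (i + 1) hi' * realGen e i hi) (STVB.widen n β)⟩
        ⟨n + 1, pulled j i (STVB.widen n α)
          (realGen e i hi * virtGen (i + 1) hi' * tauGen i hi) (STVB.widen n β)⟩
  /-- type 4, real conjugation -/
  | real_conj {n : ℕ} (e : Bool) (α : STVB n) (i : ℕ) (hi : i + 1 < n) :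
      LvMove ⟨n, realGen e i hi * α⟩ ⟨n, α * realGen e i hi⟩
  /-- type 4, singular conjugation -/
  | singular_conj {n : ℕ} (α : STVB n) (i : ℕ) (hi : i + 1 < n) :
      LvMove ⟨n, tauGen i hi * α⟩ ⟨n, α * tauGen i hi⟩
  /-- type 4, twist conjugation -/
  | twist_conj {n : ℕ} (α : STVB n) (i : ℕ) (hi : i < n) :
      LvMove ⟨n, gammaGen i hi * α⟩ ⟨n, α * gammaGen i hi⟩

/-- `L_v`-equivalence: the equivalence relation generated by the `L_v`-moves. (The elements of the
monoid are already classes of braid diagrams under braid isotopy.) -/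
def LvEquiv : (Σ n, STVB n) → (Σ n, STVB n) → Prop := Relation.EqvGen LvMove

end SingTwist

namespace SingTwist

/-! ### The monoid of braids: crossings, bars and the relations between them -/

/-! The virtual part of a braid carries no more information than a permutation. The elements `V n i`
satisfy the Coxeter relations, so the symmetric group maps to the braid monoid by `rho`. The
relations between virtual and other generators make two kinds of elements equivariant under
conjugation by `rho`: the bar `barVal a` of a strand, and the crossing `crossVal c l r` of two
arbitrary strands, followed by the virtual crossing that undoes its permutation. Every braid is a
product of such crossings and bars on labelled strands, times one `rho g`, and the braid relations
become relations of Yang-Baxter type between labelled crossings (`crossVal_mul_inv`,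
`crossVal_flip`, `crossVal_twist`, `crossVal_slide`).

Braids with isotopic closures are L_v-equivalent. A diagram is reduced to its Gauss diagram: the
real and singular crossings and the bars, joined by labelled oriented strands. Virtual crossings are
forgotten, maxima and minima become wires, and every crossing is turned until both of its strands
run down. Each label begins once and ends once, so the labels can serve as the strands of a braid:
all crossings and bars in any order, followed by the permutation that joins the strands. The choices
do not matter. Relabelling is conjugation by a virtual braid, which is obtained from virtual
L_v-moves (`lv_conj`), and contracting a strand is itself a virtual L_v-move (`Valid.exists_cut`,
`Valid.merge`). After contraction of strands, a local move between strands with compatible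
directions is a relation of the braid monoid. The others are L_v-moves: kinks on one side are the
real moves of type 1, antiparallel bigons are type 2, and the exchange of a real and a singular
crossing of antiparallel strands is type 3. Kinks on the other side and cyclically directed
triangles are combinations of these (`Good.kink_left`, `Good.cyclic`). Hence the braid of a diagram
depends on the link alone, up to L_v-equivalence (`LocalMove.invariant`, `lvEquiv_of_link_eq`), and
for the closure of a braid it is that braid (`closure_hasBraid`).

Conversely, a letter of a closed braid can be slid once around the closure, so the closure is
invariant under cyclic permutation of factors (`closure_mul_comm`). This settles the conjugations
ST4, which enter only in this direction. In the other L_v-moves the outer virtual runs cancel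
cyclically, the new maximum and minimum are pulled to the place of the cut, and the small tangle
that remains is removed or altered by kink, bigon and flip moves (`LvMove.closure_eq`). -/

theorem mk_ofList {n : ℕ} (a : List (Gen n)) :
    PresentedMonoid.mk (braidRels n) (FreeMonoid.ofList a) = (a.map STVB.of).prod := by
  induction a with
  | nil => rfl
  | cons g a ih => rw [List.map_cons, List.prod_cons, ← ih]; rfl

theorem BraidRel.prod_eq {n : ℕ} {a b : List (Gen n)} (h : BraidRel n a b) :
    (a.map STVB.of).prod = (b.map STVB.of).prod := by
  rw [← mk_ofList, ← mk_ofList]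
  exact PresentedMonoid.mk_eq_mk_of_rel (rels := braidRels n)
    (x := FreeMonoid.ofList a) (y := FreeMonoid.ofList b) h

/-- The generator with a given decoration at the strands `i` and `i + 1`. -/
def crossGen {n : ℕ} (c : Crossing) (i : ℕ) (h : i + 1 < n) : Gen n :=
  match c with
  | .rightOver => .sigma i h
  | .leftOver => .sigmaInv i h
  | .virtual => .virt i h
  | .singular => .tau i h

/-- The crossing of the strands `i` and `i + 1`, trivial if there are no such strands. -/
def X (n : ℕ) (c : Crossing) (i : ℕ) : STVB n :=
  if h : i + 1 < n then STVB.of (crossGen c i h) else 1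

/-- The virtual crossing of the strands `i` and `i + 1`, trivial if there are no such strands. -/
def V (n : ℕ) (i : ℕ) : STVB n := X n .virtual i

/-- The bar on the strand `i`, trivial if there is no such strand. -/
def B (n : ℕ) (i : ℕ) : STVB n := if h : i < n then STVB.of (.gamma i h) else 1

variable {n : ℕ}

theorem X_of_lt {c : Crossing} {i : ℕ} (h : i + 1 < n) : X n c i = STVB.of (crossGen c i h) :=
  dif_pos h

theorem X_of_ge {c : Crossing} {i : ℕ} (h : ¬ i + 1 < n) : X n c i = 1 := dif_neg h

theorem B_of_lt {i : ℕ} (h : i < n) : B n i = STVB.of (.gamma i h) := dif_pos h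

theorem V_mul_V (i : ℕ) : V n i * V n i = 1 := by
  unfold V
  by_cases h : i + 1 < n
  · rw [X_of_lt h]; simpa [crossGen, Crossing.turn] using (BraidRel.virt_sq i h).prod_eq
  · simp [X_of_ge h]

theorem B_mul_B (i : ℕ) : B n i * B n i = 1 := by
  by_cases h : i < n
  · rw [B_of_lt h]; simpa [crossGen, Crossing.turn] using (BraidRel.gamma_sq i h).prod_eq
  · simp [B, h]

theorem X_mul_X_switch {c : Crossing} (hc : c.IsReal) (i : ℕ) :
    X n c i * X n c.turn i = 1 := by
  by_cases h : i + 1 < n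
  · rw [X_of_lt h, X_of_lt h]
    rcases hc with rfl | rfl
    · simpa [crossGen, Crossing.turn] using (BraidRel.inv_sigma i h).prod_eq
    · simpa [crossGen, Crossing.turn] using (BraidRel.sigma_inv i h).prod_eq
  · simp [X_of_ge h]

theorem commute_of_inverse {M : Type*} [Monoid M] {a b x : M} (h : a * b = 1) (h' : b * a = 1)
    (hx : Commute a x) : Commute b x := by
  have := hx.eq
  calc b * x = b * x * (a * b) := by rw [h, mul_one]
    _ = b * (x * a) * b := by simp only [mul_assoc]
    _ = b * a * x * b := by rw [← this]; simp only [mul_assoc]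
    _ = x * b := by rw [h', one_mul]

theorem commute_leftOver {i : ℕ} {x : STVB n} (h : Commute (X n .rightOver i) x) :
    Commute (X n .leftOver i) x :=
  commute_of_inverse (X_mul_X_switch (c := .rightOver) (.inr rfl) i)
    (X_mul_X_switch (c := .leftOver) (.inl rfl) i) h

theorem Far.symm {i j : ℕ} (h : Far i j) : Far j i := Or.symm h

/-- The presentation lists far commutations for some ordered pairs of decorations only, and none for
inverse crossings. Exchanging the two indices and passing to inverses gives the remaining pairs. -/
theorem X_commute {i j : ℕ} (hf : Far i j) (c d : Crossing) :
    Commute (X n c i) (X n d j) := by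
  by_cases hi : i + 1 < n
  swap
  · rw [X_of_ge hi]; exact Commute.one_left _
  by_cases hj : j + 1 < n
  swap
  · rw [X_of_ge hj]; exact Commute.one_right _
  have key : ∀ (p q) (hp : p + 1 < n) (hq : q + 1 < n) (a b : Crossing),
      BraidRel n [crossGen a p hp, crossGen b q hq] [crossGen b q hq, crossGen a p hp] →
      Commute (X n a p) (X n b q) := by
    intro p q hp hq a b h
    rw [X_of_lt hp, X_of_lt hq]
    simpa [Commute, SemiconjBy] using h.prod_eq
  have hf' := hf.symm
  have sv := key i j hi hj .rightOver .virtual (.sigma_virt_far i j hi hj hf)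
  have ss := key i j hi hj .rightOver .rightOver (.sigma_far i j hi hj hf)
  have st := key i j hi hj .rightOver .singular (.sigma_tau_far i j hi hj hf)
  have vs := (key j i hj hi .rightOver .virtual (.sigma_virt_far j i hj hi hf')).symm
  have ts := (key j i hj hi .rightOver .singular (.sigma_tau_far j i hj hi hf')).symm
  have vv := key i j hi hj .virtual .virtual (.virt_far i j hi hj hf)
  have tt := key i j hi hj .singular .singular (.tau_far i j hi hj hf)
  have tv := key i j hi hj .singular .virtual (.tau_virt_far i j hi hj hf)
  have vt := (key j i hj hi .singular .virtual (.tau_virt_far j i hj hi hf')).symm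
  cases c <;> cases d <;> first
    | assumption
    | exact commute_leftOver ‹_›
    | exact (commute_leftOver (Commute.symm ‹_›)).symm
    | exact commute_leftOver (commute_leftOver (Commute.symm ‹_›)).symm

theorem B_commute (i j : ℕ) : Commute (B n i) (B n j) := by
  by_cases hi : i < n
  swap
  · simp [B, hi]
  by_cases hj : j < n
  swap
  · simp [B, hj]
  rw [B_of_lt hi, B_of_lt hj]
  simpa [crossGen, Commute, SemiconjBy] using (BraidRel.gamma_comm i j hi hj).prod_eq

theorem X_commute_B {i j : ℕ} (h : j ≠ i) (h' : j ≠ i + 1) (c : Crossing) :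
    Commute (X n c i) (B n j) := by
  by_cases hi : i + 1 < n
  swap
  · rw [X_of_ge hi]; exact Commute.one_left _
  by_cases hj : j < n
  swap
  · simp [B, hj]
  have hs : Commute (X n .rightOver i) (B n j) := by
    rw [X_of_lt hi, B_of_lt hj]
    simpa [crossGen, Commute, SemiconjBy] using (BraidRel.sigma_gamma_far i j hi hj h h').prod_eq
  cases c with
  | leftOver => exact commute_leftOver hs
  | rightOver => exact hs
  | singular =>
    rw [X_of_lt hi, B_of_lt hj]
    simpa [crossGen, Commute, SemiconjBy] using (BraidRel.tau_gamma_far i j hi hj h h').prod_eq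
  | _ =>
    rw [X_of_lt hi, B_of_lt hj]
    simpa [crossGen, Commute, SemiconjBy] using (BraidRel.gamma_virt_far i j hi hj h h').prod_eq.symm

/-- The presentation has this for positive, virtual and singular crossings. For a negative crossing
the two sides are inverse to the same element. -/
theorem V_X_V {i : ℕ} (h : i + 2 < n) (c : Crossing) :
    V n i * X n c (i + 1) * V n i = V n (i + 1) * X n c i * V n (i + 1) := by
  have hi : i + 1 < n := by omega
  have hs : V n i * X n .rightOver (i + 1) * V n i =
      V n (i + 1) * X n .rightOver i * V n (i + 1) := by
    unfold V
    rw [X_of_lt hi, X_of_lt h, X_of_lt h, X_of_lt hi]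
    simpa [crossGen, mul_assoc] using (BraidRel.virt_sigma_virt i hi h).prod_eq
  cases c with
  | rightOver => exact hs
  | leftOver =>
    have inv : ∀ i j, (V n i * X n .leftOver j * V n i) * (V n i * X n .rightOver j * V n i) = 1 ∧
        (V n i * X n .rightOver j * V n i) * (V n i * X n .leftOver j * V n i) = 1 := by
      intro i j
      have hv := V_mul_V (n := n) i
      have h1 := X_mul_X_switch (n := n) (c := .leftOver) (.inl rfl) j
      have h2 := X_mul_X_switch (n := n) (c := .rightOver) (.inr rfl) j
      simp only [Crossing.turn] at h1 h2
      constructor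
      · calc _ = V n i * X n .leftOver j * (V n i * V n i) * X n .rightOver j * V n i := by
              simp only [mul_assoc]
          _ = V n i * (X n .leftOver j * X n .rightOver j) * V n i := by
              rw [hv, mul_one]; simp only [mul_assoc]
          _ = 1 := by rw [h1, mul_one, hv]
      · calc _ = V n i * X n .rightOver j * (V n i * V n i) * X n .leftOver j * V n i := by
              simp only [mul_assoc]
          _ = V n i * (X n .rightOver j * X n .leftOver j) * V n i := by
              rw [hv, mul_one]; simp only [mul_assoc]
          _ = 1 := by rw [h2, mul_one, hv]
    refine left_inv_eq_right_inv (inv i (i + 1)).1 ?_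
    rw [hs]
    exact (inv (i + 1) i).2
  | singular =>
    unfold V
    rw [X_of_lt hi, X_of_lt h, X_of_lt h, X_of_lt hi]
    simpa [crossGen, mul_assoc] using (BraidRel.virt_tau_virt i hi h).prod_eq
  | _ =>
    unfold V
    rw [X_of_lt hi, X_of_lt h]
    simpa [crossGen, mul_assoc] using (BraidRel.virt_braid i hi h).prod_eq

theorem B_V {i : ℕ} (h : i + 1 < n) : B n (i + 1) * V n i = V n i * B n i := by
  unfold V
  rw [X_of_lt h, B_of_lt h, B_of_lt (by omega)]
  simpa [crossGen, Crossing.turn] using (BraidRel.gamma_virt i h h (by omega)).prod_eq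

/-- The braid relation and the relation for `τ` have one shape: a strand that passes under two
others is moved across their crossing `d`. They are treated together from here on. -/
theorem X_slide {i : ℕ} (h : i + 2 < n) {d : Crossing} (hd : d = .rightOver ∨ d = .singular) :
    X n .rightOver i * X n .rightOver (i + 1) * X n d i =
      X n d (i + 1) * X n .rightOver i * X n .rightOver (i + 1) := by
  have hi : i + 1 < n := by omega
  rw [X_of_lt hi, X_of_lt h, X_of_lt hi, X_of_lt h]
  rcases hd with rfl | rfl
  · simpa [crossGen, mul_assoc] using (BraidRel.sigma_braid i hi h).prod_eq
  · simpa [crossGen, mul_assoc] using (BraidRel.sigma_sigma_tau i hi h).prod_eq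

theorem X_flip (i : ℕ) :
    X n .rightOver i * X n .singular i = X n .singular i * X n .rightOver i := by
  by_cases h : i + 1 < n
  · rw [X_of_lt h, X_of_lt h]
    simpa [crossGen] using (BraidRel.sigma_tau i h).prod_eq
  · simp [X_of_ge h]

theorem X_twist {i : ℕ} (h : i + 1 < n) {c : Crossing} (hc : c ≠ .virtual) :
    V n i * X n c i * V n i = B n (i + 1) * B n i * X n c i * B n i * B n (i + 1) := by
  have hs : V n i * X n .rightOver i * V n i =
      B n (i + 1) * B n i * X n .rightOver i * B n i * B n (i + 1) := by
    unfold V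
    rw [X_of_lt h, X_of_lt h, B_of_lt h, B_of_lt (by omega)]
    simpa [crossGen, mul_assoc] using (BraidRel.sigma_twist i h h (by omega)).prod_eq
  cases c with
  | rightOver => exact hs
  | leftOver =>
    have h1 : (V n i * X n .leftOver i * V n i) * (V n i * X n .rightOver i * V n i) = 1 := by
      calc _ = V n i * X n .leftOver i * (V n i * V n i) * X n .rightOver i * V n i := by
              simp only [mul_assoc]
        _ = V n i * (X n .leftOver i * X n .rightOver i) * V n i := by
              rw [V_mul_V, mul_one]; simp only [mul_assoc]
        _ = 1 := by
          have := X_mul_X_switch (n := n) (c := .leftOver) (.inl rfl) i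
          simp only [Crossing.turn] at this
          rw [this, mul_one, V_mul_V]
    refine left_inv_eq_right_inv h1 ?_
    rw [hs]
    calc _ = B n (i + 1) * B n i * X n .rightOver i * (B n i * (B n (i + 1) * B n (i + 1)) * B n i)
          * X n .leftOver i * B n i * B n (i + 1) := by simp only [mul_assoc]
      _ = B n (i + 1) * B n i * (X n .rightOver i * X n .leftOver i) * B n i * B n (i + 1) := by
          rw [B_mul_B, mul_one, B_mul_B, mul_one]; simp only [mul_assoc]
      _ = 1 := by
        have := X_mul_X_switch (n := n) (c := .rightOver) (.inr rfl) i
        simp only [Crossing.turn] at this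
        rw [this, mul_one, mul_assoc (B n (i + 1)), B_mul_B, mul_one, B_mul_B]
  | singular =>
    unfold V
    rw [X_of_lt h, X_of_lt h, B_of_lt h, B_of_lt (by omega)]
    simpa [crossGen, mul_assoc] using (BraidRel.tau_twist i h h (by omega)).prod_eq
  | _ => exact absurd rfl hc

end SingTwist

namespace SingTwist

/-! ### Virtual braids and permutations -/

section Coxeter

variable {M : Type*} [Monoid M]

/-- The product `f (p + m - 1) ⋯ f (p + 1) * f p`. -/
def descProd (f : ℕ → M) (p : ℕ) : ℕ → M
  | 0 => 1
  | m + 1 => descProd f (p + 1) m * f p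

/-- The Coxeter relations of the symmetric group, for the first `N` elements of a sequence. -/
structure IsCoxeterSeq (f : ℕ → M) (N : ℕ) : Prop where
  sq : ∀ i < N, f i * f i = 1
  far : ∀ i j, i + 1 < j → j < N → f i * f j = f j * f i
  braid : ∀ i, i + 1 < N → f i * f (i + 1) * f i = f (i + 1) * f i * f (i + 1)

variable {f : ℕ → M} {N : ℕ}

theorem IsCoxeterSeq.descProd_comm (h : IsCoxeterSeq f N) {i : ℕ} :
    ∀ {m p : ℕ}, i + 1 < p → p + m ≤ N → descProd f p m * f i = f i * descProd f p m
  | 0, _, _, _ => by simp [descProd]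
  | m + 1, p, hp, hN => by
    rw [descProd, mul_assoc, ← h.far i p hp (by omega), ← mul_assoc,
      h.descProd_comm (by omega) (by omega), mul_assoc]

/-- A generator inside the range of a descending product passes through it with its index lowered by
one, by a single braid relation and far commutations. -/
theorem IsCoxeterSeq.descProd_shift (h : IsCoxeterSeq f N) {i : ℕ} :
    ∀ {m p : ℕ}, p ≤ i → i + 1 < p + m → p + m ≤ N →
      descProd f p m * f (i + 1) = f i * descProd f p m
  | 0, _, hp, hi, _ => by omega
  | m + 1, p, hp, hi, hN => by
    rcases hp.eq_or_lt with rfl | hlt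
    · obtain ⟨m, rfl⟩ : ∃ k, m = k + 1 := ⟨m - 1, by omega⟩
      rw [descProd, descProd, mul_assoc, mul_assoc, ← mul_assoc (f _), ← h.braid p (by omega),
        mul_assoc (f p), ← mul_assoc, h.descProd_comm (by omega) (by omega)]
      simp only [mul_assoc]
    · rw [descProd, mul_assoc, h.far p (i + 1) (by omega) (by omega), ← mul_assoc,
        h.descProd_shift (by omega) (by omega) (by omega), mul_assoc]

/-- Right multiplication by one generator preserves the shape: the generator commutes past the
descending product, lengthens it, cancels its last factor, or passes through it with lowered index.
-/
theorem IsCoxeterSeq.normal_form (h : IsCoxeterSeq f N) {k : ℕ} (hk : k < N) {x : M}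
    (hx : x ∈ Submonoid.closure (f '' Set.Iio (k + 1))) :
    ∃ y ∈ Submonoid.closure (f '' Set.Iio k), ∃ p m, p + m = k + 1 ∧ x = y * descProd f p m := by
  induction hx using Submonoid.closure_induction_right with
  | one => exact ⟨1, one_mem _, k + 1, 0, rfl, by simp [descProd]⟩
  | mul_right x hx z hz ih =>
    obtain ⟨i, hi, rfl⟩ := hz
    obtain ⟨y, hy, p, m, hpm, rfl⟩ := ih
    simp only [Set.mem_Iio] at hi
    rcases lt_trichotomy (i + 1) p with hip | rfl | hip
    · exact ⟨y * f i, mul_mem hy (Submonoid.subset_closure ⟨i, by simp; omega, rfl⟩), p, m, hpm, by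
        rw [mul_assoc, h.descProd_comm hip (by omega), mul_assoc]⟩
    · exact ⟨y, hy, i, m + 1, by omega, by rw [mul_assoc]; rfl⟩
    · obtain ⟨m, rfl⟩ : ∃ q, m = q + 1 := ⟨m - 1, by omega⟩
      rcases (Nat.lt_succ_iff.1 hip).eq_or_lt with rfl | hlt
      · exact ⟨y, hy, p + 1, m, by omega, by
          rw [mul_assoc, descProd, mul_assoc, h.sq _ (by omega), mul_one]⟩
      · obtain ⟨i, rfl⟩ : ∃ q, i = q + 1 := ⟨i - 1, by omega⟩
        exact ⟨y * f i, mul_mem hy (Submonoid.subset_closure ⟨i, by simp; omega, rfl⟩), p, m + 1,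
          hpm, by rw [mul_assoc, h.descProd_shift (by omega) (by omega) (by omega), mul_assoc]⟩

end Coxeter

variable {n : ℕ}

/-- The transposition of `i` and `i + 1`, trivial if there are no such strands. -/
def adj (n i : ℕ) : Equiv.Perm (Fin n) :=
  if h : i + 1 < n then Equiv.swap ⟨i, by omega⟩ ⟨i + 1, h⟩ else 1

theorem adj_val {i : ℕ} (h : i + 1 < n) (q : Fin n) :
    (adj n i q).val = if q.val = i then i + 1 else if q.val = i + 1 then i else q.val := by
  rw [adj, dif_pos h, Equiv.swap_apply_def]
  split_ifs <;> simp_all [Fin.ext_iff]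

/-- A virtual crossing, together with its permutation. -/
def virtPair (n i : ℕ) : STVB n × Equiv.Perm (Fin n) := (V n i, adj n i)

/-- The relations hold for virtual crossings and for transpositions at once. The submonoid generated
by the pairs will turn out to be the graph of a homomorphism from permutations to braids. -/
theorem isCoxeterSeq_virtPair (n : ℕ) : IsCoxeterSeq (virtPair n) (n - 1) where
  sq i hi := by
    refine Prod.ext (V_mul_V i) ?_
    simp only [virtPair, Prod.snd_mul, adj]
    split_ifs <;> simp
  far i j h hj := by
    refine Prod.ext (X_commute (Or.inl h) .virtual .virtual).eq ?_
    ext q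
    simp only [virtPair, Prod.snd_mul, Equiv.Perm.mul_apply]
    have hi : i + 1 < n := by omega
    have hj : j + 1 < n := by omega
    simp only [adj_val hi, adj_val hj]
    split_ifs <;> omega
  braid i hi := by
    refine Prod.ext (V_X_V (by omega) .virtual) ?_
    ext q
    simp only [virtPair, Prod.snd_mul, Equiv.Perm.mul_apply]
    have h1 : i + 1 < n := by omega
    have h2 : i + 1 + 1 < n := by omega
    simp only [adj_val h1, adj_val h2]
    split_ifs <;> omega

/-- The virtual braids on the first `k + 1` strands, together with their permutations. -/
def virtGraph (n k : ℕ) : Submonoid (STVB n × Equiv.Perm (Fin n)) :=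
  Submonoid.closure (virtPair n '' Set.Iio k)

theorem virtGraph_fix {k : ℕ} {x : STVB n × Equiv.Perm (Fin n)} (hx : x ∈ virtGraph n k)
    {j : Fin n} (hj : k < j.val) : x.2 j = j := by
  induction hx using Submonoid.closure_induction with
  | mem x hx =>
    obtain ⟨i, hi, rfl⟩ := hx
    have hi' : i < k := hi
    ext
    rw [virtPair, adj_val (by omega)]
    split_ifs <;> omega
  | one => rfl
  | mul x y _ _ hx hy => rw [Prod.snd_mul, Equiv.Perm.mul_apply, hy, hx]

theorem descProd_virtPair_apply : ∀ {m p : ℕ} (h : p + m < n),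
    ((descProd (virtPair n) p m).2 ⟨p, by omega⟩).val = p + m
  | 0, _, _ => rfl
  | m + 1, p, h => by
    have e : adj n p ⟨p, by omega⟩ = ⟨p + 1, by omega⟩ := by
      ext; rw [adj_val (by omega)]; simp
    rw [descProd, Prod.snd_mul, Equiv.Perm.mul_apply]
    simp only [virtPair, e]
    exact (descProd_virtPair_apply (by omega)).trans (by omega)

/-- In the normal form the descending factor carries `p` to `k + 1`, and the other factor fixes `k +
1`. If the whole permutation fixes `k + 1` as well, then `p = k + 1` and the descending factor is
empty. -/
theorem virtGraph_succ_of_fix {k : ℕ} (hk : k + 1 < n) {x : STVB n × Equiv.Perm (Fin n)}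
    (hx : x ∈ virtGraph n (k + 1)) (hf : x.2 ⟨k + 1, hk⟩ = ⟨k + 1, hk⟩) : x ∈ virtGraph n k := by
  obtain ⟨y, hy, p, m, hpm, rfl⟩ := (isCoxeterSeq_virtPair n).normal_form (by omega) hx
  have h1 : (descProd (virtPair n) p m).2 ⟨p, by omega⟩ = ⟨k + 1, hk⟩ :=
    Fin.ext ((descProd_virtPair_apply (by omega)).trans hpm)
  have h2 : y.2 ⟨k + 1, hk⟩ = ⟨k + 1, hk⟩ := virtGraph_fix hy (by simp)
  have h3 : (y * descProd (virtPair n) p m).2 ⟨p, by omega⟩ = ⟨k + 1, hk⟩ := by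
    rw [Prod.snd_mul, Equiv.Perm.mul_apply, h1, h2]
  have h4 := Equiv.injective _ (h3.trans hf.symm)
  obtain rfl : m = 0 := by simp at h4; omega
  rw [descProd, mul_one]
  exact hy

theorem virtGraph_of_fix {m : ℕ} : ∀ {k : ℕ}, k < n → ∀ {x : STVB n × Equiv.Perm (Fin n)},
    x ∈ virtGraph n k → (∀ j : Fin n, m < j.val → x.2 j = j) → x ∈ virtGraph n m
  | 0, _, x, hx, _ =>
    Submonoid.closure_mono (Set.image_mono (Set.Iio_subset_Iio (Nat.zero_le m))) hx
  | k + 1, hk, x, hx, hf => by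
    by_cases hm : k + 1 ≤ m
    · exact Submonoid.closure_mono (Set.image_mono (Set.Iio_subset_Iio hm)) hx
    · exact virtGraph_of_fix (by omega)
        (virtGraph_succ_of_fix hk hx (hf _ (by simp; omega))) hf

theorem virtGraph_inv {k : ℕ} {x : STVB n × Equiv.Perm (Fin n)}
    (hx : x ∈ virtGraph n k) : ∃ y ∈ virtGraph n k, x * y = 1 ∧ y * x = 1 := by
  induction hx using Submonoid.closure_induction with
  | mem x hx =>
    refine ⟨x, Submonoid.subset_closure hx, ?_⟩
    obtain ⟨i, hi, rfl⟩ := hx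
    have : virtPair n i * virtPair n i = 1 := by
      refine Prod.ext (V_mul_V i) ?_
      simp only [virtPair, Prod.snd_mul, adj]
      split_ifs <;> simp
    exact ⟨this, this⟩
  | one => exact ⟨1, one_mem _, by simp⟩
  | mul x y _ _ hx hy =>
    obtain ⟨x', hx', h1, h2⟩ := hx
    obtain ⟨y', hy', h3, h4⟩ := hy
    refine ⟨y' * x', mul_mem hy' hx', ?_, ?_⟩
    · rw [mul_assoc, ← mul_assoc y, h3, one_mul, h1]
    · rw [mul_assoc, ← mul_assoc x', h2, one_mul, h4]

/-- An element of the graph over the identity permutation lies in `virtGraph n 0`, which is trivial.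
Inverses inside the graph reduce the general case to this one. -/
theorem virtGraph_injective {x y : STVB n × Equiv.Perm (Fin n)}
    (hx : x ∈ virtGraph n (n - 1)) (hy : y ∈ virtGraph n (n - 1)) (h : x.2 = y.2) : x = y := by
  obtain ⟨z, hz, h1, h2⟩ := virtGraph_inv hx
  have h3 : (z * y).2 = 1 := by rw [Prod.snd_mul, ← h, ← Prod.snd_mul, h2]; rfl
  have h4 : z * y = 1 := by
    rcases Nat.eq_zero_or_pos n with rfl | hn
    · have key : ∀ w ∈ virtGraph 0 0, w = 1 := by
        intro w hw
        have : Set.Iio 0 = (∅ : Set ℕ) := by ext; simp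
        rw [virtGraph, this, Set.image_empty, Submonoid.closure_empty] at hw
        exact hw
      exact key _ (mul_mem hz hy)
    · have h5 := virtGraph_of_fix (m := 0) (by omega) (mul_mem hz hy) (fun j _ => by rw [h3]; rfl)
      have : Set.Iio 0 = (∅ : Set ℕ) := by ext; simp
      rw [virtGraph, this, Set.image_empty, Submonoid.closure_empty] at h5
      exact h5
  calc x = x * (z * y) := by rw [h4, mul_one]
    _ = y := by rw [← mul_assoc, h1, one_mul]

theorem closure_range_adj (n : ℕ) : Submonoid.closure (adj n '' Set.Iio (n - 1)) = ⊤ := by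
  cases n with
  | zero => exact Subsingleton.elim _ _
  | succ n =>
    rw [eq_top_iff, ← Equiv.Perm.mclosure_swap_castSucc_succ, Submonoid.closure_le]
    rintro _ ⟨i, rfl⟩
    refine Submonoid.subset_closure ⟨i.val, by simp, ?_⟩
    rw [adj, dif_pos (by omega)]
    rfl

theorem virtGraph_surjective (g : Equiv.Perm (Fin n)) : ∃ x, (x, g) ∈ virtGraph n (n - 1) := by
  have hg : g ∈ Submonoid.closure (adj n '' Set.Iio (n - 1)) := by
    rw [closure_range_adj]; trivial
  induction hg using Submonoid.closure_induction with
  | mem g hg =>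
    obtain ⟨i, hi, rfl⟩ := hg
    exact ⟨V n i, Submonoid.subset_closure ⟨i, hi, rfl⟩⟩
  | one => exact ⟨1, one_mem _⟩
  | mul g h _ _ hg hh =>
    obtain ⟨x, hx⟩ := hg
    obtain ⟨y, hy⟩ := hh
    exact ⟨x * y, mul_mem hx hy⟩

/-- The virtual braid of a permutation. The strand which ends in the position `q` is the one
which begins in the position `g q`. -/
noncomputable def rho : Equiv.Perm (Fin n) →* STVB n where
  toFun g := (virtGraph_surjective g).choose
  map_one' := congrArg Prod.fst <|
    virtGraph_injective (virtGraph_surjective (1 : Equiv.Perm (Fin n))).choose_spec (one_mem _) rfl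
  map_mul' g h := congrArg Prod.fst <|
    virtGraph_injective (virtGraph_surjective (g * h)).choose_spec
      (mul_mem (virtGraph_surjective g).choose_spec (virtGraph_surjective h).choose_spec) rfl

theorem rho_mem (g : Equiv.Perm (Fin n)) : (rho g, g) ∈ virtGraph n (n - 1) :=
  (virtGraph_surjective g).choose_spec

theorem rho_adj (i : ℕ) : rho (adj n i) = V n i := by
  by_cases h : i + 1 < n
  · exact congrArg Prod.fst (virtGraph_injective (rho_mem (adj n i))
      (y := virtPair n i) (Submonoid.subset_closure ⟨i, by simp; omega, rfl⟩) rfl)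
  · rw [adj, dif_neg h, map_one, V, X_of_ge h]

theorem rho_mul_inv (g : Equiv.Perm (Fin n)) : rho g * rho g⁻¹ = 1 := by
  rw [← map_mul, mul_inv_cancel, map_one]

theorem rho_inv_mul (g : Equiv.Perm (Fin n)) : rho g⁻¹ * rho g = 1 := by
  rw [← map_mul, inv_mul_cancel, map_one]

/-- By `virtGraph_of_fix`, a permutation that moves only positions up to `m` has a virtual braid in
the letters `V n i` with `i < m`. -/
theorem rho_commute_of_fix {m : ℕ} {z : STVB n} (hz : ∀ i < m, Commute (V n i) z)
    {g : Equiv.Perm (Fin n)} (hg : ∀ j : Fin n, m < j.val → g j = j) : Commute (rho g) z := by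
  have key : ∀ x ∈ virtGraph n m, Commute x.1 z := by
    intro x hx
    induction hx using Submonoid.closure_induction with
    | mem x hx => obtain ⟨i, hi, rfl⟩ := hx; exact hz i hi
    | one => exact Commute.one_left _
    | mul x y _ _ hx hy => exact hx.mul_left hy
  rcases Nat.eq_zero_or_pos n with rfl | hn
  · rw [Subsingleton.elim g 1, map_one]; exact Commute.one_left _
  · exact key (rho g, g) (virtGraph_of_fix (by omega) (rho_mem g) hg)

end SingTwist

namespace SingTwist

/-! ### Crossings and bars of arbitrary strands -/

variable {n : ℕ}

/-- Conjugation by the virtual braid of a permutation. -/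
noncomputable def conjBy (g : Equiv.Perm (Fin n)) : STVB n →* STVB n where
  toFun x := rho g * x * rho g⁻¹
  map_one' := by rw [mul_one, rho_mul_inv]
  map_mul' x y := by
    rw [show rho g * x * rho g⁻¹ * (rho g * y * rho g⁻¹) =
      rho g * x * (rho g⁻¹ * rho g) * y * rho g⁻¹ by simp only [mul_assoc], rho_inv_mul, mul_one]
    simp only [mul_assoc]

theorem conjBy_apply (g : Equiv.Perm (Fin n)) (x : STVB n) : conjBy g x = rho g * x * rho g⁻¹ :=
  rfl

theorem conjBy_mul (g h : Equiv.Perm (Fin n)) (x : STVB n) :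
    conjBy (g * h) x = conjBy g (conjBy h x) := by
  rw [conjBy_apply, mul_inv_rev, map_mul, map_mul]
  simp only [conjBy_apply, mul_assoc]

theorem adj_inv (i : ℕ) : (adj n i)⁻¹ = adj n i := by
  rw [adj]; split_ifs <;> simp

theorem conjBy_adj (i : ℕ) (x : STVB n) : conjBy (adj n i) x = V n i * x * V n i := by
  rw [conjBy_apply, adj_inv, rho_adj]

theorem conjBy_eq_self {g : Equiv.Perm (Fin n)} {x : STVB n} (h : Commute (rho g) x) :
    conjBy g x = x := by
  rw [conjBy_apply, h.eq, mul_assoc, rho_mul_inv, mul_one]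

theorem rho_mul_eq (g : Equiv.Perm (Fin n)) (x : STVB n) : rho g * x = conjBy g x * rho g := by
  rw [conjBy_apply, mul_assoc, rho_inv_mul, mul_one]

/-- The bar on a strand. -/
def barVal (a : Fin n) : STVB n := B n a

theorem barVal_map (g : Equiv.Perm (Fin n)) : ∀ a, barVal (g a) = conjBy g (barVal a) := by
  have hg : g ∈ Submonoid.closure (adj n '' Set.Iio (n - 1)) := by
    rw [closure_range_adj]; trivial
  induction hg using Submonoid.closure_induction with
  | mem g hg =>
    obtain ⟨i, hi, rfl⟩ := hg
    have hi : i + 1 < n := by simp at hi; omega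
    intro a
    simp only [barVal, adj_val hi, conjBy_adj]
    split_ifs with h1 h2
    · rw [h1, ← B_V hi, mul_assoc, V_mul_V, mul_one]
    · rw [h2, mul_assoc, B_V hi, ← mul_assoc, V_mul_V, one_mul]
    · rw [V, (X_commute_B h1 h2 .virtual).eq, mul_assoc, ← V, V_mul_V, mul_one]
  | one => intro a; simp [conjBy_apply]
  | mul g h _ _ hg hh =>
    intro a
    rw [Equiv.Perm.mul_apply, hg, hh, conjBy_mul]

/-- The crossing of two strands, followed by the virtual crossing which leads them back. -/
noncomputable def crossVal (c : Crossing) (l r : Fin n) : STVB n :=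
  open Classical in
  -- The last two positions serve as the reference pair, because the permutations that fix them act
  -- on an initial segment, as `rho_commute_of_fix` requires. An impossible pair gets the value `1`.
  if h : ∃ g : Equiv.Perm (Fin n), (g ⟨n - 2, by have := l.isLt; omega⟩ = l) ∧
      g ⟨n - 1, by have := l.isLt; omega⟩ = r
  then conjBy h.choose (X n c (n - 2) * V n (n - 2)) else 1

/-- Two permutations with the same values at the last two positions differ by one that fixes these
positions. Its virtual braid uses the letters `V n i` with `i < n - 3`, all far from the crossing at
`n - 2`, and so commutes with it. -/
theorem crossVal_eq (hn : 2 ≤ n) (c : Crossing) (g : Equiv.Perm (Fin n)) :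
    crossVal c (g ⟨n - 2, by omega⟩) (g ⟨n - 1, by omega⟩) =
      conjBy g (X n c (n - 2) * V n (n - 2)) := by
  have h : ∃ h : Equiv.Perm (Fin n), (h ⟨n - 2, by omega⟩ = g ⟨n - 2, by omega⟩) ∧
      h ⟨n - 1, by omega⟩ = g ⟨n - 1, by omega⟩ := ⟨g, rfl, rfl⟩
  rw [crossVal, dif_pos h]
  have hs := h.choose_spec
  generalize h.choose = f at hs
  rw [show f = g * (g⁻¹ * f) by group, conjBy_mul]
  congr 1
  apply conjBy_eq_self
  refine rho_commute_of_fix (m := n - 3) (fun i hi => ?_) (fun j hj => ?_)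
  · have : Far i (n - 2) := Or.inl (by omega)
    exact (X_commute this _ _).mul_right (X_commute this _ _)
  · rw [Equiv.Perm.mul_apply, Equiv.Perm.inv_eq_iff_eq]
    rcases (show j.val = n - 2 ∨ j.val = n - 1 by omega) with h | h
    · rw [show j = ⟨n - 2, by omega⟩ from Fin.ext h, hs.1]
    · rw [show j = ⟨n - 1, by omega⟩ from Fin.ext h, hs.2]

/-- For distinct strands some permutation carries the reference pair to them, and then `crossVal_eq`
is visibly equivariant. Equal strands and fewer than two strands are degenerate. -/
theorem crossVal_map (g : Equiv.Perm (Fin n)) (c : Crossing) (l r : Fin n) :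
    crossVal c (g l) (g r) = conjBy g (crossVal c l r) := by
  by_cases hn : 2 ≤ n
  · by_cases h : l = r
    · have no : ∀ a : Fin n, crossVal c a a = 1 := by
        intro a
        rw [crossVal, dif_neg]
        rintro ⟨f, h1, h2⟩
        have := congrArg Fin.val (f.injective (h1.trans h2.symm))
        simp at this
        omega
      rw [h, no, no, map_one]
    · have := Equiv.Perm.isMultiplyPretransitive (Fin n) 2
      obtain ⟨f, hf⟩ := MulAction.exists_smul_eq (Equiv.Perm (Fin n))
        (⟨![⟨n - 2, by omega⟩, ⟨n - 1, by omega⟩], by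
          intro i j hij; fin_cases i <;> fin_cases j <;> simp_all <;> omega⟩ : Fin 2 ↪ Fin n)
        ⟨![l, r], by intro i j hij; fin_cases i <;> fin_cases j <;> simp_all [eq_comm]⟩
      have h1 : f ⟨n - 2, by omega⟩ = l := congrArg (fun e : Fin 2 ↪ Fin n => e 0) hf
      have h2 : f ⟨n - 1, by omega⟩ = r := congrArg (fun e : Fin 2 ↪ Fin n => e 1) hf
      rw [← h1, ← h2, crossVal_eq hn, ← conjBy_mul, ← crossVal_eq hn]
      rfl
  · have key : ∀ x : STVB n, ∀ g : Equiv.Perm (Fin n), conjBy g x = x := by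
      intro x g
      have : Subsingleton (Fin n) := by
        constructor; intro a b; ext; omega
      rw [Subsingleton.elim g 1, conjBy_apply, inv_one, map_one, one_mul, mul_one]
    have : Subsingleton (Fin n) := by
      constructor; intro a b; ext; omega
    rw [key, Subsingleton.elim (g l) l, Subsingleton.elim (g r) r]

/-- Conjugation by two virtual crossings moves a crossing from `q + 1` to `q`, by `V_X_V`. So the
reference pair can be moved step by step to any adjacent pair. -/
theorem exists_perm_adjacent (hn : 2 ≤ n) (c : Crossing) : ∀ (k q : ℕ) (hq : q + 2 + k = n),
    ∃ g : Equiv.Perm (Fin n), g ⟨n - 2, by omega⟩ = ⟨q, by omega⟩ ∧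
      g ⟨n - 1, by omega⟩ = ⟨q + 1, by omega⟩ ∧
      conjBy g (X n c (n - 2) * V n (n - 2)) = X n c q * V n q
  | 0, q, hq => by
    obtain rfl : n = q + 2 := by omega
    exact ⟨1, rfl, rfl, by simp [conjBy_apply]⟩
  | k + 1, q, hq => by
    obtain ⟨g, h1, h2, h3⟩ := exists_perm_adjacent hn c k (q + 1) (by omega)
    refine ⟨adj n (q + 1) * adj n q * g, ?_, ?_, ?_⟩
    · ext
      rw [Equiv.Perm.mul_apply, Equiv.Perm.mul_apply, h1, adj_val (by omega), adj_val (by omega)]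
      simp
      omega
    · ext
      rw [Equiv.Perm.mul_apply, Equiv.Perm.mul_apply, h2, adj_val (by omega), adj_val (by omega)]
      have e1 : q + 1 + 1 ≠ q := by omega
      simp [e1]
    · have key : ∀ d, conjBy (adj n (q + 1) * adj n q) (X n d (q + 1)) = X n d q := by
        intro d
        rw [conjBy_mul, conjBy_adj, conjBy_adj, V_X_V (by omega),
          show ∀ a b : STVB n, a * (a * b * a) * a = (a * a) * b * (a * a) by
            intros; simp only [mul_assoc], V_mul_V, one_mul, mul_one]
      rw [conjBy_mul, h3, map_mul, key]
      exact congrArg _ (key .virtual)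

theorem crossVal_adjacent {q : ℕ} (h : q + 1 < n) (c : Crossing) :
    crossVal c ⟨q, by omega⟩ ⟨q + 1, h⟩ = X n c q * V n q := by
  obtain ⟨g, h1, h2, h3⟩ := exists_perm_adjacent (n := n) (by omega) c (n - 2 - q) q (by omega)
  rw [← h3, ← crossVal_eq (by omega), h1, h2]

theorem X_eq_crossVal {q : ℕ} (h : q + 1 < n) (c : Crossing) :
    X n c q = crossVal c ⟨q, by omega⟩ ⟨q + 1, h⟩ * V n q := by
  rw [crossVal_adjacent h, mul_assoc, V_mul_V, mul_one]

theorem exists_perm_of_injective {k : ℕ} (u w : Fin k → Fin n) (hu : Function.Injective u)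
    (hw : Function.Injective w) : ∃ g : Equiv.Perm (Fin n), ∀ i, g (u i) = w i := by
  have := Equiv.Perm.isMultiplyPretransitive (Fin n) k
  obtain ⟨g, hg⟩ := MulAction.exists_smul_eq (Equiv.Perm (Fin n)) (⟨u, hu⟩ : Fin k ↪ Fin n) ⟨w, hw⟩
  exact ⟨g, fun i => congrArg (fun e : Fin k ↪ Fin n => e i) hg⟩

theorem exists_perm_start {k : ℕ} (w : Fin k → Fin n) (hw : Function.Injective w) :
    ∃ (hk : k ≤ n) (g : Equiv.Perm (Fin n)), ∀ i, g (Fin.castLE hk i) = w i := by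
  have hk : k ≤ n := by simpa using Fintype.card_le_of_injective w hw
  exact ⟨hk, exists_perm_of_injective _ w (Fin.castLE_injective hk) hw⟩

theorem exists_perm_two {a b : Fin n} (h : a ≠ b) :
    ∃ (hn : 2 ≤ n) (g : Equiv.Perm (Fin n)), g ⟨0, by omega⟩ = a ∧ g ⟨1, by omega⟩ = b := by
  obtain ⟨hn, g, hg⟩ := exists_perm_start ![a, b] (by
    intro i j hij; fin_cases i <;> fin_cases j <;> simp_all [eq_comm])
  exact ⟨hn, g, hg 0, hg 1⟩

theorem exists_perm_three {a b c : Fin n} (h : a ≠ b) (h' : a ≠ c) (h'' : b ≠ c) :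
    ∃ (hn : 3 ≤ n) (g : Equiv.Perm (Fin n)), g ⟨0, by omega⟩ = a ∧ g ⟨1, by omega⟩ = b ∧
      g ⟨2, by omega⟩ = c := by
  obtain ⟨hn, g, hg⟩ := exists_perm_start ![a, b, c] (by
    intro i j hij; fin_cases i <;> fin_cases j <;> simp_all [eq_comm])
  exact ⟨hn, g, hg 0, hg 1, hg 2⟩

theorem exists_perm_four {a b c d : Fin n} (h1 : a ≠ b) (h2 : a ≠ c) (h3 : a ≠ d) (h4 : b ≠ c)
    (h5 : b ≠ d) (h6 : c ≠ d) :
    ∃ (hn : 4 ≤ n) (g : Equiv.Perm (Fin n)), g ⟨0, by omega⟩ = a ∧ g ⟨1, by omega⟩ = b ∧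
      g ⟨2, by omega⟩ = c ∧ g ⟨3, by omega⟩ = d := by
  obtain ⟨hn, g, hg⟩ := exists_perm_start ![a, b, c, d] (by
    intro i j hij; fin_cases i <;> fin_cases j <;> simp_all [eq_comm])
  exact ⟨hn, g, hg 0, hg 1, hg 2, hg 3⟩

theorem crossVal_swap {q : ℕ} (h : q + 1 < n) (c : Crossing) :
    crossVal c ⟨q + 1, h⟩ ⟨q, by omega⟩ = V n q * X n c q := by
  have h1 : adj n q ⟨q, by omega⟩ = ⟨q + 1, h⟩ := by ext; rw [adj_val h]; simp
  have h2 : adj n q ⟨q + 1, h⟩ = ⟨q, by omega⟩ := by ext; rw [adj_val h]; simp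
  have := crossVal_map (adj n q) c ⟨q, by omega⟩ ⟨q + 1, h⟩
  rw [h1, h2, crossVal_adjacent h, conjBy_adj, mul_assoc, mul_assoc, V_mul_V, mul_one] at this
  exact this

/-- Labels stay with the strands, so the inverse crossing has `b` on its left side. The virtual
crossings at the end of the first factor and at the beginning of the second cancel. -/
theorem crossVal_mul_inv {c : Crossing} (hc : c.IsReal) {a b : Fin n} (h : a ≠ b) :
    crossVal c a b * crossVal c.turn b a = 1 := by
  obtain ⟨hn, g, rfl, rfl⟩ := exists_perm_two h
  rw [crossVal_map, crossVal_map, ← map_mul, crossVal_adjacent (q := 0) (by omega),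
    crossVal_swap (q := 0) (by omega), mul_assoc, ← mul_assoc (V n 0), V_mul_V, one_mul,
    X_mul_X_switch hc, map_one]

theorem crossVal_flip_right {a b : Fin n} (h : a ≠ b) :
    crossVal .rightOver a b * crossVal .singular b a =
      crossVal .singular a b * crossVal .rightOver b a := by
  obtain ⟨hn, g, rfl, rfl⟩ := exists_perm_two h
  simp only [crossVal_map, ← map_mul]
  rw [crossVal_adjacent (q := 0) (by omega), crossVal_swap (q := 0) (by omega),
    crossVal_adjacent (q := 0) (by omega), crossVal_swap (q := 0) (by omega),
    mul_assoc, ← mul_assoc (V n 0), V_mul_V, one_mul, mul_assoc (X n .singular 0),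
    ← mul_assoc (V n 0), V_mul_V, one_mul, X_flip]

theorem crossVal_flip {c : Crossing} (hc : c.IsReal) {a b : Fin n} (h : a ≠ b) :
    crossVal c a b * crossVal .singular b a = crossVal .singular a b * crossVal c b a := by
  rcases hc with rfl | rfl
  · have h1 := crossVal_mul_inv (c := .leftOver) (.inl rfl) h
    have h2 := crossVal_mul_inv (c := .rightOver) (.inr rfl) h
    have h3 := crossVal_flip_right h.symm
    simp only [Crossing.turn] at h1 h2
    calc _ = crossVal .leftOver a b * (crossVal .singular b a * crossVal .rightOver a b) *
            crossVal .leftOver b a := by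
          rw [mul_assoc, mul_assoc, h2, mul_one]
      _ = _ := by rw [← h3, ← mul_assoc, h1, one_mul]
  · exact crossVal_flip_right h

theorem barVal_mul_self (a : Fin n) : barVal a * barVal a = 1 := B_mul_B _

theorem barVal_commute (a b : Fin n) : Commute (barVal a) (barVal b) := B_commute _ _

theorem crossVal_commute_barVal {a b c : Fin n} (h : a ≠ b) (h' : a ≠ c) (h'' : b ≠ c)
    (x : Crossing) : Commute (crossVal x a b) (barVal c) := by
  obtain ⟨hn, g, rfl, rfl, rfl⟩ := exists_perm_three h h' h''
  rw [crossVal_map, barVal_map, crossVal_adjacent (q := 0) (by omega)]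
  exact ((X_commute_B (by simp) (by simp) _).mul_left (X_commute_B (by simp) (by simp) _)).map _

theorem crossVal_commute {a b c d : Fin n} (h1 : a ≠ b) (h2 : a ≠ c) (h3 : a ≠ d) (h4 : b ≠ c)
    (h5 : b ≠ d) (h6 : c ≠ d) (x y : Crossing) : Commute (crossVal x a b) (crossVal y c d) := by
  obtain ⟨hn, g, rfl, rfl, rfl, rfl⟩ := exists_perm_four h1 h2 h3 h4 h5 h6
  rw [crossVal_map, crossVal_map, crossVal_adjacent (q := 0) (by omega),
    crossVal_adjacent (q := 2) (by omega)]
  have hf : Far 0 2 := Or.inl (by omega)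
  exact (((X_commute hf _ _).mul_left (X_commute hf _ _)).mul_right
    ((X_commute hf _ _).mul_left (X_commute hf _ _))).map _

theorem crossVal_twist {c : Crossing} (hc : c ≠ .virtual) {a b : Fin n} (h : a ≠ b) :
    barVal b * barVal a * crossVal c a b * barVal a * barVal b = crossVal c b a := by
  obtain ⟨hn, g, rfl, rfl⟩ := exists_perm_two h
  simp only [crossVal_map, barVal_map, ← map_mul]
  congr 1
  rw [crossVal_adjacent (q := 0) (by omega), crossVal_swap (q := 0) (by omega)]
  simp only [barVal]
  have hv : V n 0 * B n 0 = B n 1 * V n 0 := (B_V (by omega)).symm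
  have hv' : V n 0 * B n 1 = B n 0 * V n 0 := by
    calc V n 0 * B n 1 = V n 0 * (B n 1 * V n 0) * V n 0 := by
          rw [mul_assoc, mul_assoc, V_mul_V, mul_one]
      _ = _ := by rw [← hv, ← mul_assoc, V_mul_V, one_mul]
  calc B n 1 * B n 0 * (X n c 0 * V n 0) * B n 0 * B n 1
      = B n 1 * B n 0 * X n c 0 * (V n 0 * B n 0) * B n 1 := by simp only [mul_assoc]
    _ = B n 1 * B n 0 * X n c 0 * B n 1 * (V n 0 * B n 1) := by rw [hv]; simp only [mul_assoc]
    _ = B n 1 * B n 0 * X n c 0 * (B n 1 * B n 0) * V n 0 := by rw [hv']; simp only [mul_assoc]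
    _ = B n 1 * B n 0 * X n c 0 * B n 0 * B n 1 * V n 0 := by
        rw [(B_commute 1 0).eq]; simp only [mul_assoc]
    _ = V n 0 * X n c 0 := by
        rw [← X_twist (i := 0) (by omega) hc, mul_assoc, V_mul_V, mul_one]

/-- Pushing the virtual crossings of `X_slide` to the end gives it the Yang-Baxter form, with the
three pairs of strands in opposite orders on the two sides. The virtual words left over agree by the
virtual braid relation. -/
theorem crossVal_slide_right {d : Crossing} (hd : d = .rightOver ∨ d = .singular) {x y z : Fin n}
    (h : x ≠ y) (h' : x ≠ z) (h'' : y ≠ z) :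
    crossVal .rightOver x y * crossVal .rightOver x z * crossVal d y z =
      crossVal d y z * crossVal .rightOver x z * crossVal .rightOver x y := by
  obtain ⟨hn, g, rfl, rfl, rfl⟩ := exists_perm_three h h' h''
  simp only [crossVal_map, ← map_mul]
  congr 1
  have p0 : adj n 0 ⟨1, by omega⟩ = ⟨0, by omega⟩ := by ext; rw [adj_val (by omega)]; simp
  have p2 : adj n 0 ⟨2, by omega⟩ = ⟨2, by omega⟩ := by ext; rw [adj_val (by omega)]; simp
  have h02 := crossVal_map (adj n 0) .rightOver ⟨1, by omega⟩ ⟨2, by omega⟩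
  rw [p0, p2, crossVal_adjacent (q := 1) (by omega), conjBy_adj] at h02
  have q0 : adj n 1 ⟨0, by omega⟩ = ⟨0, by omega⟩ := by ext; rw [adj_val (by omega)]; simp
  have q2 : adj n 1 ⟨1, by omega⟩ = ⟨2, by omega⟩ := by ext; rw [adj_val (by omega)]; simp
  have h02' := crossVal_map (adj n 1) .rightOver ⟨0, by omega⟩ ⟨1, by omega⟩
  rw [q0, q2, crossVal_adjacent (q := 0) (by omega), conjBy_adj] at h02'
  have v0 := V_mul_V (n := n) 0
  have v1 := V_mul_V (n := n) 1
  have mv : ∀ c, V n 1 * V n 0 * X n c 1 = X n c 0 * V n 1 * V n 0 := by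
    intro c
    have := V_X_V (n := n) (i := 0) (by omega) c
    calc V n 1 * V n 0 * X n c 1 = V n 1 * (V n 0 * X n c 1 * V n 0) * V n 0 := by
          simp only [mul_assoc, v0, mul_one]
      _ = (V n 1 * V n 1) * X n c 0 * V n 1 * V n 0 := by rw [this]; simp only [mul_assoc]
      _ = _ := by rw [v1, one_mul]
  have mv' : ∀ c, V n 0 * V n 1 * X n c 0 = X n c 1 * V n 0 * V n 1 := by
    intro c
    have := V_X_V (n := n) (i := 0) (by omega) c
    calc V n 0 * V n 1 * X n c 0 = V n 0 * (V n 1 * X n c 0 * V n 1) * V n 1 := by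
          simp only [mul_assoc, v1, mul_one]
      _ = (V n 0 * V n 0) * X n c 1 * V n 0 * V n 1 := by rw [← this]; simp only [mul_assoc]
      _ = _ := by rw [v0, one_mul]
  calc _ = (X n .rightOver 0 * V n 0) * (V n 0 * (X n .rightOver 1 * V n 1) * V n 0) *
          (X n d 1 * V n 1) := by
        rw [h02, crossVal_adjacent (q := 0) (by omega), crossVal_adjacent (q := 1) (by omega)]
    _ = X n .rightOver 0 * (V n 0 * V n 0) * X n .rightOver 1 * (V n 1 * V n 0 * X n d 1)
          * V n 1 := by simp only [mul_assoc]
    _ = X n .rightOver 0 * X n .rightOver 1 * X n d 0 * (V n 1 * V n 0 * V n 1) := by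
        rw [v0, mv, mul_one]; simp only [mul_assoc]
    _ = X n d 1 * X n .rightOver 0 * X n .rightOver 1 * (V n 0 * V n 1 * V n 0) := by
        rw [X_slide (by omega) hd]
        exact congrArg _ (V_X_V (n := n) (i := 0) (by omega) .virtual).symm
    _ = X n d 1 * (V n 1 * V n 1) * X n .rightOver 0 * (V n 0 * V n 1 * X n .rightOver 0) *
          V n 0 := by rw [v1, mv', mul_one]; simp only [mul_assoc]
    _ = (X n d 1 * V n 1) * (V n 1 * (X n .rightOver 0 * V n 0) * V n 1) *
          (X n .rightOver 0 * V n 0) := by simp only [mul_assoc]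
    _ = _ := by
        rw [h02', crossVal_adjacent (q := 0) (by omega), crossVal_adjacent (q := 1) (by omega)]

/-- For a negative `d` the relation of its inverse is multiplied by `d` from both sides. -/
theorem crossVal_slide_right' {d : Crossing} (hd : d ≠ .virtual) {x y z : Fin n}
    (h : x ≠ y) (h' : x ≠ z) (h'' : y ≠ z) :
    crossVal .rightOver x y * crossVal .rightOver x z * crossVal d y z =
      crossVal d y z * crossVal .rightOver x z * crossVal .rightOver x y := by
  cases d with
  | rightOver => exact crossVal_slide_right (.inl rfl) h h' h''
  | singular => exact crossVal_slide_right (.inr rfl) h h' h''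
  | leftOver =>
    have h1 := crossVal_mul_inv (c := .leftOver) (.inl rfl) h''
    have h2 := crossVal_mul_inv (c := .rightOver) (.inr rfl) h''.symm
    have h3 := crossVal_slide_right (d := .rightOver) (.inl rfl) h' h h''.symm
    simp only [Crossing.turn] at h1 h2
    calc _ = crossVal .leftOver y z * (crossVal .rightOver z y * crossVal .rightOver x y *
            crossVal .rightOver x z) * crossVal .leftOver y z := by
          simp only [← mul_assoc]; rw [h1, one_mul]
      _ = _ := by
          rw [← h3, mul_assoc, mul_assoc _ _ (crossVal .leftOver y z), h2, mul_one, mul_assoc]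
  | _ => exact absurd rfl hd

theorem inverse_slide {M : Type*} [Monoid M] {a b a' b' d : M} (ha : a * a' = 1) (ha' : a' * a = 1)
    (hb : b * b' = 1) (hb' : b' * b = 1) (h : a * b * d = d * b * a) :
    b' * a' * d = d * a' * b' := by
  calc b' * a' * d = b' * a' * (d * b * (a * a') * b') := by
        rw [ha, mul_one, mul_assoc d, hb, mul_one]
    _ = b' * a' * (a * b * d) * a' * b' := by rw [h]; simp only [mul_assoc]
    _ = b' * (a' * a) * b * d * a' * b' := by simp only [mul_assoc]
    _ = d * a' * b' := by rw [ha', mul_one, hb', one_mul]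

/-- The relations used so far let a strand pass under a crossing. Conjugation by bars on all three
strands exchanges left and right in each crossing, by `crossVal_twist`. Inverting the two real
crossings of the moving strand then gives the passage over a crossing. -/
theorem crossVal_slide {c d : Crossing} (hc : c.IsReal) (hd : d ≠ .virtual) {x y z : Fin n}
    (h : x ≠ y) (h' : x ≠ z) (h'' : y ≠ z) :
    crossVal c x y * crossVal c x z * crossVal d y z =
      crossVal d y z * crossVal c x z * crossVal c x y := by
  rcases hc with rfl | rfl
  · have h1 := crossVal_mul_inv (c := .leftOver) (.inl rfl) h
    have h2 := crossVal_mul_inv (c := .rightOver) (.inr rfl) h.symm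
    have h3 := crossVal_mul_inv (c := .leftOver) (.inl rfl) h'
    have h4 := crossVal_mul_inv (c := .rightOver) (.inr rfl) h'.symm
    simp only [Crossing.turn] at h1 h2 h3 h4
    refine inverse_slide h4 h3 h2 h1 ?_
    have h5 := crossVal_slide_right' hd h' h h''.symm
    -- In the conjugation of a crossing by `P` the two bars on its strands twist it, while the third
    -- bar commutes with it and cancels; this is `tw`.
    set P := barVal x * barVal y * barVal z with hP
    have PP : P * P = 1 := by
      have e1 := (barVal_commute y x).eq
      have e2 := (barVal_commute z x).eq
      have e3 := (barVal_commute z y).eq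
      calc P * P = barVal x * barVal y * (barVal z * barVal x) * barVal y * barVal z := by
            simp only [hP, mul_assoc]
        _ = barVal x * (barVal y * barVal x) * (barVal z * barVal y) * barVal z := by
            rw [e2]; simp only [mul_assoc]
        _ = (barVal x * barVal x) * (barVal y * barVal y) * (barVal z * barVal z) := by
            rw [e1, e3]; simp only [mul_assoc]
        _ = 1 := by simp only [barVal_mul_self, one_mul]
    have tw : ∀ {a b e : Fin n} (f : Crossing), f ≠ .virtual → a ≠ b → a ≠ e → b ≠ e →
        P = barVal e * (barVal b * barVal a) →
        P * crossVal f a b * P = crossVal f b a := by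
      intro a b e f hf hab hae hbe hp
      have hp' : P = barVal a * barVal b * barVal e := by
        rw [hp, (barVal_commute b a).eq, ((barVal_commute e a).mul_right (barVal_commute e b)).eq]
      calc P * crossVal f a b * P = barVal e * (barVal b * barVal a) * crossVal f a b *
              (barVal a * barVal b * barVal e) := by rw [← hp, ← hp']
        _ = barVal e * (barVal b * barVal a * crossVal f a b * barVal a * barVal b) * barVal e := by
            simp only [mul_assoc]
        _ = crossVal f b a := by
            rw [crossVal_twist hf hab, ← (crossVal_commute_barVal hab.symm hbe hae f).eq,
              mul_assoc, barVal_mul_self, mul_one]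
    have c1 := (barVal_commute z y).eq
    have c2 := (barVal_commute z x).eq
    have c3 := (barVal_commute y x).eq
    have t1 := tw (a := x) (b := y) (e := z) .rightOver (by simp) h h' h'' (by
      rw [((barVal_commute z y).mul_right (barVal_commute z x)).eq, hP, c3])
    have t2 := tw (a := x) (b := z) (e := y) .rightOver (by simp) h' h h''.symm (by
      rw [← mul_assoc, ← c1, mul_assoc, c3, ← mul_assoc, c2, mul_assoc, c1, hP, mul_assoc])
    have t3 := tw (a := z) (b := y) (e := x) d hd h''.symm h'.symm h.symm (by
      rw [hP, mul_assoc])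
    rw [← t1, ← t2, ← t3,
      show ∀ p a b e : STVB n, p * a * p * (p * b * p) * (p * e * p) =
        p * a * (p * p) * b * (p * p) * e * p by intros; simp only [mul_assoc],
      show ∀ p a b e : STVB n, p * a * p * (p * b * p) * (p * e * p) =
        p * a * (p * p) * b * (p * p) * e * p by intros; simp only [mul_assoc], PP]
    simp only [mul_one]
    rw [mul_assoc P, mul_assoc P, h5]
    simp only [mul_assoc]
  · exact crossVal_slide_right' hd h h' h''

end SingTwist

namespace SingTwist

/-! ### The `L_v`-moves in terms of strands -/

variable {n : ℕ}

theorem LvEquiv.refl (x : Σ n, STVB n) : LvEquiv x x := Relation.EqvGen.refl x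

theorem LvEquiv.symm {x y : Σ n, STVB n} (h : LvEquiv x y) : LvEquiv y x :=
  Relation.EqvGen.symm _ _ h

theorem LvEquiv.trans {x y z : Σ n, STVB n} (h : LvEquiv x y) (h' : LvEquiv y z) : LvEquiv x z :=
  Relation.EqvGen.trans _ _ _ h h'

theorem LvMove.equiv {x y : Σ n, STVB n} (h : LvMove x y) : LvEquiv x y := Relation.EqvGen.rel _ _ h

theorem filter_finRange_of_ge {n p : ℕ} (h : n ≤ p) :
    (List.finRange n).filter (fun q => p ≤ q.val) = [] := by
  simp only [List.filter_eq_nil_iff, decide_eq_true_eq]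
  intro q _
  omega

theorem filter_finRange {n p : ℕ} (h : p < n) :
    (List.finRange n).filter (fun q => p ≤ q.val) =
      ⟨p, h⟩ :: (List.finRange n).filter (fun q => p + 1 ≤ q.val) := by
  have hs := List.pairwise_lt_finRange n
  refine List.Perm.eq_of_pairwise (le := (· ≤ ·)) (fun a b _ _ h h' => le_antisymm h h')
    ((hs.filter _).imp le_of_lt) ?_ ?_
  · refine List.pairwise_cons.2 ⟨?_, (hs.filter _).imp le_of_lt⟩
    intro q hq
    simp only [List.mem_filter, decide_eq_true_eq] at hq
    exact Fin.le_def.2 (by simp; omega)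
  · refine (List.perm_ext_iff_of_nodup ((List.nodup_finRange n).filter _) ?_).2 ?_
    · refine List.nodup_cons.2 ⟨by simp, (List.nodup_finRange n).filter _⟩
    · intro q
      simp [Fin.ext_iff]
      omega

theorem virtGen_eq {i : ℕ} (h : i + 1 < n) : virtGen i h = V n i := (X_of_lt (c := .virtual) h).symm

theorem tauGen_eq {i : ℕ} (h : i + 1 < n) : tauGen i h = X n .singular i :=
  (X_of_lt (c := .singular) h).symm

/-- The real crossing with a given sign. -/
def realCross : Bool → Crossing
  | true => .rightOver
  | false => .leftOver

theorem realGen_eq (e : Bool) {i : ℕ} (h : i + 1 < n) : realGen e i h = X n (realCross e) i := by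
  cases e
  · exact (X_of_lt (c := .leftOver) h).symm
  · exact (X_of_lt (c := .rightOver) h).symm

theorem runLeft_of_ge {p : ℕ} (h : n ≤ p) : runLeft n p = 1 := by
  rw [runLeft, filter_finRange_of_ge h]; rfl

theorem runRight_of_ge {p : ℕ} (h : n ≤ p) : runRight n p = 1 := by
  rw [runRight, filter_finRange_of_ge h]; rfl

theorem runLeft_of_lt {p : ℕ} (h : p < n) : runLeft n p = runLeft n (p + 1) * V (n + 1) p := by
  rw [runLeft, filter_finRange h, runLeft]
  simp [virtGen_eq]

theorem runRight_of_lt {p : ℕ} (h : p < n) : runRight n p = V (n + 1) p * runRight n (p + 1) := by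
  rw [runRight, filter_finRange h, runRight]
  simp [virtGen_eq]

/-- The permutation of `runLeft`. -/
theorem exists_perm_run : ∀ (k p : ℕ), p + k = n → ∃ g : Equiv.Perm (Fin (n + 1)),
    runLeft n p = rho g ∧ runRight n p = rho g⁻¹ ∧ (∀ q : Fin (n + 1), q.val < p → g q = q) ∧
      (∀ q : Fin (n + 1), q.val = p → g q = Fin.last n) ∧
      ∀ q : Fin (n + 1), p < q.val → (g q).val + 1 = q.val
  | 0, p, h => ⟨1, by rw [runLeft_of_ge (by omega), map_one],
      by rw [runRight_of_ge (by omega), inv_one, map_one], fun _ _ => rfl,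
      fun q hq => Fin.ext (by simp; omega), fun q hq => by omega⟩
  | k + 1, p, h => by
    obtain ⟨g, h1, h2, h3, h4, h5⟩ := exists_perm_run k (p + 1) (by omega)
    have hp : p + 1 < n + 1 := by omega
    refine ⟨g * adj (n + 1) p, ?_, ?_, ?_, ?_, ?_⟩
    · rw [runLeft_of_lt (by omega), h1, map_mul, rho_adj]
    · rw [runRight_of_lt (by omega), h2, mul_inv_rev, map_mul, adj_inv, rho_adj]
    · intro q hq
      rw [Equiv.Perm.mul_apply, show adj (n + 1) p q = q by
        ext; rw [adj_val hp]; split_ifs <;> omega, h3 q (by omega)]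
    · intro q hq
      rw [Equiv.Perm.mul_apply, h4]
      rw [adj_val hp, if_pos hq]
    · intro q hq
      rw [Equiv.Perm.mul_apply]
      by_cases hq' : q.val = p + 1
      · rw [h3] <;> · rw [adj_val hp]; split_ifs <;> omega
      · rw [show adj (n + 1) p q = q by ext; rw [adj_val hp]; split_ifs <;> omega]
        exact h5 q (by omega)

theorem runLeft_mul_runRight {p : ℕ} : runLeft n p * runRight n p = 1 := by
  by_cases h : p ≤ n
  · obtain ⟨g, h1, h2, -⟩ := exists_perm_run (n := n) (n - p) p (by omega)
    rw [h1, h2, rho_mul_inv]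
  · rw [runLeft_of_ge (by omega), runRight_of_ge (by omega), one_mul]

theorem runRight_mul_runLeft {p : ℕ} : runRight n p * runLeft n p = 1 := by
  by_cases h : p ≤ n
  · obtain ⟨g, h1, h2, -⟩ := exists_perm_run (n := n) (n - p) p (by omega)
    rw [h1, h2, rho_inv_mul]
  · rw [runLeft_of_ge (by omega), runRight_of_ge (by omega), one_mul]

theorem widen_X {i : ℕ} (h : i + 1 < n) (c : Crossing) :
    STVB.widen n (X n c i) = X (n + 1) c i := by
  rw [X_of_lt h, X_of_lt (by omega)]
  cases c <;> rfl

theorem widen_V {i : ℕ} (h : i + 1 < n) : STVB.widen n (V n i) = V (n + 1) i := widen_X h _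

theorem widen_B {i : ℕ} (h : i < n) : STVB.widen n (B n i) = B (n + 1) i := by
  rw [B_of_lt h, B_of_lt (by omega)]; rfl

/-- The permutation of the widened braid. -/
noncomputable def extPerm : Equiv.Perm (Fin n) →* Equiv.Perm (Fin (n + 1)) :=
  Equiv.Perm.viaEmbeddingHom Fin.castSuccEmb

theorem extPerm_castSucc (g : Equiv.Perm (Fin n)) (i : Fin n) :
    extPerm g i.castSucc = (g i).castSucc := Equiv.Perm.viaEmbedding_apply g Fin.castSuccEmb i

theorem extPerm_last (g : Equiv.Perm (Fin n)) : extPerm g (Fin.last n) = Fin.last n := by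
  refine Equiv.Perm.viaEmbedding_apply_of_notMem g Fin.castSuccEmb _ ?_
  rintro ⟨i, hi⟩
  exact (Fin.castSucc_lt_last i).ne hi

theorem extPerm_adj {i : ℕ} (h : i + 1 < n) : extPerm (adj n i) = adj (n + 1) i := by
  ext q
  induction q using Fin.lastCases with
  | last => rw [extPerm_last, adj_val (by omega), Fin.val_last]; split_ifs <;> omega
  | cast q => rw [extPerm_castSucc, adj_val (by omega), Fin.val_castSucc, adj_val h]; simp

theorem widen_rho (g : Equiv.Perm (Fin n)) : STVB.widen n (rho g) = rho (extPerm g) := by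
  have hg : g ∈ Submonoid.closure (adj n '' Set.Iio (n - 1)) := by
    rw [closure_range_adj]; trivial
  induction hg using Submonoid.closure_induction with
  | mem g hg =>
    obtain ⟨i, hi, rfl⟩ := hg
    have hi : i + 1 < n := by simp at hi; omega
    rw [rho_adj, widen_V hi, extPerm_adj hi, rho_adj]
  | one => simp
  | mul g h _ _ hg hh => simp only [map_mul, hg, hh]

theorem widen_conjBy (g : Equiv.Perm (Fin n)) (x : STVB n) :
    STVB.widen n (conjBy g x) = conjBy (extPerm g) (STVB.widen n x) := by
  rw [conjBy_apply, map_mul, map_mul, widen_rho, widen_rho, map_inv]; rfl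

theorem widen_barVal (a : Fin n) : STVB.widen n (barVal a) = barVal a.castSucc := widen_B a.isLt

theorem widen_crossVal (c : Crossing) {a b : Fin n} (h : a ≠ b) :
    STVB.widen n (crossVal c a b) = crossVal c a.castSucc b.castSucc := by
  obtain ⟨hn, g, rfl, rfl⟩ := exists_perm_two h
  rw [← extPerm_castSucc, ← extPerm_castSucc, crossVal_map, crossVal_map, widen_conjBy,
    crossVal_adjacent (q := 0) (by omega), map_mul, widen_X (by omega), widen_V (by omega),
    ← crossVal_adjacent (n := n + 1) (q := 0) (by omega)]
  rfl

theorem conjBy_rho (g h : Equiv.Perm (Fin n)) : conjBy g (rho h) = rho (g * h * g⁻¹) := by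
  rw [conjBy_apply, map_mul, map_mul]

theorem conjBy_rho_swap (g : Equiv.Perm (Fin n)) (a b : Fin n) :
    conjBy g (rho (Equiv.swap a b)) = rho (Equiv.swap (g a) (g b)) := by
  rw [conjBy_rho, Equiv.swap_apply_apply]

theorem adj_eq_swap {i : ℕ} (h : i + 1 < n) :
    adj n i = Equiv.swap ⟨i, by omega⟩ ⟨i + 1, h⟩ := dif_pos h

/-- This is the box of the right moves of type 2 and 3: strand `i` is the one that is cut, `i + 1`
the thread, `i + 2` the new strand. As a permutation the box exchanges the cut strand with the new
one. -/
theorem X_V_X_right {i : ℕ} (h : i + 2 < n) (c d : Crossing) :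
    X n c (i + 1) * V n i * X n d (i + 1) =
      crossVal c ⟨i + 1, by omega⟩ ⟨i + 2, h⟩ * crossVal d ⟨i, by omega⟩ ⟨i + 1, by omega⟩ *
        rho (Equiv.swap ⟨i, by omega⟩ ⟨i + 2, h⟩) := by
  have e1 : adj n (i + 1) ⟨i, by omega⟩ = ⟨i, by omega⟩ := by
    ext; rw [adj_val (by omega)]; simp; omega
  have e2 : adj n (i + 1) ⟨i + 1, by omega⟩ = ⟨i + 2, h⟩ := by
    ext; rw [adj_val (by omega)]; simp
  have e3 : adj n (i + 1) ⟨i + 2, h⟩ = ⟨i + 1, by omega⟩ := by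
    ext; rw [adj_val (by omega)]; simp
  have e4 : adj n i ⟨i + 1, by omega⟩ = ⟨i, by omega⟩ := by
    ext; rw [adj_val (by omega)]; simp
  have e5 : adj n i ⟨i + 2, h⟩ = ⟨i + 2, h⟩ := by
    ext; rw [adj_val (by omega)]; simp
  have h1 := conjBy_rho_swap (adj n (i + 1)) ⟨i, by omega⟩ ⟨i + 1, by omega⟩
  rw [e1, e2, ← adj_eq_swap (by omega), rho_adj, conjBy_adj] at h1
  have h2 := crossVal_map (adj n (i + 1) * adj n i) d ⟨i + 1, by omega⟩ ⟨i + 2, h⟩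
  rw [Equiv.Perm.mul_apply, Equiv.Perm.mul_apply, e4, e5, e1, e3, conjBy_mul, conjBy_adj,
    conjBy_adj] at h2
  rw [h2, ← h1, X_eq_crossVal (q := i + 1) (by omega), X_eq_crossVal (q := i + 1) (by omega)]
  have v0 := V_mul_V (n := n) i
  have v1 := V_mul_V (n := n) (i + 1)
  rw [show ∀ p q r s : STVB n, p * (q * (r * s * r) * q) * (q * r * q) =
    p * q * r * s * (r * (q * q) * r) * q by intros; simp only [mul_assoc], v1, mul_one, v0,
    mul_one]
  simp only [mul_assoc]

theorem X_V_X_left {i : ℕ} (h : i + 2 < n) (c d : Crossing) :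
    X n c i * V n (i + 1) * X n d i =
      crossVal c ⟨i, by omega⟩ ⟨i + 1, by omega⟩ * crossVal d ⟨i + 1, by omega⟩ ⟨i + 2, h⟩ *
        rho (Equiv.swap ⟨i, by omega⟩ ⟨i + 2, h⟩) := by
  have e1 : adj n (i + 1) ⟨i, by omega⟩ = ⟨i, by omega⟩ := by
    ext; rw [adj_val (by omega)]; simp; omega
  have e2 : adj n (i + 1) ⟨i + 1, by omega⟩ = ⟨i + 2, h⟩ := by
    ext; rw [adj_val (by omega)]; simp
  have e4 : adj n i ⟨i, by omega⟩ = ⟨i + 1, by omega⟩ := by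
    ext; rw [adj_val (by omega)]; simp
  have e6 : adj n i ⟨i + 1, by omega⟩ = ⟨i, by omega⟩ := by
    ext; rw [adj_val (by omega)]; simp
  have e5 : adj n i ⟨i + 2, h⟩ = ⟨i + 2, h⟩ := by
    ext; rw [adj_val (by omega)]; simp
  have h1 := conjBy_rho_swap (adj n i) ⟨i + 1, by omega⟩ ⟨i + 2, by omega⟩
  rw [e5, e6, ← adj_eq_swap (i := i + 1) (by omega), rho_adj, conjBy_adj] at h1
  have h2 := crossVal_map (adj n i * adj n (i + 1)) d ⟨i, by omega⟩ ⟨i + 1, by omega⟩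
  rw [Equiv.Perm.mul_apply, Equiv.Perm.mul_apply, e1, e2, e4, e5, conjBy_mul, conjBy_adj,
    conjBy_adj] at h2
  rw [h2, ← h1, X_eq_crossVal (q := i) (by omega), X_eq_crossVal (q := i) (by omega)]
  have v0 := V_mul_V (n := n) i
  have v1 := V_mul_V (n := n) (i + 1)
  rw [show ∀ p q r s : STVB n, p * (q * (r * s * r) * q) * (q * r * q) =
    p * q * r * s * (r * (q * q) * r) * q by intros; simp only [mul_assoc], v0, mul_one, v1,
    mul_one]
  simp only [mul_assoc]

/-- The braid which results when the strand which begins in the position `i` is cut between `α` and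
`β`, the piece `T` being inserted there. -/
noncomputable def cutBraid (α T β : STVB (n + 1)) (i : Fin n) : STVB (n + 1) :=
  α * (T * rho (Equiv.swap i.castSucc (Fin.last n))) * β

theorem pulled_last (p : ℕ) (α K β : STVB (n + 1)) :
    pulled n p α K β = α * (runLeft n p * K * runRight n p) * β := by
  rw [pulled, runRight_of_ge le_rfl, runLeft_of_ge le_rfl, one_mul, mul_one]

theorem run_virt (i : Fin n) :
    runLeft n (i + 1) * V (n + 1) i * runRight n (i + 1) =
      rho (Equiv.swap i.castSucc (Fin.last n)) := by
  obtain ⟨g, h1, h2, h3, h4, -⟩ := exists_perm_run (n := n) (n - (i + 1)) (i + 1) (by omega)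
  rw [h1, h2, ← rho_adj, ← conjBy_apply, adj_eq_swap (by omega), conjBy_rho_swap, h3, h4]
  · rfl
  · rfl
  · simp

theorem run_cross (c : Crossing) (i : Fin n) :
    runLeft n (i + 1) * X (n + 1) c i * runRight n (i + 1) =
      crossVal c i.castSucc (Fin.last n) * rho (Equiv.swap i.castSucc (Fin.last n)) := by
  obtain ⟨g, h1, h2, h3, h4, -⟩ := exists_perm_run (n := n) (n - (i + 1)) (i + 1) (by omega)
  rw [h1, h2, ← conjBy_apply, X_eq_crossVal (by omega), map_mul, ← crossVal_map, ← rho_adj,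
    adj_eq_swap (by omega), conjBy_rho_swap, h3, h4]
  · rfl
  · rfl
  · simp

theorem run_right (c d : Crossing) {i : ℕ} (h : i + 1 < n) :
    runLeft n (i + 2) * (X (n + 1) c (i + 1) * V (n + 1) i * X (n + 1) d (i + 1)) *
        runRight n (i + 2) =
      crossVal c (Fin.castSucc ⟨i + 1, h⟩) (Fin.last n) *
        crossVal d (Fin.castSucc ⟨i, by omega⟩) (Fin.castSucc ⟨i + 1, h⟩) *
        rho (Equiv.swap (Fin.castSucc ⟨i, by omega⟩) (Fin.last n)) := by
  obtain ⟨g, h1, h2, h3, h4, -⟩ := exists_perm_run (n := n) (n - (i + 2)) (i + 2) (by omega)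
  rw [h1, h2, ← conjBy_apply, X_V_X_right (by omega), map_mul, map_mul, ← crossVal_map,
    ← crossVal_map, conjBy_rho_swap, h3 ⟨i, _⟩ (by simp), h3 ⟨i + 1, _⟩ (by simp),
    h4 ⟨i + 2, _⟩ rfl]
  rfl

/-- The new strand enters at position `i`, to the left of the thread, so the positions after `i`
have to be lowered by one. The thread is the old strand `i`, and the cut one the old strand `i + 1`.
-/
theorem run_left (c d : Crossing) {i : ℕ} (h : i + 1 < n) :
    runLeft n i * (X (n + 1) c i * V (n + 1) (i + 1) * X (n + 1) d i) * runRight n i =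
      crossVal c (Fin.last n) (Fin.castSucc ⟨i, by omega⟩) *
        crossVal d (Fin.castSucc ⟨i, by omega⟩) (Fin.castSucc ⟨i + 1, h⟩) *
        rho (Equiv.swap (Fin.castSucc ⟨i + 1, h⟩) (Fin.last n)) := by
  obtain ⟨g, h1, h2, h3, h4, h5⟩ := exists_perm_run (n := n) (n - i) i (by omega)
  have e1 : g ⟨i + 1, by omega⟩ = Fin.castSucc ⟨i, by omega⟩ :=
    Fin.ext (by have := h5 ⟨i + 1, by omega⟩ (by simp); simpa using this)
  have e2 : g ⟨i + 2, by omega⟩ = Fin.castSucc ⟨i + 1, h⟩ :=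
    Fin.ext (by have := h5 ⟨i + 2, by omega⟩ (by simp); simpa using this)
  rw [h1, h2, ← conjBy_apply, X_V_X_left (by omega), map_mul, map_mul, ← crossVal_map,
    ← crossVal_map, conjBy_rho_swap, h4 ⟨i, _⟩ rfl, e1, e2, Equiv.swap_comm]

/-- For `j = n` the outer runs are empty. This value suffices for all moves on strands below; other
values serve only to obtain conjugation by virtual braids. -/
theorem lv_cut (α β : STVB n) (i : Fin n) :
    LvEquiv ⟨n, α * β⟩ ⟨n + 1, cutBraid (STVB.widen n α) 1 (STVB.widen n β) i⟩ := by
  have := (LvMove.virtual_one α β n i le_rfl (by omega)).equiv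
  rwa [pulled_last, virtGen_eq, run_virt, ← one_mul (rho _)] at this

theorem lv_kink (e : Bool) (α β : STVB n) (i : Fin n) :
    LvEquiv ⟨n, α * β⟩ ⟨n + 1, cutBraid (STVB.widen n α)
      (crossVal (realCross e) i.castSucc (Fin.last n)) (STVB.widen n β) i⟩ := by
  have := (LvMove.real_one e α β n i le_rfl (by omega)).equiv
  rwa [pulled_last, realGen_eq, run_cross] at this

/-- Conjugation by a virtual braid. -/
theorem lv_conj_run {m j : ℕ} (hj : j ≤ m) (x : STVB (m + 1)) :
    LvEquiv ⟨m + 1, x⟩ ⟨m + 1, runRight m j * x * runLeft m j⟩ := by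
  -- The last strand is cut below `x` and its ends are pulled to position `j`. On the other side
  -- strand `j` is cut above the conjugate of `x` and its ends are pulled to the last position. The
  -- two results are the same braid on `m + 2` strands.
  have h1 := (LvMove.virtual_one (n := m + 1) x 1 j m (by omega) (by omega)).equiv
  have h2 := (LvMove.virtual_one (n := m + 1) 1 (runRight m j * x * runLeft m j) (m + 1) j
    (by omega) (by omega)).equiv
  rw [mul_one] at h1
  rw [one_mul] at h2
  refine h1.trans (LvEquiv.trans ?_ h2.symm)
  suffices h : pulled (n := m + 1) j (m + 1) (STVB.widen (m + 1) x) (virtGen m (by omega))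
      (STVB.widen (m + 1) 1) = pulled (m + 1) (j + 1) (STVB.widen (m + 1) 1)
        (virtGen j (by omega)) (STVB.widen (m + 1) (runRight m j * x * runLeft m j)) by
    rw [h]; exact .refl _
  -- A run on `m + 2` strands is a run on the first `m + 1` strands together with one more virtual
  -- crossing, at its rightmost end.
  have hL : ∀ k p, p + k = m →
      runLeft (m + 1) p = V (m + 2) m * STVB.widen (m + 1) (runLeft m p) ∧
      runRight (m + 1) p = STVB.widen (m + 1) (runRight m p) * V (m + 2) m := by
    intro k
    induction k with
    | zero =>
      rintro p rfl
      rw [runLeft_of_lt (by omega), runLeft_of_ge (by omega), runRight_of_lt (by omega),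
        runRight_of_ge (by omega), runLeft_of_ge (by omega), runRight_of_ge (by omega)]
      simp
    | succ k ih =>
      intro p hp
      obtain ⟨h1, h2⟩ := ih (p + 1) (by omega)
      constructor
      · rw [runLeft_of_lt (by omega), h1, runLeft_of_lt (n := m) (p := p) (by omega), map_mul,
          widen_V (by omega), mul_assoc]
      · rw [runRight_of_lt (by omega), h2, runRight_of_lt (n := m) (p := p) (by omega), map_mul,
          widen_V (by omega), mul_assoc]
  obtain ⟨hl, hr⟩ := hL (m - j) j (by omega)
  obtain ⟨g, e1, e2, -, e4, -⟩ := exists_perm_run (n := m) (m - j) j (by omega)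
  rw [pulled_last, virtGen_eq, virtGen_eq, run_virt ⟨j, by omega⟩, pulled, hl, hr,
    runLeft_of_ge le_rfl, runRight_of_ge le_rfl]
  have e5 : extPerm g (Fin.castSucc ⟨j, by omega⟩) = Fin.castSucc (Fin.last m) := by
    rw [extPerm_castSucc, e4 _ rfl]
  have e6 := conjBy_rho_swap (extPerm g) (Fin.castSucc ⟨j, by omega⟩) (Fin.last (m + 1))
  rw [e5, extPerm_last] at e6
  have e7 : rho (Equiv.swap (Fin.castSucc (Fin.last m)) (Fin.last (m + 1))) = V (m + 2) m := by
    rw [← rho_adj, adj_eq_swap (by omega)]; rfl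
  rw [e7, conjBy_apply] at e6
  simp only [map_mul, map_one, e1, e2, widen_rho, map_inv, one_mul, mul_one]
  have v := V_mul_V (n := m + 2) m
  have e8 := rho_inv_mul (extPerm g)
  calc _ = rho (extPerm g)⁻¹ * V (m + 2) m * STVB.widen (m + 1) x * (V (m + 2) m * V (m + 2) m) *
        rho (extPerm g) := by simp only [mul_assoc]
    _ = rho (extPerm g)⁻¹ * V (m + 2) m * STVB.widen (m + 1) x * rho (extPerm g) := by
        rw [v, mul_one]
    _ = (rho (extPerm g)⁻¹ * rho (extPerm g)) * rho (Equiv.swap (Fin.castSucc ⟨j, by omega⟩)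
          (Fin.last (m + 1))) * (rho (extPerm g)⁻¹ * STVB.widen (m + 1) x * rho (extPerm g)) := by
        rw [← e6, e8, one_mul]
        simp only [mul_assoc]
        rw [← mul_assoc (rho (extPerm g)⁻¹) (rho (extPerm g)), e8, one_mul]
    _ = _ := by rw [e8, one_mul]

/-- The runs at `j` and `j + 1` differ by one virtual crossing. Applied to the same braid, the
conjugations of `lv_conj_run` for these two values give `x` and its conjugate by `V j`. The adjacent
transpositions generate the rest. -/
theorem lv_conj (g : Equiv.Perm (Fin n)) : ∀ x : STVB n, LvEquiv ⟨n, x⟩ ⟨n, conjBy g x⟩ := by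
  have hg : g ∈ Submonoid.closure (adj n '' Set.Iio (n - 1)) := by
    rw [closure_range_adj]; trivial
  induction hg using Submonoid.closure_induction with
  | mem g hg =>
    obtain ⟨j, hj, rfl⟩ := hg
    obtain ⟨m, rfl⟩ : ∃ m, n = m + 1 := ⟨n - 1, by simp at hj; omega⟩
    have hj : j < m := by simpa using hj
    intro x
    have h1 := lv_conj_run (j := j) (by omega) (runLeft m (j + 1) * x * runRight m (j + 1))
    have h2 := lv_conj_run (j := j + 1) (by omega) (runLeft m (j + 1) * x * runRight m (j + 1))
    have e := runRight_mul_runLeft (n := m) (p := j + 1)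
    have key : runRight m (j + 1) * (runLeft m (j + 1) * x * runRight m (j + 1)) *
        runLeft m (j + 1) = x := by
      rw [show ∀ a b c : STVB (m + 1), a * (b * c * a) * b = (a * b) * c * (a * b) by
        intros; simp only [mul_assoc], e, one_mul, mul_one]
    rw [key] at h2
    rw [runRight_of_lt hj, runLeft_of_lt hj, show ∀ v a b c : STVB (m + 1),
      v * a * (b * c * a) * (b * v) = v * (a * (b * c * a) * b) * v by
        intros; simp only [mul_assoc], key, ← conjBy_adj] at h1
    exact h2.symm.trans h1
  | one =>
    intro x
    rw [conjBy_apply, inv_one, map_one, one_mul, mul_one]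
    exact .refl _
  | mul g h _ _ hg hh =>
    intro x
    rw [conjBy_mul]
    exact (hh x).trans (hg _)

theorem cutBraid_conj (g : Equiv.Perm (Fin n)) (α T β : STVB (n + 1)) (i : Fin n) :
    conjBy (extPerm g) (cutBraid α T β i) =
      cutBraid (conjBy (extPerm g) α) (conjBy (extPerm g) T) (conjBy (extPerm g) β) (g i) := by
  rw [cutBraid, cutBraid, map_mul, map_mul, map_mul, conjBy_rho_swap, extPerm_castSucc,
    extPerm_last]

/-- This reduces a move on arbitrary strands to the strands `0` and `1`: the conjugating permutation
fixes the new strand. -/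
theorem lv_relabel (g : Equiv.Perm (Fin n)) (α β : STVB n) (T : STVB (n + 1)) (i : Fin n) :
    LvEquiv ⟨n + 1, cutBraid (STVB.widen n (conjBy g α)) (conjBy (extPerm g) T)
      (STVB.widen n (conjBy g β)) (g i)⟩
    ⟨n + 1, cutBraid (STVB.widen n α) T (STVB.widen n β) i⟩ := by
  rw [widen_conjBy, widen_conjBy, ← cutBraid_conj]
  exact (lv_conj _ _).symm

theorem conjBy_conjBy_inv (g : Equiv.Perm (Fin n)) (x : STVB n) : conjBy g (conjBy g⁻¹ x) = x := by
  rw [← conjBy_mul, mul_inv_cancel, conjBy_apply, inv_one, map_one, one_mul, mul_one]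

theorem lv_under_right (α β : STVB n) {x y : Fin n} (h : x ≠ y) :
    LvEquiv ⟨n, α * β⟩ ⟨n + 1, cutBraid (STVB.widen n α)
      (crossVal .leftOver y.castSucc (Fin.last n) * crossVal .rightOver x.castSucc y.castSucc)
      (STVB.widen n β) x⟩ := by
  obtain ⟨hn, g, rfl, rfl⟩ := exists_perm_two h
  have h1 := (LvMove.under_right (conjBy g⁻¹ α) (conjBy g⁻¹ β) n 0 le_rfl (by omega)
    (by omega)).equiv
  rw [pulled_last, realGen_eq, realGen_eq, virtGen_eq, realCross, realCross,
    run_right (i := 0) _ _ (by omega)] at h1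
  have h2 := lv_conj g (conjBy g⁻¹ α * conjBy g⁻¹ β)
  rw [map_mul, conjBy_conjBy_inv, conjBy_conjBy_inv] at h2
  refine (h2.symm.trans h1).trans ?_
  have h3 := lv_relabel g (conjBy g⁻¹ α) (conjBy g⁻¹ β)
    (crossVal .leftOver (Fin.castSucc ⟨1, by omega⟩) (Fin.last n) *
      crossVal .rightOver (Fin.castSucc ⟨0, by omega⟩) (Fin.castSucc ⟨1, by omega⟩)) ⟨0, by omega⟩
  rw [conjBy_conjBy_inv, conjBy_conjBy_inv, map_mul, ← crossVal_map, ← crossVal_map,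
    extPerm_castSucc, extPerm_castSucc, extPerm_last] at h3
  exact h3.symm

theorem lv_under_left (α β : STVB n) {x y : Fin n} (h : x ≠ y) :
    LvEquiv ⟨n, α * β⟩ ⟨n + 1, cutBraid (STVB.widen n α)
      (crossVal .rightOver (Fin.last n) y.castSucc * crossVal .leftOver y.castSucc x.castSucc)
      (STVB.widen n β) x⟩ := by
  obtain ⟨hn, g, rfl, rfl⟩ := exists_perm_two h.symm
  have h1 := (LvMove.under_left (conjBy g⁻¹ α) (conjBy g⁻¹ β) n 0 le_rfl (by omega)
    (by omega)).equiv
  rw [pulled_last, realGen_eq, realGen_eq, virtGen_eq, realCross, realCross,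
    run_left (i := 0) _ _ (by omega)] at h1
  have h2 := lv_conj g (conjBy g⁻¹ α * conjBy g⁻¹ β)
  rw [map_mul, conjBy_conjBy_inv, conjBy_conjBy_inv] at h2
  refine (h2.symm.trans h1).trans ?_
  have h3 := lv_relabel g (conjBy g⁻¹ α) (conjBy g⁻¹ β)
    (crossVal .rightOver (Fin.last n) (Fin.castSucc ⟨0, by omega⟩) *
      crossVal .leftOver (Fin.castSucc ⟨0, by omega⟩) (Fin.castSucc ⟨1, by omega⟩)) ⟨1, by omega⟩
  rw [conjBy_conjBy_inv, conjBy_conjBy_inv, map_mul, ← crossVal_map, ← crossVal_map,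
    extPerm_castSucc, extPerm_castSucc, extPerm_last] at h3
  exact h3.symm

theorem lv_rs_right (e : Bool) (α β : STVB n) {x y : Fin n} (h : x ≠ y) :
    LvEquiv ⟨n + 1, cutBraid (STVB.widen n α)
      (crossVal .singular y.castSucc (Fin.last n) * crossVal (realCross e) x.castSucc y.castSucc)
      (STVB.widen n β) x⟩
    ⟨n + 1, cutBraid (STVB.widen n α)
      (crossVal (realCross e) y.castSucc (Fin.last n) * crossVal .singular x.castSucc y.castSucc)
      (STVB.widen n β) x⟩ := by
  obtain ⟨hn, g, rfl, rfl⟩ := exists_perm_two h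
  have h1 := (LvMove.rs_right e (conjBy g⁻¹ α) (conjBy g⁻¹ β) n 0 le_rfl (by omega)
    (by omega)).equiv
  rw [pulled_last, pulled_last, realGen_eq, tauGen_eq, virtGen_eq,
    run_right (i := 0) _ _ (by omega), run_right (i := 0) _ _ (by omega)] at h1
  have h3 := fun c d => lv_relabel g (conjBy g⁻¹ α) (conjBy g⁻¹ β)
    (crossVal c (Fin.castSucc ⟨1, by omega⟩) (Fin.last n) *
      crossVal d (Fin.castSucc ⟨0, by omega⟩) (Fin.castSucc ⟨1, by omega⟩)) ⟨0, by omega⟩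
  simp only [conjBy_conjBy_inv, map_mul, ← crossVal_map, extPerm_castSucc, extPerm_last] at h3
  exact (h3 _ _).trans (h1.trans (h3 _ _).symm)

theorem lv_rs_left (e : Bool) (α β : STVB n) {x y : Fin n} (h : x ≠ y) :
    LvEquiv ⟨n + 1, cutBraid (STVB.widen n α)
      (crossVal .singular (Fin.last n) y.castSucc * crossVal (realCross e) y.castSucc x.castSucc)
      (STVB.widen n β) x⟩
    ⟨n + 1, cutBraid (STVB.widen n α)
      (crossVal (realCross e) (Fin.last n) y.castSucc * crossVal .singular y.castSucc x.castSucc)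
      (STVB.widen n β) x⟩ := by
  obtain ⟨hn, g, rfl, rfl⟩ := exists_perm_two h.symm
  have h1 := (LvMove.rs_left e (conjBy g⁻¹ α) (conjBy g⁻¹ β) n 0 le_rfl (by omega)
    (by omega)).equiv
  rw [pulled_last, pulled_last, realGen_eq, tauGen_eq, virtGen_eq,
    run_left (i := 0) _ _ (by omega), run_left (i := 0) _ _ (by omega)] at h1
  have h3 := fun c d => lv_relabel g (conjBy g⁻¹ α) (conjBy g⁻¹ β)
    (crossVal c (Fin.last n) (Fin.castSucc ⟨0, by omega⟩) *
      crossVal d (Fin.castSucc ⟨0, by omega⟩) (Fin.castSucc ⟨1, by omega⟩)) ⟨1, by omega⟩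
  simp only [conjBy_conjBy_inv, map_mul, ← crossVal_map, extPerm_castSucc, extPerm_last] at h3
  exact (h3 _ _).trans (h1.trans (h3 _ _).symm)

end SingTwist

namespace SingTwist

/-! ### Nets: crossings and bars on labelled strands, and the way the strands are joined -/

/-- A crossing of two strands (the left one and the right one, both running down),
or a bar on a strand. -/
inductive Ev (α : Type) : Type
  | cross (c : Crossing) (l r : α)
  | bar (a : α)

namespace Ev

variable {α β γ : Type}

/-- Renaming of the strands. -/
def map (f : α → β) : Ev α → Ev β
  | cross c l r => cross c (f l) (f r)
  | bar a => bar (f a)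

/-- The strands of a crossing or of a bar. -/
def labels : Ev α → List α
  | cross _ l r => [l, r]
  | bar a => [a]

/-- The two strands of a crossing are distinct. -/
def Ok : Ev α → Prop
  | cross _ l r => l ≠ r
  | bar _ => True

theorem map_map (f : α → β) (g : β → γ) (e : Ev α) : (e.map f).map g = e.map (g ∘ f) := by
  cases e <;> rfl

theorem map_congr {f g : α → β} {e : Ev α} (h : ∀ a ∈ e.labels, f a = g a) :
    e.map f = e.map g := by
  cases e <;> simp_all [map, labels]

theorem map_id_of {f : α → α} {e : Ev α} (h : ∀ a ∈ e.labels, f a = a) : e.map f = e := by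
  cases e <;> simp_all [map, labels]

theorem map_injective {f : α → β} (hf : Function.Injective f) : Function.Injective (map f) := by
  intro e e' h
  cases e <;> cases e' <;> simp_all [map, hf.eq_iff]

theorem labels_map (f : α → β) (e : Ev α) : (e.map f).labels = e.labels.map f := by
  cases e <;> rfl

theorem Ok.map {f : α → β} {e : Ev α} (h : e.Ok)
    (hf : ∀ a ∈ e.labels, ∀ b ∈ e.labels, f a = f b → a = b) : (e.map f).Ok := by
  cases e with
  | cross c l r => exact fun h' => h (hf l (by simp [labels]) r (by simp [labels]) h')
  | bar => trivial

theorem Ok.of_map {f : α → β} {e : Ev α} (h : (e.map f).Ok) : e.Ok := by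
  cases e with
  | cross c l r => exact fun h' => h (congrArg f h')
  | bar => trivial

theorem exists_map_eq {f : α → β} {e : Ev β} (h : ∀ b ∈ e.labels, ∃ a, f a = b) :
    ∃ e', map f e' = e := by
  cases e with
  | cross c l r =>
    obtain ⟨l, rfl⟩ := h l (by simp [labels])
    obtain ⟨r, rfl⟩ := h r (by simp [labels])
    exact ⟨cross c l r, rfl⟩
  | bar a =>
    obtain ⟨a, rfl⟩ := h a (by simp [labels])
    exact ⟨bar a, rfl⟩

/-- The braid of a crossing, followed by the virtual crossing which leads the strands back,
or of a bar. -/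
noncomputable def val {n : ℕ} : Ev (Fin n) → STVB n
  | cross c l r => crossVal c l r
  | bar a => barVal a

theorem val_map {n : ℕ} (g : Equiv.Perm (Fin n)) (e : Ev (Fin n)) :
    (e.map g).val = conjBy g e.val := by
  cases e with
  | cross c l r => exact crossVal_map g c l r
  | bar a => exact barVal_map g a

theorem val_castSucc {n : ℕ} {e : Ev (Fin n)} (h : e.Ok) :
    (e.map Fin.castSucc).val = STVB.widen n e.val := by
  cases e with
  | cross c l r => exact (widen_crossVal c h).symm
  | bar a => exact (widen_barVal a).symm

theorem val_commute {n : ℕ} {e e' : Ev (Fin n)} (h : e.Ok) (h' : e'.Ok)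
    (hd : ∀ a ∈ e.labels, a ∉ e'.labels) : Commute e.val e'.val := by
  cases e with
  | cross c l r =>
    cases e' with
    | cross c' l' r' =>
      simp only [labels, List.mem_cons, List.not_mem_nil, or_false, forall_eq_or_imp, forall_eq,
        not_or] at hd
      exact crossVal_commute h hd.1.1 hd.1.2 hd.2.1 hd.2.2 h' _ _
    | bar a =>
      simp only [labels, List.mem_cons, List.not_mem_nil, or_false, forall_eq_or_imp,
        forall_eq] at hd
      exact crossVal_commute_barVal h hd.1 hd.2 _
  | bar a =>
    cases e' with
    | cross c' l' r' =>
      simp only [labels, List.mem_cons, List.not_mem_nil, or_false, forall_eq, not_or] at hd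
      exact (crossVal_commute_barVal h' (Ne.symm hd.1) (Ne.symm hd.2) _).symm
    | bar b => exact barVal_commute a b

end Ev

/-- The braid of a list of crossings and bars. -/
noncomputable def evs {n : ℕ} (F : List (Ev (Fin n))) : STVB n := (F.map Ev.val).prod

theorem evs_append {n : ℕ} (F G : List (Ev (Fin n))) : evs (F ++ G) = evs F * evs G := by
  simp [evs]

theorem evs_map {n : ℕ} (g : Equiv.Perm (Fin n)) (F : List (Ev (Fin n))) :
    evs (F.map (Ev.map g)) = conjBy g (evs F) := by
  rw [evs, evs, map_list_prod, List.map_map, List.map_map]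
  congr 1
  exact List.map_congr_left fun e _ => Ev.val_map g e

theorem evs_castSucc {n : ℕ} {F : List (Ev (Fin n))} (h : ∀ e ∈ F, e.Ok) :
    evs (F.map (Ev.map Fin.castSucc)) = STVB.widen n (evs F) := by
  rw [evs, evs, map_list_prod, List.map_map, List.map_map]
  congr 1
  exact List.map_congr_left fun e he => Ev.val_castSucc (h e he)

theorem evs_perm {n : ℕ} {F G : List (Ev (Fin n))} (h : F.Perm G) (hF : ∀ e ∈ F, e.Ok)
    (hd : F.Pairwise fun e e' => ∀ a ∈ e.labels, a ∉ e'.labels) : evs F = evs G := by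
  refine (h.map Ev.val).prod_eq' (List.pairwise_map.2 ?_)
  exact (List.Pairwise.and_mem.1 hd).imp fun ⟨h1, h2, h3⟩ => Ev.val_commute (hF _ h1) (hF _ h2) h3

/-- The list `P` says how the strands are joined: `(a, b) ∈ P` if the strand `a` continues as the
strand `b`. The braid `x` realizes the net. -/
def Rep (E : List (Ev ℕ)) (P : List (ℕ × ℕ)) (n : ℕ) (x : STVB n) : Prop :=
  -- The position `q` is labelled `ℓ q` at the top. The strand that ends there began at `g q`, and
  -- the closing arc leads it back to the top of `q`: thus `ℓ (g q)` continues as `ℓ q`.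
  ∃ (ℓ : Fin n → ℕ) (g : Equiv.Perm (Fin n)) (F : List (Ev (Fin n))), Function.Injective ℓ ∧
    P.Perm (List.ofFn fun q => (ℓ (g q), ℓ q)) ∧ E = F.map (Ev.map ℓ) ∧ (∀ e ∈ F, e.Ok) ∧
    x = evs F * rho g

/-- A net is valid if each strand begins once and ends once. -/
structure Valid (E : List (Ev ℕ)) (P : List (ℕ × ℕ)) : Prop where
  nodup : (P.map Prod.fst).Nodup
  perm : (P.map Prod.fst).Perm (P.map Prod.snd)
  ok : ∀ e ∈ E, e.Ok
  mem : ∀ e ∈ E, ∀ a ∈ e.labels, a ∈ P.map Prod.fst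

/-- The injective labels match the positions of the two braids by a bijection `k`, which carries the
crossings and joins of one to those of the other. Hence the braids are conjugate by `rho k`. -/
theorem Rep.unique {E : List (Ev ℕ)} {P : List (ℕ × ℕ)} {n n' : ℕ} {x : STVB n} {x' : STVB n'}
    (h : Rep E P n x) (h' : Rep E P n' x') : LvEquiv ⟨n, x⟩ ⟨n', x'⟩ := by
  obtain ⟨ℓ, g, F, hℓ, hP, hE, hF, rfl⟩ := h
  obtain ⟨ℓ', g', F', hℓ', hP', hE', hF', rfl⟩ := h'
  obtain rfl : n = n' := by simpa using (hP.symm.trans hP').length_eq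
  have hm : ∀ q, ∃ q', ℓ' q' = ℓ q ∧ ℓ' (g' q') = ℓ (g q) := by
    intro q
    have : (ℓ (g q), ℓ q) ∈ List.ofFn fun q => (ℓ' (g' q), ℓ' q) :=
      (hP.symm.trans hP').subset (List.mem_ofFn.2 ⟨q, rfl⟩)
    obtain ⟨q', hq'⟩ := List.mem_ofFn.1 this
    simp only [Prod.mk.injEq] at hq'
    exact ⟨q', hq'.2, hq'.1⟩
  choose f hf hf' using hm
  have finj : Function.Injective f := by
    intro a b hab
    apply hℓ
    rw [← hf, hab, hf]
  let k := Equiv.ofBijective f (Finite.injective_iff_bijective.1 finj)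
  have hk : ℓ = ℓ' ∘ k := funext fun q => (hf q).symm
  have hg : g' = k * g * k⁻¹ := by
    rw [eq_mul_inv_iff_mul_eq]
    ext1 q
    apply hℓ'
    exact (hf' q).trans (hf (g q)).symm
  have hFF : F' = F.map (Ev.map k) := by
    apply List.map_injective_iff.2 (Ev.map_injective hℓ')
    rw [← hE', hE, List.map_map, hk]
    exact List.map_congr_left fun e _ => (Ev.map_map _ _ e).symm
  have := lv_conj k (evs F * rho g)
  rw [map_mul, ← evs_map, conjBy_rho, ← hFF, ← hg] at this
  exact this

theorem exists_lift {n : ℕ} {ℓ : Fin n → ℕ} {E : List (Ev ℕ)}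
    (h : ∀ e ∈ E, ∀ a ∈ e.labels, ∃ q, ℓ q = a) : ∃ F : List (Ev (Fin n)), E = F.map (Ev.map ℓ) := by
  induction E with
  | nil => exact ⟨[], rfl⟩
  | cons e E ih =>
    obtain ⟨F, rfl⟩ := ih fun e' he' => h e' (List.mem_cons_of_mem _ he')
    obtain ⟨f, rfl⟩ := Ev.exists_map_eq (h e List.mem_cons_self)
    exact ⟨f :: F, rfl⟩

/-- There is one position for each pair of `P`, labelled by the strand which begins there; `g` sends
it to the position labelled by the first entry of the pair. -/
theorem Valid.exists_rep {E : List (Ev ℕ)} {P : List (ℕ × ℕ)} (h : Valid E P) :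
    ∃ n x, Rep E P n x := by
  have hnd : (P.map Prod.snd).Nodup := h.perm.nodup_iff.1 h.nodup
  let ℓ : Fin P.length → ℕ := fun q => P[q].2
  have hℓ : Function.Injective ℓ := by
    intro a b hab
    have := List.nodup_iff_injective_get.1 hnd
    have h2 := @this (a.cast (by simp)) (b.cast (by simp)) (by simpa [ℓ] using hab)
    simpa [Fin.ext_iff] using h2
  have hsurj : ∀ a ∈ P.map Prod.fst, ∃ q, ℓ q = a := by
    intro a ha
    obtain ⟨p, hp, rfl⟩ := List.mem_map.1 (h.perm.subset ha)
    obtain ⟨i, hi, rfl⟩ := List.getElem_of_mem hp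
    exact ⟨⟨i, hi⟩, rfl⟩
  have hg : ∀ q : Fin P.length, ∃ q', ℓ q' = P[q].1 := fun q =>
    hsurj _ (List.mem_map.2 ⟨P[q], List.getElem_mem _, rfl⟩)
  choose f hf using hg
  have finj : Function.Injective f := by
    intro a b hab
    have h1 : P[a].1 = P[b].1 := by rw [← hf, hab, hf]
    have := List.nodup_iff_injective_get.1 h.nodup
    have h2 := @this (a.cast (by simp)) (b.cast (by simp)) (by simpa using h1)
    simpa [Fin.ext_iff] using h2
  obtain ⟨F, hF⟩ := exists_lift (ℓ := ℓ) fun e he a ha => hsurj a (h.mem e he a ha)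
  refine ⟨_, _, ℓ, Equiv.ofBijective f (Finite.injective_iff_bijective.1 finj), F, hℓ, ?_, hF, ?_,
    rfl⟩
  · have : (List.ofFn fun q => (ℓ (f q), ℓ q)) = P := by
      refine Eq.trans ?_ (List.ofFn_get P)
      congr 1
      funext q
      rw [hf]
      rfl
    exact List.Perm.of_eq this.symm
  · intro e he
    exact Ev.Ok.of_map (h.ok (e.map ℓ) (by rw [hF]; exact List.mem_map_of_mem he))

theorem ofFn_comp_perm {α : Type} {n : ℕ} (f : Fin n → α) (g : Equiv.Perm (Fin n)) :
    (List.ofFn fun q => f (g q)).Perm (List.ofFn f) :=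
  Equiv.Perm.ofFn_comp_perm g f

theorem Rep.valid {E : List (Ev ℕ)} {P : List (ℕ × ℕ)} {n : ℕ} {x : STVB n} (h : Rep E P n x) :
    Valid E P := by
  obtain ⟨ℓ, g, F, hℓ, hP, rfl, hF, rfl⟩ := h
  have h1 : (P.map Prod.fst).Perm (List.ofFn fun q => ℓ (g q)) := by
    refine (hP.map _).trans (List.Perm.of_eq ?_)
    rw [List.map_ofFn]; rfl
  have h2 : (P.map Prod.snd).Perm (List.ofFn ℓ) := by
    refine (hP.map _).trans (List.Perm.of_eq ?_)
    rw [List.map_ofFn]; rfl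
  have h3 := h1.trans (ofFn_comp_perm ℓ g)
  refine ⟨h3.nodup_iff.2 (List.nodup_ofFn.2 hℓ), h3.trans h2.symm, ?_, ?_⟩
  · intro e he
    obtain ⟨e, he', rfl⟩ := List.mem_map.1 he
    exact (hF e he').map fun a _ b _ hab => hℓ hab
  · intro e he a ha
    obtain ⟨e, he, rfl⟩ := List.mem_map.1 he
    rw [Ev.labels_map] at ha
    obtain ⟨a, ha, rfl⟩ := List.mem_map.1 ha
    exact h3.symm.subset (List.mem_ofFn.2 ⟨a, rfl⟩)

/-- Two nets are equivalent if their braids are `L_v`-equivalent. -/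
def NetEq (E : List (Ev ℕ)) (P : List (ℕ × ℕ)) (E' : List (Ev ℕ)) (P' : List (ℕ × ℕ)) : Prop :=
  ∃ n x n' x', Rep E P n x ∧ Rep E' P' n' x' ∧ LvEquiv ⟨n, x⟩ ⟨n', x'⟩

section NetEq

variable {E E' E'' E₁ E₂ : List (Ev ℕ)} {P P' P'' : List (ℕ × ℕ)}

theorem Valid.netEq (h : Valid E P) : NetEq E P E P := by
  obtain ⟨n, x, h⟩ := h.exists_rep
  exact ⟨n, x, n, x, h, h, .refl _⟩

theorem NetEq.symm (h : NetEq E P E' P') : NetEq E' P' E P := by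
  obtain ⟨n, x, n', x', h1, h2, h3⟩ := h
  exact ⟨n', x', n, x, h2, h1, h3.symm⟩

theorem NetEq.trans (h : NetEq E P E' P') (h' : NetEq E' P' E'' P'') : NetEq E P E'' P'' := by
  obtain ⟨n, x, n', x', h1, h2, h3⟩ := h
  obtain ⟨k, y, k', y', h4, h5, h6⟩ := h'
  exact ⟨n, x, k', y', h1, h5, (h3.trans (h2.unique h4)).trans h6⟩

theorem NetEq.valid_left (h : NetEq E P E' P') : Valid E P := by
  obtain ⟨n, x, n', x', h1, h2, h3⟩ := h
  exact h1.valid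

theorem NetEq.valid_right (h : NetEq E P E' P') : Valid E' P' := h.symm.valid_left

theorem Valid.perm_pairs (h : Valid E P) (hP : P.Perm P') : NetEq E P E P' := by
  obtain ⟨n, x, h⟩ := h.exists_rep
  refine ⟨n, x, n, x, h, ?_, .refl _⟩
  obtain ⟨ℓ, g, F, h1, h2, h3⟩ := h
  exact ⟨ℓ, g, F, h1, hP.symm.trans h2, h3⟩

theorem Valid.of_perm (h : Valid E P) (hP : P.Perm P') : Valid E P' :=
  (h.perm_pairs hP).valid_right

/-- Crossings and bars without common strands commute in the braid monoid, so their order does not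
affect the realizing braid. -/
theorem Valid.perm_evs (h : Valid E P) (hE : E.Perm E')
    (hd : E.Pairwise fun e e' => ∀ a ∈ e.labels, a ∉ e'.labels) : NetEq E P E' P := by
  obtain ⟨n, x, h⟩ := h.exists_rep
  refine ⟨n, x, n, x, h, ?_, .refl _⟩
  obtain ⟨ℓ, g, F, h1, h2, rfl, h4, h5⟩ := h
  obtain ⟨F', rfl⟩ : ∃ F' : List (Ev (Fin n)), E' = F'.map (Ev.map ℓ) := by
    refine exists_lift fun e he a ha => ?_
    obtain ⟨e, -, rfl⟩ := List.mem_map.1 (hE.symm.subset he)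
    rw [Ev.labels_map] at ha
    obtain ⟨a, -, rfl⟩ := List.mem_map.1 ha
    exact ⟨a, rfl⟩
  have hFF : F.Perm F' := (List.map_perm_map_iff (Ev.map_injective h1)).1 hE
  refine ⟨ℓ, g, F', h1, h2, rfl, fun e he => h4 e (hFF.symm.subset he), ?_⟩
  rw [h5, evs_perm hFF h4]
  refine (List.pairwise_map.1 hd).imp ?_
  intro e e' he a ha ha'
  refine he (ℓ a) ?_ ?_ <;> rw [Ev.labels_map]
  · exact List.mem_map_of_mem ha
  · exact List.mem_map_of_mem ha'

/-- A relation between braids may be applied in a net. -/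
theorem Valid.rel {k : ℕ} (f : Fin k → ℕ) (L R : List (Ev (Fin k)))
    (h : Valid (E₁ ++ (L.map (Ev.map f) ++ E₂)) P) (hf : Function.Injective f)
    (hm : ∀ i, f i ∈ P.map Prod.fst) (hR : ∀ e ∈ R, e.Ok)
    (hrel : ∀ (n : ℕ) (u : Fin k → Fin n), Function.Injective u →
      evs (L.map (Ev.map u)) = evs (R.map (Ev.map u))) :
    NetEq (E₁ ++ (L.map (Ev.map f) ++ E₂)) P (E₁ ++ (R.map (Ev.map f) ++ E₂)) P := by
  obtain ⟨n, x, h⟩ := h.exists_rep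
  refine ⟨n, x, n, x, h, ?_, .refl _⟩
  have hv := h.valid
  obtain ⟨ℓ, g, F, h1, h2, h3, h4, h5⟩ := h
  have hs : ∀ a ∈ P.map Prod.fst, ∃ q, ℓ q = a := by
    intro a ha
    obtain ⟨p, hp, rfl⟩ := List.mem_map.1 ha
    obtain ⟨q, rfl⟩ := List.mem_ofFn.1 (h2.subset hp)
    exact ⟨_, rfl⟩
  choose u hu using fun i => hs (f i) (hm i)
  have hu' : ℓ ∘ u = f := funext hu
  obtain ⟨F₁, rfl⟩ := exists_lift (ℓ := ℓ) (E := E₁) fun e he a ha =>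
    hs a (hv.mem e (by simp [he]) a ha)
  obtain ⟨F₂, rfl⟩ := exists_lift (ℓ := ℓ) (E := E₂) fun e he a ha =>
    hs a (hv.mem e (by simp [he]) a ha)
  have lift : ∀ L : List (Ev (Fin k)), L.map (Ev.map f) = (L.map (Ev.map u)).map (Ev.map ℓ) := by
    intro L
    rw [List.map_map, ← hu']
    exact List.map_congr_left fun e _ => (Ev.map_map _ _ e).symm
  have hF : F = F₁ ++ (L.map (Ev.map u) ++ F₂) := by
    apply List.map_injective_iff.2 (Ev.map_injective h1)
    rw [← h3, lift]
    simp only [List.map_append]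
  have ui : Function.Injective u := by
    intro a b hab
    apply hf
    rw [← hu, hab, hu]
  refine ⟨ℓ, g, F₁ ++ (R.map (Ev.map u) ++ F₂), h1, h2, ?_, ?_, ?_⟩
  · rw [lift]; simp only [List.map_append]
  · intro e he
    simp only [List.mem_append] at he
    rcases he with he | he | he
    · exact h4 e (by simp [hF, he])
    · obtain ⟨e, he', rfl⟩ := List.mem_map.1 he
      exact (hR e he').map fun a _ b _ hab => ui hab
    · exact h4 e (by simp [hF, he])
  · rw [h5, hF]
    simp only [evs_append, hrel n u ui]

theorem Rep.rename {n : ℕ} {x : STVB n} (h : Rep E P n x) {f : ℕ → ℕ}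
    (hf : Set.InjOn f {a | a ∈ P.map Prod.fst}) :
    Rep (E.map (Ev.map f)) (P.map (Prod.map f f)) n x := by
  obtain ⟨ℓ, g, F, h1, h2, h3, h4, h5⟩ := h
  have hs : ∀ q, ℓ q ∈ P.map Prod.fst := by
    intro q
    refine List.mem_map.2 ⟨(ℓ q, ℓ (g.symm q)), h2.symm.subset (List.mem_ofFn.2 ⟨g.symm q, ?_⟩), rfl⟩
    simp
  refine ⟨f ∘ ℓ, g, F, fun a b hab => h1 (hf (hs a) (hs b) hab), ?_, ?_, h4, h5⟩
  · refine (h2.map _).trans (List.Perm.of_eq ?_)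
    rw [List.map_ofFn]; rfl
  · rw [h3, List.map_map]
    exact List.map_congr_left fun e _ => Ev.map_map _ _ e

theorem Valid.rename (h : Valid E P) {f : ℕ → ℕ} (hf : Set.InjOn f {a | a ∈ P.map Prod.fst}) :
    NetEq E P (E.map (Ev.map f)) (P.map (Prod.map f f)) := by
  obtain ⟨n, x, h⟩ := h.exists_rep
  exact ⟨n, x, n, x, h, h.rename hf, .refl _⟩

end NetEq

end SingTwist

namespace SingTwist

/-! ### Cutting a strand of a net -/

/-- The strand `z` is renamed to `a`. -/
def sub (z a : ℕ) : ℕ → ℕ := fun x => if x = z then a else x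

theorem sub_self (z a : ℕ) : sub z a z = a := if_pos rfl

theorem sub_of_ne {z a x : ℕ} (h : x ≠ z) : sub z a x = x := if_neg h

theorem map_sub_eq_self {E : List (Ev ℕ)} {z a : ℕ} (h : ∀ e ∈ E, z ∉ e.labels) :
    E.map (Ev.map (sub z a)) = E := by
  conv_rhs => rw [← List.map_id E]
  refine List.map_congr_left fun e he => Ev.map_id_of fun x hx => sub_of_ne ?_
  rintro rfl
  exact h e he hx

section

variable {E₁ E₂ : List (Ev ℕ)} {P : List (ℕ × ℕ)} {a z c : ℕ}

theorem Valid.merge_valid (h : Valid (E₁ ++ E₂) ((a, z) :: (z, c) :: P))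
    (h1 : ∀ e ∈ E₁, z ∉ e.labels) (h2 : ∀ e ∈ E₂, a ∉ e.labels) :
    Valid (E₁ ++ E₂.map (Ev.map (sub z a))) ((a, c) :: P) where
  nodup := by
    have := h.nodup
    simp only [List.map_cons, List.nodup_cons, List.mem_cons, not_or] at this ⊢
    exact ⟨this.1.2, this.2.2⟩
  perm := by
    have := h.perm
    simp only [List.map_cons] at this ⊢
    exact ((List.Perm.swap a z _).trans this).cons_inv
  ok e he := by
    rcases List.mem_append.1 he with he | he
    · exact h.ok e (by simp [he])
    · obtain ⟨e, he', rfl⟩ := List.mem_map.1 he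
      refine (h.ok e (by simp [he'])).map fun x hx y hy hxy => ?_
      have hxa : x ≠ a := by rintro rfl; exact h2 e he' hx
      have hya : y ≠ a := by rintro rfl; exact h2 e he' hy
      simp only [sub] at hxy
      split_ifs at hxy <;> simp_all
  mem e he x hx := by
    rcases List.mem_append.1 he with he' | he'
    · have := h.mem e (by simp [he']) x hx
      have hxz : x ≠ z := by rintro rfl; exact h1 e he' hx
      simp_all
    · obtain ⟨e, he'', rfl⟩ := List.mem_map.1 he'
      rw [Ev.labels_map] at hx
      obtain ⟨x, hx', rfl⟩ := List.mem_map.1 hx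
      have := h.mem e (by simp [he'']) x hx'
      simp only [sub]
      split_ifs <;> simp_all

/-- The moves of type 1, 2 and 3 all take this form. When `z` is merged into `a`, the crossings `E₁`
give `α`, and `E₂` together with the joins gives `β`. Adding `z` as last strand and exchanging it
with `a` between `α` and `β` realizes the net before the merging, and crossings `FT` at this place
become the inserted piece. The conditions say that `z` is not used above the cut and `a` not below
it. -/
theorem Valid.exists_cut (h : Valid (E₁ ++ E₂) ((a, z) :: (z, c) :: P))
    (h1 : ∀ e ∈ E₁, z ∉ e.labels) (h2 : ∀ e ∈ E₂, a ∉ e.labels) :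
    ∃ (n : ℕ) (ℓ : Fin n → ℕ) (α β : STVB n) (i : Fin n), ℓ i = a ∧
      (∀ y ∈ P.map Prod.fst, ∃ q, ℓ q = y) ∧
      Rep (E₁ ++ E₂.map (Ev.map (sub z a))) ((a, c) :: P) n (α * β) ∧
      ∀ FT : List (Ev (Fin (n + 1))), (∀ e ∈ FT, e.Ok) →
        Rep (E₁ ++ (FT.map (Ev.map (Fin.snoc (α := fun _ => ℕ) ℓ z)) ++ E₂))
          ((a, z) :: (z, c) :: P) (n + 1)
          (cutBraid (STVB.widen n α) (evs FT) (STVB.widen n β) i) := by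
  have hv := h.merge_valid h1 h2
  obtain ⟨n, x, hr⟩ := hv.exists_rep
  obtain ⟨ℓ, g, F, hℓ, hP, hF, hok, rfl⟩ := id hr
  obtain ⟨F₁, F₂, rfl, hF₁, hF₂⟩ := List.append_eq_map_iff.1 hF
  have hs : ∀ y ∈ ((a, c) :: P).map Prod.fst, ∃ q, ℓ q = y := by
    intro y hy
    obtain ⟨p, hp, rfl⟩ := List.mem_map.1 hy
    obtain ⟨q, rfl⟩ := List.mem_ofFn.1 (hP.subset hp)
    exact ⟨_, rfl⟩
  obtain ⟨i, hi⟩ := hs a (by simp)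
  have hnd := h.nodup
  simp only [List.map_cons, List.nodup_cons, List.mem_cons, not_or] at hnd
  have hzℓ : ∀ q, ℓ q ≠ z := by
    rintro q rfl
    have : ℓ q ∈ ((a, c) :: P).map Prod.fst := by
      refine List.mem_map.2 ⟨(ℓ q, ℓ (g.symm q)), hP.symm.subset
        (List.mem_ofFn.2 ⟨g.symm q, by simp⟩), rfl⟩
    simp only [List.map_cons, List.mem_cons] at this
    exact this.elim (fun h => hnd.1.1 h.symm) hnd.2.1
  refine ⟨n, ℓ, evs F₁, evs F₂ * rho g, i, hi, fun y hy => hs y (by simp [hy]), ?_, ?_⟩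
  · rw [← mul_assoc, ← evs_append]; exact hr
  · intro FT hFT
    let ℓ' : Fin (n + 1) → ℕ := Fin.snoc (α := fun _ => ℕ) ℓ z
    have l1 : ∀ q : Fin n, ℓ' q.castSucc = ℓ q := fun q => Fin.snoc_castSucc (α := fun _ => ℕ) _ _ _
    have l2 : ℓ' (Fin.last n) = z := Fin.snoc_last (α := fun _ => ℕ) _ _
    let s : Equiv.Perm (Fin (n + 1)) := Equiv.swap i.castSucc (Fin.last n)
    have l3 : ∀ q : Fin n, ℓ' (s q.castSucc) = sub a z (ℓ q) := by
      intro q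
      by_cases hq : q = i
      · subst hq
        rw [hi, sub_self]
        simp only [s, Equiv.swap_apply_left, l2]
      · rw [sub_of_ne (by rw [← hi]; exact fun h => hq (hℓ h))]
        simp only [s]
        rw [Equiv.swap_apply_of_ne_of_ne (by simpa using hq) (Fin.castSucc_lt_last q).ne, l1]
    -- Below the swap `s` the crossings that acted on `a` act on `z`. Moving `s` down through them
    -- relabels them by `s`, and at the bottom `s` joins the final permutation.
    refine ⟨ℓ', s * extPerm g,
      F₁.map (Ev.map Fin.castSucc) ++ (FT ++ (F₂.map (Ev.map Fin.castSucc)).map (Ev.map s)),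
      ?_, ?_, ?_, ?_, ?_⟩
    · intro p q
      induction p using Fin.lastCases with
      | last =>
        induction q using Fin.lastCases with
        | last => exact fun _ => rfl
        | cast q => rw [l1, l2]; exact fun h => absurd h.symm (hzℓ q)
      | cast p =>
        induction q using Fin.lastCases with
        | last => rw [l1, l2]; exact fun h => absurd h (hzℓ p)
        | cast q => rw [l1, l1]; exact fun h => congrArg _ (hℓ h)
    · rw [List.ofFn_succ']
      have e1 : (ℓ' ((s * extPerm g) (Fin.last n)), ℓ' (Fin.last n)) = (a, z) := by
        rw [Equiv.Perm.mul_apply, extPerm_last, l2]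
        simp only [s, Equiv.swap_apply_right, l1, hi]
      have e2 : (List.ofFn fun q : Fin n => (ℓ' ((s * extPerm g) q.castSucc), ℓ' q.castSucc)) =
          (List.ofFn fun q : Fin n => (ℓ (g q), ℓ q)).map fun p => (sub a z p.1, p.2) := by
        rw [List.map_ofFn]
        congr 1
        funext q
        simp only [Function.comp, Equiv.Perm.mul_apply, extPerm_castSucc, l3, l1]
      rw [e1, e2, List.concat_eq_append]
      refine (List.Perm.cons _ ?_).trans (List.perm_append_comm (l₁ := [(a, z)]))
      refine List.Perm.trans (List.Perm.of_eq ?_) (hP.map _)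
      rw [List.map_cons, sub_self]
      congr 1
      conv_lhs => rw [← List.map_id P]
      refine List.map_congr_left fun p hp => ?_
      rw [sub_of_ne]
      · rfl
      · rintro rfl
        exact hnd.1.2 (List.mem_map_of_mem hp)
    · have m1 : (F₁.map (Ev.map Fin.castSucc)).map (Ev.map ℓ') = E₁ := by
        rw [← hF₁, List.map_map]
        exact List.map_congr_left fun e _ => (Ev.map_map _ _ e).trans
          (Ev.map_congr fun q _ => l1 q)
      have m2 : ((F₂.map (Ev.map Fin.castSucc)).map (Ev.map s)).map (Ev.map ℓ') = E₂ := by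
        have : (F₂.map (Ev.map ℓ)).map (Ev.map (sub a z)) = E₂ := by
          rw [hF₂, List.map_map]
          conv_rhs => rw [← List.map_id E₂]
          refine List.map_congr_left fun e he => (Ev.map_map _ _ e).trans
            (Ev.map_id_of fun x hx => ?_)
          have hxa : x ≠ a := by rintro rfl; exact h2 e he hx
          simp only [Function.comp, sub]
          by_cases hxz : x = z
          · simp [hxz]
          · simp [hxz, hxa]
        rw [← this, List.map_map, List.map_map, List.map_map]
        exact List.map_congr_left fun e _ => by
          simp only [Function.comp, Ev.map_map]
          exact Ev.map_congr fun q _ => l3 q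
      rw [List.map_append, List.map_append, m1, m2]
    · intro e he
      simp only [List.mem_append] at he
      rcases he with he | he | he
      · obtain ⟨e, he', rfl⟩ := List.mem_map.1 he
        exact (hok e (by simp [he'])).map fun x _ y _ hxy => Fin.castSucc_injective n hxy
      · exact hFT e he
      · obtain ⟨e, he', rfl⟩ := List.mem_map.1 he
        obtain ⟨e, he'', rfl⟩ := List.mem_map.1 he'
        exact ((hok e (by simp [he''])).map fun x _ y _ hxy => Fin.castSucc_injective n hxy).map
          fun x _ y _ hxy => s.injective hxy
    · rw [evs_append, evs_append, evs_map, evs_castSucc fun e he => hok e (by simp [he]),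
        evs_castSucc fun e he => hok e (by simp [he]), cutBraid, map_mul (STVB.widen n), widen_rho,
        map_mul rho]
      have := rho_mul_eq s (STVB.widen n (evs F₂))
      simp only [mul_assoc]
      congr 2
      rw [← mul_assoc (rho _) (STVB.widen n (evs F₂)), this]
      simp only [mul_assoc]

/-- Contraction of a strand is the virtual L_v-move, the cut with nothing inserted. -/
theorem Valid.merge (h : Valid (E₁ ++ E₂) ((a, z) :: (z, c) :: P))
    (h1 : ∀ e ∈ E₁, z ∉ e.labels) (h2 : ∀ e ∈ E₂, a ∉ e.labels) :
    NetEq (E₁ ++ E₂) ((a, z) :: (z, c) :: P)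
      (E₁ ++ E₂.map (Ev.map (sub z a))) ((a, c) :: P) := by
  obtain ⟨n, ℓ, α, β, i, hi, hs, hr, hc⟩ := h.exists_cut h1 h2
  exact ⟨_, _, _, _, hc [] (by simp), hr, (lv_cut α β i).symm⟩

/-- Pieces that may be inserted at the place where a strand is cut. -/
theorem Valid.insert_kink (e : Bool) (h : Valid (E₁ ++ E₂) ((a, z) :: (z, c) :: P))
    (h1 : ∀ e ∈ E₁, z ∉ e.labels) (h2 : ∀ e ∈ E₂, a ∉ e.labels) :
    NetEq (E₁ ++ (.cross (realCross e) a z :: E₂)) ((a, z) :: (z, c) :: P)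
      (E₁ ++ E₂) ((a, z) :: (z, c) :: P) := by
  obtain ⟨n, ℓ, α, β, i, hi, hs, hr, hc⟩ := h.exists_cut h1 h2
  have h3 := hc [.cross (realCross e) i.castSucc (Fin.last n)]
    (by simp [Ev.Ok, (Fin.castSucc_lt_last i).ne])
  simp only [List.map_cons, List.map_nil, Ev.map, Fin.snoc_castSucc, Fin.snoc_last, hi] at h3
  refine ⟨_, _, _, _, h3, hc [] (by simp), ?_⟩
  simpa [evs, Ev.val] using (lv_kink e α β i).symm.trans (lv_cut α β i)

/-- Both sides come from the same braid `α * β`: one by the under-threaded move with thread `y`, the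
other by the plain cut. -/
theorem Valid.insert_right {y : ℕ} (h : Valid (E₁ ++ E₂) ((a, z) :: (z, c) :: P))
    (h1 : ∀ e ∈ E₁, z ∉ e.labels) (h2 : ∀ e ∈ E₂, a ∉ e.labels) (hy : y ∈ P.map Prod.fst) :
    NetEq (E₁ ++ (.cross .leftOver y z :: .cross .rightOver a y :: E₂)) ((a, z) :: (z, c) :: P)
      (E₁ ++ E₂) ((a, z) :: (z, c) :: P) := by
  obtain ⟨n, ℓ, α, β, i, hi, hs, hr, hc⟩ := h.exists_cut h1 h2
  obtain ⟨j, hj⟩ := hs y hy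
  have hij : i ≠ j := by
    rintro rfl
    have := h.nodup
    rw [hj] at hi
    subst hi
    simp [hy] at this
  have h3 := hc [.cross .leftOver j.castSucc (Fin.last n), .cross .rightOver i.castSucc j.castSucc]
    (by simp [Ev.Ok, (Fin.castSucc_lt_last j).ne, hij])
  simp only [List.map_cons, List.map_nil, Ev.map, Fin.snoc_castSucc, Fin.snoc_last, hi, hj] at h3
  refine ⟨_, _, _, _, h3, hc [] (by simp), ?_⟩
  simpa [evs, Ev.val] using (lv_under_right α β hij).symm.trans (lv_cut α β i)

theorem Valid.insert_left {y : ℕ} (h : Valid (E₁ ++ E₂) ((a, z) :: (z, c) :: P))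
    (h1 : ∀ e ∈ E₁, z ∉ e.labels) (h2 : ∀ e ∈ E₂, a ∉ e.labels) (hy : y ∈ P.map Prod.fst) :
    NetEq (E₁ ++ (.cross .rightOver z y :: .cross .leftOver y a :: E₂)) ((a, z) :: (z, c) :: P)
      (E₁ ++ E₂) ((a, z) :: (z, c) :: P) := by
  obtain ⟨n, ℓ, α, β, i, hi, hs, hr, hc⟩ := h.exists_cut h1 h2
  obtain ⟨j, hj⟩ := hs y hy
  have hij : i ≠ j := by
    rintro rfl
    have := h.nodup
    rw [hj] at hi
    subst hi
    simp [hy] at this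
  have h3 := hc [.cross .rightOver (Fin.last n) j.castSucc, .cross .leftOver j.castSucc i.castSucc]
    (by simp [Ev.Ok, (Fin.castSucc_lt_last j).ne', hij.symm])
  simp only [List.map_cons, List.map_nil, Ev.map, Fin.snoc_castSucc, Fin.snoc_last, hi, hj] at h3
  refine ⟨_, _, _, _, h3, hc [] (by simp), ?_⟩
  simpa [evs, Ev.val] using (lv_under_left α β hij).symm.trans (lv_cut α β i)

theorem Valid.rs_right (e : Bool) {y : ℕ} (h : Valid (E₁ ++ E₂) ((a, z) :: (z, c) :: P))
    (h1 : ∀ e ∈ E₁, z ∉ e.labels) (h2 : ∀ e ∈ E₂, a ∉ e.labels) (hy : y ∈ P.map Prod.fst) :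
    NetEq (E₁ ++ (.cross .singular y z :: .cross (realCross e) a y :: E₂)) ((a, z) :: (z, c) :: P)
      (E₁ ++ (.cross (realCross e) y z :: .cross .singular a y :: E₂))
      ((a, z) :: (z, c) :: P) := by
  obtain ⟨n, ℓ, α, β, i, hi, hs, hr, hc⟩ := h.exists_cut h1 h2
  obtain ⟨j, hj⟩ := hs y hy
  have hij : i ≠ j := by
    rintro rfl
    have := h.nodup
    rw [hj] at hi
    subst hi
    simp [hy] at this
  have h3 := fun c d => hc [.cross c j.castSucc (Fin.last n), .cross d i.castSucc j.castSucc]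
    (by simp [Ev.Ok, (Fin.castSucc_lt_last j).ne, hij])
  simp only [List.map_cons, List.map_nil, Ev.map, Fin.snoc_castSucc, Fin.snoc_last, hi, hj] at h3
  refine ⟨_, _, _, _, h3 _ _, h3 _ _, ?_⟩
  simpa [evs, Ev.val] using lv_rs_right e α β hij

theorem Valid.rs_left (e : Bool) {y : ℕ} (h : Valid (E₁ ++ E₂) ((a, z) :: (z, c) :: P))
    (h1 : ∀ e ∈ E₁, z ∉ e.labels) (h2 : ∀ e ∈ E₂, a ∉ e.labels) (hy : y ∈ P.map Prod.fst) :
    NetEq (E₁ ++ (.cross .singular z y :: .cross (realCross e) y a :: E₂)) ((a, z) :: (z, c) :: P)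
      (E₁ ++ (.cross (realCross e) z y :: .cross .singular y a :: E₂))
      ((a, z) :: (z, c) :: P) := by
  obtain ⟨n, ℓ, α, β, i, hi, hs, hr, hc⟩ := h.exists_cut h1 h2
  obtain ⟨j, hj⟩ := hs y hy
  have hij : i ≠ j := by
    rintro rfl
    have := h.nodup
    rw [hj] at hi
    subst hi
    simp [hy] at this
  have h3 := fun c d => hc [.cross c (Fin.last n) j.castSucc, .cross d j.castSucc i.castSucc]
    (by simp [Ev.Ok, (Fin.castSucc_lt_last j).ne', hij.symm])
  simp only [List.map_cons, List.map_nil, Ev.map, Fin.snoc_castSucc, Fin.snoc_last, hi, hj] at h3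
  refine ⟨_, _, _, _, h3 _ _, h3 _ _, ?_⟩
  simpa [evs, Ev.val] using lv_rs_left e α β hij

end

end SingTwist

namespace SingTwist

/-! ### Gauss diagrams -/

/-- A vertex of a Gauss diagram. In a crossing the strand `l` comes from the upper left and
continues as `l'`, the strand `r` comes from the upper right and continues as `r'`. -/
inductive Vert : Type
  | cross (c : Crossing) (l l' r r' : ℕ)
  | bar (a a' : ℕ)
  | wire (a a' : ℕ)

namespace Vert

/-- The joined strands. -/
def pairs : Vert → List (ℕ × ℕ)
  | cross _ l l' r r' => [(l, l'), (r, r')]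
  | bar a a' => [(a, a')]
  | wire a a' => [(a, a')]

/-- The crossing or the bar. -/
def events : Vert → List (Ev ℕ)
  | cross c l _ r _ => [.cross c l r]
  | bar a _ => [.bar a]
  | wire _ _ => []

/-- Renaming of the strands. -/
def map (f : ℕ → ℕ) : Vert → Vert
  | cross c l l' r r' => cross c (f l) (f l') (f r) (f r')
  | bar a a' => bar (f a) (f a')
  | wire a a' => wire (f a) (f a')

theorem pairs_map (f : ℕ → ℕ) (v : Vert) : (v.map f).pairs = v.pairs.map (Prod.map f f) := by
  cases v <;> rfl

theorem events_map (f : ℕ → ℕ) (v : Vert) : (v.map f).events = v.events.map (Ev.map f) := by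
  cases v <;> rfl

end Vert

/-- The joined strands of a Gauss diagram. -/
def netP (V : List Vert) : List (ℕ × ℕ) := V.flatMap Vert.pairs

/-- The crossings and bars of a Gauss diagram. -/
def netE (V : List Vert) : List (Ev ℕ) := V.flatMap Vert.events

theorem netP_append (V W : List Vert) : netP (V ++ W) = netP V ++ netP W := List.flatMap_append

theorem netE_append (V W : List Vert) : netE (V ++ W) = netE V ++ netE W := List.flatMap_append

theorem netP_map (f : ℕ → ℕ) (V : List Vert) :
    netP (V.map (Vert.map f)) = (netP V).map (Prod.map f f) := by
  rw [netP, netP, List.flatMap_map, List.map_flatMap]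
  congr 1
  funext v
  exact Vert.pairs_map f v

theorem netE_map (f : ℕ → ℕ) (V : List Vert) :
    netE (V.map (Vert.map f)) = (netE V).map (Ev.map f) := by
  rw [netE, netE, List.flatMap_map, List.map_flatMap]
  congr 1
  funext v
  exact Vert.events_map f v

/-- The strands which end at a vertex. -/
def ins (V : List Vert) : List ℕ := (netP V).map Prod.fst

/-- The strands which begin at a vertex. -/
def outs (V : List Vert) : List ℕ := (netP V).map Prod.snd

theorem ins_append (V W : List Vert) : ins (V ++ W) = ins V ++ ins W := by
  simp [ins, netP_append]

theorem outs_append (V W : List Vert) : outs (V ++ W) = outs V ++ outs W := by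
  simp [outs, netP_append]

/-- Each strand begins once and ends once. -/
structure Good (V : List Vert) : Prop where
  nodup : (ins V).Nodup
  perm : (ins V).Perm (outs V)

theorem mem_ins_of_netE {V : List Vert} {e : Ev ℕ} (he : e ∈ netE V) {a : ℕ} (ha : a ∈ e.labels) :
    a ∈ ins V := by
  obtain ⟨v, hv, he⟩ := List.mem_flatMap.1 he
  refine List.mem_map.2 ?_
  suffices ∃ p ∈ v.pairs, p.1 = a by
    obtain ⟨p, hp, rfl⟩ := this
    exact ⟨p, List.mem_flatMap.2 ⟨v, hv, hp⟩, rfl⟩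
  cases v <;> simp_all [Vert.events, Vert.pairs, Ev.labels]
  exact ha.imp Eq.symm Eq.symm

theorem netE_ok {V : List Vert} (h : (ins V).Nodup) : ∀ e ∈ netE V, e.Ok := by
  induction V with
  | nil => simp [netE]
  | cons v V ih =>
    rw [show v :: V = [v] ++ V from rfl, ins_append] at h
    intro e he
    rw [show v :: V = [v] ++ V from rfl, netE_append] at he
    rcases List.mem_append.1 he with he | he
    · have h := h.of_append_left
      cases v <;> simp_all [netE, Vert.events, Ev.Ok, ins, netP, Vert.pairs]
    · exact ih h.of_append_right e he

/-- A crossing or bar is recorded under the labels of the strands that end at it, and each strand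
ends at one vertex only. -/
theorem netE_pairwise {V : List Vert} (h : (ins V).Nodup) :
    (netE V).Pairwise fun e e' => ∀ a ∈ e.labels, a ∉ e'.labels := by
  induction V with
  | nil => exact List.Pairwise.nil
  | cons v V ih =>
    rw [show v :: V = [v] ++ V from rfl, ins_append] at h
    rw [show v :: V = [v] ++ V from rfl, netE_append]
    refine List.pairwise_append.2 ⟨?_, ih h.of_append_right, ?_⟩
    · cases v <;> simp [netE, Vert.events]
    · intro e he e' he' a ha ha'
      exact List.disjoint_of_nodup_append h (mem_ins_of_netE he ha) (mem_ins_of_netE he' ha')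

theorem Good.valid {V : List Vert} (h : Good V) : Valid (netE V) (netP V) :=
  ⟨h.nodup, h.perm, netE_ok h.nodup, fun _ he _ ha => mem_ins_of_netE he ha⟩

theorem Valid.good {V : List Vert} {E : List (Ev ℕ)} (h : Valid E (netP V)) : Good V :=
  ⟨h.nodup, h.perm⟩

/-- Equivalence of Gauss diagrams. -/
def VEq (V W : List Vert) : Prop := NetEq (netE V) (netP V) (netE W) (netP W)

theorem Good.refl {V : List Vert} (h : Good V) : VEq V V := h.valid.netEq

theorem VEq.symm {V W : List Vert} (h : VEq V W) : VEq W V := NetEq.symm h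

theorem VEq.trans {U V W : List Vert} (h : VEq U V) (h' : VEq V W) : VEq U W := NetEq.trans h h'

theorem VEq.good_left {V W : List Vert} (h : VEq V W) : Good V := (NetEq.valid_left h).good

theorem VEq.good_right {V W : List Vert} (h : VEq V W) : Good W := (NetEq.valid_right h).good

/-- The vertices of a Gauss diagram have no order: the joins form an unordered list, and the events
use disjoint strands. -/
theorem Good.perm_eq {V W : List Vert} (h : Good V) (hp : V.Perm W) : VEq V W := by
  have h1 : (netP V).Perm (netP W) := hp.flatMap_right _
  have h2 : (netE V).Perm (netE W) := hp.flatMap_right _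
  exact (h.valid.perm_pairs h1).trans
    ((h.valid.of_perm h1).perm_evs h2 (netE_pairwise h.nodup))

theorem Good.of_perm {V W : List Vert} (h : Good V) (hp : V.Perm W) : Good W :=
  (h.perm_eq hp).good_right

/-- Reordering the vertices on both sides. -/
theorem VEq.of_perm {V V' W W' : List Vert} (h : VEq V W) (h1 : V.Perm V') (h2 : W.Perm W') :
    VEq V' W' :=
  (h.good_left.perm_eq h1).symm.trans (h.trans (h.good_right.perm_eq h2))

theorem Good.rename {V : List Vert} (h : Good V) {f : ℕ → ℕ}
    (hf : Set.InjOn f {a | a ∈ ins V}) : VEq V (V.map (Vert.map f)) := by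
  have := h.valid.rename hf
  rwa [← netE_map, ← netP_map] at this

theorem Vert.map_eq_self {f : ℕ → ℕ} {v : Vert} (h : ∀ p ∈ v.pairs, f p.1 = p.1 ∧ f p.2 = p.2) :
    v.map f = v := by
  cases v <;> simp_all [Vert.pairs, Vert.map]

theorem map_vert_eq_self {f : ℕ → ℕ} {V : List Vert} (h1 : ∀ a ∈ ins V, f a = a)
    (h2 : ∀ a ∈ outs V, f a = a) : V.map (Vert.map f) = V := by
  conv_rhs => rw [← List.map_id V]
  refine List.map_congr_left fun v hv => Vert.map_eq_self fun p hp => ?_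
  have : p ∈ netP V := List.mem_flatMap.2 ⟨v, hv, hp⟩
  exact ⟨h1 _ (List.mem_map_of_mem this), h2 _ (List.mem_map_of_mem this)⟩

theorem Good.map_sub {F C : List Vert} (h : Good (F ++ C)) {b : ℕ} (a : ℕ) (h1 : b ∈ ins F)
    (h2 : b ∈ outs F) : C.map (Vert.map (sub b a)) = C := by
  have n1 := h.nodup
  have n2 := h.perm.nodup_iff.1 h.nodup
  rw [ins_append] at n1
  rw [outs_append] at n2
  refine map_vert_eq_self (fun x hx => sub_of_ne ?_) (fun x hx => sub_of_ne ?_)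
  · rintro rfl; exact List.disjoint_of_nodup_append n1 h1 hx
  · rintro rfl; exact List.disjoint_of_nodup_append n2 h2 hx

theorem Good.disjoint {F C : List Vert} (h : Good (F ++ C)) {b : ℕ} (h1 : b ∈ ins F) :
    ∀ e ∈ netE C, b ∉ e.labels := fun e he hb => by
  have n1 := h.nodup
  rw [ins_append] at n1
  exact List.disjoint_of_nodup_append n1 h1 (mem_ins_of_netE he hb)

/-- This is merging inside a local configuration: the context `EC` avoids both labels, so it may
stand below the cut and remains unchanged. -/
theorem NetEq.merge_step {E E' E₁ M EC : List (Ev ℕ)} {P P' P₀ : List (ℕ × ℕ)} {a z c : ℕ}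
    (h : NetEq E' P' E P) (hE : E = E₁ ++ (M ++ EC)) (hP : P.Perm ((a, z) :: (z, c) :: P₀))
    (h1 : ∀ e ∈ E₁, z ∉ e.labels) (h2 : ∀ e ∈ M, a ∉ e.labels)
    (h3 : ∀ e ∈ EC, a ∉ e.labels) (h4 : ∀ e ∈ EC, z ∉ e.labels) :
    NetEq E' P' (E₁ ++ (M.map (Ev.map (sub z a)) ++ EC)) ((a, c) :: P₀) := by
  subst hE
  have h5 := h.valid_right.perm_pairs hP
  refine (h.trans h5).trans ?_
  have h6 : EC.map (Ev.map (sub z a)) = EC := map_sub_eq_self h4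
  have h7 := h5.valid_right.merge h1 fun e he => (List.mem_append.1 he).elim (h2 e) (h3 e)
  rwa [List.map_append, h6] at h7

theorem Valid.wire_out {E : List (Ev ℕ)} {P : List (ℕ × ℕ)} {a b : ℕ}
    (h : Valid E ((a, b) :: P)) (hab : a ≠ b) : ∃ c P₀, P.Perm ((b, c) :: P₀) := by
  have : b ∈ ((a, b) :: P).map Prod.fst := h.perm.symm.subset (by simp)
  simp only [List.map_cons, List.mem_cons, hab.symm, false_or] at this
  obtain ⟨⟨b', c⟩, hp, rfl⟩ := List.mem_map.1 this
  exact ⟨c, P.erase (b', c), List.perm_cons_erase hp⟩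

/-- A strand may be contracted. -/
theorem Good.wire {C : List Vert} {a b : ℕ} (h : Good (.wire a b :: C)) (hab : a ≠ b) :
    VEq (.wire a b :: C) (C.map (Vert.map (sub b a))) := by
  have hv := h.valid
  obtain ⟨c, P₀, hP⟩ := Valid.wire_out (E := netE C) (P := netP C) hv hab
  -- The strand `a` ends at the wire and therefore enters no crossing, so all events may be placed
  -- below the cut.
  have hd : ∀ e ∈ netE C, a ∉ e.labels :=
    Good.disjoint (F := [.wire a b]) h (by simp [ins, netP, Vert.pairs])
  have h1 := hv.perm_pairs (P' := (a, b) :: (b, c) :: P₀) (hP.cons _)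
  have hperm : ((a, c) :: P₀).Perm (netP (C.map (Vert.map (sub b a)))) := by
    rw [netP_map]
    refine List.Perm.trans (List.Perm.of_eq ?_) (hP.map _).symm
    have n1 := h1.valid_right.nodup
    have n2 := h1.valid_right.perm.nodup_iff.1 n1
    simp only [List.map_cons, List.nodup_cons, List.mem_cons, not_or] at n1 n2
    rw [List.map_cons]
    congr 1
    · rw [Prod.map_apply, sub_self, sub_of_ne (fun h => n2.1.1 h.symm)]
    · conv_lhs => rw [← List.map_id P₀]
      refine List.map_congr_left fun p hp => Prod.ext ?_ ?_
      · refine (sub_of_ne ?_).symm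
        rintro h; rw [← h] at n1; exact n1.2.1 (List.mem_map_of_mem hp)
      · refine (sub_of_ne ?_).symm
        rintro h; rw [← h] at n2; exact n2.1.2 (List.mem_map_of_mem hp)
  have h2 := h1.valid_right.merge (E₁ := []) (E₂ := netE C) (by simp) hd
  exact NetEq.trans h1 (h2.trans (by rw [netE_map]; exact h2.valid_right.perm_pairs hperm))

end SingTwist

namespace SingTwist

/-! ### Moves of Gauss diagrams -/

theorem Good.congr {V W : List Vert} (h : Good V) (h1 : (ins V).Perm (ins W))
    (h2 : (outs V).Perm (outs W)) : Good W :=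
  ⟨h1.nodup_iff.1 h.nodup, h1.symm.trans (h.perm.trans h2)⟩

theorem NetEq.merge {E E' EC : List (Ev ℕ)} {P P' : List (ℕ × ℕ)}
    (h : NetEq E' P' E P) (E₁ M M' : List (Ev ℕ)) (P₀ : List (ℕ × ℕ)) (a z c : ℕ)
    (h3 : ∀ e ∈ EC, a ∉ e.labels) (h4 : ∀ e ∈ EC, z ∉ e.labels)
    (hE : E = E₁ ++ (M ++ EC)) (hP : P.Perm ((a, z) :: (z, c) :: P₀))
    (h1 : ∀ e ∈ E₁, z ∉ e.labels) (h2 : ∀ e ∈ M, a ∉ e.labels)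
    (hM : M.map (Ev.map (sub z a)) = M') :
    NetEq E' P' (E₁ ++ (M' ++ EC)) ((a, c) :: P₀) :=
  hM ▸ h.merge_step hE hP h1 h2 h3 h4

/-- A crossing of two strands; the first one is the left one if `s` is true. -/
def xv (s : Bool) (c : Crossing) (x x' y y' : ℕ) : Vert :=
  if s then .cross c x x' y y' else .cross c y y' x x'

/-- The event of a crossing of two strands; the first one is the left one if `s` is true. -/
def xe {α : Type} (s : Bool) (c : Crossing) (x y : α) : Ev α :=
  if s then .cross c x y else .cross c y x

theorem mem_labels_xe {α : Type} {s : Bool} {c : Crossing} {x y a : α} :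
    a ∈ (xe s c x y).labels ↔ a = x ∨ a = y := by
  cases s <;> simp [xe, Ev.labels, or_comm]

theorem map_xe {α β : Type} (f : α → β) (s : Bool) (c : Crossing) (x y : α) :
    (xe s c x y).map f = xe s c (f x) (f y) := by
  cases s <;> rfl

theorem ok_xe {α : Type} {s : Bool} {c : Crossing} {x y : α} (h : x ≠ y) : (xe s c x y).Ok := by
  cases s
  exacts [h.symm, h]

theorem netE_xv_cons (s : Bool) (c : Crossing) (x x' y y' : ℕ) (C : List Vert) :
    netE (xv s c x x' y y' :: C) = xe s c x y :: netE C := by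
  cases s <;> rfl

theorem netP_xv_cons (s : Bool) (c : Crossing) (x x' y y' : ℕ) (C : List Vert) :
    (netP (xv s c x x' y y' :: C)).Perm ((x, x') :: (y, y') :: netP C) := by
  cases s
  exacts [.swap _ _ _, .refl _]

theorem ins_xv_cons (s : Bool) (c : Crossing) (x x' y y' : ℕ) (C : List Vert) :
    (ins (xv s c x x' y y' :: C)).Perm (x :: y :: ins C) :=
  (netP_xv_cons s c x x' y y' C).map _

theorem outs_xv_cons (s : Bool) (c : Crossing) (x x' y y' : ℕ) (C : List Vert) :
    (outs (xv s c x x' y y' :: C)).Perm (x' :: y' :: outs C) :=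
  (netP_xv_cons s c x x' y y' C).map _

/-- The net of a Gauss diagram, part of it being given explicitly. -/
theorem Good.net {F C : List Vert} {E : List (Ev ℕ)} {P : List (ℕ × ℕ)} (h : Good (F ++ C))
    (hE : netE F = E) (hP : (netP F).Perm P) : NetEq (netE (F ++ C)) (netP (F ++ C)) (E ++ netE C)
      (P ++ netP C) := by
  subst hE
  rw [netE_append]
  refine Valid.perm_pairs ?_ ?_
  · rw [← netE_append]; exact h.valid
  · rw [netP_append]; exact hP.append_right _

theorem Good.net_nodup {F C : List Vert} {P : List (ℕ × ℕ)} (h : Good (F ++ C))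
    (hP : (netP F).Perm P) : (P.map Prod.fst).Nodup ∧ ∀ a ∈ P.map Prod.fst, ∀ e ∈ netE C,
      a ∉ e.labels := by
  have h1 := h.nodup
  rw [ins_append] at h1
  refine ⟨(hP.map _).nodup_iff.1 h1.of_append_left, fun a ha => h.disjoint ?_⟩
  exact (hP.map _).symm.subset ha

/-- Both strands meet the two crossings in the same order. So the middle labels can be merged into
the first ones, and the crossings become a product in the braid monoid. -/
theorem Good.pair {C : List Vert} {s1 s2 : Bool} {c1 c2 : Crossing} {x x1 x2 y y1 y2 : ℕ}
    (h : Good ([xv s1 c1 x x1 y y1, xv s2 c2 x1 x2 y1 y2] ++ C)) :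
    NetEq (netE ([xv s1 c1 x x1 y y1, xv s2 c2 x1 x2 y1 y2] ++ C))
      (netP ([xv s1 c1 x x1 y y1, xv s2 c2 x1 x2 y1 y2] ++ C))
      ([xe s1 c1 x y, xe s2 c2 x y] ++ netE C) ((x, x2) :: (y, y2) :: netP C) := by
  have hP : (netP [xv s1 c1 x x1 y y1, xv s2 c2 x1 x2 y1 y2]).Perm
      [(x, x1), (y, y1), (x1, x2), (y1, y2)] :=
    (netP_xv_cons _ _ _ _ _ _ _).trans (((netP_xv_cons _ _ _ _ _ _ _).cons _).cons _)
  have h0 := h.net (E := [xe s1 c1 x y, xe s2 c2 x1 y1]) (by rw [netE_xv_cons, netE_xv_cons]; rfl) hP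
  obtain ⟨hn, hd⟩ := h.net_nodup hP
  simp only [List.map_cons, List.map_nil, List.nodup_cons, List.mem_cons, List.not_mem_nil, not_or,
    or_false, List.nodup_nil, not_false_eq_true, and_true] at hn hd
  have h1 := h0.merge [xe s1 c1 x y] [xe s2 c2 x1 y1] [xe s2 c2 x y1]
    ([(y, y1), (y1, y2)] ++ netP C) x x1 x2 (hd _ (by simp)) (hd _ (by simp)) rfl
    (by grind) (by grind [mem_labels_xe]) (by grind [mem_labels_xe]) (by grind [map_xe, sub])
  have h2 := h1.merge [xe s1 c1 x y] [xe s2 c2 x y1] [xe s2 c2 x y]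
    ([(x, x2)] ++ netP C) y y1 y2 (hd _ (by simp)) (hd _ (by simp)) rfl
    (by grind) (by grind [mem_labels_xe]) (by grind [mem_labels_xe]) (by grind [map_xe, sub])
  exact h2.trans (h2.valid_right.perm_pairs (.swap _ _ _))

/-- Merging needs an order of the crossings that agrees with the direction of every strand. Such an
order exists here: `x` meets `y`, then `x` meets `z`, and at last `y` meets `z`. -/
theorem Good.tri {C : List Vert} {s1 s2 s3 : Bool} {c1 c2 c3 : Crossing}
    {x x1 x2 y y1 y2 z z1 z2 : ℕ}
    (h : Good ([xv s1 c1 x x1 y y1, xv s2 c2 x1 x2 z z1, xv s3 c3 y1 y2 z1 z2] ++ C)) :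
    NetEq (netE ([xv s1 c1 x x1 y y1, xv s2 c2 x1 x2 z z1, xv s3 c3 y1 y2 z1 z2] ++ C))
      (netP ([xv s1 c1 x x1 y y1, xv s2 c2 x1 x2 z z1, xv s3 c3 y1 y2 z1 z2] ++ C))
      ([xe s1 c1 x y, xe s2 c2 x z, xe s3 c3 y z] ++ netE C)
      ((x, x2) :: (y, y2) :: (z, z2) :: netP C) := by
  have hP : (netP [xv s1 c1 x x1 y y1, xv s2 c2 x1 x2 z z1, xv s3 c3 y1 y2 z1 z2]).Perm
      [(x, x1), (y, y1), (x1, x2), (z, z1), (y1, y2), (z1, z2)] :=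
    (netP_xv_cons _ _ _ _ _ _ _).trans ((((netP_xv_cons _ _ _ _ _ _ _).trans
      (((netP_xv_cons _ _ _ _ _ _ _).cons _).cons _)).cons _).cons _)
  have h0 := h.net (E := [xe s1 c1 x y, xe s2 c2 x1 z, xe s3 c3 y1 z1])
    (by rw [netE_xv_cons, netE_xv_cons, netE_xv_cons]; rfl) hP
  obtain ⟨hn, hd⟩ := h.net_nodup hP
  simp only [List.map_cons, List.map_nil, List.nodup_cons, List.mem_cons, List.not_mem_nil, not_or,
    or_false, List.nodup_nil, not_false_eq_true, and_true] at hn hd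
  have h1 := h0.merge [xe s1 c1 x y] [xe s2 c2 x1 z, xe s3 c3 y1 z1]
    [xe s2 c2 x z, xe s3 c3 y1 z1] ([(y, y1), (z, z1), (y1, y2), (z1, z2)] ++ netP C) x x1 x2
    (hd _ (by simp)) (hd _ (by simp)) rfl
    (by grind) (by grind [mem_labels_xe]) (by grind [mem_labels_xe]) (by grind [map_xe, sub])
  have h2 := h1.merge [xe s1 c1 x y, xe s2 c2 x z] [xe s3 c3 y1 z1] [xe s3 c3 y z1]
    ([(x, x2), (z, z1), (z1, z2)] ++ netP C) y y1 y2 (hd _ (by simp)) (hd _ (by simp)) rfl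
    (by grind) (by grind [mem_labels_xe]) (by grind [mem_labels_xe]) (by grind [map_xe, sub])
  have h3 := h2.merge [xe s1 c1 x y, xe s2 c2 x z] [xe s3 c3 y z1] [xe s3 c3 y z]
    ([(x, x2), (y, y2)] ++ netP C) z z1 z2 (hd _ (by simp)) (hd _ (by simp)) rfl
    (by grind) (by grind [mem_labels_xe]) (by grind [mem_labels_xe]) (by grind [map_xe, sub])
  exact h3.trans (h3.valid_right.perm_pairs (by grind))

/-- Three crossings of three strands are reversed. -/
theorem Good.reverse {C : List Vert} {s1 s2 s3 : Bool} {c1 c2 c3 : Crossing}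
    {x x1 x2 y y1 y2 z z1 z2 : ℕ}
    (h : Good ([xv s1 c1 x x1 y y1, xv s2 c2 x1 x2 z z1, xv s3 c3 y1 y2 z1 z2] ++ C))
    (hrel : ∀ (n : ℕ) (x y z : Fin n), x ≠ y → x ≠ z → y ≠ z →
      evs [xe s1 c1 x y, xe s2 c2 x z, xe s3 c3 y z] =
        evs [xe s3 c3 y z, xe s2 c2 x z, xe s1 c1 x y]) :
    VEq ([xv s1 c1 x x1 y y1, xv s2 c2 x1 x2 z z1, xv s3 c3 y1 y2 z1 z2] ++ C)
      ([xv s3 c3 y y1 z z1, xv s2 c2 x x1 z1 z2, xv s1 c1 x1 x2 y1 y2] ++ C) := by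
  have e3 : ∀ z₀ z₁ y₀ y₁, xv s3 c3 y₀ y₁ z₀ z₁ = xv (!s3) c3 z₀ z₁ y₀ y₁ := by
    intros; cases s3 <;> rfl
  have e2 : ∀ z₀ z₁ x₀ x₁, xv s2 c2 x₀ x₁ z₀ z₁ = xv (!s2) c2 z₀ z₁ x₀ x₁ := by
    intros; cases s2 <;> rfl
  have e1 : ∀ y₀ y₁ x₀ x₁, xv s1 c1 x₀ x₁ y₀ y₁ = xv (!s1) c1 y₀ y₁ x₀ x₁ := by
    intros; cases s1 <;> rfl
  have f3 : ∀ (z₀ y₀ : ℕ), xe (!s3) c3 z₀ y₀ = xe s3 c3 y₀ z₀ := by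
    intros; cases s3 <;> rfl
  have f2 : ∀ (z₀ x₀ : ℕ), xe (!s2) c2 z₀ x₀ = xe s2 c2 x₀ z₀ := by
    intros; cases s2 <;> rfl
  have f1 : ∀ (y₀ x₀ : ℕ), xe (!s1) c1 y₀ x₀ = xe s1 c1 x₀ y₀ := by
    intros; cases s1 <;> rfl
  have h' : Good ([xv s3 c3 y y1 z z1, xv s2 c2 x x1 z1 z2, xv s1 c1 x1 x2 y1 y2] ++ C) := by
    refine h.congr ?_ ?_
    · have a1 := ((ins_xv_cons s1 c1 x x1 y y1 _).trans (((ins_xv_cons s2 c2 x1 x2 z z1 _).trans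
        (((ins_xv_cons s3 c3 y1 y2 z1 z2 C).cons _).cons _)).cons _ |>.cons _))
      have a2 := ((ins_xv_cons s3 c3 y y1 z z1 _).trans (((ins_xv_cons s2 c2 x x1 z1 z2 _).trans
        (((ins_xv_cons s1 c1 x1 x2 y1 y2 C).cons _).cons _)).cons _ |>.cons _))
      refine a1.trans (List.Perm.trans ?_ a2.symm)
      grind
    · have a1 := ((outs_xv_cons s1 c1 x x1 y y1 _).trans (((outs_xv_cons s2 c2 x1 x2 z z1 _).trans
        (((outs_xv_cons s3 c3 y1 y2 z1 z2 C).cons _).cons _)).cons _ |>.cons _))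
      have a2 := ((outs_xv_cons s3 c3 y y1 z z1 _).trans (((outs_xv_cons s2 c2 x x1 z1 z2 _).trans
        (((outs_xv_cons s1 c1 x1 x2 y1 y2 C).cons _).cons _)).cons _ |>.cons _))
      refine a1.trans (List.Perm.trans ?_ a2.symm)
      grind
  have h1 := h.tri
  -- The reversed triangle has the shape of `Good.tri` again, for the strands in the order `z`, `y`,
  -- `x` and with the sides of each crossing exchanged.
  have h2 : NetEq (netE ([xv s3 c3 y y1 z z1, xv s2 c2 x x1 z1 z2, xv s1 c1 x1 x2 y1 y2] ++ C))
      (netP ([xv s3 c3 y y1 z z1, xv s2 c2 x x1 z1 z2, xv s1 c1 x1 x2 y1 y2] ++ C))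
      ([xe s3 c3 y z, xe s2 c2 x z, xe s1 c1 x y] ++ netE C)
      ((x, x2) :: (y, y2) :: (z, z2) :: netP C) := by
    rw [e3 z, e2 z1, e1 y1] at h' ⊢
    have h3 := h'.tri
    rw [f3, f2, f1] at h3
    exact h3.trans (h3.valid_right.perm_pairs (by grind))
  have hn := h1.valid_right.nodup
  simp only [List.map_cons, List.nodup_cons, List.mem_cons, not_or] at hn
  refine (h1.trans ?_).trans h2.symm
  have h4 := Valid.rel (E₁ := []) (E₂ := netE C) ![x, y, z]
    [xe s1 c1 0 1, xe s2 c2 0 2, xe s3 c3 1 2] [xe s3 c3 1 2, xe s2 c2 0 2, xe s1 c1 0 1]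
    (P := (x, x2) :: (y, y2) :: (z, z2) :: netP C)
    (by simp only [List.map_cons, map_xe]; exact h1.valid_right)
    (by
      intro i j hij
      fin_cases i <;> fin_cases j <;> simp at hij ⊢ <;> grind)
    (by intro i; fin_cases i <;> simp)
    (by simp [ok_xe])
    (fun n u hu => by
      simp only [List.map_cons, map_xe]
      exact hrel n (u 0) (u 1) (u 2) (hu.ne (by decide))
        (hu.ne (by decide)) (hu.ne (by decide)))
  simp only [List.map_cons, map_xe] at h4
  exact h4

/-- Two crossings of two strands are replaced. -/
theorem Good.replace {C : List Vert} {s1 s2 : Bool} {c1 c2 : Crossing} {x x1 x2 y y1 y2 : ℕ}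
    (h : Good ([xv s1 c1 x x1 y y1, xv s2 c2 x1 x2 y1 y2] ++ C)) (R : List (Ev (Fin 2)))
    (hR : ∀ e ∈ R, e.Ok)
    (hrel : ∀ (n : ℕ) (u : Fin 2 → Fin n), u 0 ≠ u 1 →
      evs [xe s1 c1 (u 0) (u 1), xe s2 c2 (u 0) (u 1)] = evs (R.map (Ev.map u))) :
    NetEq (netE ([xv s1 c1 x x1 y y1, xv s2 c2 x1 x2 y1 y2] ++ C))
      (netP ([xv s1 c1 x x1 y y1, xv s2 c2 x1 x2 y1 y2] ++ C))
      (R.map (Ev.map ![x, y]) ++ netE C) ((x, x2) :: (y, y2) :: netP C) := by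
  have h1 := h.pair
  have hn := h1.valid_right.nodup
  simp only [List.map_cons, List.nodup_cons, List.mem_cons, not_or] at hn
  refine h1.trans ?_
  have h4 := Valid.rel (E₁ := []) (E₂ := netE C) ![x, y]
    [xe s1 c1 0 1, xe s2 c2 0 1] R
    (P := (x, x2) :: (y, y2) :: netP C)
    (by simp only [List.map_cons, map_xe]; exact h1.valid_right)
    (by
      intro i j hij
      fin_cases i <;> fin_cases j <;> simp at hij ⊢ <;> grind)
    (by intro i; fin_cases i <;> simp)
    hR
    (fun n u hu => by
      simp only [List.map_cons, map_xe]
      exact hrel n u (hu.ne (by decide)))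
  simp only [List.map_cons, map_xe] at h4
  exact h4

theorem Good.bigon {C : List Vert} {c : Crossing} (hc : c.IsReal) {x x1 x2 y y1 y2 : ℕ}
    (h : Good ([.cross c x x1 y y1, .cross c.turn y1 y2 x1 x2] ++ C)) :
    VEq ([.cross c x x1 y y1, .cross c.turn y1 y2 x1 x2] ++ C)
      ([.wire x x2, .wire y y2] ++ C) :=
  Good.replace (s1 := true) (s2 := false) h [] (by simp) fun n u hu => by
    simpa [evs, xe, Ev.val] using crossVal_mul_inv hc hu

theorem Good.flip {C : List Vert} {c : Crossing} (hc : c.IsReal) {x x1 x2 y y1 y2 : ℕ}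
    (h : Good ([.cross c x x1 y y1, .cross .singular y1 y2 x1 x2] ++ C)) :
    VEq ([.cross c x x1 y y1, .cross .singular y1 y2 x1 x2] ++ C)
      ([.cross .singular x x1 y y1, .cross c y1 y2 x1 x2] ++ C) := by
  have h1 := Good.replace (s1 := true) (s2 := false) h
    [.cross .singular 0 1, .cross c 1 0] (by simp [Ev.Ok]) fun n u hu => by
      simpa [evs, xe, Ev.val, Ev.map] using crossVal_flip hc hu
  have h' : Good ([xv true .singular x x1 y y1, xv false c x1 x2 y1 y2] ++ C) :=
    h.congr (.refl _) (.refl _)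
  exact h1.trans h'.pair.symm

end SingTwist

/-! ### Triangles with compatible directions, wires, bars, and antiparallel strands -/

namespace SingTwist

theorem Crossing.IsReal.turn {c : Crossing} (h : c.IsReal) : c.turn.IsReal := by
  rcases h with rfl | rfl
  exacts [.inr rfl, .inl rfl]

theorem Crossing.turn_turn (c : Crossing) : c.turn.turn = c := by cases c <;> rfl

theorem Crossing.turn_ne_virtual {c : Crossing} (h : c ≠ .virtual) : c.turn ≠ .virtual := by
  cases c <;> simp_all [Crossing.turn]

theorem Good.slide {C : List Vert} {c d : Crossing} (hc : c.IsReal) (hd : d ≠ .virtual)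
    {x x1 x2 y y1 y2 z z1 z2 : ℕ}
    (h : Good ([.cross c x x1 y y1, .cross c x1 x2 z z1, .cross d y1 y2 z1 z2] ++ C)) :
    VEq ([.cross c x x1 y y1, .cross c x1 x2 z z1, .cross d y1 y2 z1 z2] ++ C)
      ([.cross d y y1 z z1, .cross c x x1 z1 z2, .cross c x1 x2 y1 y2] ++ C) :=
  Good.reverse (s1 := true) (s2 := true) (s3 := true) h fun n x y z h1 h2 h3 => by
    simpa [evs, xe, Ev.val, mul_assoc] using crossVal_slide hc hd h1 h2 h3

/-- The moving strand `x` comes from the right here, and the relation is that of `crossVal_slide`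
for the inverses of its two crossings. -/
theorem Good.slide_inv {C : List Vert} {c d : Crossing} (hc : c.IsReal) (hd : d ≠ .virtual)
    {x x1 x2 y y1 y2 z z1 z2 : ℕ}
    (h : Good ([.cross c z z1 x x1, .cross c y y1 x1 x2, .cross d y1 y2 z1 z2] ++ C)) :
    VEq ([.cross c z z1 x x1, .cross c y y1 x1 x2, .cross d y1 y2 z1 z2] ++ C)
      ([.cross d y y1 z z1, .cross c y1 y2 x x1, .cross c z1 z2 x1 x2] ++ C) := by
  have h' : Good ([xv false c x x1 z z1, xv false c x1 x2 y y1, xv false d z1 z2 y1 y2] ++ C) := h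
  have := h'.reverse fun n x z y h1 h2 h3 => by
    have e1 := crossVal_mul_inv hc.turn h1
    have e2 := crossVal_mul_inv hc.turn h2
    have e3 := crossVal_mul_inv hc h1.symm
    have e4 := crossVal_mul_inv hc h2.symm
    rw [Crossing.turn_turn] at e1 e2
    have := inverse_slide e2 e4 e1 e3 (crossVal_slide hc.turn hd h2 h1 h3.symm)
    simpa [evs, xe, Ev.val, mul_assoc] using this
  exact this.of_perm (.refl _) (.refl _)

/-- The moving strand `x` is to the left of `y` and to the right of `z`. Multiplying
`crossVal_slide` from both sides by the inverse of the crossing of `x` with `z` brings it to this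
form. -/
theorem Good.slide_mixed {C : List Vert} {c d : Crossing} (hc : c.IsReal) (hd : d ≠ .virtual)
    {x x1 x2 y y1 y2 z z1 z2 : ℕ}
    (h : Good ([.cross c x x1 y y1, .cross d z z1 y1 y2, .cross c.turn z1 z2 x1 x2] ++ C)) :
    VEq ([.cross c x x1 y y1, .cross d z z1 y1 y2, .cross c.turn z1 z2 x1 x2] ++ C)
      ([.cross c.turn z z1 x x1, .cross d z1 z2 y y1, .cross c x1 x2 y1 y2] ++ C) := by
  have h' : Good ([xv false c y y1 x x1, xv false d y1 y2 z z1, xv false c.turn x1 x2 z1 z2] ++ C) :=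
    h
  have := h'.reverse fun n y x z h1 h2 h3 => by
    have e1 := crossVal_mul_inv hc h3
    have e2 := crossVal_mul_inv hc.turn h3.symm
    rw [Crossing.turn_turn] at e2
    have e3 := crossVal_slide hc hd h3 h1.symm h2.symm
    simp only [evs, xe, Ev.val, List.map_cons, List.map_nil, List.prod_cons, List.prod_nil, mul_one,
      Bool.false_eq_true, if_false]
    calc crossVal c x y * (crossVal d z y * crossVal c.turn z x)
        = crossVal c.turn z x * (crossVal c x z * crossVal c x y * crossVal d z y) *
            crossVal c.turn z x := by
          rw [← mul_assoc (crossVal c.turn z x), ← mul_assoc (crossVal c.turn z x), e2, one_mul,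
            mul_assoc]
      _ = crossVal c.turn z x * (crossVal d z y * crossVal c x y) *
            (crossVal c x z * crossVal c.turn z x) := by rw [e3]; simp only [mul_assoc]
      _ = _ := by rw [e1, mul_one]
  exact this.of_perm (.refl _) (.refl _)

/-! ### Wires -/

/-- The contracted strand now keeps its other label. The transposition of the two labels leads from
one version to the other. -/
theorem Good.wire' {C : List Vert} {a b : ℕ} (h : Good (.wire a b :: C)) (hab : a ≠ b) :
    VEq (.wire a b :: C) (C.map (Vert.map (sub a b))) := by
  have h1 := h.wire hab
  refine h1.trans ?_
  have h2 := h1.good_right.rename (f := Equiv.swap a b) (Equiv.injective _).injOn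
  rw [List.map_map] at h2
  convert h2 using 2
  funext v
  have : sub a b = fun x => Equiv.swap a b (sub b a x) := by
    funext x
    simp only [sub, Equiv.swap_apply_def]
    grind
  rw [this]
  cases v <;> rfl

/-- The label `b` begins at the wire and ends in `F`, so it does not occur in the context `C`, which
keeps its labels. -/
theorem Good.contract {F C : List Vert} {a b : ℕ} (h : Good (.wire a b :: (F ++ C)))
    (hb : b ∈ ins F) : VEq (.wire a b :: (F ++ C)) (F.map (Vert.map (sub b a)) ++ C) := by
  have hab : a ≠ b := by
    rintro rfl
    have := h.nodup
    rw [show ins (Vert.wire a a :: (F ++ C)) = a :: ins (F ++ C) from rfl, ins_append] at this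
    simp [hb] at this
  have h1 := h.wire hab
  rw [List.map_append, Good.map_sub (F := .wire a b :: F) h a (List.mem_cons_of_mem _ hb)
    List.mem_cons_self] at h1
  exact h1

theorem Good.contract' {F C : List Vert} {a b : ℕ} (h : Good (.wire a b :: (F ++ C)))
    (ha : a ∈ outs F) : VEq (.wire a b :: (F ++ C)) (F.map (Vert.map (sub a b)) ++ C) := by
  have hab : a ≠ b := by
    rintro rfl
    have := h.perm.nodup_iff.1 h.nodup
    rw [show outs (Vert.wire a a :: (F ++ C)) = a :: outs (F ++ C) from rfl, outs_append] at this
    simp [ha] at this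
  have h1 := h.wire' hab
  rw [List.map_append, Good.map_sub (F := .wire a b :: F) h b List.mem_cons_self
    (List.mem_cons_of_mem _ ha)] at h1
  exact h1

/-! ### Bars -/

theorem Good.bar_bar {C : List Vert} {a a1 a2 : ℕ} (h : Good ([.bar a a1, .bar a1 a2] ++ C)) :
    VEq ([.bar a a1, .bar a1 a2] ++ C) ([.wire a a2] ++ C) := by
  have h0 := h.net (E := [.bar a, .bar a1]) (P := [(a, a1), (a1, a2)]) rfl (.refl _)
  obtain ⟨hn, hd⟩ := h.net_nodup (P := [(a, a1), (a1, a2)]) (.refl _)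
  simp only [List.map_cons, List.map_nil, List.nodup_cons, List.mem_cons, List.not_mem_nil,
    or_false, List.nodup_nil, not_false_eq_true, and_true] at hn hd
  have h1 := h0.merge [.bar a] [.bar a1] [.bar a] (netP C) a a1 a2 (hd _ (by simp)) (hd _ (by simp))
    rfl (.refl _) (by grind [Ev.labels]) (by grind [Ev.labels]) (by grind [Ev.map, sub])
  refine h1.trans ?_
  exact Valid.rel (E₁ := []) (E₂ := netE C) ![a] [.bar 0, .bar 0] [] (P := (a, a2) :: netP C)
    h1.valid_right (by intro i j _; exact Subsingleton.elim _ _) (by intro i; fin_cases i; simp)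
    (by simp) (fun n u hu => by simpa [evs, Ev.val, Ev.map] using barVal_mul_self (u 0))

theorem Good.twist {C : List Vert} {c : Crossing} (hc : c ≠ .virtual) {a a1 a2 a3 b b1 b2 b3 : ℕ}
    (h : Good ([.bar b b1, .bar a a1, .cross c a1 a2 b1 b2, .bar a2 a3, .bar b2 b3] ++ C)) :
    VEq ([.bar b b1, .bar a a1, .cross c a1 a2 b1 b2, .bar a2 a3, .bar b2 b3] ++ C)
      ([.cross c b b3 a a3] ++ C) := by
  have hP : (netP [.bar b b1, .bar a a1, .cross c a1 a2 b1 b2, .bar a2 a3, .bar b2 b3]).Perm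
    [(b, b1), (a, a1), (a1, a2), (b1, b2), (a2, a3), (b2, b3)] := .refl _
  have h0 := h.net (E := [.bar b, .bar a, .cross c a1 b1, .bar a2, .bar b2]) rfl hP
  obtain ⟨hn, hd⟩ := h.net_nodup hP
  simp only [List.map_cons, List.map_nil, List.nodup_cons, List.mem_cons, List.not_mem_nil, not_or,
    or_false, List.nodup_nil, not_false_eq_true, and_true] at hn hd
  have h1 := h0.merge [.bar b, .bar a] [.cross c a1 b1, .bar a2, .bar b2]
    [.cross c a b1, .bar a2, .bar b2] ([(b, b1), (b1, b2), (a2, a3), (b2, b3)] ++ netP C) a a1 a2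
    (hd _ (by simp)) (hd _ (by simp)) rfl (by grind) (by grind [Ev.labels]) (by grind [Ev.labels])
    (by grind [Ev.map, sub])
  have h2 := h1.merge [.bar b, .bar a] [.cross c a b1, .bar a2, .bar b2]
    [.cross c a b, .bar a2, .bar b2] ([(a, a2), (a2, a3), (b2, b3)] ++ netP C) b b1 b2
    (hd _ (by simp)) (hd _ (by simp)) rfl (by grind) (by grind [Ev.labels]) (by grind [Ev.labels])
    (by grind [Ev.map, sub])
  have h3 := h2.merge [.bar b, .bar a, .cross c a b] [.bar a2, .bar b2]
    [.bar a, .bar b2] ([(b, b2), (b2, b3)] ++ netP C) a a2 a3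
    (hd _ (by simp)) (hd _ (by simp)) rfl (by grind) (by grind [Ev.labels]) (by grind [Ev.labels])
    (by grind [Ev.map, sub])
  have h4 := h3.merge [.bar b, .bar a, .cross c a b, .bar a] [.bar b2]
    [.bar b] ([(a, a3)] ++ netP C) b b2 b3
    (hd _ (by simp)) (hd _ (by simp)) rfl (by grind) (by grind [Ev.labels]) (by grind [Ev.labels])
    (by grind [Ev.map, sub])
  refine h4.trans ?_
  refine Valid.rel (E₁ := []) (E₂ := netE C) ![b, a]
    [.bar 0, .bar 1, .cross c 1 0, .bar 1, .bar 0] [.cross c 0 1] (P := (b, b3) :: (a, a3) :: netP C)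
    h4.valid_right ?_ (by intro i; fin_cases i <;> simp) (by simp [Ev.Ok]) (fun n u hu => ?_)
  · intro i j hij
    fin_cases i <;> fin_cases j <;> simp at hij ⊢ <;> grind
  · have := crossVal_twist hc (hu.ne (show (1 : Fin 2) ≠ 0 by decide))
    simpa [evs, Ev.val, Ev.map, mul_assoc] using this

/-! ### Two crossings of a strand with a thread, in opposite directions -/

/-- The strand runs through `x`, `z`, `z'`, but the thread meets `z` before `x`. The thread can be
merged; the strand cannot, since its second part has to cross first. It stays cut, as in the moves
of type 2 and 3. -/
theorem Good.thread {C : List Vert} {s : Bool} {c d : Crossing} {x z z' y y' y'' : ℕ}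
    (h : Good ([xv s c y y' z z', xv (!s) d y' y'' x z] ++ C)) :
    NetEq (netE ([xv s c y y' z z', xv (!s) d y' y'' x z] ++ C))
      (netP ([xv s c y y' z z', xv (!s) d y' y'' x z] ++ C))
      ([xe s c y z, xe (!s) d y x] ++ netE C) ((x, z) :: (z, z') :: (y, y'') :: netP C) := by
  have hP : (netP [xv s c y y' z z', xv (!s) d y' y'' x z]).Perm
      [(y, y'), (z, z'), (y', y''), (x, z)] :=
    (netP_xv_cons _ _ _ _ _ _ _).trans (((netP_xv_cons _ _ _ _ _ _ _).cons _).cons _)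
  have h0 := h.net (E := [xe s c y z, xe (!s) d y' x]) (by rw [netE_xv_cons, netE_xv_cons]; rfl) hP
  obtain ⟨hn, hd⟩ := h.net_nodup hP
  simp only [List.map_cons, List.map_nil, List.nodup_cons, List.mem_cons, List.not_mem_nil, not_or,
    or_false, List.nodup_nil, not_false_eq_true, and_true] at hn hd
  have h1 := h0.merge [xe s c y z] [xe (!s) d y' x] [xe (!s) d y x]
    ([(x, z), (z, z')] ++ netP C) y y' y'' (hd _ (by simp)) (hd _ (by simp)) rfl
    (by grind) (by grind [mem_labels_xe]) (by grind [mem_labels_xe]) (by grind [map_xe, sub])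
  exact h1.trans (h1.valid_right.perm_pairs (by grind))

theorem Good.xv_swap {C : List Vert} {s : Bool} {c d : Crossing} {x z z' y y' y'' : ℕ}
    (h : Good ([xv s c y y' z z', xv (!s) d y' y'' x z] ++ C)) :
    Good ([.wire x z, .wire z z', .wire y y''] ++ C) := by
  have h1 := h.thread.valid_right
  exact ⟨h1.nodup, h1.perm⟩

/-- The two crossings are those of an under-threaded move. Once they are gone nothing prevents the
merging of the strand. -/
theorem Good.thread_out {C : List Vert} {s : Bool} {x z z' y y' y'' : ℕ}
    (h : Good ([xv s (realCross (!s)) y y' z z', xv (!s) (realCross s) y' y'' x z] ++ C)) :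
    VEq ([xv s (realCross (!s)) y y' z z', xv (!s) (realCross s) y' y'' x z] ++ C)
      ([.wire x z', .wire y y''] ++ C) := by
  have h1 := h.thread
  have hd : ∀ e ∈ netE C, x ∉ e.labels := by
    refine h.disjoint ?_
    refine (ins_xv_cons _ _ _ _ _ _ _).symm.subset ?_
    simp only [List.mem_cons]
    exact .inr (.inr ((ins_xv_cons _ _ _ _ _ _ _).symm.subset (by simp)))
  have h2 : Valid ([] ++ netE C) ((x, z) :: (z, z') :: (y, y'') :: netP C) := h.xv_swap.valid
  have hy : y ∈ ((y, y'') :: netP C).map Prod.fst := by simp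
  refine h1.trans ?_
  have h3 := h2.merge (by simp) hd
  have h4 : (netE C).map (Ev.map (sub z x)) = netE C := map_sub_eq_self
    (h.xv_swap.disjoint (by simp [ins, netP, Vert.pairs]))
  rw [h4] at h3
  cases s with
  | true => exact (h2.insert_right (by simp) hd hy).trans h3
  | false => exact (h2.insert_left (by simp) hd hy).trans h3

/-- An antiparallel bigon is symmetric in strand and thread. The under-threaded move covers the sign
for which the strand lies below the thread; for the other sign their roles are exchanged by
reordering the vertices. -/
theorem Good.opp_first {C : List Vert} {c : Crossing} (hc : c.IsReal) {x z z' y y' y'' : ℕ}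
    (h : Good ([.cross c y y' z z', .cross c.turn x z y' y''] ++ C)) :
    VEq ([.cross c y y' z z', .cross c.turn x z y' y''] ++ C)
      ([.wire y y'', .wire x z'] ++ C) := by
  rcases hc with rfl | rfl
  · exact (Good.thread_out (s := true) h).of_perm (.refl _) (.swap _ _ _)
  · have h1 := h.of_perm (List.Perm.swap _ _ _)
    exact (Good.thread_out (s := true) h1).of_perm (.swap _ _ _) (.refl _)

theorem Good.opp_last {C : List Vert} {c : Crossing} (hc : c.IsReal) {x z z' y y' y'' : ℕ}
    (h : Good ([.cross c z z' y y', .cross c.turn y' y'' x z] ++ C)) :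
    VEq ([.cross c z z' y y', .cross c.turn y' y'' x z] ++ C)
      ([.wire x z', .wire y y''] ++ C) := by
  rcases hc with rfl | rfl
  · have h1 := h.of_perm (List.Perm.swap _ _ _)
    exact (Good.thread_out (s := false) h1).of_perm (.swap _ _ _) (.swap _ _ _)
  · exact Good.thread_out (s := false) h

theorem Good.rs_right {C : List Vert} {c : Crossing} (hc : c.IsReal) {x z z' y y' y'' : ℕ}
    (h : Good ([.cross .singular y y' z z', .cross c x z y' y''] ++ C)) :
    VEq ([.cross .singular y y' z z', .cross c x z y' y''] ++ C)
      ([.cross c y y' z z', .cross .singular x z y' y''] ++ C) := by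
  obtain ⟨e, rfl⟩ : ∃ e, c = realCross e := by
    rcases hc with rfl | rfl
    exacts [⟨false, rfl⟩, ⟨true, rfl⟩]
  have h' : Good ([.cross (realCross e) y y' z z', .cross .singular x z y' y''] ++ C) :=
    h.congr (.refl _) (.refl _)
  have h1 := Good.thread (s := true) h
  have h2 : Valid ([] ++ netE C) ((x, z) :: (z, z') :: (y, y'') :: netP C) :=
    (Good.xv_swap (s := true) h).valid
  exact h1.trans ((h2.rs_right e (by simp) (h.disjoint (by simp [ins, netP, Vert.pairs]))
    (by simp)).trans (Good.thread (s := true) h').symm)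

theorem Good.rs_left {C : List Vert} {c : Crossing} (hc : c.IsReal) {x z z' y y' y'' : ℕ}
    (h : Good ([.cross .singular z z' y y', .cross c y' y'' x z] ++ C)) :
    VEq ([.cross .singular z z' y y', .cross c y' y'' x z] ++ C)
      ([.cross c z z' y y', .cross .singular y' y'' x z] ++ C) := by
  obtain ⟨e, rfl⟩ : ∃ e, c = realCross e := by
    rcases hc with rfl | rfl
    exacts [⟨false, rfl⟩, ⟨true, rfl⟩]
  have h' : Good ([.cross (realCross e) z z' y y', .cross .singular y' y'' x z] ++ C) :=
    h.congr (.refl _) (.refl _)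
  have h1 := Good.thread (s := false) h
  have h2 : Valid ([] ++ netE C) ((x, z) :: (z, z') :: (y, y'') :: netP C) :=
    (Good.xv_swap (s := false) h).valid
  exact h1.trans ((h2.rs_left e (by simp) (h.disjoint (by simp [ins, netP, Vert.pairs]))
    (by simp)).trans (Good.thread (s := false) h').symm)

end SingTwist

namespace SingTwist

/-! ### Kinks -/

theorem Valid.subset {E E' : List (Ev ℕ)} {P : List (ℕ × ℕ)} (h : Valid E P) (hE : E' ⊆ E) :
    Valid E' P :=
  ⟨h.nodup, h.perm, fun e he => h.ok e (hE he), fun e he => h.mem e (hE he)⟩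

theorem exists_fresh (L : List ℕ) : ∃ w, w ∉ L := by
  obtain ⟨w, hw⟩ := Infinite.exists_notMem_finset L.toFinset
  exact ⟨w, by simpa using hw⟩

/-- This is the real move of type 1 on the strand cut at the kink, followed by contraction. -/
theorem Good.kink_right {C : List Vert} {c : Crossing} (hc : c.IsReal) {x m y : ℕ}
    (h : Good ([.cross c x m m y] ++ C)) :
    VEq ([.cross c x m m y] ++ C) ([.wire x y] ++ C) := by
  obtain ⟨e, rfl⟩ : ∃ e, c = realCross e := by
    rcases hc with rfl | rfl
    exacts [⟨false, rfl⟩, ⟨true, rfl⟩]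
  have hx : ∀ e ∈ netE C, x ∉ e.labels := h.disjoint (by simp [ins, netP, Vert.pairs])
  have hm : ∀ e ∈ netE C, m ∉ e.labels := h.disjoint (by simp [ins, netP, Vert.pairs])
  have h1 : Valid ([] ++ netE C) ((x, m) :: (m, y) :: netP C) :=
    Valid.subset (E := netE ([.cross (realCross e) x m m y] ++ C)) h.valid
      (List.subset_cons_self _ _)
  have h2 := h1.merge (by simp) hx
  rw [map_sub_eq_self hm] at h2
  exact (h1.insert_kink e (by simp) hx).trans h2

/-- The real moves of type 1 give kinks on one side only. A fresh strand `w` between `x` and `m`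
makes room for an under-threaded pair of crossings, one of which is a right kink. Removing that kink
leaves the left one. -/
theorem Good.kink_left {C : List Vert} {c : Crossing} (hc : c.IsReal) {x m y : ℕ}
    (h : Good ([.cross c m y x m] ++ C)) :
    VEq ([.cross c m y x m] ++ C) ([.wire x y] ++ C) := by
  obtain ⟨w, hw⟩ := exists_fresh (m :: x :: ins C)
  have hx : ∀ e ∈ netE C, x ∉ e.labels := h.disjoint (by simp [ins, netP, Vert.pairs])
  have hm : ∀ e ∈ netE C, m ∉ e.labels := h.disjoint (by simp [ins, netP, Vert.pairs])
  have n1 : (m :: x :: ins C).Nodup := h.nodup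
  have hmx : m ≠ x := by simp at n1; grind
  have hwx : w ≠ x := by simp at hw; grind
  have hwm : w ≠ m := by simp at hw; grind
  have hw' : ∀ e ∈ netE C, w ∉ e.labels := fun e he hwe =>
    hw (List.mem_cons_of_mem _ (List.mem_cons_of_mem _ (mem_ins_of_netE he hwe)))
  have hv : Valid (netE C) ((w, m) :: (m, y) :: (x, w) :: netP C) := by
    have g : Good ([.wire w m, .wire m y, .wire x w] ++ C) := by
      refine ⟨?_, ?_⟩
      · exact List.nodup_cons.2 ⟨hw, n1⟩
      · have p1 : (m :: x :: ins C).Perm (y :: m :: outs C) := h.perm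
        have p2 : (w :: m :: x :: ins C).Perm (m :: y :: w :: outs C) :=
          (p1.cons w).trans (by grind)
        exact p2
    exact g.valid
  have hv' : Valid (netE C) ((x, w) :: (w, m) :: (m, y) :: netP C) := hv.of_perm (by grind)
  -- the net without crossings
  have k1 : NetEq (netE C) ((x, w) :: (w, m) :: (m, y) :: netP C) (netE C)
      ((x, y) :: netP C) := by
    have h1 := Valid.merge (E₁ := []) (E₂ := netE C) hv' (by simp) hx
    rw [map_sub_eq_self hw'] at h1
    have h2 := Valid.merge (E₁ := []) (E₂ := netE C) h1.valid_right (by simp) hx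
    rw [map_sub_eq_self hm] at h2
    exact h1.trans h2
  have p12 : ((w, m) :: (m, y) :: (x, w) :: netP C).Perm ((x, w) :: (w, m) :: (m, y) :: netP C) := by
    grind
  have p13 : ((x, w) :: (m, y) :: (w, m) :: netP C).Perm ((x, w) :: (w, m) :: (m, y) :: netP C) := by
    grind
  -- the net with one crossing
  have k2 : ∀ c, Valid ([.cross c m x] ++ netE C) ((x, w) :: (w, m) :: (m, y) :: netP C) →
      NetEq ([.cross c m x] ++ netE C) ((x, w) :: (w, m) :: (m, y) :: netP C)
      (netE ([.cross c m y x m] ++ C)) (netP ([.cross c m y x m] ++ C)) := by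
    intro c hc
    have h1 := hc.merge (by simp [Ev.labels, hwx, hwm]) hx
    rw [map_sub_eq_self hw'] at h1
    exact h1.trans (h1.valid_right.perm_pairs (.swap _ _ _))
  rcases hc with rfl | rfl
  -- The thread is `m`, and the right kink to be removed is the crossing of `w` and `m`. For the
  -- other sign the thread is `x`, and the kink is the crossing of `x` and `w`.
  · have j1 := Valid.insert_left (E₁ := []) (E₂ := netE C) (y := m) hv' (by simp) hx (by simp)
    have j2 := Valid.insert_kink (E₁ := []) (E₂ := [.cross .leftOver m x] ++ netE C)
      (P := (x, w) :: netP C) (a := w) (z := m) (c := y) true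
      ((j1.valid_left.subset (List.subset_cons_self _ _)).of_perm p12.symm) (by simp) (by
        intro e he
        rcases List.mem_append.1 he with he | he
        · simp only [List.mem_singleton] at he
          subst he
          simp [Ev.labels, hwx, hwm]
        · exact hw' e he)
    have j3 := (j2.valid_left.perm_pairs p12).symm.trans (j2.trans (j2.valid_right.perm_pairs p12))
    exact ((k2 _ j3.valid_right).symm.trans j3.symm).trans (j1.trans k1)
  · have j1 := Valid.insert_left (E₁ := []) (E₂ := netE C) (y := x) hv (by simp) hw' (by simp)
    have j2 := (j1.valid_left.perm_pairs p12).symm.trans (j1.trans (j1.valid_right.perm_pairs p12))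
    have j3 := Valid.insert_kink (E₁ := [.cross .rightOver m x]) (E₂ := netE C)
      (P := (m, y) :: netP C) (a := x) (z := w) (c := m) false
      (j2.valid_left.subset (List.cons_subset_cons _ (List.subset_cons_self _ _))) (by simp [Ev.labels, hwx, hwm]) hx
    exact ((k2 _ j3.valid_right).symm.trans j3.symm).trans (j2.trans k1)

/-! ### Three strands which cross each other cyclically -/

/-- Each crossing should precede the next one in cyclic order, so no product in the braid monoid
represents this triangle. An antiparallel bigon between `x` and `y` is created. One of its crossings
forms a compatible triangle with the two crossings of `z`, and this triangle is slid. Then the old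
crossing of `x` and `y` bounds another antiparallel bigon, which is removed. -/
theorem Good.cyclic {C : List Vert} {c d : Crossing} (hc : c.IsReal) (hd : d ≠ .virtual)
    {x x1 x2 y y1 y2 z z1 z2 : ℕ}
    (h : Good ([.cross c.turn y1 y2 x x1, .cross c x1 x2 z z1, .cross d z1 z2 y y1] ++ C)) :
    VEq ([.cross c.turn y1 y2 x x1, .cross c x1 x2 z z1, .cross d z1 z2 y y1] ++ C)
      ([.cross c x x1 z1 z2, .cross c.turn y y1 x1 x2, .cross d z z1 y1 y2] ++ C) := by
  obtain ⟨u, hu⟩ := exists_fresh (y1 :: x :: x1 :: z :: z1 :: y :: ins C)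
  obtain ⟨u1, hu1⟩ := exists_fresh (u :: y1 :: x :: x1 :: z :: z1 :: y :: ins C)
  obtain ⟨v, hv⟩ := exists_fresh (u1 :: u :: y1 :: x :: x1 :: z :: z1 :: y :: ins C)
  obtain ⟨v1, hv1⟩ := exists_fresh (v :: u1 :: u :: y1 :: x :: x1 :: z :: z1 :: y :: ins C)
  have n0 : (y1 :: x :: x1 :: z :: z1 :: y :: ins C).Nodup := h.nodup
  have p0 : (y1 :: x :: x1 :: z :: z1 :: y :: ins C).Perm
    (y2 :: x1 :: x2 :: z1 :: z2 :: y1 :: outs C) := h.perm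
  have n1 : (v1 :: v :: u1 :: u :: y1 :: x :: x1 :: z :: z1 :: y :: ins C).Nodup :=
    List.nodup_cons.2 ⟨hv1, List.nodup_cons.2 ⟨hv, List.nodup_cons.2 ⟨hu1,
      List.nodup_cons.2 ⟨hu, n0⟩⟩⟩⟩
  have p1 : (v1 :: v :: u1 :: u :: y1 :: x :: x1 :: z :: z1 :: y :: ins C).Perm
    (v1 :: v :: u1 :: u :: y2 :: x1 :: x2 :: z1 :: z2 :: y1 :: outs C) :=
    (((p0.cons _).cons _).cons _).cons _
  have o1 : (v1 :: v :: u1 :: u :: y2 :: x1 :: x2 :: z1 :: z2 :: y1 :: outs C).Nodup :=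
    p1.nodup_iff.1 n1
  simp only [List.nodup_cons, List.mem_cons, not_or] at n1 o1
  -- the diagram with two more crossings
  have g : Good ([.cross c u u1 v1 v, .cross c.turn y v1 u1 x2] ++ ([.cross c.turn y1 y2 x x1,
      .cross c x1 u z z1, .cross d z1 z2 v y1] ++ C)) := by
    refine ⟨?_, ?_⟩
    · refine List.Perm.nodup (l := v1 :: v :: u1 :: u :: y1 :: x :: x1 :: z :: z1 :: y :: ins C)
        ?_ (by simpa only [List.nodup_cons, List.mem_cons, not_or] using n1)
      show List.Perm _ (u :: v1 :: y :: u1 :: y1 :: x :: x1 :: z :: z1 :: v :: ins C)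
      rw [← Multiset.coe_eq_coe]
      simp only [← Multiset.cons_coe, ← Multiset.singleton_add]
      abel
    · show List.Perm (u :: v1 :: y :: u1 :: y1 :: x :: x1 :: z :: z1 :: v :: ins C)
        (u1 :: v :: v1 :: x2 :: y2 :: x1 :: u :: z1 :: z2 :: y1 :: outs C)
      refine List.Perm.trans ?_ (p1.trans ?_) <;> rw [← Multiset.coe_eq_coe] <;>
        simp only [← Multiset.cons_coe, ← Multiset.singleton_add] <;> abel
  have e1 := g.opp_first hc
  have e2 := Good.contract' (F := [.wire y v, .cross c.turn y1 y2 x x1,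
      .cross c x1 u z z1, .cross d z1 z2 v y1]) (C := C) (a := u) (b := x2)
      e1.good_right (by simp [outs, netP, Vert.pairs])
  have q2 : [.wire y v, .cross c.turn y1 y2 x x1, .cross c x1 u z z1, .cross d z1 z2 v y1].map
      (Vert.map (sub u x2)) = [.wire y v, .cross c.turn y1 y2 x x1, .cross c x1 x2 z z1,
      .cross d z1 z2 v y1] := by
    simp only [List.map_cons, List.map_nil, Vert.map, sub]; grind
  rw [q2] at e2
  have e3 := Good.contract (F := [.cross c.turn y1 y2 x x1,
      .cross c x1 x2 z z1, .cross d z1 z2 v y1]) (C := C) (a := y) (b := v)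
      e2.good_right (by simp [ins, netP, Vert.pairs])
  have q3 : [.cross c.turn y1 y2 x x1, .cross c x1 x2 z z1, .cross d z1 z2 v y1].map
      (Vert.map (sub v y)) = [.cross c.turn y1 y2 x x1, .cross c x1 x2 z z1,
      .cross d z1 z2 y y1] := by
    simp only [List.map_cons, List.map_nil, Vert.map, sub]; grind
  rw [q3] at e3
  have p4 : List.Perm (α := Vert) ([.cross c u u1 v1 v, .cross c.turn y v1 u1 x2] ++ ([.cross c.turn y1 y2 x x1,
      .cross c x1 u z z1, .cross d z1 z2 v y1] ++ C)) ([.cross c x1 u z z1,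
      .cross c u u1 v1 v, .cross d z1 z2 v y1] ++ ([.cross c.turn y1 y2 x x1,
      .cross c.turn y v1 u1 x2] ++ C)) := by
    rw [← Multiset.coe_eq_coe]
    simp only [List.cons_append, List.nil_append, ← Multiset.cons_coe, ← Multiset.singleton_add]
    abel
  have e4 := (g.perm_eq p4).trans ((g.of_perm p4).slide hc hd)
  have p5 : List.Perm (α := Vert) ([.cross d z z1 v1 v, .cross c x1 u v y1, .cross c u u1 z1 z2] ++
      ([.cross c.turn y1 y2 x x1, .cross c.turn y v1 u1 x2] ++ C))
      ([.cross c x1 u v y1, .cross c.turn y1 y2 x x1] ++ ([.cross c u u1 z1 z2,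
      .cross c.turn y v1 u1 x2, .cross d z z1 v1 v] ++ C)) := by
    rw [← Multiset.coe_eq_coe]
    simp only [List.cons_append, List.nil_append, ← Multiset.cons_coe, ← Multiset.singleton_add]
    abel
  have e5 := (e4.good_right.perm_eq p5).trans ((e4.good_right.of_perm p5).opp_last hc)
  have e6 := Good.contract (F := [.wire v y2, .cross c u u1 z1 z2, .cross c.turn y v1 u1 x2,
      .cross d z z1 v1 v]) (C := C) (a := x) (b := u)
      e5.good_right (by simp [ins, netP, Vert.pairs])
  have q6 : [.wire v y2, .cross c u u1 z1 z2, .cross c.turn y v1 u1 x2, .cross d z z1 v1 v].map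
      (Vert.map (sub u x)) = [.wire v y2, .cross c x u1 z1 z2, .cross c.turn y v1 u1 x2,
      .cross d z z1 v1 v] := by
    simp only [List.map_cons, List.map_nil, Vert.map, sub]; grind
  rw [q6] at e6
  have e7 := Good.contract' (F := [.cross c x u1 z1 z2, .cross c.turn y v1 u1 x2,
      .cross d z z1 v1 v]) (C := C) (a := v) (b := y2)
      e6.good_right (by simp [outs, netP, Vert.pairs])
  have q7 : [.cross c x u1 z1 z2, .cross c.turn y v1 u1 x2, .cross d z z1 v1 v].map
      (Vert.map (sub v y2)) = [.cross c x u1 z1 z2, .cross c.turn y v1 u1 x2,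
      .cross d z z1 v1 y2] := by
    simp only [List.map_cons, List.map_nil, Vert.map, sub]; grind
  rw [q7] at e7
  -- renaming
  have e8 := e7.good_right.rename (f := (Equiv.swap u1 x1 * Equiv.swap v1 y1 : Equiv.Perm ℕ))
    (Equiv.injective _).injOn
  rw [List.map_append, map_vert_eq_self (V := C)] at e8
  rotate_left
  · intro a ha
    simp only [Equiv.Perm.coe_mul, Function.comp, Equiv.swap_apply_def]
    grind
  · intro a ha
    simp only [Equiv.Perm.coe_mul, Function.comp, Equiv.swap_apply_def]
    grind
  have q8 : [.cross c x u1 z1 z2, .cross c.turn y v1 u1 x2, .cross d z z1 v1 y2].map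
      (Vert.map (Equiv.swap u1 x1 * Equiv.swap v1 y1 : Equiv.Perm ℕ)) = [.cross c x x1 z1 z2,
      .cross c.turn y y1 x1 x2, .cross d z z1 y1 y2] := by
    simp only [List.map_cons, List.map_nil, Vert.map, Equiv.Perm.coe_mul, Function.comp,
      Equiv.swap_apply_def]
    grind
  rw [q8] at e8
  exact ((e1.trans e2).trans e3).symm.trans (((e4.trans e5).trans (e6.trans e7)).trans e8)

end SingTwist

namespace SingTwist

/-! ### The Gauss diagram of a diagram -/

/-- The vertex of a real or singular crossing, the strand `x`, `x'` coming from the upper left and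
the strand `y`, `y'` from the upper right, with the orientations `o` and `p`. -/
def crossVert (c : Crossing) (o p : Bool) (x x' y y' : ℕ) : Vert :=
  match o, p with
  | true, true => .cross c x x' y y'
  | false, false => .cross c x' x y' y
  -- For opposite directions a quarter turn makes both strands run down. It puts the left branch on
  -- the right, so it exchanges the two real decorations; the half turn in the preceding case does
  -- not.
  | true, false => .cross c.turn y' y x x'
  | false, true => .cross c.turn y y' x' x

/-- A strand with orientation `o` which leads from `a` to `b`. -/
def wireVert (o : Bool) (a b : ℕ) : Vert := if o then .wire a b else .wire b a

/-- A bar on a strand with orientation `o`. -/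
def barVert (o : Bool) (a b : ℕ) : Vert := if o then .bar a b else .bar b a

/-- The vertices of a layer, together with the strands above and below. -/
inductive Piece : Layer → List (Bool × ℕ) → List Vert → List ℕ → List (Bool × ℕ) → Prop
  | birth (i : ℕ) (o : Bool) (a b : ℕ) :
      Piece (.birth i o) [] [wireVert (!o) a b] [a, b] [(o, a), (!o, b)]
  | death (i : ℕ) (o : Bool) (a b : ℕ) :
      Piece (.death i) [(o, a), (!o, b)] [wireVert o a b] [] []
  | virt (i : ℕ) (o p : Bool) (x y : ℕ) :
      Piece (.cross i .virtual) [(o, x), (p, y)] [] [] [(p, y), (o, x)]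
  | cross (i : ℕ) (c : Crossing) (hc : c ≠ .virtual) (o p : Bool) (x x' y y' : ℕ) :
      Piece (.cross i c) [(o, x), (p, y)] [crossVert c o p x x' y y'] [x', y'] [(p, y'), (o, x')]
  | bar (i : ℕ) (o : Bool) (a b : ℕ) : Piece (.bar i) [(o, a)] [barVert o a b] [b] [(o, b)]

/-- The vertices of a layer, together with all strands above and below. -/
def LRun (e : Layer) (s : List (Bool × ℕ)) (V : List Vert) (N : List ℕ) (t : List (Bool × ℕ)) :
    Prop :=
  ∃ l u v r, l.length = e.pos ∧ s = l ++ (u ++ r) ∧ t = l ++ (v ++ r) ∧ Piece e u V N v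

/-- The vertices `V` of a part of a diagram, together with the strands above and below; the strands
in `N` begin or end in this part. -/
inductive Run : List Layer → List (Bool × ℕ) → List Vert → List ℕ → List (Bool × ℕ) → Prop
  | nil (s : List (Bool × ℕ)) : Run [] s [] [] s
  | cons {e : Layer} {w : List Layer} {s t u : List (Bool × ℕ)} {V V' : List Vert} {N N' : List ℕ} :
      LRun e s V N t → Run w t V' N' u → Run (e :: w) s (V ++ V') (N ++ N') u

/-- Renaming of the strands. -/
def smap (f : ℕ → ℕ) (s : List (Bool × ℕ)) : List (Bool × ℕ) := s.map (Prod.map id f)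

/-- The strands. -/
def labels (s : List (Bool × ℕ)) : List ℕ := s.map Prod.snd

section

variable {e : Layer} {v w : List Layer} {s t u : List (Bool × ℕ)} {V V' : List Vert} {N N' : List ℕ}

theorem smap_append (f : ℕ → ℕ) (s t : List (Bool × ℕ)) : smap f (s ++ t) = smap f s ++ smap f t :=
  List.map_append

theorem labels_append (s t : List (Bool × ℕ)) : labels (s ++ t) = labels s ++ labels t :=
  List.map_append

theorem smap_congr {f g : ℕ → ℕ} (h : ∀ a ∈ labels s, f a = g a) : smap f s = smap g s :=
  List.map_congr_left fun _ hp => Prod.ext rfl (h _ (List.mem_map_of_mem hp))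

theorem smap_id (s : List (Bool × ℕ)) : smap id s = s := by simp [smap]

theorem LRun.run (h : LRun e s V N t) : Run [e] s V N t := by
  have := Run.cons h (.nil t)
  rwa [List.append_nil, List.append_nil] at this

theorem Run.append (h : Run v s V N t) (h' : Run w t V' N' u) :
    Run (v ++ w) s (V ++ V') (N ++ N') u := by
  induction h with
  | nil => exact h'
  | cons e _ ih =>
    rw [List.append_assoc, List.append_assoc]
    exact .cons e (ih h')

theorem Run.of_append (h : Run (v ++ w) s V N u) : ∃ V₁ N₁ t V₂ N₂, V = V₁ ++ V₂ ∧ N = N₁ ++ N₂ ∧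
    Run v s V₁ N₁ t ∧ Run w t V₂ N₂ u := by
  induction v generalizing s V N with
  | nil => exact ⟨[], [], s, V, N, rfl, rfl, .nil s, h⟩
  | cons e v ih =>
    cases h with
    | cons h1 h2 =>
      obtain ⟨V₁, N₁, t, V₂, N₂, rfl, rfl, h3, h4⟩ := ih h2
      exact ⟨_, _, t, V₂, N₂, (List.append_assoc _ _ _).symm, (List.append_assoc _ _ _).symm,
        .cons h1 h3, h4⟩

theorem crossVert_map (f : ℕ → ℕ) (c : Crossing) (o p : Bool) (x x' y y' : ℕ) :
    (crossVert c o p x x' y y').map f = crossVert c o p (f x) (f x') (f y) (f y') := by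
  cases o <;> cases p <;> rfl

theorem wireVert_map (f : ℕ → ℕ) (o : Bool) (a b : ℕ) :
    (wireVert o a b).map f = wireVert o (f a) (f b) := by
  cases o <;> rfl

theorem barVert_map (f : ℕ → ℕ) (o : Bool) (a b : ℕ) :
    (barVert o a b).map f = barVert o (f a) (f b) := by
  cases o <;> rfl

theorem Piece.map (f : ℕ → ℕ) (h : Piece e s V N t) :
    Piece e (smap f s) (V.map (Vert.map f)) (N.map f) (smap f t) := by
  cases h with
  | birth i o a b => simpa [wireVert_map, smap] using Piece.birth i o (f a) (f b)
  | death i o a b => simpa [wireVert_map, smap] using Piece.death i o (f a) (f b)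
  | virt i o p x y => simpa [smap] using Piece.virt i o p (f x) (f y)
  | cross i c hc o p x x' y y' =>
    simpa [crossVert_map, smap] using Piece.cross i c hc o p (f x) (f x') (f y) (f y')
  | bar i o a b => simpa [barVert_map, smap] using Piece.bar i o (f a) (f b)

theorem LRun.map (f : ℕ → ℕ) (h : LRun e s V N t) :
    LRun e (smap f s) (V.map (Vert.map f)) (N.map f) (smap f t) := by
  obtain ⟨l, u, v, r, h1, rfl, rfl, h2⟩ := h
  refine ⟨smap f l, smap f u, smap f v, smap f r, by simpa [smap] using h1, ?_, ?_, h2.map f⟩ <;>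
    simp only [smap_append]

theorem Run.map (f : ℕ → ℕ) (h : Run w s V N t) :
    Run w (smap f s) (V.map (Vert.map f)) (N.map f) (smap f t) := by
  induction h with
  | nil s => exact .nil _
  | cons e _ ih =>
    rw [List.map_append, List.map_append]
    exact .cons (e.map f) ih

theorem Piece.length (h : Piece e s V N t) : s.length = e.top := by
  cases h <;> rfl

/-! ### Uniqueness -/

/-- A layer determines its vertices up to the names of the strands in `N`. These are distinct from
each other and from the strands above, so a renaming of the latter extends to them. -/
theorem Piece.unique {s' t' : List (Bool × ℕ)} {f : ℕ → ℕ} (h : Piece e s V N t)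
    (h' : Piece e s' V' N' t') (hs : s' = smap f s) (hn : (labels s ++ N).Nodup) :
    ∃ g : ℕ → ℕ, (∀ a ∉ N, g a = f a) ∧ V' = V.map (Vert.map g) ∧ N' = N.map g ∧
      t' = smap g t := by
  cases h with
  | birth i o a b =>
    cases h' with
    | birth _ _ a' b' =>
      have hab : a ≠ b := by simpa [labels] using hn
      refine ⟨Function.update (Function.update f a a') b b', ?_, ?_, ?_, ?_⟩
      · intro x hx
        simp only [List.mem_cons, List.not_mem_nil, or_false, not_or] at hx
        simp [Function.update_of_ne hx.1, Function.update_of_ne hx.2]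
      all_goals simp [wireVert_map, smap, Function.update_of_ne hab]
  | death i o a b =>
    cases h' with
    | death _ o' a' b' =>
      simp only [smap, List.map_cons, List.map_nil, Prod.map_apply, id, List.cons.injEq,
        Prod.mk.injEq, and_true] at hs
      obtain ⟨⟨rfl, rfl⟩, -, rfl⟩ := hs
      exact ⟨f, fun _ _ => rfl, by simp [wireVert_map], rfl, rfl⟩
  | virt i o p x y =>
    cases h' with
    | virt _ o' p' x' y' =>
      simp only [smap, List.map_cons, List.map_nil, Prod.map_apply, id, List.cons.injEq,
        Prod.mk.injEq, and_true] at hs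
      obtain ⟨⟨rfl, rfl⟩, rfl, rfl⟩ := hs
      exact ⟨f, fun _ _ => rfl, rfl, rfl, rfl⟩
    | cross _ _ hc => exact absurd rfl hc
  | cross i c hc o p x x' y y' =>
    cases h' with
    | virt => exact absurd rfl hc
    | cross _ _ _ o₂ p₂ x₂ x₂' y₂ y₂' =>
      simp only [smap, List.map_cons, List.map_nil, Prod.map_apply, id, List.cons.injEq,
        Prod.mk.injEq, and_true] at hs
      obtain ⟨⟨rfl, rfl⟩, rfl, rfl⟩ := hs
      simp only [labels, List.map_cons, List.map_nil, List.cons_append, List.nil_append,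
        List.nodup_cons, List.mem_cons, List.not_mem_nil, or_false, not_or] at hn
      obtain ⟨⟨h1, h2, h3⟩, ⟨h4, h5⟩, h6, -⟩ := hn
      refine ⟨Function.update (Function.update f x' x₂') y' y₂', ?_, ?_, ?_, ?_⟩
      · intro a hx
        simp only [List.mem_cons, List.not_mem_nil, or_false, not_or] at hx
        simp [Function.update_of_ne hx.1, Function.update_of_ne hx.2]
      all_goals simp [crossVert_map, smap, Function.update_of_ne, *]
  | bar i o a b =>
    cases h' with
    | bar _ o' a' b' =>
      simp only [smap, List.map_cons, List.map_nil, Prod.map_apply, id, List.cons.injEq,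
        Prod.mk.injEq, and_true] at hs
      obtain ⟨rfl, rfl⟩ := hs
      have hab : a ≠ b := by simpa [labels] using hn
      refine ⟨Function.update f b b', ?_, ?_, ?_, ?_⟩
      · intro x hx
        simp only [List.mem_singleton] at hx
        simp [Function.update_of_ne hx]
      all_goals simp [barVert_map, smap, Function.update_of_ne hab]

theorem LRun.unique {t' : List (Bool × ℕ)} {f : ℕ → ℕ} (h : LRun e s V N t)
    (h' : LRun e (smap f s) V' N' t') (hn : (labels s ++ N).Nodup) :
    ∃ g : ℕ → ℕ, (∀ a ∉ N, g a = f a) ∧ V' = V.map (Vert.map g) ∧ N' = N.map g ∧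
      t' = smap g t := by
  obtain ⟨l, u, v, r, h1, rfl, rfl, h2⟩ := h
  obtain ⟨l', u', v', r', h1', h3, rfl, h2'⟩ := h'
  rw [smap_append, smap_append] at h3
  obtain ⟨h4, h5⟩ := List.append_inj h3 (by rw [h1', ← h1]; simp [smap])
  obtain ⟨h6, h7⟩ := List.append_inj h5 (by rw [h2'.length, ← h2.length]; simp [smap])
  simp only [labels_append, List.append_assoc] at hn
  have hn1 : (labels u ++ N).Nodup := hn.sublist
    ((List.Sublist.append_left (List.sublist_append_right _ _) _).trans
      (List.sublist_append_right _ _))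
  obtain ⟨g, g1, g2, g3, g4⟩ := h2.unique h2' h6.symm hn1
  refine ⟨g, g1, g2, g3, ?_⟩
  have hl : ∀ a ∈ labels l, a ∉ N := fun a ha ha' => by
    refine (List.disjoint_of_nodup_append hn) ha ?_
    simp [ha']
  have hr : ∀ a ∈ labels r, a ∉ N := fun a ha ha' => by
    have := (hn.of_append_right).of_append_right
    exact (List.disjoint_of_nodup_append this) ha ha'
  rw [smap_append, smap_append, g4, ← h4, ← h7, smap_congr fun a ha => (g1 a (hl a ha)).symm,
    smap_congr fun a ha => (g1 a (hr a ha)).symm]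

/-- As a bound of multisets, this passes the distinctness of all labels on from one level to the
next. -/
theorem Piece.labels_le (h : Piece e s V N t) :
    (labels t : Multiset ℕ) ≤ (labels s : Multiset ℕ) + (N : Multiset ℕ) := by
  rw [Multiset.coe_add, Multiset.coe_le]
  cases h with
  | birth i o a b => exact .refl _
  | death i o a b => exact List.nil_subperm
  | virt i o p x y => exact (List.Perm.swap _ _ _).subperm
  | cross i c hc o p x x' y y' =>
    exact (List.Perm.swap _ _ _).subperm.trans (List.sublist_append_right [x, y] [x', y']).subperm
  | bar i o a b => exact (List.sublist_append_right [a] [b]).subperm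

theorem LRun.labels_le (h : LRun e s V N t) :
    (labels t : Multiset ℕ) ≤ (labels s : Multiset ℕ) + (N : Multiset ℕ) := by
  obtain ⟨l, u, v, r, h1, rfl, rfl, h2⟩ := h
  have h3 := h2.labels_le
  simp only [labels_append, ← Multiset.coe_add]
  calc (labels l : Multiset ℕ) + ((labels v : Multiset ℕ) + (labels r : Multiset ℕ))
      ≤ (labels l : Multiset ℕ) + (((labels u : Multiset ℕ) + (N : Multiset ℕ)) +
        (labels r : Multiset ℕ)) := by gcongr
    _ = _ := by abel

theorem Run.labels_le (h : Run w s V N t) :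
    (labels t : Multiset ℕ) ≤ (labels s : Multiset ℕ) + (N : Multiset ℕ) := by
  induction h with
  | nil s => simp
  | cons h1 _ ih =>
    rw [← Multiset.coe_add, ← add_assoc]
    exact ih.trans (by gcongr; exact h1.labels_le)

theorem LRun.nodup_append (h : LRun e s V N t) (hn : (labels s ++ (N ++ N')).Nodup) :
    (labels t ++ N').Nodup := by
  rw [← Multiset.coe_nodup, ← Multiset.coe_add] at hn ⊢
  refine Multiset.nodup_of_le ?_ hn
  rw [← Multiset.coe_add, ← add_assoc]
  gcongr
  exact h.labels_le

/-- The strands which run down. -/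
def downs (s : List (Bool × ℕ)) : List ℕ := (s.filter fun p => p.1).map Prod.snd

/-- The strands which run up. -/
def ups (s : List (Bool × ℕ)) : List ℕ := (s.filter fun p => !p.1).map Prod.snd

theorem downs_append (s t : List (Bool × ℕ)) : downs (s ++ t) = downs s ++ downs t := by
  simp [downs]

theorem ups_append (s t : List (Bool × ℕ)) : ups (s ++ t) = ups s ++ ups t := by
  simp [ups]

theorem downs_add_ups (s : List (Bool × ℕ)) :
    (downs s : Multiset ℕ) + (ups s : Multiset ℕ) = labels s := by
  induction s with
  | nil => rfl
  | cons p s ih =>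
    obtain ⟨o, a⟩ := p
    have h1 : ((labels ((o, a) :: s) : List ℕ) : Multiset ℕ) = a ::ₘ (labels s : Multiset ℕ) := rfl
    rw [h1, ← ih]
    cases o <;> simp [downs, ups, ← Multiset.cons_coe]

/-- Every strand that occurs ends at a vertex, or leaves through the lower boundary running down, or
through the upper one running up; its beginning is counted in the same way. In a closed diagram the
boundary terms vanish, so the strands which end and those which begin are both given by `N`. -/
theorem Piece.count (h : Piece e s V N t) :
    ((ins V : Multiset ℕ) + (downs t + ups s) = labels s + N) ∧
    ((outs V : Multiset ℕ) + (downs s + ups t) = labels s + N) := by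
  cases h with
  | birth i o a b =>
    cases o <;> constructor <;>
    simp only [ins, outs, netP, wireVert, Vert.pairs, downs, ups, labels, List.flatMap_cons,
      List.flatMap_nil, Multiset.coe_add, Multiset.coe_eq_coe] <;> simp <;> grind
  | death i o a b =>
    cases o <;> constructor <;>
    simp only [ins, outs, netP, wireVert, Vert.pairs, downs, ups, labels, List.flatMap_cons,
      List.flatMap_nil, Multiset.coe_add, Multiset.coe_eq_coe] <;> simp <;> grind
  | virt i o p x y =>
    cases o <;> cases p <;> constructor <;>
    simp only [ins, outs, netP, downs, ups, labels, List.flatMap_nil, Multiset.coe_add,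
      Multiset.coe_eq_coe] <;> simp <;> grind
  | cross i c hc o p x x' y y' =>
    cases o <;> cases p <;> constructor <;>
    simp only [ins, outs, netP, crossVert, Vert.pairs, downs, ups, labels, List.flatMap_cons,
      List.flatMap_nil, Multiset.coe_add, Multiset.coe_eq_coe] <;> simp <;> grind
  | bar i o a b =>
    cases o <;> constructor <;>
    simp only [ins, outs, netP, barVert, Vert.pairs, downs, ups, labels, List.flatMap_cons,
      List.flatMap_nil, Multiset.coe_add, Multiset.coe_eq_coe] <;> simp <;> grind

theorem LRun.count (h : LRun e s V N t) :
    ((ins V : Multiset ℕ) + (downs t + ups s) = labels s + N) ∧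
    ((outs V : Multiset ℕ) + (downs s + ups t) = labels s + N) := by
  obtain ⟨l, u, v, r, h1, rfl, rfl, h2⟩ := h
  simp only [downs_append, ups_append, labels_append, ← Multiset.coe_add]
  rw [← downs_add_ups l, ← downs_add_ups r]
  obtain ⟨h3, h4⟩ := h2.count
  constructor
  · calc _ = ((ins V : Multiset ℕ) + (downs v + ups u)) + (downs l + ups l + (downs r + ups r)) := by
          abel
      _ = _ := by rw [h3]; abel
  · calc _ = ((outs V : Multiset ℕ) + (downs u + ups v)) + (downs l + ups l + (downs r + ups r)) := by
          abel
      _ = _ := by rw [h4]; abel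

theorem Run.count (h : Run w s V N t) :
    ((ins V : Multiset ℕ) + (downs t + ups s) = labels s + N) ∧
    ((outs V : Multiset ℕ) + (downs s + ups t) = labels s + N) := by
  induction h with
  | nil s =>
    rw [downs_add_ups]
    constructor <;> exact add_comm _ _
  | @cons e w s t u V₁ V₂ N₁ N₂ h1 _ ih =>
    obtain ⟨h2, h3⟩ := h1.count
    obtain ⟨h4, h5⟩ := ih
    rw [← downs_add_ups] at h2 h3 h4 h5 ⊢
    simp only [ins_append, outs_append, ← Multiset.coe_add]
    constructor
    · refine add_right_cancel (b := (downs t + ups t : Multiset ℕ)) ?_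
      calc _ = ((ins V₁ : Multiset ℕ) + (downs t + ups s)) + (ins V₂ + (downs u + ups t)) := by abel
        _ = _ := by rw [h2, h4]; abel
    · refine add_right_cancel (b := (downs t + ups t : Multiset ℕ)) ?_
      calc _ = ((outs V₁ : Multiset ℕ) + (downs s + ups t)) + (outs V₂ + (downs t + ups u)) := by abel
        _ = _ := by rw [h3, h5]; abel

theorem mem_of_count {A B D U L : List ℕ} (h : (A : Multiset ℕ) + (D + U) = L + B) {a : ℕ}
    (ha : a ∈ A) : a ∈ L ∨ a ∈ B := by
  have : a ∈ (L : Multiset ℕ) + (B : Multiset ℕ) := by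
    rw [← h, Multiset.mem_add]
    exact .inl ha
  simpa using this

theorem Vert.map_congr {f g : ℕ → ℕ} {v : Vert} (h : ∀ p ∈ v.pairs, f p.1 = g p.1 ∧ f p.2 = g p.2) :
    v.map f = v.map g := by
  cases v <;> simp_all [Vert.pairs, Vert.map]

theorem map_vert_congr {f g : ℕ → ℕ} {V : List Vert} (h1 : ∀ a ∈ ins V, f a = g a)
    (h2 : ∀ a ∈ outs V, f a = g a) : V.map (Vert.map f) = V.map (Vert.map g) := by
  refine List.map_congr_left fun v hv => Vert.map_congr fun p hp => ?_
  have : p ∈ netP V := List.mem_flatMap.2 ⟨v, hv, hp⟩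
  exact ⟨h1 _ (List.mem_map_of_mem this), h2 _ (List.mem_map_of_mem this)⟩

theorem Run.unique {t' : List (Bool × ℕ)} {f : ℕ → ℕ} (h : Run w s V N t)
    (h' : Run w (smap f s) V' N' t') (hn : (labels s ++ N).Nodup) :
    ∃ g : ℕ → ℕ, (∀ a ∉ N, g a = f a) ∧ V' = V.map (Vert.map g) ∧ N' = N.map g ∧
      t' = smap g t := by
  induction h generalizing f V' N' with
  | nil s =>
    cases h'
    exact ⟨f, fun _ _ => rfl, rfl, rfl, rfl⟩
  | @cons e w s t u V₁ V₂ N₁ N₂ h1 h2 ih =>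
    cases h' with
    | cons h1' h2' =>
      have hn1 : (labels s ++ N₁).Nodup :=
        hn.sublist (List.Sublist.append_left (List.sublist_append_left _ _) _)
      obtain ⟨g₁, k1, rfl, rfl, rfl⟩ := h1.unique h1' hn1
      obtain ⟨g, k2, rfl, rfl, rfl⟩ := ih h2' (h1.nodup_append hn)
      rw [← List.append_assoc] at hn
      have hd := List.disjoint_of_nodup_append hn
      have hg : ∀ a, a ∈ labels s ∨ a ∈ N₁ → g₁ a = g a := fun a ha =>
        (k2 a fun ha' => hd (List.mem_append.2 ha) ha').symm
      refine ⟨g, fun a ha => ?_, ?_, ?_, rfl⟩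
      · simp only [List.mem_append, not_or] at ha
        rw [k2 a ha.2, k1 a ha.1]
      · rw [List.map_append, map_vert_congr (fun a ha => hg a (mem_of_count h1.count.1 ha))
          fun a ha => hg a (mem_of_count h1.count.2 ha)]
      · rw [List.map_append, List.map_congr_left fun a ha => hg a (.inr ha)]

/-! ### Existence -/

theorem Layer.Leads.exists_run {σ τ : List Bool} (h : e.Leads σ τ) (hs : s.map Prod.fst = σ)
    (L : List ℕ) : ∃ V N t, LRun e s V N t ∧ N.Nodup ∧ (∀ a ∈ N, a ∉ L) ∧ t.map Prod.fst = τ := by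
  obtain ⟨a, ha⟩ := exists_fresh L
  obtain ⟨b, hb⟩ := exists_fresh (a :: L)
  simp only [List.mem_cons, not_or] at hb
  cases h with
  | birth l r o =>
    obtain ⟨l, r, rfl, rfl, rfl⟩ := List.map_eq_append_iff.1 hs
    refine ⟨_, _, _, ⟨l, _, _, r, (List.length_map _).symm, rfl, rfl, .birth _ o a b⟩, ?_, ?_, ?_⟩
    · simpa using Ne.symm hb.1
    · simp [ha, hb]
    · simp
  | death l r o =>
    obtain ⟨l, q, rfl, rfl, hq⟩ := List.map_eq_append_iff.1 hs
    obtain ⟨⟨o', x⟩, q, rfl, rfl, hq'⟩ := List.map_eq_cons_iff.1 hq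
    obtain ⟨⟨p', y⟩, r, rfl, hp, rfl⟩ := List.map_eq_cons_iff.1 hq'
    simp only at hp
    subst hp
    exact ⟨_, _, _, ⟨l, _, _, r, (List.length_map _).symm, rfl, rfl, .death _ o' x y⟩, .nil,
      by simp, by simp⟩
  | cross l r c o p =>
    obtain ⟨l, q, rfl, rfl, hq⟩ := List.map_eq_append_iff.1 hs
    obtain ⟨⟨o', x⟩, q, rfl, rfl, hq'⟩ := List.map_eq_cons_iff.1 hq
    obtain ⟨⟨p', y⟩, r, rfl, rfl, rfl⟩ := List.map_eq_cons_iff.1 hq'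
    by_cases hc : c = .virtual
    · subst hc
      exact ⟨_, _, _, ⟨l, _, _, r, (List.length_map _).symm, rfl, rfl, .virt _ o' p' x y⟩, .nil,
        by simp, by simp⟩
    · refine ⟨_, _, _, ⟨l, _, _, r, (List.length_map _).symm, rfl, rfl,
        .cross _ c hc o' p' x a y b⟩, ?_, ?_, ?_⟩
      · simpa using Ne.symm hb.1
      · simp [ha, hb]
      · simp
  | bar l r o =>
    obtain ⟨l, q, rfl, rfl, hq⟩ := List.map_eq_append_iff.1 hs
    obtain ⟨⟨o', x⟩, r, rfl, rfl, rfl⟩ := List.map_eq_cons_iff.1 hq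
    exact ⟨_, _, _, ⟨l, _, _, r, (List.length_map _).symm, rfl, rfl, .bar _ o' x a⟩, by simp,
      by simpa using ha, by simp⟩

theorem Leads.exists_run {σ τ : List Bool} (h : Leads w σ τ) (hs : s.map Prod.fst = σ)
    (L : List ℕ) : ∃ V N t, Run w s V N t ∧ N.Nodup ∧ (∀ a ∈ N, a ∉ L) ∧ t.map Prod.fst = τ := by
  induction h generalizing s L with
  | nil => exact ⟨_, _, _, .nil s, .nil, by simp, hs⟩
  | cons h1 h2 ih =>
    obtain ⟨V₁, N₁, t, r1, n1, d1, e1⟩ := h1.exists_run hs L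
    obtain ⟨V₂, N₂, u, r2, n2, d2, e2⟩ := ih e1 (N₁ ++ L)
    refine ⟨_, _, _, .cons r1 r2, List.nodup_append.2 ⟨n1, n2, ?_⟩, ?_, e2⟩
    · rintro a ha b hb rfl
      exact d2 a hb (List.mem_append_left _ ha)
    · intro a ha
      rcases List.mem_append.1 ha with ha | ha
      · exact d1 a ha
      · exact fun h => d2 a ha (List.mem_append_right _ h)

/-! ### Closed diagrams -/

theorem Run.ins_perm (h : Run w [] V N []) : (ins V).Perm N := by
  have := h.count.1
  simpa [downs, ups, labels] using this

theorem Run.good (h : Run w [] V N []) (hn : N.Nodup) : Good V := by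
  have h2 : (outs V).Perm N := by simpa [downs, ups, labels] using h.count.2
  exact ⟨h.ins_perm.nodup_iff.2 hn, h.ins_perm.trans h2.symm⟩

/-- Two labellings of a closed diagram differ by a renaming, and it is injective on the labels that
occur because the new labels are distinct too. -/
theorem Run.vEq (h : Run w [] V N []) (h' : Run w [] V' N' []) (hV : Good V) (hV' : Good V') :
    VEq V V' := by
  have hN := h.ins_perm.nodup_iff.1 hV.nodup
  have hN' := h'.ins_perm.nodup_iff.1 hV'.nodup
  obtain ⟨g, -, rfl, rfl, -⟩ := h.unique (f := id) h' (by simpa [labels] using hN)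
  refine hV.rename fun a ha b hb hab => ?_
  exact List.inj_on_of_nodup_map hN' (h.ins_perm.subset ha) (h.ins_perm.subset hb) hab

/-- The braid `x` is a braid of the Gauss diagram of the diagram `D`. -/
def Diagram.HasBraid (D : Diagram) (n : ℕ) (x : STVB n) : Prop :=
  ∃ V N, Run D.1 [] V N [] ∧ Good V ∧ Rep (netE V) (netP V) n x

theorem Diagram.exists_run (D : Diagram) : ∃ V N, Run D.1 [] V N [] ∧ Good V := by
  obtain ⟨V, N, t, h1, h2, -, h3⟩ := D.2.exists_run (s := []) rfl []
  obtain rfl : t = [] := by simpa using h3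
  exact ⟨V, N, h1, h1.good h2⟩

theorem Diagram.exists_braid (D : Diagram) : ∃ n x, D.HasBraid n x := by
  obtain ⟨V, N, h1, h2⟩ := D.exists_run
  obtain ⟨n, x, h3⟩ := h2.valid.exists_rep
  exact ⟨n, x, V, N, h1, h2, h3⟩

/-- A local move does not change the braid of the Gauss diagram. -/
def Invariant (L R : List Layer) : Prop :=
  ∀ (s t : List (Bool × ℕ)) (V C : List Vert) (N : List ℕ), Run L s V N t →
    (labels s ++ N).Nodup → Good (V ++ C) → ∃ f V' N', Run R (smap f s) V' N' (smap f t) ∧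
      VEq (V ++ C) (V' ++ C.map (Vert.map f))

end

theorem NetEq.lvEquiv {E E' : List (Ev ℕ)} {P P' : List (ℕ × ℕ)} {n n' : ℕ} {x : STVB n}
    {x' : STVB n'} (h : NetEq E P E' P') (h1 : Rep E P n x) (h2 : Rep E' P' n' x') :
    LvEquiv ⟨n, x⟩ ⟨n', x'⟩ := by
  obtain ⟨k, y, k', y', h3, h4, h5⟩ := h
  exact ((h1.unique h3).trans h5).trans (h4.unique h2)

theorem Diagram.HasBraid.unique {D : Diagram} {n n' : ℕ} {x : STVB n} {x' : STVB n'}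
    (h : D.HasBraid n x) (h' : D.HasBraid n' x') : LvEquiv ⟨n, x⟩ ⟨n', x'⟩ := by
  obtain ⟨V, N, h1, h2, h3⟩ := h
  obtain ⟨V', N', h1', h2', h3'⟩ := h'
  exact (h1.vEq h1' h2 h2').lvEquiv h3 h3'

/-- The renaming `f` may identify labels, namely where a move contracts a strand. It is applied to
the parts above and below too, since a run stays a run under any renaming. -/
theorem Invariant.exists_run {A B L R : List Layer} {V : List Vert} {N : List ℕ}
    (hI : Invariant L R) (h1 : Run (A ++ L ++ B) [] V N []) (h2 : Good V) :
    ∃ V' N', Run (A ++ R ++ B) [] V' N' [] ∧ VEq V V' := by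
  have hN := h1.ins_perm.nodup_iff.1 h2.nodup
  obtain ⟨V₁, N₁, t, V₂, N₂, rfl, rfl, r1, rB⟩ := h1.of_append
  obtain ⟨VA, NA, s, VL, NL, rfl, rfl, rA, rL⟩ := r1.of_append
  have hp : (VA ++ VL ++ V₂).Perm (VL ++ (VA ++ V₂)) := by
    rw [← List.append_assoc]
    exact List.perm_append_comm.append_right _
  have hs : (labels s ++ NL).Nodup := by
    rw [← Multiset.coe_nodup, ← Multiset.coe_add] at hN ⊢
    refine Multiset.nodup_of_le (le_trans ?_ (Multiset.le_add_right _ _)) hN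
    rw [← Multiset.coe_add]
    gcongr
    simpa [labels] using rA.labels_le
  obtain ⟨f, V', N', rR, hv⟩ := hI s t VL (VA ++ V₂) NL rL hs (h2.of_perm hp)
  have hp' : (V' ++ (VA ++ V₂).map (Vert.map f)).Perm
      (VA.map (Vert.map f) ++ V' ++ V₂.map (Vert.map f)) := by
    rw [List.map_append, ← List.append_assoc]
    exact List.perm_append_comm.append_right _
  exact ⟨_, _, ((rA.map f).append rR).append (rB.map f),
    (h2.perm_eq hp).trans (hv.trans (hv.good_right.perm_eq hp'))⟩

theorem Diagram.Step.lvEquiv (hinv : ∀ L R, LocalMove L R → Invariant L R) {D D' : Diagram}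
    (h : D.Step D') {n n' : ℕ} {x : STVB n} {x' : STVB n'} (hx : D.HasBraid n x)
    (hx' : D'.HasBraid n' x') : LvEquiv ⟨n, x⟩ ⟨n', x'⟩ := by
  obtain ⟨A, B, L, R, hm, hD, hD'⟩ := h
  obtain ⟨V, N, h1, h2, h3⟩ := hx
  rw [hD] at h1
  obtain ⟨V', N', r, hv⟩ := (hinv L R hm).exists_run h1 h2
  rw [← hD'] at r
  obtain ⟨k, y, hy⟩ := hv.good_right.valid.exists_rep
  exact (hv.lvEquiv h3 hy).trans (Diagram.HasBraid.unique ⟨_, _, r, hv.good_right, hy⟩ hx')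

theorem lvEquiv_of_link_eq (hinv : ∀ L R, LocalMove L R → Invariant L R) {D D' : Diagram}
    (h : D.link = D'.link) {n n' : ℕ} {x : STVB n} {x' : STVB n'} (hx : D.HasBraid n x)
    (hx' : D'.HasBraid n' x') : LvEquiv ⟨n, x⟩ ⟨n', x'⟩ := by
  replace h : Relation.EqvGen Diagram.Step D D' := Quot.eqvGen_exact h
  induction h generalizing n x n' x' with
  | rel D D' h => exact h.lvEquiv hinv hx hx'
  | refl D => exact hx.unique hx'
  | symm D D' h ih => exact (ih hx' hx).symm
  | trans D D' D'' h h' ih ih' =>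
    obtain ⟨k, y, hy⟩ := D'.exists_braid
    exact (ih hx hy).trans (ih' hy hx')

end SingTwist

namespace SingTwist

/-! ### Moves of Gauss diagrams, with all orientations -/

section

variable {C : List Vert} {c d : Crossing}

theorem Crossing.IsReal.ne_virtual (h : c.IsReal) : c ≠ .virtual := by
  rcases h with rfl | rfl <;> simp

theorem Good.congr_prefix {F F' : List Vert} (h : Good (F ++ C)) (h1 : (ins F).Perm (ins F'))
    (h2 : (outs F).Perm (outs F')) : Good (F' ++ C) := by
  refine h.congr ?_ ?_
  · rw [ins_append, ins_append]; exact h1.append_right _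
  · rw [outs_append, outs_append]; exact h2.append_right _

/-- Parallel strands give a relation of the braid monoid, antiparallel ones a move of type 2. -/
theorem Good.crossVert_bigon (hc : c.IsReal) {o p : Bool} {x x1 x2 y y1 y2 : ℕ}
    (h : Good ([crossVert c o p x x1 y y1, crossVert c.turn p o y1 y2 x1 x2] ++ C)) :
    VEq ([crossVert c o p x x1 y y1, crossVert c.turn p o y1 y2 x1 x2] ++ C)
      ([wireVert o x x2, wireVert p y y2] ++ C) := by
  cases o <;> cases p
  · have h1 : Good ([.cross c.turn y2 y1 x2 x1, .cross c.turn.turn x1 x y1 y] ++ C) := by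
      rw [c.turn_turn]; exact h.of_perm (.swap _ _ _)
    have h2 := h1.bigon hc.turn
    rw [c.turn_turn] at h2
    exact h2.of_perm (.swap _ _ _) (.swap _ _ _)
  · exact (Good.opp_first (c := c.turn) hc.turn h).of_perm (.refl _) (.swap _ _ _)
  · exact (Good.opp_last (c := c.turn) hc.turn h).of_perm (.refl _) (.swap _ _ _)
  · exact Good.bigon hc h

/-- Parallel strands give a relation of the braid monoid, antiparallel ones a move of type 3. -/
theorem Good.crossVert_flip (hc : c.IsReal) {o p : Bool} {x x1 x2 y y1 y2 : ℕ}
    (h : Good ([crossVert c o p x x1 y y1, crossVert .singular p o y1 y2 x1 x2] ++ C)) :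
    VEq ([crossVert c o p x x1 y y1, crossVert .singular p o y1 y2 x1 x2] ++ C)
      ([crossVert .singular o p x x1 y y1, crossVert c p o y1 y2 x1 x2] ++ C) := by
  have h' : Good ([crossVert .singular o p x x1 y y1, crossVert c p o y1 y2 x1 x2] ++ C) := by
    cases o <;> cases p <;> exact h.congr (.refl _) (.refl _)
  cases o <;> cases p
  · have h2 := Good.flip (c := c) hc (h'.of_perm (.swap _ _ _))
    exact (h2.of_perm (.swap _ _ _) (.swap _ _ _)).symm
  · exact (Good.rs_right (c := c.turn) hc.turn h').symm
  · exact (Good.rs_left (c := c.turn) hc.turn h').symm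
  · exact Good.flip hc h

/-- Reversing all three orientations turns the move upside down, which accounts for half of the
eight cases. The triangle is cyclic exactly when `p` differs from both `o` and `q`; otherwise it is
one of the compatible triangles. -/
theorem Good.crossVert_triangle (hc : c.IsReal) (hd : d ≠ .virtual) {o p q : Bool}
    {x x1 x2 y y1 y2 z z1 z2 : ℕ}
    (h : Good ([crossVert c o p x x1 y y1, crossVert c o q x1 x2 z z1,
      crossVert d p q y1 y2 z1 z2] ++ C)) :
    VEq ([crossVert c o p x x1 y y1, crossVert c o q x1 x2 z z1,
      crossVert d p q y1 y2 z1 z2] ++ C)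
      ([crossVert d p q y y1 z z1, crossVert c o q x x1 z1 z2,
        crossVert c o p x1 x2 y1 y2] ++ C) := by
  have rev : ∀ u v w : Vert, ([u, v, w] ++ C).Perm ([w, v, u] ++ C) := fun u v w =>
    (List.reverse_perm [w, v, u]).append_right C
  have rot : ∀ u v w : Vert, ([u, v, w] ++ C).Perm ([v, w, u] ++ C) := fun u v w =>
    (List.perm_append_comm (l₁ := [u]) (l₂ := [v, w])).append_right C
  have rot' : ∀ u v w : Vert, ([u, v, w] ++ C).Perm ([w, u, v] ++ C) := fun u v w =>
    (rot _ _ _).symm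
  have sw : ∀ u v w : Vert, ([u, v, w] ++ C).Perm ([v, u, w] ++ C) := fun u v w => .swap _ _ _
  have sw' : ∀ u v w : Vert, ([u, v, w] ++ C).Perm ([u, w, v] ++ C) := fun u v w =>
    (List.Perm.swap _ _ _).cons _
  have h' : Good ([crossVert d p q y y1 z z1, crossVert c o q x x1 z1 z2,
      crossVert c o p x1 x2 y1 y2] ++ C) := by
    refine h.congr_prefix ?_ ?_ <;> cases o <;> cases p <;> cases q <;>
      simp only [ins, outs, netP, crossVert, Vert.pairs, List.flatMap_cons, List.flatMap_nil,
        List.map_cons, List.map_nil, List.cons_append, List.nil_append] <;> grind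
  have hd' := Crossing.turn_ne_virtual hd
  cases o <;> cases p <;> cases q
  · exact ((Good.slide hc hd (h'.of_perm (rev _ _ _))).of_perm (rev _ _ _) (rev _ _ _)).symm
  · exact ((Good.slide_mixed hc hd' (h'.of_perm (rot' _ _ _))).of_perm (rot _ _ _)
      (rot' _ _ _)).symm
  · exact ((Good.cyclic hc hd' (h'.of_perm (rev _ _ _))).of_perm (rev _ _ _) (sw _ _ _)).symm
  · exact (Good.slide_inv hc.turn hd (h.of_perm (sw _ _ _))).of_perm (sw _ _ _) (sw' _ _ _)
  · exact ((Good.slide_inv hc.turn hd (h'.of_perm (rot _ _ _))).of_perm (rot' _ _ _)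
      (rot _ _ _)).symm
  · exact (Good.cyclic hc hd' h).of_perm (.refl _) (rot' _ _ _)
  · exact (Good.slide_mixed hc hd' (h.of_perm (sw' _ _ _))).of_perm (sw' _ _ _) (sw _ _ _)
  · exact Good.slide hc hd h

theorem Good.barVert_bar {o : Bool} {a a1 a2 : ℕ}
    (h : Good ([barVert o a a1, barVert o a1 a2] ++ C)) :
    VEq ([barVert o a a1, barVert o a1 a2] ++ C) ([wireVert o a a2] ++ C) := by
  cases o
  · exact (Good.bar_bar (h.of_perm (.swap _ _ _))).of_perm (.swap _ _ _) (.refl _)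
  · exact h.bar_bar

/-- For every orientation the five vertices are those of `Good.twist`, up to their order: reversing
a strand only exchanges its two bars. -/
theorem Good.crossVert_twist (hc : c ≠ .virtual) {o p : Bool} {x x1 x2 x3 y y1 y2 y3 : ℕ}
    (h : Good ([barVert p y y1, barVert o x x1, crossVert c o p x1 x2 y1 y2, barVert p y2 y3,
      barVert o x2 x3] ++ C)) :
    VEq ([barVert p y y1, barVert o x x1, crossVert c o p x1 x2 y1 y2, barVert p y2 y3,
      barVert o x2 x3] ++ C) ([crossVert c p o y y3 x x3] ++ C) := by
  have key : ∀ {c : Crossing}, c ≠ .virtual → ∀ {a a1 a2 a3 b b1 b2 b3 : ℕ} {F : List Vert},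
      F.Perm [.bar b b1, .bar a a1, .cross c a1 a2 b1 b2, .bar a2 a3, .bar b2 b3] → Good (F ++ C) →
      VEq (F ++ C) ([.cross c b b3 a a3] ++ C) := fun hc _ _ _ _ _ _ _ _ _ hp h =>
    (Good.twist hc (h.of_perm (hp.append_right C))).of_perm (hp.symm.append_right C) (.refl _)
  cases o <;> cases p
  · exact key hc (a := x3) (a1 := x2) (a2 := x1) (a3 := x) (b := y3) (b1 := y2) (b2 := y1) (b3 := y)
      (by
        rw [← Multiset.coe_eq_coe]
        simp only [barVert, crossVert, Bool.false_eq_true, if_false, ← Multiset.cons_coe,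
          ← Multiset.singleton_add]
        abel) h
  · exact key (Crossing.turn_ne_virtual hc) (a := y) (a1 := y1) (a2 := y2) (a3 := y3) (b := x3)
      (b1 := x2) (b2 := x1) (b3 := x) (by
        rw [← Multiset.coe_eq_coe]
        simp only [barVert, crossVert, if_true, Bool.false_eq_true, if_false, ← Multiset.cons_coe,
          ← Multiset.singleton_add]
        abel) h
  · exact key (Crossing.turn_ne_virtual hc) (a := y3) (a1 := y2) (a2 := y1) (a3 := y) (b := x)
      (b1 := x1) (b2 := x2) (b3 := x3) (by
        rw [← Multiset.coe_eq_coe]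
        simp only [barVert, crossVert, if_true, Bool.false_eq_true, if_false, ← Multiset.cons_coe,
          ← Multiset.singleton_add]
        abel) h
  · exact key hc (a := x) (a1 := x1) (a2 := x2) (a3 := x3) (b := y) (b1 := y1) (b2 := y2) (b3 := y3)
      (by
        rw [← Multiset.coe_eq_coe]
        simp only [barVert, crossVert, if_true, ← Multiset.cons_coe,
          ← Multiset.singleton_add]
        abel) h

theorem Good.crossVert_kink_right (hc : c.IsReal) {o : Bool} {x m y : ℕ}
    (h : Good ([crossVert c o o x m m y] ++ C)) :
    VEq ([crossVert c o o x m m y] ++ C) ([wireVert o x y] ++ C) := by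
  cases o
  exacts [h.kink_left hc, h.kink_right hc]

theorem Good.crossVert_kink_left (hc : c.IsReal) {o : Bool} {x m y : ℕ}
    (h : Good ([crossVert c o o m y x m] ++ C)) :
    VEq ([crossVert c o o m y x m] ++ C) ([wireVert o x y] ++ C) := by
  cases o
  exacts [h.kink_right hc, h.kink_left hc]

theorem Good.contract_wireVert {o : Bool} {a b : ℕ} (h : Good (wireVert o a b :: C)) (hab : a ≠ b) :
    VEq (wireVert o a b :: C) (C.map (Vert.map (sub b a))) := by
  cases o
  exacts [h.wire' hab.symm, h.wire hab]

theorem wireVert_swap (o : Bool) (a b : ℕ) : wireVert o a b = wireVert (!o) b a := by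
  cases o <;> rfl

theorem Good.wireVert_contract {F : List Vert} {o : Bool} {a b : ℕ}
    (h : Good (wireVert o a b :: (F ++ C))) (hb : b ∈ if o then ins F else outs F) :
    VEq (wireVert o a b :: (F ++ C)) (F.map (Vert.map (sub b a)) ++ C) := by
  cases o
  exacts [h.contract' hb, h.contract hb]

end

end SingTwist

namespace SingTwist

/-! ### Shifts -/

section

variable {e : Layer} {v w : List Layer} {s t u : List (Bool × ℕ)} {V V' C : List Vert}
  {N N' : List ℕ}

theorem Layer.pos_shift (k : ℕ) (e : Layer) : (e.shift k).pos = e.pos + k := by cases e <;> rfl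

theorem Piece.shift (k : ℕ) (h : Piece e s V N t) : Piece (e.shift k) s V N t := by
  cases h <;> constructor
  assumption

theorem Piece.of_shift {k : ℕ} (h : Piece (e.shift k) s V N t) : Piece e s V N t := by
  cases e <;> cases h <;> constructor
  assumption

theorem LRun.shift (q : List (Bool × ℕ)) (h : LRun e s V N t) :
    LRun (e.shift q.length) (q ++ s) V N (q ++ t) := by
  obtain ⟨l, u, v, r, h1, rfl, rfl, h2⟩ := h
  refine ⟨q ++ l, u, v, r, ?_, ?_, ?_, h2.shift _⟩
  · rw [List.length_append, e.pos_shift, h1, add_comm]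
  · simp only [List.append_assoc]
  · simp only [List.append_assoc]

theorem LRun.of_shift {k : ℕ} (h : LRun (e.shift k) s V N t) :
    ∃ q s' t', q.length = k ∧ s = q ++ s' ∧ t = q ++ t' ∧ LRun e s' V N t' := by
  obtain ⟨l, u, v, r, h1, rfl, rfl, h2⟩ := h
  rw [e.pos_shift] at h1
  refine ⟨l.take k, l.drop k ++ (u ++ r), l.drop k ++ (v ++ r), ?_, ?_, ?_,
    l.drop k, u, v, r, ?_, rfl, rfl, h2.of_shift⟩
  · rw [List.length_take]; omega
  · rw [← List.append_assoc (l.take k), List.take_append_drop]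
  · rw [← List.append_assoc (l.take k), List.take_append_drop]
  · rw [List.length_drop]; omega

theorem Run.shift (q : List (Bool × ℕ)) (h : Run w s V N t) :
    Run (w.map (Layer.shift q.length)) (q ++ s) V N (q ++ t) := by
  induction h with
  | nil s => exact .nil _
  | cons h1 _ ih => exact .cons (h1.shift q) ih

theorem Run.of_shift {q : List (Bool × ℕ)} (h : Run (w.map (Layer.shift q.length)) (q ++ s) V N t) :
    ∃ t', t = q ++ t' ∧ Run w s V N t' := by
  induction w generalizing s V N with
  | nil =>
    cases h
    exact ⟨s, rfl, .nil s⟩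
  | cons e w ih =>
    cases h with
    | cons h1 h2 =>
      obtain ⟨q', s', t', h3, h4, rfl, h5⟩ := h1.of_shift
      obtain ⟨rfl, rfl⟩ := List.append_inj h4 h3.symm
      obtain ⟨t', rfl, h6⟩ := ih h2
      exact ⟨t', rfl, .cons h5 h6⟩

/-- By this lemma a local move has to be examined only at the left end of the diagram. -/
theorem Invariant.shift {L R : List Layer} (k : ℕ) (hL : L ≠ []) (h : Invariant L R) :
    Invariant (L.map (Layer.shift k)) (R.map (Layer.shift k)) := by
  intro s t V C N h1 h2 h3
  -- The first layer of the shifted word can occur only if there are at least `k` strands to its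
  -- left.
  obtain ⟨q, s', rfl, rfl⟩ : ∃ q s', q.length = k ∧ s = q ++ s' := by
    cases L with
    | nil => exact absurd rfl hL
    | cons e L =>
      cases h1 with
      | cons h4 _ =>
        obtain ⟨q, s', _, h5, h6, _⟩ := h4.of_shift
        exact ⟨q, s', h5, h6⟩
  obtain ⟨t, rfl, h4⟩ := h1.of_shift
  rw [labels_append, List.append_assoc] at h2
  obtain ⟨f, V', N', h5, h6⟩ := h s' t V C N h4 h2.of_append_right h3
  refine ⟨f, V', N', ?_, h6⟩
  rw [smap_append, smap_append]
  have := h5.shift (smap f q)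
  rwa [show (smap f q).length = q.length by simp [smap]] at this

/-- A local move whose strands keep their labels. -/
theorem invariant_of {s t : List (Bool × ℕ)} {R : List Layer} (h : Run R s V' N' t)
    (hv : VEq (V ++ C) (V' ++ C)) : ∃ f V' N', Run R (smap f s) V' N' (smap f t) ∧
      VEq (V ++ C) (V' ++ C.map (Vert.map f)) := by
  refine ⟨id, V', N', by rwa [smap_id, smap_id], ?_⟩
  rwa [map_vert_eq_self (f := id) (fun _ _ => rfl) fun _ _ => rfl]

/-! ### Layers at the left end -/

theorem lrun_zero (h : e.pos = 0) :
    LRun e s V N t ↔ ∃ u v r, s = u ++ r ∧ t = v ++ r ∧ Piece e u V N v := by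
  constructor
  · rintro ⟨l, u, v, r, h1, rfl, rfl, h2⟩
    obtain rfl : l = [] := List.length_eq_zero_iff.1 (h1.trans h)
    exact ⟨u, v, r, rfl, rfl, h2⟩
  · rintro ⟨u, v, r, rfl, rfl, h2⟩
    exact ⟨[], u, v, r, h.symm, rfl, rfl, h2⟩

theorem lrun_one (h : e.pos = 1) :
    LRun e s V N t ↔ ∃ q u v r, s = q :: (u ++ r) ∧ t = q :: (v ++ r) ∧ Piece e u V N v := by
  constructor
  · rintro ⟨l, u, v, r, h1, rfl, rfl, h2⟩
    obtain ⟨q, rfl⟩ := List.length_eq_one_iff.1 (h1.trans h)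
    exact ⟨q, u, v, r, rfl, rfl, h2⟩
  · rintro ⟨q, u, v, r, rfl, rfl, h2⟩
    exact ⟨[q], u, v, r, h.symm, rfl, rfl, h2⟩

theorem run_nil : Run [] s V N t ↔ V = [] ∧ N = [] ∧ t = s := by
  constructor
  · intro h
    cases h
    exact ⟨rfl, rfl, rfl⟩
  · rintro ⟨rfl, rfl, rfl⟩
    exact .nil _

theorem run_cons : Run (e :: w) s V N t ↔ ∃ V₁ N₁ u V₂ N₂, LRun e s V₁ N₁ u ∧ Run w u V₂ N₂ t ∧
    V = V₁ ++ V₂ ∧ N = N₁ ++ N₂ := by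
  constructor
  · intro h
    cases h with
    | cons h1 h2 => exact ⟨_, _, _, _, _, h1, h2, rfl, rfl⟩
  · rintro ⟨_, _, _, _, _, h1, h2, rfl, rfl⟩
    exact .cons h1 h2

theorem piece_birth {i : ℕ} {o : Bool} : Piece (.birth i o) s V N t ↔ ∃ a b, s = [] ∧
    V = [wireVert (!o) a b] ∧ N = [a, b] ∧ t = [(o, a), (!o, b)] := by
  constructor
  · rintro ⟨⟩
    exact ⟨_, _, rfl, rfl, rfl, rfl⟩
  · rintro ⟨_, _, rfl, rfl, rfl, rfl⟩
    constructor

theorem piece_death {i : ℕ} : Piece (.death i) s V N t ↔ ∃ o a b, s = [(o, a), (!o, b)] ∧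
    V = [wireVert o a b] ∧ N = [] ∧ t = [] := by
  constructor
  · rintro ⟨⟩
    exact ⟨_, _, _, rfl, rfl, rfl, rfl⟩
  · rintro ⟨_, _, _, rfl, rfl, rfl, rfl⟩
    constructor

theorem piece_virt {i : ℕ} : Piece (.cross i .virtual) s V N t ↔ ∃ o x p y, s = [(o, x), (p, y)] ∧
    V = [] ∧ N = [] ∧ t = [(p, y), (o, x)] := by
  constructor
  · rintro (_ | _ | _ | ⟨_, _, h⟩)
    · exact ⟨_, _, _, _, rfl, rfl, rfl, rfl⟩
    · exact absurd rfl h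
  · rintro ⟨_, _, _, _, rfl, rfl, rfl, rfl⟩
    constructor

theorem piece_cross {i : ℕ} {c : Crossing} (hc : c ≠ .virtual) :
    Piece (.cross i c) s V N t ↔ ∃ o x p y x' y', s = [(o, x), (p, y)] ∧
    V = [crossVert c o p x x' y y'] ∧ N = [x', y'] ∧ t = [(p, y'), (o, x')] := by
  constructor
  · rintro (_ | _ | _ | ⟨_, _, h⟩)
    · exact absurd rfl hc
    · exact ⟨_, _, _, _, _, _, rfl, rfl, rfl, rfl⟩
  · rintro ⟨_, _, _, _, _, _, rfl, rfl, rfl, rfl⟩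
    constructor
    exact hc

theorem piece_bar {i : ℕ} : Piece (.bar i) s V N t ↔ ∃ o a b, s = [(o, a)] ∧
    V = [barVert o a b] ∧ N = [b] ∧ t = [(o, b)] := by
  constructor
  · rintro ⟨⟩
    exact ⟨_, _, _, rfl, rfl, rfl, rfl⟩
  · rintro ⟨_, _, _, rfl, rfl, rfl, rfl⟩
    constructor

theorem lrun_birth_zero {o : Bool} : LRun (.birth 0 o) s V N t ↔ ∃ a b,
    V = [wireVert (!o) a b] ∧ N = [a, b] ∧ t = (o, a) :: (!o, b) :: s := by
  rw [lrun_zero rfl]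
  constructor
  · rintro ⟨u, v, r, rfl, rfl, h⟩
    obtain ⟨a, b, rfl, rfl, rfl, rfl⟩ := piece_birth.1 h
    exact ⟨a, b, rfl, rfl, rfl⟩
  · rintro ⟨a, b, rfl, rfl, rfl⟩
    exact ⟨[], _, s, rfl, rfl, .birth _ _ _ _⟩

theorem lrun_birth_one {o : Bool} : LRun (.birth 1 o) s V N t ↔ ∃ q r a b, s = q :: r ∧
    V = [wireVert (!o) a b] ∧ N = [a, b] ∧ t = q :: (o, a) :: (!o, b) :: r := by
  rw [lrun_one rfl]
  constructor
  · rintro ⟨q, u, v, r, rfl, rfl, h⟩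
    obtain ⟨a, b, rfl, rfl, rfl, rfl⟩ := piece_birth.1 h
    exact ⟨q, r, a, b, rfl, rfl, rfl, rfl⟩
  · rintro ⟨q, r, a, b, rfl, rfl, rfl, rfl⟩
    exact ⟨q, [], _, r, rfl, rfl, .birth _ _ _ _⟩

theorem lrun_death_zero : LRun (.death 0) s V N t ↔ ∃ o a b, s = (o, a) :: (!o, b) :: t ∧
    V = [wireVert o a b] ∧ N = [] := by
  rw [lrun_zero rfl]
  constructor
  · rintro ⟨u, v, r, rfl, rfl, h⟩
    obtain ⟨o, a, b, rfl, rfl, rfl, rfl⟩ := piece_death.1 h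
    exact ⟨o, a, b, rfl, rfl, rfl⟩
  · rintro ⟨o, a, b, rfl, rfl, rfl⟩
    exact ⟨_, [], t, rfl, rfl, .death _ o a b⟩

theorem lrun_death_one : LRun (.death 1) s V N t ↔ ∃ q r o a b, s = q :: (o, a) :: (!o, b) :: r ∧
    V = [wireVert o a b] ∧ N = [] ∧ t = q :: r := by
  rw [lrun_one rfl]
  constructor
  · rintro ⟨q, u, v, r, rfl, rfl, h⟩
    obtain ⟨o, a, b, rfl, rfl, rfl, rfl⟩ := piece_death.1 h
    exact ⟨q, r, o, a, b, rfl, rfl, rfl, rfl⟩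
  · rintro ⟨q, r, o, a, b, rfl, rfl, rfl, rfl⟩
    exact ⟨q, _, [], r, rfl, rfl, .death _ o a b⟩

theorem lrun_virt_zero : LRun (.cross 0 .virtual) s V N t ↔ ∃ o x p y r,
    s = (o, x) :: (p, y) :: r ∧ V = [] ∧ N = [] ∧ t = (p, y) :: (o, x) :: r := by
  rw [lrun_zero rfl]
  constructor
  · rintro ⟨u, v, r, rfl, rfl, h⟩
    obtain ⟨o, x, p, y, rfl, rfl, rfl, rfl⟩ := piece_virt.1 h
    exact ⟨o, x, p, y, r, rfl, rfl, rfl, rfl⟩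
  · rintro ⟨o, x, p, y, r, rfl, rfl, rfl, rfl⟩
    exact ⟨_, _, r, rfl, rfl, .virt _ o p x y⟩

theorem lrun_virt_one : LRun (.cross 1 .virtual) s V N t ↔ ∃ q o x p y r,
    s = q :: (o, x) :: (p, y) :: r ∧ V = [] ∧ N = [] ∧ t = q :: (p, y) :: (o, x) :: r := by
  rw [lrun_one rfl]
  constructor
  · rintro ⟨q, u, v, r, rfl, rfl, h⟩
    obtain ⟨o, x, p, y, rfl, rfl, rfl, rfl⟩ := piece_virt.1 h
    exact ⟨q, o, x, p, y, r, rfl, rfl, rfl, rfl⟩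
  · rintro ⟨q, o, x, p, y, r, rfl, rfl, rfl, rfl⟩
    exact ⟨q, _, _, r, rfl, rfl, .virt _ o p x y⟩

theorem lrun_cross_zero {c : Crossing} (hc : c ≠ .virtual) : LRun (.cross 0 c) s V N t ↔
    ∃ o x p y r x' y', s = (o, x) :: (p, y) :: r ∧ V = [crossVert c o p x x' y y'] ∧ N = [x', y'] ∧
      t = (p, y') :: (o, x') :: r := by
  rw [lrun_zero rfl]
  constructor
  · rintro ⟨u, v, r, rfl, rfl, h⟩
    obtain ⟨o, x, p, y, x', y', rfl, rfl, rfl, rfl⟩ := (piece_cross hc).1 h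
    exact ⟨o, x, p, y, r, x', y', rfl, rfl, rfl, rfl⟩
  · rintro ⟨o, x, p, y, r, x', y', rfl, rfl, rfl, rfl⟩
    exact ⟨_, _, r, rfl, rfl, .cross _ _ hc o p x x' y y'⟩

theorem lrun_cross_one {c : Crossing} (hc : c ≠ .virtual) : LRun (.cross 1 c) s V N t ↔
    ∃ q o x p y r x' y', s = q :: (o, x) :: (p, y) :: r ∧ V = [crossVert c o p x x' y y'] ∧
      N = [x', y'] ∧ t = q :: (p, y') :: (o, x') :: r := by
  rw [lrun_one rfl]
  constructor
  · rintro ⟨q, u, v, r, rfl, rfl, h⟩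
    obtain ⟨o, x, p, y, x', y', rfl, rfl, rfl, rfl⟩ := (piece_cross hc).1 h
    exact ⟨q, o, x, p, y, r, x', y', rfl, rfl, rfl, rfl⟩
  · rintro ⟨q, o, x, p, y, r, x', y', rfl, rfl, rfl, rfl⟩
    exact ⟨q, _, _, r, rfl, rfl, .cross _ _ hc o p x x' y y'⟩

theorem lrun_bar_zero : LRun (.bar 0) s V N t ↔ ∃ o a b r, s = (o, a) :: r ∧
    V = [barVert o a b] ∧ N = [b] ∧ t = (o, b) :: r := by
  rw [lrun_zero rfl]
  constructor
  · rintro ⟨u, v, r, rfl, rfl, h⟩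
    obtain ⟨o, a, b, rfl, rfl, rfl, rfl⟩ := piece_bar.1 h
    exact ⟨o, a, b, r, rfl, rfl, rfl, rfl⟩
  · rintro ⟨o, a, b, r, rfl, rfl, rfl, rfl⟩
    exact ⟨_, _, r, rfl, rfl, .bar _ o a b⟩

theorem lrun_bar_one : LRun (.bar 1) s V N t ↔ ∃ q o a b r, s = q :: (o, a) :: r ∧
    V = [barVert o a b] ∧ N = [b] ∧ t = q :: (o, b) :: r := by
  rw [lrun_one rfl]
  constructor
  · rintro ⟨q, u, v, r, rfl, rfl, h⟩
    obtain ⟨o, a, b, rfl, rfl, rfl, rfl⟩ := piece_bar.1 h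
    exact ⟨q, o, a, b, r, rfl, rfl, rfl, rfl⟩
  · rintro ⟨q, o, a, b, r, rfl, rfl, rfl, rfl⟩
    exact ⟨q, _, _, r, rfl, rfl, .bar _ o a b⟩

theorem Run.two {e f : Layer} {W W' : List Vert} (h : LRun e s W N t) (h' : LRun f t W' N' u) :
    Run [e, f] s (W ++ W') (N ++ N') u :=
  h.run.append h'.run

end

/-! ### Local moves -/

open Layer Crossing

section

variable {C V : List Vert} {s t : List (Bool × ℕ)} {N : List ℕ}

theorem Piece.length_bottom {e : Layer} (h : Piece e s V N t) : t.length = e.bottom := by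
  cases h <;> rfl

/-- The same vertices appear in the other order, and the order is irrelevant. -/
theorem invariant_exchange (e f : Layer) :
    Invariant [e, f.shift (e.pos + e.bottom)] [f.shift (e.pos + e.top), e] := by
  intro s t V C N h1 h2 h3
  simp only [run_cons, run_nil] at h1
  obtain ⟨V₁, N₁, m, _, _, ⟨l, u, v, r, e1, rfl, rfl, h4⟩, ⟨V₂, N₂, _, _, _, h5, ⟨rfl, rfl, rfl⟩,
    rfl, rfl⟩, rfl, rfl⟩ := h1
  obtain ⟨q, s', t', e2, e3, rfl, h6⟩ := h5.of_shift
  rw [← List.append_assoc] at e3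
  obtain ⟨rfl, rfl⟩ := List.append_inj e3 (by rw [e2, List.length_append, e1, h4.length_bottom])
  have r1 := h6.shift (l ++ u)
  rw [List.length_append, e1, h4.length, List.append_assoc, List.append_assoc] at r1
  have r2 : LRun e (l ++ (u ++ t')) V₁ N₁ (l ++ v ++ t') :=
    ⟨l, u, v, t', e1, rfl, List.append_assoc _ _ _, h4⟩
  refine invariant_of (Run.two r1 r2) (h3.perm_eq ?_)
  rw [List.append_nil]
  exact List.perm_append_comm.append_right _

/-- This serves the moves which replace a part by a plain vertical strand. The wire from `x` to `y`
is contracted, and the renaming identifies its upper and lower label, as an empty part demands. -/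
theorem VEq.invariant_one {o : Bool} {x y : ℕ} {r : List (Bool × ℕ)}
    (h : VEq (V ++ C) ([wireVert o x y] ++ C)) (hxy : x ≠ y) :
    ∃ f V' N', Run [] (smap f ((o, x) :: r)) V' N' (smap f ((o, y) :: r)) ∧
      VEq (V ++ C) (V' ++ C.map (Vert.map f)) := by
  refine ⟨sub y x, [], [], ?_, h.trans (Good.contract_wireVert h.good_right hxy)⟩
  have : smap (sub y x) ((o, y) :: r) = smap (sub y x) ((o, x) :: r) := by
    simp [smap, sub_self, sub_of_ne hxy]
  rw [this]
  exact .nil _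

theorem VEq.invariant_two {o p : Bool} {x y x' y' : ℕ} {r : List (Bool × ℕ)}
    (h : VEq (V ++ C) ([wireVert o x x', wireVert p y y'] ++ C)) (h1 : x ≠ x') (h2 : y ≠ y')
    (h3 : y ≠ x') (h4 : x' ≠ y') :
    ∃ f V' N', Run [] (smap f ((o, x) :: (p, y) :: r)) V' N' (smap f ((o, x') :: (p, y') :: r)) ∧
      VEq (V ++ C) (V' ++ C.map (Vert.map f)) := by
  have e1 := h.trans (Good.contract_wireVert h.good_right h1)
  rw [List.append_eq, List.map_append, List.map_cons, wireVert_map, sub_of_ne h3,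
    sub_of_ne h4.symm] at e1
  have e2 := e1.trans (Good.contract_wireVert e1.good_right h2)
  refine ⟨fun a => sub y' y (sub x' x a), [], [], ?_, ?_⟩
  · have : smap (fun a => sub y' y (sub x' x a)) ((o, x') :: (p, y') :: r) =
        smap (fun a => sub y' y (sub x' x a)) ((o, x) :: (p, y) :: r) := by
      simp [smap, sub_self, sub_of_ne h1, sub_of_ne h3, sub_of_ne h4.symm, sub_of_ne h2]
    rw [this]
    exact .nil _
  · rw [List.append_eq, List.map_nil, List.nil_append, List.map_map] at e2
    convert e2 using 2
    rw [List.nil_append]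
    exact List.map_congr_left fun v _ => by cases v <;> rfl

theorem Good.wireVert_wireVert {o : Bool} {a b c : ℕ} (h : Good ([wireVert o a b, wireVert o b c] ++ C))
    (hc : c ≠ b) : VEq ([wireVert o a b, wireVert o b c] ++ C)
      ([wireVert o a c] ++ C) := by
  have h1 := Good.wireVert_contract (F := [wireVert o b c]) h
    (by cases o <;> simp [wireVert, ins, outs, netP, Vert.pairs])
  rwa [List.map_cons, wireVert_map, sub_self, sub_of_ne hc] at h1

theorem invariant_bar_bar : Invariant [bar 0, bar 0] [] := by
  intro s t V C N h1 h2 h3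
  simp only [run_cons, run_nil, lrun_bar_zero] at h1
  obtain ⟨_, _, _, _, _, ⟨o, a, a1, r, rfl, rfl, rfl, rfl⟩, ⟨_, _, _, _, _,
    ⟨o', a', a2, r', h, rfl, rfl, rfl⟩, ⟨rfl, rfl, rfl⟩, rfl, rfl⟩, rfl, rfl⟩ := h1
  simp only [List.cons.injEq, Prod.mk.injEq] at h
  obtain ⟨⟨rfl, rfl⟩, rfl⟩ := h
  simp [labels, List.nodup_append] at h2
  exact VEq.invariant_one h3.barVert_bar (by omega)

theorem invariant_real_bigon {c : Crossing} (hc : c.IsReal) :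
    Invariant [cross 0 c, cross 0 c.switch] [] := by
  intro s t V C N h1 h2 h3
  simp only [run_cons, run_nil, lrun_cross_zero hc.ne_virtual,
    lrun_cross_zero (c := c.switch) hc.turn.ne_virtual] at h1
  obtain ⟨_, _, _, _, _, ⟨o, x, p, y, r, x1, y1, rfl, rfl, rfl, rfl⟩, ⟨_, _, _, _, _,
    ⟨p', y', o', x', r', y2, x2, e, rfl, rfl, rfl⟩, ⟨rfl, rfl, rfl⟩, rfl, rfl⟩, rfl, rfl⟩ := h1
  simp only [List.cons.injEq, Prod.mk.injEq] at e
  obtain ⟨⟨rfl, rfl⟩, ⟨rfl, rfl⟩, rfl⟩ := e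
  simp [labels, List.nodup_append] at h2
  exact VEq.invariant_two (Good.crossVert_bigon hc h3) (by omega) (by omega) (by omega) (by omega)

theorem invariant_virtual_bigon : Invariant [cross 0 .virtual, cross 0 .virtual] [] := by
  intro s t V C N h1 h2 h3
  simp only [run_cons, run_nil, lrun_virt_zero] at h1
  obtain ⟨_, _, _, _, _, ⟨o, x, p, y, r, rfl, rfl, rfl, rfl⟩, ⟨_, _, _, _, _,
    ⟨p', y', o', x', r', e, rfl, rfl, rfl⟩, ⟨rfl, rfl, rfl⟩, rfl, rfl⟩, rfl, rfl⟩ := h1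
  simp only [List.cons.injEq, Prod.mk.injEq] at e
  obtain ⟨⟨rfl, rfl⟩, ⟨rfl, rfl⟩, rfl⟩ := e
  exact invariant_of (.nil _) h3.refl

theorem invariant_zigzag_left (o : Bool) : Invariant [birth 0 o, death 1] [] := by
  intro s t V C N h1 h2 h3
  simp only [run_cons, run_nil, lrun_birth_zero, lrun_death_one] at h1
  obtain ⟨_, _, _, _, _, ⟨a, b, rfl, rfl, rfl⟩, ⟨_, _, _, _, _,
    ⟨q, r, o', b', c, e, rfl, rfl, rfl⟩, ⟨rfl, rfl, rfl⟩, rfl, rfl⟩, rfl, rfl⟩ := h1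
  simp only [List.cons.injEq, Prod.mk.injEq] at e
  obtain ⟨rfl, ⟨rfl, rfl⟩, rfl⟩ := e
  rw [Bool.not_not] at h2 ⊢
  simp [labels, List.nodup_append] at h2
  have h4 := h3.wireVert_wireVert (by omega)
  rw [wireVert_swap (!o) a c, Bool.not_not] at h4
  exact VEq.invariant_one h4 (by omega)

theorem invariant_zigzag_right (o : Bool) : Invariant [birth 1 o, death 0] [] := by
  intro s t V C N h1 h2 h3
  simp only [run_cons, run_nil, lrun_birth_one, lrun_death_zero] at h1
  obtain ⟨_, _, _, _, _, ⟨q, r, a, b, rfl, rfl, rfl, rfl⟩, ⟨_, _, _, _, _,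
    ⟨q, c, a', e, rfl, rfl⟩, ⟨rfl, rfl, rfl⟩, rfl, rfl⟩, rfl, rfl⟩ := h1
  simp only [List.cons.injEq, Prod.mk.injEq] at e
  obtain ⟨rfl, ⟨rfl, rfl⟩, rfl⟩ := e
  rw [Bool.not_not] at h3 ⊢
  simp [labels, List.nodup_append] at h2
  have h4 := Good.wireVert_wireVert (h3.of_perm (.swap _ _ _)) (by omega)
  exact VEq.invariant_one (h4.of_perm (.swap _ _ _) (.refl _)) (by omega)

theorem invariant_triangle {c d : Crossing} (hc : c.IsReal) (hd : d ≠ .virtual) :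
    Invariant [cross 0 c, cross 1 c, cross 0 d] [cross 1 d, cross 0 c, cross 1 c] := by
  intro s t V C N h1 h2 h3
  have hc' := hc.ne_virtual
  simp only [run_cons, run_nil, lrun_cross_zero hc', lrun_cross_one hc', lrun_cross_zero hd] at h1
  obtain ⟨_, _, _, _, _, ⟨o, x, p, y, r, x1, y1, rfl, rfl, rfl, rfl⟩, ⟨_, _, _, _, _,
    ⟨q₂, o₂, x₂, q, z, r₂, x2, z1, e1, rfl, rfl, rfl⟩, ⟨_, _, _, _, _,
    ⟨p₃, y₃, q₃, z₃, r₃, y2, z2, e2, rfl, rfl, rfl⟩, ⟨rfl, rfl, rfl⟩, rfl, rfl⟩, rfl, rfl⟩,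
    rfl, rfl⟩ := h1
  simp only [List.cons.injEq, Prod.mk.injEq] at e1
  obtain ⟨rfl, ⟨rfl, rfl⟩, rfl⟩ := e1
  simp only [List.cons.injEq, Prod.mk.injEq] at e2
  obtain ⟨⟨rfl, rfl⟩, ⟨rfl, rfl⟩, rfl⟩ := e2
  have r1 := Run.cons ((lrun_cross_one hd).2 ⟨(o, x), p, y, q, z, r₂, y1, z1, rfl, rfl, rfl, rfl⟩)
    (.two ((lrun_cross_zero hc').2 ⟨o, x, q, z1, _, x1, z2, rfl, rfl, rfl, rfl⟩)
    ((lrun_cross_one hc').2 ⟨_, o, x1, p, y1, _, x2, y2, rfl, rfl, rfl, rfl⟩))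
  exact invariant_of r1 (Good.crossVert_triangle hc hd h3)

/-- Virtual crossings have no vertices and strands keep their labels there, so both sides have the
same Gauss diagram. -/
theorem invariant_virtual_triangle (c : Crossing) :
    Invariant [cross 0 .virtual, cross 1 c, cross 0 .virtual]
      [cross 1 .virtual, cross 0 c, cross 1 .virtual] := by
  intro s t V C N h1 h2 h3
  by_cases hc : c = .virtual
  · subst hc
    simp only [run_cons, run_nil, lrun_virt_zero, lrun_virt_one] at h1
    obtain ⟨_, _, _, _, _, ⟨o, x, p, y, r, rfl, rfl, rfl, rfl⟩, ⟨_, _, _, _, _,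
      ⟨q₂, o₂, x₂, q, z, r₂, e1, rfl, rfl, rfl⟩, ⟨_, _, _, _, _,
      ⟨p₃, y₃, q₃, z₃, r₃, e2, rfl, rfl, rfl⟩, ⟨rfl, rfl, rfl⟩, rfl, rfl⟩, rfl, rfl⟩,
      rfl, rfl⟩ := h1
    simp only [List.cons.injEq, Prod.mk.injEq] at e1
    obtain ⟨rfl, ⟨rfl, rfl⟩, rfl⟩ := e1
    simp only [List.cons.injEq, Prod.mk.injEq] at e2
    obtain ⟨⟨rfl, rfl⟩, ⟨rfl, rfl⟩, rfl⟩ := e2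
    have r1 := Run.cons (lrun_virt_one.2 ⟨(o, x), p, y, q, z, r₂, rfl, rfl, rfl, rfl⟩)
      (.two (lrun_virt_zero.2 ⟨o, x, q, z, _, rfl, rfl, rfl, rfl⟩)
      (lrun_virt_one.2 ⟨_, o, x, p, y, _, rfl, rfl, rfl, rfl⟩))
    exact invariant_of r1 h3.refl
  · simp only [run_cons, run_nil, lrun_virt_zero, lrun_cross_one hc] at h1
    obtain ⟨_, _, _, _, _, ⟨o, x, p, y, r, rfl, rfl, rfl, rfl⟩, ⟨_, _, _, _, _,
      ⟨q₂, o₂, x₂, q, z, r₂, x1, z1, e1, rfl, rfl, rfl⟩, ⟨_, _, _, _, _,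
      ⟨p₃, y₃, q₃, z₃, r₃, e2, rfl, rfl, rfl⟩, ⟨rfl, rfl, rfl⟩, rfl, rfl⟩, rfl, rfl⟩,
      rfl, rfl⟩ := h1
    simp only [List.cons.injEq, Prod.mk.injEq] at e1
    obtain ⟨rfl, ⟨rfl, rfl⟩, rfl⟩ := e1
    simp only [List.cons.injEq, Prod.mk.injEq] at e2
    obtain ⟨⟨rfl, rfl⟩, ⟨rfl, rfl⟩, rfl⟩ := e2
    have r1 := Run.cons (lrun_virt_one.2 ⟨(o, x), p, y, q, z, r₂, rfl, rfl, rfl, rfl⟩)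
      (.two ((lrun_cross_zero hc).2 ⟨o, x, q, z, _, x1, z1, rfl, rfl, rfl, rfl⟩)
      (lrun_virt_one.2 ⟨_, o, x1, p, y, _, rfl, rfl, rfl, rfl⟩))
    exact invariant_of r1 h3.refl

theorem invariant_singular_flip {c : Crossing} (hc : c.IsReal) :
    Invariant [cross 0 c, cross 0 .singular] [cross 0 .singular, cross 0 c] := by
  intro s t V C N h1 h2 h3
  have hs : Crossing.singular ≠ .virtual := by simp
  simp only [run_cons, run_nil, lrun_cross_zero hc.ne_virtual, lrun_cross_zero hs] at h1
  obtain ⟨_, _, _, _, _, ⟨o, x, p, y, r, x1, y1, rfl, rfl, rfl, rfl⟩, ⟨_, _, _, _, _,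
    ⟨p', y', o', x', r', y2, x2, e, rfl, rfl, rfl⟩, ⟨rfl, rfl, rfl⟩, rfl, rfl⟩, rfl, rfl⟩ := h1
  simp only [List.cons.injEq, Prod.mk.injEq] at e
  obtain ⟨⟨rfl, rfl⟩, ⟨rfl, rfl⟩, rfl⟩ := e
  have r1 := Run.two ((lrun_cross_zero hs).2 ⟨o, x, p, y, r, x1, y1, rfl, rfl, rfl, rfl⟩)
    ((lrun_cross_zero hc.ne_virtual).2 ⟨p, y1, o, x1, r, y2, x2, rfl, rfl, rfl, rfl⟩)
  exact invariant_of r1 (Good.crossVert_flip hc h3)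

theorem invariant_bar_virtual_left :
    Invariant [bar 0, cross 0 .virtual] [cross 0 .virtual, bar 1] := by
  intro s t V C N h1 h2 h3
  simp only [run_cons, run_nil, lrun_virt_zero, lrun_bar_zero] at h1
  obtain ⟨_, _, _, _, _, ⟨o, x, x1, r, rfl, rfl, rfl, rfl⟩, ⟨_, _, _, _, _,
    ⟨o', x', p, y, r', e, rfl, rfl, rfl⟩, ⟨rfl, rfl, rfl⟩, rfl, rfl⟩, rfl, rfl⟩ := h1
  simp only [List.cons.injEq, Prod.mk.injEq] at e
  obtain ⟨⟨rfl, rfl⟩, rfl⟩ := e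
  have r1 := Run.two (lrun_virt_zero.2 ⟨o, x, p, y, r', rfl, rfl, rfl, rfl⟩)
    (lrun_bar_one.2 ⟨(p, y), o, x, x1, r', rfl, rfl, rfl, rfl⟩)
  exact invariant_of r1 h3.refl

theorem invariant_bar_virtual_right :
    Invariant [bar 1, cross 0 .virtual] [cross 0 .virtual, bar 0] := by
  intro s t V C N h1 h2 h3
  simp only [run_cons, run_nil, lrun_virt_zero, lrun_bar_one] at h1
  obtain ⟨_, _, _, _, _, ⟨q, p, y, y1, r, rfl, rfl, rfl, rfl⟩, ⟨_, _, _, _, _,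
    ⟨o, x, p', y', r', e, rfl, rfl, rfl⟩, ⟨rfl, rfl, rfl⟩, rfl, rfl⟩, rfl, rfl⟩ := h1
  simp only [List.cons.injEq, Prod.mk.injEq] at e
  obtain ⟨rfl, ⟨rfl, rfl⟩, rfl⟩ := e
  have r1 := Run.two (lrun_virt_zero.2 ⟨o, x, p, y, r, rfl, rfl, rfl, rfl⟩)
    (lrun_bar_zero.2 ⟨p, y, y1, _, rfl, rfl, rfl, rfl⟩)
  exact invariant_of r1 h3.refl

theorem invariant_bar_twist {c : Crossing} (hc : c ≠ .virtual) :
    Invariant [bar 1, bar 0, cross 0 c, bar 0, bar 1]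
      [cross 0 .virtual, cross 0 c, cross 0 .virtual] := by
  intro s t V C N h1 h2 h3
  simp only [run_cons, run_nil, lrun_cross_zero hc, lrun_bar_one, lrun_bar_zero] at h1
  obtain ⟨_, _, _, _, _, ⟨q, p, y, y1, r, rfl, rfl, rfl, rfl⟩, ⟨_, _, _, _, _,
    ⟨o, x, x1, r, e1, rfl, rfl, rfl⟩, ⟨_, _, _, _, _,
    ⟨_, _, _, _, _, x2, y2, e2, rfl, rfl, rfl⟩, ⟨_, _, _, _, _,
    ⟨_, _, y3, _, e3, rfl, rfl, rfl⟩, ⟨_, _, _, _, _,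
    ⟨_, _, _, x3, _, e4, rfl, rfl, rfl⟩, ⟨rfl, rfl, rfl⟩, rfl, rfl⟩, rfl, rfl⟩, rfl, rfl⟩,
    rfl, rfl⟩, rfl, rfl⟩ := h1
  simp only [List.cons.injEq, Prod.mk.injEq] at e1 e2 e3 e4
  obtain ⟨rfl, rfl⟩ := e1
  simp only [List.cons.injEq, Prod.mk.injEq] at e2
  obtain ⟨⟨rfl, rfl⟩, ⟨rfl, rfl⟩, rfl⟩ := e2
  obtain ⟨⟨rfl, rfl⟩, rfl⟩ := e3
  simp only [List.cons.injEq, Prod.mk.injEq] at e4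
  obtain ⟨rfl, ⟨rfl, rfl⟩, rfl⟩ := e4
  have r1 := Run.cons (lrun_virt_zero.2 ⟨o, x, p, y, r, rfl, rfl, rfl, rfl⟩)
    (.two ((lrun_cross_zero hc).2 ⟨p, y, o, x, r, y3, x3, rfl, rfl, rfl, rfl⟩)
      (lrun_virt_zero.2 ⟨o, x3, p, y3, r, rfl, rfl, rfl, rfl⟩))
  exact invariant_of r1 (Good.crossVert_twist hc h3)

end

end SingTwist

/-! ### Local moves at maxima and minima -/

namespace SingTwist

open Layer Crossing

/-- Contracting the wire of the maximum leaves the same vertex on both sides: in `crossVert` the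
quarter turn of the decoration is compensated by the opposite orientation of the other leg. -/
theorem invariant_birth_cross (o : Bool) (c : Crossing) :
    Invariant [birth 0 o, cross 1 c] [birth 1 o, cross 0 c.turn] := by
  intro s t V C N h1 h2 h3
  by_cases hc : c = .virtual
  · subst hc
    simp only [run_cons, run_nil, lrun_birth_zero, lrun_virt_one] at h1
    obtain ⟨_, _, _, _, _, ⟨a, b, rfl, rfl, rfl⟩, ⟨_, _, _, _, _,
      ⟨_, _, _, q, z, r, e, rfl, rfl, rfl⟩, ⟨rfl, rfl, rfl⟩, rfl, rfl⟩, rfl, rfl⟩ := h1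
    simp only [List.cons.injEq, Prod.mk.injEq] at e
    obtain ⟨rfl, ⟨rfl, rfl⟩, rfl⟩ := e
    have r1 := Run.two (lrun_birth_one.2 ⟨(q, z), r, a, b, rfl, rfl, rfl, rfl⟩)
      (lrun_virt_zero.2 ⟨q, z, o, a, _, rfl, rfl, rfl, rfl⟩)
    exact invariant_of r1 h3.refl
  · simp only [run_cons, run_nil, lrun_birth_zero, lrun_cross_one hc] at h1
    obtain ⟨_, _, _, _, _, ⟨a, b, rfl, rfl, rfl⟩, ⟨_, _, _, _, _,
      ⟨_, _, _, q, z, r, b', z', e, rfl, rfl, rfl⟩, ⟨rfl, rfl, rfl⟩, rfl, rfl⟩, rfl, rfl⟩ := h1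
    simp only [List.cons.injEq, Prod.mk.injEq] at e
    obtain ⟨rfl, ⟨rfl, rfl⟩, rfl⟩ := e
    -- The labels are chosen so that the lower boundary stays as it was; `b` now names the part of
    -- the left leg above the crossing.
    have r1 := Run.two (lrun_birth_one.2 ⟨(q, z), r, b, b', rfl, rfl, rfl, rfl⟩)
      ((lrun_cross_zero (c := c.turn) (turn_ne_virtual hc)).2
        ⟨q, z, o, b, _, z', a, rfl, rfl, rfl, rfl⟩)
    refine invariant_of r1 ?_
    simp [labels, List.nodup_append] at h2
    have h4 := Good.wireVert_contract (F := [crossVert c (!o) q b b' z z']) h3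
      (by cases o <;> cases q <;> simp [crossVert, ins, outs, netP, Vert.pairs])
    have h5 : Good ([wireVert (!o) b b', crossVert c.turn q o z z' b a] ++ C) := by
      refine h3.congr_prefix ?_ ?_ <;> rw [List.perm_iff_count] <;> intro i <;> cases o <;>
        cases q <;> simp [ins, outs, netP, crossVert, wireVert, Vert.pairs, List.count_cons] <;>
        omega
    rw [wireVert_swap] at h5
    have h6 := Good.wireVert_contract (F := [crossVert c.turn q o z z' b a]) h5
      (by cases o <;> cases q <;> simp [crossVert, ins, outs, netP, Vert.pairs])
    rw [← wireVert_swap] at h6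
    refine h4.trans (VEq.trans ?_ h6.symm)
    simp only [List.map_cons, List.map_nil, crossVert_map, sub_self]
    rw [sub_of_ne (by omega), sub_of_ne (by omega), sub_of_ne (by omega), sub_of_ne (by omega),
      sub_of_ne (by omega), sub_of_ne (by omega)]
    have : crossVert c.turn q o z z' b' a = crossVert c (!o) q a b' z z' := by
      cases o <;> cases q <;> simp [crossVert, turn_turn]
    rw [this]
    have h7 := h4.good_right
    rw [List.map_cons, crossVert_map, sub_self, sub_of_ne (by omega), sub_of_ne (by omega),
      sub_of_ne (by omega)] at h7
    exact h7.refl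

theorem invariant_cross_death (c : Crossing) :
    Invariant [cross 1 c, death 0] [cross 0 c.turn, death 1] := by
  intro s t V C N h1 h2 h3
  by_cases hc : c = .virtual
  · subst hc
    simp only [run_cons, run_nil, lrun_death_zero, lrun_virt_one] at h1
    obtain ⟨_, _, _, _, _, ⟨_, o, x, p, y, r, rfl, rfl, rfl, rfl⟩, ⟨_, _, _, _, _,
      ⟨h, w, _, e, rfl, rfl⟩, ⟨rfl, rfl, rfl⟩, rfl, rfl⟩, rfl, rfl⟩ := h1
    simp only [List.cons.injEq, Prod.mk.injEq] at e
    obtain ⟨rfl, ⟨rfl, rfl⟩, rfl⟩ := e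
    have r1 := Run.two (lrun_virt_zero.2 ⟨h, w, o, x, (!h, y) :: r, rfl, rfl, rfl, rfl⟩)
      (lrun_death_one.2 ⟨(o, x), r, h, w, y, rfl, rfl, rfl, rfl⟩)
    exact invariant_of r1 h3.refl
  · simp only [run_cons, run_nil, lrun_death_zero, lrun_cross_one hc] at h1
    obtain ⟨_, _, _, _, _, ⟨_, o, x, p, y, r, x', y', rfl, rfl, rfl, rfl⟩, ⟨_, _, _, _, _,
      ⟨h, w, _, e, rfl, rfl⟩, ⟨rfl, rfl, rfl⟩, rfl, rfl⟩, rfl, rfl⟩ := h1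
    simp only [List.cons.injEq, Prod.mk.injEq] at e
    obtain ⟨rfl, ⟨rfl, rfl⟩, rfl⟩ := e
    have r1 := Run.two ((lrun_cross_zero (c := c.turn) (turn_ne_virtual hc)).2
        ⟨h, w, o, x, (!h, y) :: r, y', x', rfl, rfl, rfl, rfl⟩)
      (lrun_death_one.2 ⟨(o, x'), r, h, y', y, rfl, rfl, rfl, rfl⟩)
    refine invariant_of r1 ?_
    simp [labels, List.nodup_append] at h2
    have h4 := Good.wireVert_contract (F := [crossVert c o (!h) x x' y y'])
      (o := h) (a := w) (b := y') (h3.of_perm (.swap _ _ _))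
      (by cases o <;> cases h <;> simp [crossVert, ins, outs, netP, Vert.pairs])
    have h5 : Good ([crossVert c.turn h o w y' x x', wireVert h y' y] ++ C) := by
      refine h3.congr_prefix ?_ ?_ <;> rw [List.perm_iff_count] <;> intro i <;> cases o <;>
        cases h <;> simp [ins, outs, netP, crossVert, wireVert, Vert.pairs, List.count_cons] <;>
        omega
    rw [wireVert_swap] at h5
    have h6 := Good.wireVert_contract (F := [crossVert c.turn h o w y' x x'])
      (o := !h) (a := y) (b := y') (h5.of_perm (.swap _ _ _))
      (by cases o <;> cases h <;> simp [crossVert, ins, outs, netP, Vert.pairs])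
    rw [← wireVert_swap] at h6
    refine VEq.trans (h4.of_perm (.swap _ _ _) (.refl _)) (VEq.trans ?_
      (h6.of_perm (.swap _ _ _) (.refl _)).symm)
    simp only [List.map_cons, List.map_nil, crossVert_map, sub_self]
    rw [sub_of_ne (by omega), sub_of_ne (by omega), sub_of_ne (by omega), sub_of_ne (by omega),
      sub_of_ne (by omega), sub_of_ne (by omega)]
    have : crossVert c.turn h o w y x x' = crossVert c o (!h) x x' y w := by
      cases o <;> cases h <;> simp [crossVert, turn_turn]
    rw [this]
    have h7 := h4.good_right
    rw [List.map_cons, crossVert_map, sub_self, sub_of_ne (by omega), sub_of_ne (by omega),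
      sub_of_ne (by omega)] at h7
    exact h7.refl

theorem barVert_swap (o : Bool) (a b : ℕ) : barVert o a b = barVert (!o) b a := by
  cases o <;> rfl

/-- Contraction of the wire leaves one bar on the strand through the maximum, whichever leg carried
it. -/
theorem invariant_birth_bar (o : Bool) : Invariant [birth 0 o, bar 0] [birth 0 o, bar 1] := by
  intro s t V C N h1 h2 h3
  simp only [run_cons, run_nil, lrun_birth_zero, lrun_bar_zero] at h1
  obtain ⟨_, _, _, _, _, ⟨a, b, rfl, rfl, rfl⟩, ⟨_, _, _, _, _,
    ⟨_, _, a', _, e, rfl, rfl, rfl⟩, ⟨rfl, rfl, rfl⟩, rfl, rfl⟩, rfl, rfl⟩ := h1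
  simp only [List.cons.injEq, Prod.mk.injEq] at e
  obtain ⟨⟨rfl, rfl⟩, rfl⟩ := e
  have r1 := Run.two (lrun_birth_zero.2 ⟨a', a, rfl, rfl, rfl⟩)
    (lrun_bar_one.2 ⟨(o, a'), !o, a, b, s, rfl, rfl, rfl, rfl⟩)
  refine invariant_of r1 ?_
  simp [labels, List.nodup_append] at h2
  have h3' := h3
  rw [wireVert_swap] at h3
  have h4 := Good.wireVert_contract (F := [barVert o a a']) h3
    (by cases o <;> simp [barVert, ins, outs, netP, Vert.pairs])
  have h5 : Good ([wireVert (!o) a' a, barVert (!o) a b] ++ C) := by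
    refine h3'.congr_prefix ?_ ?_ <;> rw [List.perm_iff_count] <;> intro i <;> cases o <;>
      simp [ins, outs, netP, barVert, wireVert, Vert.pairs, List.count_cons] <;> omega
  have h6 := Good.wireVert_contract (F := [barVert (!o) a b]) h5
    (by cases o <;> simp [barVert, ins, outs, netP, Vert.pairs])
  rw [← wireVert_swap] at h4
  refine h4.trans (VEq.trans ?_ h6.symm)
  simp only [List.map_cons, List.map_nil, barVert_map, sub_self]
  rw [sub_of_ne (by omega), sub_of_ne (by omega), barVert_swap (!o), Bool.not_not]
  have := h4.good_right
  rw [List.map_cons, barVert_map, sub_self, sub_of_ne (by omega)] at this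
  exact this.refl

theorem invariant_bar_death : Invariant [bar 0, death 0] [bar 1, death 0] := by
  intro s t V C N h1 h2 h3
  simp only [run_cons, run_nil, lrun_death_zero, lrun_bar_zero] at h1
  obtain ⟨_, _, _, _, _, ⟨o, x, x', r, rfl, rfl, rfl, rfl⟩, ⟨_, _, _, _, _,
    ⟨_, _, y, e, rfl, rfl⟩, ⟨rfl, rfl, rfl⟩, rfl, rfl⟩, rfl, rfl⟩ := h1
  simp only [List.cons.injEq, Prod.mk.injEq] at e
  obtain ⟨⟨rfl, rfl⟩, rfl⟩ := e
  have r1 := Run.two (lrun_bar_one.2 ⟨(o, x), !o, y, x', t, rfl, rfl, rfl, rfl⟩)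
    (lrun_death_zero.2 ⟨o, x, x', rfl, rfl, rfl⟩)
  refine invariant_of r1 ?_
  simp [labels, List.nodup_append] at h2
  have h3' := h3
  rw [wireVert_swap] at h3
  have h4 := Good.wireVert_contract (F := [barVert o x x'])
    (o := !o) (a := y) (b := x') (h3.of_perm (.swap _ _ _))
    (by cases o <;> simp [barVert, ins, outs, netP, Vert.pairs])
  have h5 : Good ([barVert (!o) y x', wireVert o x x'] ++ C) := by
    refine h3'.congr_prefix ?_ ?_ <;> rw [List.perm_iff_count] <;> intro i <;> cases o <;>
      simp [ins, outs, netP, barVert, wireVert, Vert.pairs, List.count_cons] <;> omega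
  have h6 := Good.wireVert_contract (F := [barVert (!o) y x'])
    (o := o) (a := x) (b := x') (h5.of_perm (.swap _ _ _))
    (by cases o <;> simp [barVert, ins, outs, netP, Vert.pairs])
  rw [← wireVert_swap] at h4
  refine VEq.trans (h4.of_perm (.swap _ _ _) (.refl _)) (VEq.trans ?_
    (h6.of_perm (.swap _ _ _) (.refl _)).symm)
  simp only [List.map_cons, List.map_nil, barVert_map, sub_self]
  rw [sub_of_ne (by omega), sub_of_ne (by omega), barVert_swap (!o), Bool.not_not]
  have := h4.good_right
  rw [List.map_cons, barVert_map, sub_self, sub_of_ne (by omega)] at this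
  exact this.refl

/-- The wires of the maximum and the minimum form one strand that leaves the crossing and returns to
it. Contracting it gives a kink vertex. -/
theorem invariant_real_kink_right (o : Bool) {c : Crossing} (hc : c.IsReal) :
    Invariant [birth 1 o, cross 0 c, death 1] [] := by
  intro s t V C N h1 h2 h3
  simp only [run_cons, run_nil, lrun_birth_one, lrun_cross_zero hc.ne_virtual, lrun_death_one] at h1
  obtain ⟨_, _, _, _, _, ⟨⟨q, z⟩, r, a, b, rfl, rfl, rfl, rfl⟩, ⟨_, _, _, _, _,
    ⟨_, _, _, _, _, z', a', e, rfl, rfl, rfl⟩, ⟨_, _, _, _, _,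
    ⟨_, _, _, _, _, e', rfl, rfl, rfl⟩, ⟨rfl, rfl, rfl⟩, rfl, rfl⟩, rfl, rfl⟩, rfl, rfl⟩ := h1
  simp only [List.cons.injEq, Prod.mk.injEq] at e
  obtain ⟨⟨rfl, rfl⟩, ⟨rfl, rfl⟩, rfl⟩ := e
  simp only [List.cons.injEq, Prod.mk.injEq, Bool.not_inj_iff] at e'
  obtain ⟨rfl, ⟨rfl, rfl⟩, ⟨rfl, rfl⟩, rfl⟩ := e'
  simp [labels, List.nodup_append] at h2
  rw [wireVert_swap (!o) a b, Bool.not_not] at h3 ⊢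
  have p1 : ([wireVert o b a, crossVert c o o z z' a a', wireVert o z' b] ++ C).Perm
      ([wireVert o z' b, wireVert o b a] ++ (crossVert c o o z z' a a' :: C)) :=
    (List.perm_append_comm (l₁ := [wireVert o b a, crossVert c o o z z' a a'])
      (l₂ := [wireVert o z' b])).append_right C
  have h4 := Good.wireVert_wireVert (h3.of_perm p1) (by omega)
  have h5 := Good.wireVert_contract (F := [crossVert c o o z z' a a']) h4.good_right
    (by cases o <;> simp [crossVert, ins, outs, netP, Vert.pairs])
  rw [List.map_cons, crossVert_map, sub_self, sub_of_ne (by omega), sub_of_ne (by omega),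
    sub_of_ne (by omega)] at h5
  have h6 := (h4.trans h5).trans (Good.crossVert_kink_right hc h5.good_right)
  exact VEq.invariant_one (h6.of_perm p1.symm (.refl _)) (by omega)

theorem invariant_real_kink_left (o : Bool) {c : Crossing} (hc : c.IsReal) :
    Invariant [birth 0 o, cross 1 c, death 0] [] := by
  intro s t V C N h1 h2 h3
  simp only [run_cons, run_nil, lrun_birth_zero, lrun_cross_one hc.ne_virtual, lrun_death_zero] at h1
  obtain ⟨_, _, _, _, _, ⟨a, b, rfl, rfl, rfl⟩, ⟨_, _, _, _, _,
    ⟨_, _, _, q, z, r, b', z', e, rfl, rfl, rfl⟩, ⟨_, _, _, _, _,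
    ⟨_, _, _, e', rfl, rfl⟩, ⟨rfl, rfl, rfl⟩, rfl, rfl⟩, rfl, rfl⟩, rfl, rfl⟩ := h1
  simp only [List.cons.injEq, Prod.mk.injEq] at e
  obtain ⟨rfl, ⟨rfl, rfl⟩, rfl⟩ := e
  simp only [List.cons.injEq, Prod.mk.injEq] at e'
  obtain ⟨⟨rfl, rfl⟩, ⟨rfl, rfl⟩, rfl⟩ := e'
  simp [labels, List.nodup_append] at h2
  rw [wireVert_swap o a z'] at h3 ⊢
  have p1 : ([wireVert (!o) a b, crossVert c (!o) (!o) b b' z z', wireVert (!o) z' a] ++ C).Perm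
      ([wireVert (!o) z' a, wireVert (!o) a b] ++ (crossVert c (!o) (!o) b b' z z' :: C)) :=
    (List.perm_append_comm (l₁ := [wireVert (!o) a b, crossVert c (!o) (!o) b b' z z'])
      (l₂ := [wireVert (!o) z' a])).append_right C
  have h4 := Good.wireVert_wireVert (h3.of_perm p1) (by omega)
  have h5 := Good.wireVert_contract (F := [crossVert c (!o) (!o) b b' z z']) h4.good_right
    (by cases o <;> simp [crossVert, ins, outs, netP, Vert.pairs])
  rw [List.map_cons, crossVert_map, sub_self, sub_of_ne (by omega), sub_of_ne (by omega),
    sub_of_ne (by omega)] at h5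
  have h6 := (h4.trans h5).trans (Good.crossVert_kink_left hc h5.good_right)
  exact VEq.invariant_one (h6.of_perm p1.symm (.refl _)) (by omega)

theorem invariant_virtual_kink_right (o : Bool) :
    Invariant [birth 1 o, cross 0 .virtual, death 1] [] := by
  intro s t V C N h1 h2 h3
  simp only [run_cons, run_nil, lrun_birth_one, lrun_virt_zero, lrun_death_one] at h1
  obtain ⟨_, _, _, _, _, ⟨⟨q, z⟩, r, a, b, rfl, rfl, rfl, rfl⟩, ⟨_, _, _, _, _,
    ⟨_, _, _, _, _, e, rfl, rfl, rfl⟩, ⟨_, _, _, _, _,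
    ⟨_, _, _, _, _, e', rfl, rfl, rfl⟩, ⟨rfl, rfl, rfl⟩, rfl, rfl⟩, rfl, rfl⟩, rfl, rfl⟩ := h1
  simp only [List.cons.injEq, Prod.mk.injEq] at e
  obtain ⟨⟨rfl, rfl⟩, ⟨rfl, rfl⟩, rfl⟩ := e
  simp only [List.cons.injEq, Prod.mk.injEq, Bool.not_inj_iff] at e'
  obtain ⟨rfl, ⟨rfl, rfl⟩, ⟨rfl, rfl⟩, rfl⟩ := e'
  simp [labels, List.nodup_append] at h2
  rw [wireVert_swap (!o) a b, Bool.not_not] at h3 ⊢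
  have h4 := Good.wireVert_wireVert (h3.of_perm (.swap _ _ _)) (by omega)
  exact VEq.invariant_one (h4.of_perm (.swap _ _ _) (.refl _)) (by omega)

theorem invariant_virtual_kink_left (o : Bool) :
    Invariant [birth 0 o, cross 1 .virtual, death 0] [] := by
  intro s t V C N h1 h2 h3
  simp only [run_cons, run_nil, lrun_birth_zero, lrun_virt_one, lrun_death_zero] at h1
  obtain ⟨_, _, _, _, _, ⟨a, b, rfl, rfl, rfl⟩, ⟨_, _, _, _, _,
    ⟨_, _, _, q, z, r, e, rfl, rfl, rfl⟩, ⟨_, _, _, _, _,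
    ⟨_, _, _, e', rfl, rfl⟩, ⟨rfl, rfl, rfl⟩, rfl, rfl⟩, rfl, rfl⟩, rfl, rfl⟩ := h1
  simp only [List.cons.injEq, Prod.mk.injEq] at e
  obtain ⟨rfl, ⟨rfl, rfl⟩, rfl⟩ := e
  simp only [List.cons.injEq, Prod.mk.injEq] at e'
  obtain ⟨⟨rfl, rfl⟩, ⟨rfl, rfl⟩, rfl⟩ := e'
  simp [labels, List.nodup_append] at h2
  rw [wireVert_swap o a z] at h3 ⊢
  have h4 := Good.wireVert_wireVert (h3.of_perm (.swap _ _ _)) (by omega)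
  exact VEq.invariant_one (h4.of_perm (.swap _ _ _) (.refl _)) (by omega)

theorem LocalMove.invariant {L R : List Layer} (h : LocalMove L R) : Invariant L R := by
  cases h with
  | exchange e f => exact invariant_exchange e f
  | zigzag_left i o =>
    simpa [Layer.shift, add_comm] using (invariant_zigzag_left o).shift i (by simp)
  | zigzag_right i o =>
    simpa [Layer.shift, add_comm] using (invariant_zigzag_right o).shift i (by simp)
  | birth_cross i o c =>
    simpa [Layer.shift, add_comm] using (invariant_birth_cross o c).shift i (by simp)
  | cross_death i c =>
    simpa [Layer.shift, add_comm] using (invariant_cross_death c).shift i (by simp)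
  | birth_bar i o =>
    simpa [Layer.shift, add_comm] using (invariant_birth_bar o).shift i (by simp)
  | bar_death i =>
    simpa [Layer.shift, add_comm] using invariant_bar_death.shift i (by simp)
  | real_kink_right i o c hc =>
    simpa [Layer.shift, add_comm] using (invariant_real_kink_right o hc).shift i (by simp)
  | real_kink_left i o c hc =>
    simpa [Layer.shift, add_comm] using (invariant_real_kink_left o hc).shift i (by simp)
  | real_bigon i c hc =>
    simpa [Layer.shift, add_comm] using (invariant_real_bigon hc).shift i (by simp)
  | real_triangle i c hc =>
    simpa [Layer.shift, add_comm] using (invariant_triangle hc hc.ne_virtual).shift i (by simp)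
  | virtual_kink_right i o =>
    simpa [Layer.shift, add_comm] using (invariant_virtual_kink_right o).shift i (by simp)
  | virtual_kink_left i o =>
    simpa [Layer.shift, add_comm] using (invariant_virtual_kink_left o).shift i (by simp)
  | virtual_bigon i =>
    simpa [Layer.shift, add_comm] using invariant_virtual_bigon.shift i (by simp)
  | virtual_triangle i c =>
    simpa [Layer.shift, add_comm] using (invariant_virtual_triangle c).shift i (by simp)
  | bar_virtual_left i =>
    simpa [Layer.shift, add_comm] using invariant_bar_virtual_left.shift i (by simp)
  | bar_virtual_right i =>
    simpa [Layer.shift, add_comm] using invariant_bar_virtual_right.shift i (by simp)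
  | bar_bar i =>
    simpa [Layer.shift, add_comm] using invariant_bar_bar.shift i (by simp)
  | bar_twist i c hc =>
    simpa [Layer.shift, add_comm] using (invariant_bar_twist hc).shift i (by simp)
  | singular_triangle i c hc =>
    simpa [Layer.shift, add_comm] using
      (invariant_triangle hc (d := .singular) (by simp)).shift i (by simp)
  | singular_flip i c hc =>
    simpa [Layer.shift, add_comm] using (invariant_singular_flip hc).shift i (by simp)

end SingTwist

namespace SingTwist

/-! ### The braid of the closure of a braid -/

section

variable {n : ℕ}

theorem ofFn_perm_one (i : Fin n) : ∃ L : List (Fin n), (∀ q ∈ L, q ≠ i) ∧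
    ∀ f : Fin n → ℕ × ℕ, (List.ofFn f).Perm (f i :: L.map f) := by
  refine ⟨(List.finRange n).erase i, fun q hq => ((List.nodup_finRange n).mem_erase_iff.1 hq).1,
    fun f => ?_⟩
  rw [List.ofFn_eq_map]
  exact (List.perm_cons_erase (List.mem_finRange i)).map f

theorem ofFn_perm_two {i j : Fin n} (h : i ≠ j) : ∃ L : List (Fin n), (∀ q ∈ L, q ≠ i ∧ q ≠ j) ∧
    ∀ f : Fin n → ℕ × ℕ, (List.ofFn f).Perm (f i :: f j :: L.map f) := by
  have nd := (List.nodup_finRange n).erase i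
  refine ⟨((List.finRange n).erase i).erase j, fun q hq => ?_, fun f => ?_⟩
  · have h1 := nd.mem_erase_iff.1 hq
    exact ⟨((List.nodup_finRange n).mem_erase_iff.1 h1.2).1, h1.1⟩
  · rw [List.ofFn_eq_map]
    exact ((List.perm_cons_erase (List.mem_finRange i)).trans (.cons _ (List.perm_cons_erase
      ((List.mem_erase_of_ne h.symm).2 (List.mem_finRange j))))).map f

/-- The strands at a level of a closed braid. -/
def strands (n : ℕ) (cur : ℕ → ℕ) (T : List (Bool × ℕ)) : List (Bool × ℕ) :=
  (List.range n).map (fun q => (true, cur q)) ++ T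

theorem strands_split_one {i : ℕ} (h : i < n) (cur : ℕ → ℕ) (T : List (Bool × ℕ)) :
    ∃ l r, l.length = i ∧ ∀ x, strands n (Function.update cur i x) T = l ++ (true, x) :: r := by
  obtain ⟨k, rfl⟩ := Nat.exists_eq_add_of_lt h
  refine ⟨(List.range i).map (fun q => (true, cur q)),
    (List.range k).map (fun q => (true, cur (i + 1 + q))) ++ T, by simp, fun x => ?_⟩
  rw [strands, show i + k + 1 = i + 1 + k by omega, List.range_add, List.range_succ]
  simp only [List.map_append, List.map_cons, Function.update_self, List.append_assoc,
    List.cons_append, List.nil_append, List.map_map]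
  congr 1
  · refine List.map_congr_left fun q hq => ?_
    rw [Function.update_of_ne (by have := List.mem_range.1 hq; omega)]
  · congr 2
    refine List.map_congr_left fun q hq => ?_
    simp only [Function.comp_apply]
    rw [Function.update_of_ne (by omega)]

/-- One decomposition serves the levels above and below a crossing: the level above is the case `x =
cur i`, `y = cur (i + 1)`. -/
theorem strands_split_two {i : ℕ} (h : i + 1 < n) (cur : ℕ → ℕ) (T : List (Bool × ℕ)) :
    ∃ l r, l.length = i ∧ ∀ x y, strands n (Function.update (Function.update cur i x) (i + 1) y) T =
      l ++ ([(true, x), (true, y)] ++ r) := by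
  obtain ⟨k, rfl⟩ := Nat.exists_eq_add_of_lt h
  refine ⟨(List.range i).map (fun q => (true, cur q)),
    (List.range k).map (fun q => (true, cur (i + 2 + q))) ++ T, by simp, fun x y => ?_⟩
  rw [strands, show i + 1 + k + 1 = i + 1 + 1 + k by omega, List.range_add, List.range_succ,
    List.range_succ]
  simp only [List.map_append, List.map_cons, Function.update_self, List.append_assoc,
    List.cons_append, List.nil_append, List.map_map]
  rw [Function.update_of_ne (by omega), Function.update_self]
  congr 1
  · refine List.map_congr_left fun q hq => ?_
    have := List.mem_range.1 hq
    rw [Function.update_of_ne (by omega), Function.update_of_ne (by omega)]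
  · congr 3
    refine List.map_congr_left fun q hq => ?_
    simp only [Function.comp_apply]
    rw [Function.update_of_ne (by omega), Function.update_of_ne (by omega)]

variable {cur : ℕ → ℕ} {T t : List (Bool × ℕ)} {W : List Vert} {N : List ℕ}

theorem LRun.of_append {e : Layer} {l s : List (Bool × ℕ)} (h : LRun e (l ++ s) W N t)
    (hl : l.length = e.pos) : ∃ u v r, s = u ++ r ∧ t = l ++ (v ++ r) ∧ Piece e u W N v := by
  obtain ⟨l', u, v, r, h1, h2, rfl, h3⟩ := h
  obtain ⟨rfl, rfl⟩ := List.append_inj h2 (hl.trans h1.symm)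
  exact ⟨u, v, r, rfl, rfl, h3⟩

theorem lrun_strands_virt {i : ℕ} (h : i + 1 < n)
    (hr : LRun (.cross i .virtual) (strands n cur T) W N t) :
    W = [] ∧ t = strands n (Function.update (Function.update cur i (cur (i + 1))) (i + 1) (cur i)) T := by
  obtain ⟨l, r, hl, hs⟩ := strands_split_two h cur T
  have e := hs (cur i) (cur (i + 1))
  rw [Function.update_eq_self, Function.update_eq_self] at e
  rw [e] at hr
  obtain ⟨u, v, r', h1, rfl, h2⟩ := hr.of_append hl
  obtain ⟨_, _, _, _, rfl, rfl, rfl, rfl⟩ := piece_virt.1 h2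
  simp only [List.cons_append, List.nil_append, List.cons.injEq, Prod.mk.injEq] at h1
  obtain ⟨⟨rfl, rfl⟩, ⟨rfl, rfl⟩, rfl⟩ := h1
  exact ⟨rfl, (hs _ _).symm⟩

theorem lrun_strands_cross {i : ℕ} (h : i + 1 < n) {c : Crossing} (hc : c ≠ .virtual)
    (hr : LRun (.cross i c) (strands n cur T) W N t) :
    ∃ x y, W = [.cross c (cur i) x (cur (i + 1)) y] ∧
      t = strands n (Function.update (Function.update cur i y) (i + 1) x) T := by
  obtain ⟨l, r, hl, hs⟩ := strands_split_two h cur T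
  have e := hs (cur i) (cur (i + 1))
  rw [Function.update_eq_self, Function.update_eq_self] at e
  rw [e] at hr
  obtain ⟨u, v, r', h1, rfl, h2⟩ := hr.of_append hl
  obtain ⟨_, _, _, _, x, y, rfl, rfl, rfl, rfl⟩ := (piece_cross hc).1 h2
  simp only [List.cons_append, List.nil_append, List.cons.injEq, Prod.mk.injEq] at h1
  obtain ⟨⟨rfl, rfl⟩, ⟨rfl, rfl⟩, rfl⟩ := h1
  exact ⟨x, y, rfl, (hs _ _).symm⟩

theorem lrun_strands_bar {i : ℕ} (h : i < n) (hr : LRun (.bar i) (strands n cur T) W N t) :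
    ∃ x, W = [.bar (cur i) x] ∧ t = strands n (Function.update cur i x) T := by
  obtain ⟨l, r, hl, hs⟩ := strands_split_one h cur T
  have e := hs (cur i)
  rw [Function.update_eq_self] at e
  rw [e] at hr
  obtain ⟨u, v, r', h1, rfl, h2⟩ := hr.of_append hl
  obtain ⟨_, _, x, rfl, rfl, rfl, rfl⟩ := piece_bar.1 h2
  simp only [List.cons_append, List.nil_append, List.cons.injEq, Prod.mk.injEq] at h1
  obtain ⟨⟨rfl, rfl⟩, rfl⟩ := h1
  exact ⟨x, rfl, (hs _).symm⟩

/-- The pairs of a partially absorbed braid. -/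
def openPairs (ℓ : Fin n → ℕ) (g : Equiv.Perm (Fin n)) (cur : ℕ → ℕ) : List (ℕ × ℕ) :=
  List.ofFn fun q => (ℓ (g q), cur q)

theorem openPairs_fst (ℓ : Fin n → ℕ) (g : Equiv.Perm (Fin n)) (cur : ℕ → ℕ) (b : Fin n) :
    ℓ b ∈ (openPairs ℓ g cur).map Prod.fst := by
  rw [openPairs, List.map_ofFn]
  exact List.mem_ofFn.2 ⟨g.symm b, by simp⟩

theorem not_mem_labels_map {ℓ : Fin n → ℕ} {z : ℕ} (h : ∀ b, ℓ b ≠ z) (F : List (Ev (Fin n))) :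
    ∀ e ∈ F.map (Ev.map ℓ), z ∉ e.labels := by
  intro e he hz
  obtain ⟨e, -, rfl⟩ := List.mem_map.1 he
  rw [Ev.labels_map] at hz
  obtain ⟨b, -, hb⟩ := List.mem_map.1 hz
  exact h b hb

/-- A virtual crossing changes no strand, only the position at which it is found. -/
theorem openPairs_virt {i : ℕ} (h : i + 1 < n) (ℓ : Fin n → ℕ) (g : Equiv.Perm (Fin n))
    (cur : ℕ → ℕ) : (openPairs ℓ g cur).Perm (openPairs ℓ (g * adj n i)
      (Function.update (Function.update cur i (cur (i + 1))) (i + 1) (cur i))) := by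
  refine (ofFn_comp_perm (fun q : Fin n => (ℓ (g q), cur q)) (adj n i)).symm.trans
    (List.Perm.of_eq (congrArg List.ofFn (funext fun q => ?_)))
  rw [Equiv.Perm.mul_apply, adj_val h]
  simp only [Function.update_apply]
  congr 1
  split_ifs <;> first | rfl | omega

theorem openPairs_cross {i : ℕ} (h : i + 1 < n) (ℓ : Fin n → ℕ) (g : Equiv.Perm (Fin n))
    (cur : ℕ → ℕ) : ∃ P₀, (openPairs ℓ g cur).Perm
      ((ℓ (g ⟨i, by omega⟩), cur i) :: (ℓ (g ⟨i + 1, h⟩), cur (i + 1)) :: P₀) ∧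
      ∀ x y, ((ℓ (g ⟨i, by omega⟩), x) :: (ℓ (g ⟨i + 1, h⟩), y) :: P₀).Perm
        (openPairs ℓ (g * adj n i) (Function.update (Function.update cur i y) (i + 1) x)) := by
  have hij : (⟨i, by omega⟩ : Fin n) ≠ ⟨i + 1, h⟩ := by simp [Fin.ext_iff]
  obtain ⟨L, hL, hp⟩ := ofFn_perm_two hij
  refine ⟨_, hp _, fun x y => ?_⟩
  refine List.Perm.trans ?_ (hp _).symm
  have e1 : adj n i ⟨i, by omega⟩ = ⟨i + 1, h⟩ := Fin.ext (by simp [adj_val h])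
  have e2 : adj n i ⟨i + 1, h⟩ = ⟨i, by omega⟩ := Fin.ext (by simp [adj_val h])
  simp only [Equiv.Perm.mul_apply, e1, e2, Function.update_self]
  rw [Function.update_of_ne (by omega), Function.update_self]
  refine (List.Perm.swap _ _ _).trans (.cons _ (.cons _ (.of_eq (List.map_congr_left fun q hq => ?_))))
  have h1 := hL q hq
  simp only [ne_eq, Fin.ext_iff] at h1
  rw [Function.update_of_ne h1.2, Function.update_of_ne h1.1]
  congr 3
  exact (Fin.ext (by rw [adj_val h, if_neg h1.1, if_neg h1.2])).symm

theorem openPairs_bar {i : ℕ} (h : i < n) (ℓ : Fin n → ℕ) (g : Equiv.Perm (Fin n))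
    (cur : ℕ → ℕ) : ∃ P₀, (openPairs ℓ g cur).Perm ((ℓ (g ⟨i, h⟩), cur i) :: P₀) ∧
      ∀ x, ((ℓ (g ⟨i, h⟩), x) :: P₀).Perm (openPairs ℓ g (Function.update cur i x)) := by
  obtain ⟨L, hL, hp⟩ := ofFn_perm_one (⟨i, h⟩ : Fin n)
  refine ⟨_, hp _, fun x => ?_⟩
  refine List.Perm.trans ?_ (hp _).symm
  simp only [Function.update_self]
  refine .cons _ (.of_eq (List.map_congr_left fun q hq => ?_))
  have h1 := hL q hq
  simp only [ne_eq, Fin.ext_iff] at h1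
  rw [Function.update_of_ne h1]

end

end SingTwist

/-! ### Absorbing the letters of a closed braid -/

namespace SingTwist

section

variable {n : ℕ} {ℓ : Fin n → ℕ} {g : Equiv.Perm (Fin n)} {F : List (Ev (Fin n))} {cur : ℕ → ℕ}
  {W : List Vert} {Q : List (ℕ × ℕ)}

theorem netEq_virt {i : ℕ} (h : i + 1 < n)
    (hv : Valid (F.map (Ev.map ℓ) ++ netE W) (openPairs ℓ g cur ++ (netP W ++ Q))) :
    NetEq (F.map (Ev.map ℓ) ++ netE W) (openPairs ℓ g cur ++ (netP W ++ Q))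
      (F.map (Ev.map ℓ) ++ netE W) (openPairs ℓ (g * adj n i)
        (Function.update (Function.update cur i (cur (i + 1))) (i + 1) (cur i)) ++ (netP W ++ Q)) :=
  hv.perm_pairs ((openPairs_virt h ℓ g cur).append_right _)

theorem Valid.open_disjoint {E : List (Ev ℕ)} {R : List (ℕ × ℕ)}
    (hv : Valid E (openPairs ℓ g cur ++ R)) (b : Fin n) : ℓ b ∉ R.map Prod.fst := by
  have h := hv.nodup
  rw [List.map_append] at h
  exact fun h' => List.disjoint_of_nodup_append h (openPairs_fst ℓ g cur b) h'

theorem netEq_bar {i x : ℕ} (h : i < n)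
    (hv : Valid (F.map (Ev.map ℓ) ++ netE (.bar (cur i) x :: W))
      (openPairs ℓ g cur ++ (netP (.bar (cur i) x :: W) ++ Q))) :
    NetEq (F.map (Ev.map ℓ) ++ netE (.bar (cur i) x :: W))
      (openPairs ℓ g cur ++ (netP (.bar (cur i) x :: W) ++ Q))
      ((F ++ [Ev.bar (g ⟨i, h⟩)]).map (Ev.map ℓ) ++ netE W)
      (openPairs ℓ g (Function.update cur i x) ++ (netP W ++ Q)) := by
  have hd := hv.open_disjoint
  have hn := hv.nodup
  simp only [List.map_append, netP, List.flatMap_cons, Vert.pairs, List.cons_append,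
    List.nil_append, List.map_cons, List.mem_cons, List.mem_append, not_or] at hd
  simp only [List.map_append, netP, List.flatMap_cons, Vert.pairs, List.cons_append,
    List.nil_append, List.map_cons] at hn
  have hn2 := (List.nodup_cons.1 hn.of_append_right).1
  rw [List.mem_append, not_or] at hn2
  obtain ⟨P₀, h1, h2⟩ := openPairs_bar h ℓ g cur
  have h3 := hv.netEq.merge (EC := netE W) (F.map (Ev.map ℓ)) [.bar (cur i)]
    [.bar (ℓ (g ⟨i, h⟩))] (P₀ ++ (netP W ++ Q)) (ℓ (g ⟨i, h⟩)) (cur i) x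
    (fun e he ha => (hd (g ⟨i, h⟩)).2.1 (mem_ins_of_netE he ha))
    (fun e he ha => hn2.1 (mem_ins_of_netE he ha)) rfl
    (by
      refine (h1.append_right _).trans (.cons _ ?_)
      exact List.perm_middle)
    (not_mem_labels_map (fun b => (hd b).1) F)
    (by simpa [Ev.labels] using (hd (g ⟨i, h⟩)).1) (by simp [Ev.map, sub_self])
  refine (h3.trans (h3.valid_right.perm_pairs ((h2 x).append_right _))).trans ?_
  have h4 := (h3.valid_right.of_perm ((h2 x).append_right _)).netEq
  simpa [Ev.map] using h4

/-- At every level the position `q` carries a long strand `ℓ (g q)`, whose present part has the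
label `cur q`. The two parts above the crossing are merged into their long strands, the parts below
become the present ones, and `g` records that the strands have changed places. -/
theorem netEq_cross {i x y : ℕ} (c : Crossing) (h : i + 1 < n) (hℓ : Function.Injective ℓ)
    (hv : Valid (F.map (Ev.map ℓ) ++ netE (.cross c (cur i) x (cur (i + 1)) y :: W))
      (openPairs ℓ g cur ++ (netP (.cross c (cur i) x (cur (i + 1)) y :: W) ++ Q))) :
    NetEq (F.map (Ev.map ℓ) ++ netE (.cross c (cur i) x (cur (i + 1)) y :: W))
      (openPairs ℓ g cur ++ (netP (.cross c (cur i) x (cur (i + 1)) y :: W) ++ Q))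
      ((F ++ [Ev.cross c (g ⟨i, by omega⟩) (g ⟨i + 1, h⟩)]).map (Ev.map ℓ) ++ netE W)
      (openPairs ℓ (g * adj n i) (Function.update (Function.update cur i y) (i + 1) x) ++
        (netP W ++ Q)) := by
  have hd := hv.open_disjoint
  have hn := hv.nodup
  simp only [List.map_append, netP, List.flatMap_cons, Vert.pairs, List.cons_append,
    List.nil_append, List.map_cons, List.mem_cons, List.mem_append, not_or] at hd
  simp only [List.map_append, netP, List.flatMap_cons, Vert.pairs, List.cons_append,
    List.nil_append, List.map_cons] at hn
  have hn2 := (List.nodup_cons.1 hn.of_append_right).1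
  have hn3 := (List.nodup_cons.1 (List.nodup_cons.1 hn.of_append_right).2).1
  rw [List.mem_cons, List.mem_append, not_or, not_or] at hn2
  rw [List.mem_append, not_or] at hn3
  obtain ⟨P₀, h1, h2⟩ := openPairs_cross h ℓ g cur
  have hne : ℓ (g ⟨i + 1, h⟩) ≠ ℓ (g ⟨i, by omega⟩) := fun e => by
    simpa using g.injective (hℓ e)
  have h3 := hv.netEq.merge (EC := netE W) (F.map (Ev.map ℓ)) [.cross c (cur i) (cur (i + 1))]
    [.cross c (ℓ (g ⟨i, by omega⟩)) (cur (i + 1))]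
    ((ℓ (g ⟨i + 1, h⟩), cur (i + 1)) :: (cur (i + 1), y) :: (P₀ ++ (netP W ++ Q)))
    (ℓ (g ⟨i, by omega⟩)) (cur i) x
    (fun e he ha => (hd (g ⟨i, by omega⟩)).2.2.1 (mem_ins_of_netE he ha))
    (fun e he ha => hn2.2.1 (mem_ins_of_netE he ha)) rfl
    (by
      refine (h1.append_right _).trans (.cons _ ?_)
      refine (List.Perm.cons _ (List.perm_middle (l₁ := P₀))).trans ((List.Perm.swap _ _ _).trans
        (.cons _ (.cons _ ?_)))
      exact List.perm_middle)
    (not_mem_labels_map (fun b => (hd b).1) F)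
    (by simpa [Ev.labels] using ⟨(hd (g ⟨i, by omega⟩)).1, (hd (g ⟨i, by omega⟩)).2.1⟩)
    (by simp [Ev.map, sub_self, sub_of_ne (Ne.symm hn2.1)])
  have h4 := h3.merge (EC := netE W) (F.map (Ev.map ℓ))
    [.cross c (ℓ (g ⟨i, by omega⟩)) (cur (i + 1))]
    [.cross c (ℓ (g ⟨i, by omega⟩)) (ℓ (g ⟨i + 1, h⟩))]
    ((ℓ (g ⟨i, by omega⟩), x) :: (P₀ ++ (netP W ++ Q)))
    (ℓ (g ⟨i + 1, h⟩)) (cur (i + 1)) y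
    (fun e he ha => (hd (g ⟨i + 1, h⟩)).2.2.1 (mem_ins_of_netE he ha))
    (fun e he ha => hn3.1 (mem_ins_of_netE he ha)) rfl
    ((List.Perm.swap _ _ _).trans (.cons _ (.swap _ _ _)))
    (not_mem_labels_map (fun b => (hd b).2.1) F)
    (by simpa [Ev.labels] using ⟨hne, (hd (g ⟨i + 1, h⟩)).2.1⟩)
    (by simp [Ev.map, sub_self, sub_of_ne (hd (g ⟨i, by omega⟩)).2.1])
  have hp := (List.Perm.swap _ _ _).trans ((h2 x y).append_right (netP W ++ Q))
  refine (h4.trans (h4.valid_right.perm_pairs hp)).trans ?_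
  have h5 := (h4.valid_right.of_perm hp).netEq
  simpa [Ev.map] using h5

/-- Moving the crossing to the left past `rho g` names its strands by the positions where they
began. Thus the step `netEq_cross` of the net is right multiplication by a letter. -/
theorem evs_mul_rho_cross (c : Crossing) {i : ℕ} (h : i + 1 < n) :
    evs (F ++ [.cross c (g ⟨i, by omega⟩) (g ⟨i + 1, h⟩)]) * rho (g * adj n i) =
      evs F * rho g * X n c i := by
  rw [evs_append, X_eq_crossVal h, map_mul, rho_adj, mul_assoc (evs F) (rho g),
    ← mul_assoc (rho g) (crossVal _ _ _), rho_mul_eq g (crossVal _ _ _), ← crossVal_map]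
  simp [evs, Ev.val, mul_assoc]

theorem evs_mul_rho_bar {i : ℕ} (h : i < n) :
    evs (F ++ [.bar (g ⟨i, h⟩)]) * rho g = evs F * rho g * B n i := by
  rw [evs_append, show B n i = barVal (⟨i, h⟩ : Fin n) from rfl, mul_assoc (evs F) (rho g),
    rho_mul_eq, ← barVal_map, mul_assoc]
  simp [evs, Ev.val]

/-- The last part `cur q` of a long strand is merged with it, so that `ℓ (g q)` continues directly
as `ℓ q`. The positions in `L₁` are done, those in `L₂` remain. -/
theorem netEq_close (L₁ L₂ : List (Fin n))
    (hv : Valid (F.map (Ev.map ℓ)) (L₁.map (fun q => (ℓ (g q), ℓ q)) ++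
      (L₂.map (fun q => (ℓ (g q), cur q)) ++ L₂.map (fun q : Fin n => (cur q, ℓ q)))))
    (hc : ∀ q ∈ L₂, ∀ b, ℓ b ≠ cur q) :
    NetEq (F.map (Ev.map ℓ)) (L₁.map (fun q => (ℓ (g q), ℓ q)) ++
      (L₂.map (fun q => (ℓ (g q), cur q)) ++ L₂.map (fun q : Fin n => (cur q, ℓ q))))
      (F.map (Ev.map ℓ)) ((L₁ ++ L₂).map (fun q => (ℓ (g q), ℓ q))) := by
  induction L₂ generalizing L₁ with
  | nil => simpa using hv.netEq
  | cons q L₂ ih =>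
    have h1 := hv.netEq.merge (EC := []) (F.map (Ev.map ℓ)) [] []
      (L₁.map (fun q => (ℓ (g q), ℓ q)) ++
      (L₂.map (fun q => (ℓ (g q), cur q)) ++ L₂.map (fun q : Fin n => (cur q, ℓ q))))
      (ℓ (g q)) (cur q) (ℓ q) (by simp) (by simp) (by simp)
      (by
        rw [List.map_cons, List.map_cons]
        refine List.perm_middle.trans (.cons _ ?_)
        rw [List.append_eq, ← List.append_assoc]
        refine List.perm_middle.trans (.cons _ ?_)
        rw [List.append_assoc])
      (not_mem_labels_map (hc q (by simp)) F) (by simp) rfl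
    rw [List.append_nil, List.append_nil] at h1
    have hp : ((ℓ (g q), ℓ q) :: (L₁.map (fun q => (ℓ (g q), ℓ q)) ++
      (L₂.map (fun q => (ℓ (g q), cur q)) ++ L₂.map (fun q : Fin n => (cur q, ℓ q))))).Perm
      ((L₁ ++ [q]).map (fun q => (ℓ (g q), ℓ q)) ++
      (L₂.map (fun q => (ℓ (g q), cur q)) ++ L₂.map (fun q : Fin n => (cur q, ℓ q)))) := by
      rw [List.map_append, List.append_assoc]
      exact List.perm_middle.symm
    have h2 := ih _ (h1.valid_right.of_perm hp) fun q hq => hc q (List.mem_cons_of_mem _ hq)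
    rw [List.append_assoc] at h2
    exact (h1.trans (h1.valid_right.perm_pairs hp)).trans h2

theorem Gen.cases_layer (a : Gen n) :
    (∃ i, ∃ _ : i + 1 < n, a.layer = .cross i .virtual ∧ STVB.of a = V n i) ∨
    (∃ i c, ∃ _ : i + 1 < n, c ≠ .virtual ∧ a.layer = .cross i c ∧ STVB.of a = X n c i) ∨
    ∃ i, ∃ _ : i < n, a.layer = .bar i ∧ STVB.of a = B n i := by
  cases a with
  | sigma i h => exact .inr (.inl ⟨i, .rightOver, h, by simp, rfl, (X_of_lt (c := .rightOver) h).symm⟩)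
  | sigmaInv i h => exact .inr (.inl ⟨i, .leftOver, h, by simp, rfl, (X_of_lt (c := .leftOver) h).symm⟩)
  | virt i h => exact .inl ⟨i, h, rfl, (X_of_lt (c := .virtual) h).symm⟩
  | tau i h => exact .inr (.inl ⟨i, .singular, h, by simp, rfl, (X_of_lt (c := .singular) h).symm⟩)
  | gamma i h => exact .inr (.inr ⟨i, h, rfl, (B_of_lt h).symm⟩)

/-- The crossings and bars of a braid are absorbed one after the other. -/
theorem Run.absorb (hℓ : Function.Injective ℓ) {w : List (Gen n)} {T t : List (Bool × ℕ)}
    {N : List ℕ} (hr : Run (w.map Gen.layer) (strands n cur T) W N t) :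
    ∃ cur', t = strands n cur' T ∧ ∀ (g : Equiv.Perm (Fin n)) (F : List (Ev (Fin n)))
      (Q : List (ℕ × ℕ)), (∀ e ∈ F, e.Ok) →
      Valid (F.map (Ev.map ℓ) ++ netE W) (openPairs ℓ g cur ++ (netP W ++ Q)) →
      ∃ (g' : Equiv.Perm (Fin n)) (F' : List (Ev (Fin n))), (∀ e ∈ F', e.Ok) ∧
        evs F' * rho g' = evs F * rho g * (w.map STVB.of).prod ∧
        NetEq (F.map (Ev.map ℓ) ++ netE W) (openPairs ℓ g cur ++ (netP W ++ Q))
          (F'.map (Ev.map ℓ)) (openPairs ℓ g' cur' ++ Q) := by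
  induction w generalizing cur W N with
  | nil =>
    obtain ⟨rfl, rfl, rfl⟩ := run_nil.1 hr
    refine ⟨cur, rfl, fun g F Q hF hv => ⟨g, F, hF, by simp, ?_⟩⟩
    simpa [netE, netP] using hv.netEq
  | cons a w ih =>
    obtain ⟨W₁, N₁, u, W₂, N₂, h1, h2, rfl, rfl⟩ := run_cons.1 hr
    rw [List.map_cons, List.prod_cons]
    rcases a.cases_layer with ⟨i, h, e, e'⟩ | ⟨i, c, h, hc, e, e'⟩ | ⟨i, h, e, e'⟩ <;> rw [e] at h1 <;>
      rw [e']
    · obtain ⟨rfl, rfl⟩ := lrun_strands_virt h h1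
      obtain ⟨cur', ht, h3⟩ := ih h2
      refine ⟨cur', ht, fun g F Q hF hv => ?_⟩
      have h4 := netEq_virt h hv
      obtain ⟨g', F', hF', hx, h5⟩ := h3 _ F Q hF h4.valid_right
      refine ⟨g', F', hF', ?_, h4.trans h5⟩
      rw [hx, map_mul, rho_adj]
      simp only [mul_assoc]
    · obtain ⟨x, y, rfl, rfl⟩ := lrun_strands_cross h hc h1
      obtain ⟨cur', ht, h3⟩ := ih h2
      refine ⟨cur', ht, fun g F Q hF hv => ?_⟩
      have h4 := netEq_cross c h hℓ hv
      obtain ⟨g', F', hF', hx, h5⟩ := h3 _ _ Q (by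
        intro e he
        rcases List.mem_append.1 he with he | he
        · exact hF e he
        · rw [List.mem_singleton.1 he]
          simp [Ev.Ok]) h4.valid_right
      refine ⟨g', F', hF', ?_, h4.trans h5⟩
      rw [hx, evs_mul_rho_cross, mul_assoc]
    · obtain ⟨x, rfl, rfl⟩ := lrun_strands_bar h h1
      obtain ⟨cur', ht, h3⟩ := ih h2
      refine ⟨cur', ht, fun g F Q hF hv => ?_⟩
      have h4 := netEq_bar h hv
      obtain ⟨g', F', hF', hx, h5⟩ := h3 _ _ Q (by
        intro e he
        rcases List.mem_append.1 he with he | he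
        · exact hF e he
        · rw [List.mem_singleton.1 he]
          simp [Ev.Ok]) h4.valid_right
      refine ⟨g', F', hF', ?_, h4.trans h5⟩
      rw [hx, evs_mul_rho_bar, mul_assoc]

/-- The strands which run up on the right of a closed braid. -/
def returns (n : ℕ) (b : ℕ → ℕ) : List (Bool × ℕ) :=
  (List.range n).reverse.map fun q => (false, b q)

theorem strands_returns_succ (cur b : ℕ → ℕ) :
    strands (n + 1) cur (returns (n + 1) b) =
      (List.range n).map (fun q => (true, cur q)) ++
        ([(true, cur n), (false, b n)] ++ returns n b) := by
  simp [strands, returns, List.range_succ]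

theorem run_births (cur b : ℕ → ℕ) : ∀ n, Run (births n) []
    ((List.range n).map fun q => .wire (b q) (cur q)) ((List.range n).flatMap fun q => [cur q, b q])
    (strands n cur (returns n b))
  | 0 => .nil _
  | n + 1 => by
    have h : births (n + 1) = births n ++ [Layer.birth n true] := by
      simp [births, List.range_succ]
    rw [h, List.range_succ, List.map_append, List.flatMap_append]
    refine (run_births cur b n).append ?_
    have h2 : LRun (.birth n true) (strands n cur (returns n b)) [wireVert (!true) (cur n) (b n)]
        [cur n, b n] (strands (n + 1) cur (returns (n + 1) b)) := by
      refine ⟨(List.range n).map (fun q => (true, cur q)), [], _, returns n b, by simp [Layer.pos],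
        rfl, ?_, .birth n true (cur n) (b n)⟩
      rw [strands_returns_succ]
      rfl
    simpa [wireVert] using h2.run

theorem run_deaths (cur b : ℕ → ℕ) : ∀ n, Run (deaths n) (strands n cur (returns n b))
    ((List.range n).reverse.map fun q => .wire (cur q) (b q)) [] []
  | 0 => .nil _
  | n + 1 => by
    have h : deaths (n + 1) = Layer.death n :: deaths n := by
      simp [deaths, List.range_succ]
    rw [h, List.range_succ, List.reverse_append, List.map_append]
    refine .cons (V := [.wire (cur n) (b n)]) (N := []) (t := strands n cur (returns n b)) ?_
      (run_deaths cur b n)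
    refine ⟨(List.range n).map (fun q => (true, cur q)), _, [], returns n b, by simp [Layer.pos],
      ?_, rfl, .death n true (cur n) (b n)⟩
    rw [strands_returns_succ]
    rfl

theorem netE_map_wire {α : Type} (L : List α) (a b : α → ℕ) :
    netE (L.map fun q => .wire (a q) (b q)) = [] := by
  simp [netE, List.flatMap_map, Vert.events]

theorem netP_map_wire {α : Type} (L : List α) (a b : α → ℕ) :
    netP (L.map fun q => .wire (a q) (b q)) = L.map fun q => (a q, b q) := by
  induction L with
  | nil => rfl
  | cons q L ih =>
    rw [List.map_cons, List.map_cons, ← ih]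
    rfl

theorem map_range_eq_ofFn (f : ℕ → ℕ × ℕ) (n : ℕ) :
    (List.range n).map f = List.ofFn fun q : Fin n => f q := by
  rw [List.ofFn_eq_map, ← List.map_coe_finRange_eq_range, List.map_map]
  rfl

theorem closure_hasBraid (w : List (Gen n)) : ∃ k x, (closureDiagram w).HasBraid k x ∧
    LvEquiv ⟨k, x⟩ ⟨n, (w.map STVB.of).prod⟩ := by
  have h0 : Leads (w.map Gen.layer) (level n) (level n) := by
    induction w with
    | nil => exact .nil _
    | cons a w ih => exact .cons a.leads ih
  -- At the maxima, position `q` has the label `2 * q` on the leg that runs down and `2 * q + 1` on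
  -- the returning leg. The long strands are named after the returning legs.
  set T := returns n fun q => 2 * q + 1
  have hs : (strands n (2 * ·) T).map Prod.fst = level n := by
    simp [strands, T, returns, level, Function.comp_def]
  obtain ⟨V, N, t, r1, n1, d1, -⟩ := h0.exists_run hs
    ((List.range n).flatMap fun q => [2 * q, 2 * q + 1])
  have hℓ : Function.Injective fun q : Fin n => 2 * q.val + 1 := fun a b h => by
    simp only at h
    exact Fin.ext (by omega)
  obtain ⟨cur', rfl, h1⟩ := r1.absorb hℓ
  have r2 : Run (closureWord w) [] _ _ [] :=
    ((run_births (2 * ·) (fun q => 2 * q + 1) n).append r1).append (run_deaths cur' _ n)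
  have hN : (((List.range n).flatMap fun q => [2 * q, 2 * q + 1]) ++ N ++ []).Nodup := by
    rw [List.append_nil]
    refine List.nodup_append.2 ⟨?_, n1, fun a ha b hb hab => d1 b hb (hab ▸ ha)⟩
    refine List.nodup_flatMap.2 ⟨fun q _ => by simp, ?_⟩
    refine List.nodup_range.imp fun {a b} h => ?_
    simp [Function.onFun, List.disjoint_left]
    omega
  have hG := r2.good hN
  obtain ⟨k, x, hx⟩ := hG.valid.exists_rep
  refine ⟨k, x, ⟨_, _, r2, hG, hx⟩, ?_⟩
  rw [netE_append, netE_append, netE_map_wire, netE_map_wire, List.nil_append, List.append_nil,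
    netP_append, netP_append, netP_map_wire, netP_map_wire, map_range_eq_ofFn, List.append_assoc] at hx
  have hp : ((List.range n).reverse.map fun q => (cur' q, 2 * q + 1)).Perm
      (List.ofFn fun q : Fin n => (cur' q, 2 * q.val + 1)) := by
    rw [← map_range_eq_ofFn fun q => (cur' q, 2 * q + 1)]
    exact (List.reverse_perm _).map _
  have h2 := hx.valid.perm_pairs ((hp.append_left _).append_left _)
  obtain ⟨g, F, hF, hx', h3⟩ := h1 1 [] _ (by simp) h2.valid_right
  rw [show evs [] = (1 : STVB n) from rfl, map_one, one_mul, one_mul] at hx'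
  have h4 : NetEq (F.map (Ev.map fun q : Fin n => 2 * q.val + 1)) _ _ _ :=
    netEq_close (g := g) (cur := cur') [] (List.finRange n) (by
      rw [List.map_nil, List.nil_append, ← List.ofFn_eq_map, ← List.ofFn_eq_map]
      exact h3.valid_right) fun q _ b hb => by
        refine h3.valid_right.open_disjoint b ?_
        rw [List.map_ofFn]
        exact List.mem_ofFn.2 ⟨q, hb.symm⟩
  rw [List.map_nil, List.nil_append, List.nil_append, ← List.ofFn_eq_map, ← List.ofFn_eq_map,
    ← List.ofFn_eq_map] at h4
  exact (h2.trans (h3.trans h4)).lvEquiv hx ⟨_, g, F, hℓ, .refl _, rfl, hF, hx'.symm⟩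

/-- Each braid is equivalent to the braid of the Gauss diagram of its closure, and that one depends
only on the link. -/
theorem lvEquiv_of_closure_eq {m n : ℕ} {a : STVB m} {b : STVB n} (h : a.closure = b.closure) :
    LvEquiv ⟨m, a⟩ ⟨n, b⟩ := by
  induction a using Quotient.inductionOn with | _ a =>
  induction b using Quotient.inductionOn with | _ b =>
  obtain ⟨k, x, hx, hx'⟩ := closure_hasBraid a.toList
  obtain ⟨l, y, hy, hy'⟩ := closure_hasBraid b.toList
  rw [← mk_ofList] at hx' hy'
  exact (hx'.symm.trans (lvEquiv_of_link_eq (fun _ _ => LocalMove.invariant) h hx hy)).trans hy'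

end

end SingTwist

namespace SingTwist

/-! ### Reductions of diagrams -/

theorem Run.leads {w : List Layer} {s t : List (Bool × ℕ)} {V : List Vert} {N : List ℕ}
    (h : Run w s V N t) : Leads w (s.map Prod.fst) (t.map Prod.fst) := by
  induction h with
  | nil => exact .nil _
  | cons h1 _ ih =>
    refine .cons ?_ ih
    obtain ⟨l, u, v, r, hl, rfl, rfl, h2⟩ := h1
    have hl' : (l.map Prod.fst).length = _ := (List.length_map _).trans hl
    cases h2 <;> simp only [Layer.pos] at hl' <;> subst hl' <;>
      simp only [List.map_append, List.map_cons, List.nil_append, List.cons_append] <;>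
      constructor

section

variable {A B L R U W : List Layer} {s t : List Bool}

theorem Leads.of_append (h : Leads (A ++ B) s t) : ∃ u, Leads A s u ∧ Leads B u t := by
  induction A generalizing s with
  | nil => exact ⟨s, .nil s, h⟩
  | cons e A ih =>
    cases h with
    | cons h1 h2 =>
      obtain ⟨u, h3, h4⟩ := ih h2
      exact ⟨u, .cons h1 h3, h4⟩

/-- The labelled run constructed for the invariance of the Gauss diagram also certifies that the
other side of the move fits into the diagram. -/
theorem LocalMove.leads (hm : LocalMove L R) (h : Leads (A ++ L ++ B) [] []) :
    Leads (A ++ R ++ B) [] [] := by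
  obtain ⟨V, N, h1, h2⟩ := Diagram.exists_run ⟨_, h⟩
  obtain ⟨V', N', r, -⟩ := hm.invariant.exists_run h1 h2
  exact r.leads

/-- Wherever `L` occurs in a diagram, it can be replaced by `R`. -/
def Red (L R : List Layer) : Prop :=
  ∀ (A B : List Layer) (h : Leads (A ++ L ++ B) [] []), ∃ h' : Leads (A ++ R ++ B) [] [],
    Diagram.link ⟨_, h⟩ = Diagram.link ⟨_, h'⟩

theorem LocalMove.red (hm : LocalMove L R) : Red L R := fun _ _ h =>
  ⟨hm.leads h, Quot.sound ⟨_, _, _, _, hm, rfl, rfl⟩⟩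

theorem Red.refl (L : List Layer) : Red L L := fun _ _ h => ⟨h, rfl⟩

theorem Red.trans (h : Red L R) (h' : Red R W) : Red L W := by
  intro A B hd
  obtain ⟨h1, e1⟩ := h A B hd
  obtain ⟨h2, e2⟩ := h' A B h1
  exact ⟨h2, e1.trans e2⟩

theorem Red.within (h : Red L R) (X Y : List Layer) : Red (X ++ (L ++ Y)) (X ++ (R ++ Y)) := by
  intro A B hd
  have e : ∀ M : List Layer, A ++ (X ++ (M ++ Y)) ++ B = (A ++ X) ++ M ++ (Y ++ B) := by simp
  have := h (A ++ X) (Y ++ B) (e L ▸ hd)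
  simpa only [e] using this

theorem Red.left (h : Red L R) (X : List Layer) : Red (X ++ L) (X ++ R) := by
  simpa using h.within X []

theorem Red.right (h : Red L R) (Y : List Layer) : Red (L ++ Y) (R ++ Y) := h.within [] Y

theorem Red.cons (h : Red L R) (e : Layer) : Red (e :: L) (e :: R) := h.left [e]

theorem Leads.replace (h : ∀ s t, Leads L s t → Leads R s t) (hd : Leads (A ++ L ++ B) s t) :
    Leads (A ++ R ++ B) s t := by
  obtain ⟨u, h1, h2⟩ := hd.of_append
  obtain ⟨v, h3, h4⟩ := h1.of_append
  exact (h3.append (h _ _ h4)).append h2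

/-- The converse of a local move, in a context in which it is possible. -/
theorem LocalMove.red_symm (hm : LocalMove R L) (X Y : List Layer)
    (h : ∀ s t, Leads (X ++ (L ++ Y)) s t → Leads (X ++ (R ++ Y)) s t) :
    Red (X ++ (L ++ Y)) (X ++ (R ++ Y)) := by
  intro A B hd
  refine ⟨hd.replace h, (Quot.sound ⟨A ++ X, Y ++ B, R, L, hm, ?_, ?_⟩).symm⟩ <;> simp

theorem leads_cons {e : Layer} : Leads (e :: W) s t ↔ ∃ u, e.Leads s u ∧ Leads W u t := by
  constructor
  · rintro (_ | ⟨h1, h2⟩)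
    exact ⟨_, h1, h2⟩
  · rintro ⟨u, h1, h2⟩
    exact .cons h1 h2

theorem leads_nil : Leads [] s t ↔ t = s := by
  constructor
  · rintro ⟨⟩
    rfl
  · rintro rfl
    exact .nil _

theorem leads_birth {i : ℕ} {o : Bool} : (Layer.birth i o).Leads s t ↔
    ∃ l r, l.length = i ∧ s = l ++ r ∧ t = l ++ o :: (!o) :: r := by
  constructor
  · rintro ⟨l, r, _⟩
    exact ⟨l, r, rfl, rfl, rfl⟩
  · rintro ⟨l, r, rfl, rfl, rfl⟩
    constructor

theorem leads_death {i : ℕ} : (Layer.death i).Leads s t ↔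
    ∃ l r o, l.length = i ∧ s = l ++ o :: (!o) :: r ∧ t = l ++ r := by
  constructor
  · rintro ⟨⟩
    exact ⟨_, _, _, rfl, rfl, rfl⟩
  · rintro ⟨l, r, o, rfl, rfl, rfl⟩
    constructor

theorem leads_cross {i : ℕ} {c : Crossing} : (Layer.cross i c).Leads s t ↔
    ∃ l r x y, l.length = i ∧ s = l ++ x :: y :: r ∧ t = l ++ y :: x :: r := by
  constructor
  · rintro ⟨⟩
    exact ⟨_, _, _, _, rfl, rfl, rfl⟩
  · rintro ⟨l, r, x, y, rfl, rfl, rfl⟩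
    constructor

theorem leads_bar {i : ℕ} : (Layer.bar i).Leads s t ↔
    ∃ l r x, l.length = i ∧ s = l ++ x :: r ∧ t = l ++ x :: r := by
  constructor
  · rintro ⟨⟩
    exact ⟨_, _, _, rfl, rfl, rfl⟩
  · rintro ⟨l, r, x, rfl, rfl, rfl⟩
    constructor

theorem Layer.Leads.split {e : Layer} (h : e.Leads s t) : ∃ l u v r, l.length = e.pos ∧
    u.length = e.top ∧ v.length = e.bottom ∧ s = l ++ (u ++ r) ∧ t = l ++ (v ++ r) ∧
    ∀ r', e.Leads (l ++ (u ++ r')) (l ++ (v ++ r')) := by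
  cases h with
  | birth l r o => exact ⟨l, [], [o, !o], r, rfl, rfl, rfl, rfl, rfl, fun r' => .birth l r' o⟩
  | death l r o => exact ⟨l, [o, !o], [], r, rfl, rfl, rfl, rfl, rfl, fun r' => .death l r' o⟩
  | cross l r c x y => exact ⟨l, [x, y], [y, x], r, rfl, rfl, rfl, rfl, rfl, fun r' => .cross l r' c x y⟩
  | bar l r x => exact ⟨l, [x], [x], r, rfl, rfl, rfl, rfl, rfl, fun r' => .bar l r' x⟩

theorem Layer.Leads.shift {e : Layer} (h : e.Leads s t) (q : List Bool) :
    (e.shift q.length).Leads (q ++ s) (q ++ t) := by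
  cases h <;> simp only [← List.append_assoc, Layer.shift] <;>
    rw [add_comm, ← List.length_append] <;> constructor

theorem Layer.Leads.of_shift {e : Layer} {k : ℕ} (h : (e.shift k).Leads s t) :
    ∃ q s' t', q.length = k ∧ s = q ++ s' ∧ t = q ++ t' ∧ e.Leads s' t' := by
  have key : ∀ (l : List Bool) (i : ℕ), l.length = i + k →
      ∃ q l', q.length = k ∧ l'.length = i ∧ l = q ++ l' := fun l i hl =>
    ⟨l.take k, l.drop k, by rw [List.length_take]; omega, by rw [List.length_drop]; omega,
      (List.take_append_drop k l).symm⟩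
  cases e with
  | birth i o =>
    obtain ⟨l, r, hl, rfl, rfl⟩ := leads_birth.1 h
    obtain ⟨q, l, rfl, rfl, rfl⟩ := key l i hl
    exact ⟨q, _, _, rfl, List.append_assoc _ _ _, List.append_assoc _ _ _, .birth _ _ _⟩
  | death i =>
    obtain ⟨l, r, o, hl, rfl, rfl⟩ := leads_death.1 h
    obtain ⟨q, l, rfl, rfl, rfl⟩ := key l i hl
    exact ⟨q, _, _, rfl, List.append_assoc _ _ _, List.append_assoc _ _ _, .death _ _ _⟩
  | cross i c =>
    obtain ⟨l, r, x, y, hl, rfl, rfl⟩ := leads_cross.1 h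
    obtain ⟨q, l, rfl, rfl, rfl⟩ := key l i hl
    exact ⟨q, _, _, rfl, List.append_assoc _ _ _, List.append_assoc _ _ _, .cross _ _ _ _ _⟩
  | bar i =>
    obtain ⟨l, r, x, hl, rfl, rfl⟩ := leads_bar.1 h
    obtain ⟨q, l, rfl, rfl, rfl⟩ := key l i hl
    exact ⟨q, _, _, rfl, List.append_assoc _ _ _, List.append_assoc _ _ _, .bar _ _ _⟩

end

open Layer Crossing

theorem red_exchange (e f : Layer) :
    Red [e, f.shift (e.pos + e.bottom)] [f.shift (e.pos + e.top), e] :=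
  (LocalMove.exchange e f).red

theorem red_exchange' (e f : Layer) :
    Red [f.shift (e.pos + e.top), e] [e, f.shift (e.pos + e.bottom)] := by
  refine (LocalMove.exchange e f).red_symm [] [] fun s t h => ?_
  simp only [List.nil_append, List.append_nil, leads_cons, leads_nil] at h ⊢
  obtain ⟨m, h1, _, h2, rfl⟩ := h
  obtain ⟨q, s', t', hq, rfl, rfl, h3⟩ := h1.of_shift
  obtain ⟨l, u, v, r, hl, hu, hv, e1, rfl, h4⟩ := h2.split
  rw [← List.append_assoc] at e1
  obtain ⟨rfl, rfl⟩ := List.append_inj e1 (by rw [hq, List.length_append, hl, hu])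
  refine ⟨l ++ v ++ s', ?_, _, ?_, rfl⟩
  · simpa using h4 s'
  · have := h3.shift (l ++ v)
    rwa [List.length_append, hl, hv, List.append_assoc l v t'] at this

theorem exists_concat {l : List Bool} {i : ℕ} (h : l.length = i + 1) :
    ∃ l' x, l'.length = i ∧ l = l' ++ [x] := by
  rcases l.eq_nil_or_concat with rfl | ⟨l', x, rfl⟩
  · simp at h
  · exact ⟨l', x, by simpa using h, by simp⟩

theorem red_birth_cross (i : ℕ) (o : Bool) (c : Crossing) :
    Red [birth i o, cross (i + 1) c] [birth (i + 1) o, cross i c.turn] :=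
  (LocalMove.birth_cross i o c).red

theorem red_birth_cross' (i : ℕ) (o : Bool) (c : Crossing) :
    Red [birth (i + 1) o, cross i c] [birth i o, cross (i + 1) c.turn] := by
  have hm := LocalMove.birth_cross i o c.turn
  rw [turn_turn] at hm
  refine hm.red_symm [] [] fun s t h => ?_
  simp only [List.nil_append, List.append_nil, leads_cons, leads_nil, leads_birth, leads_cross] at h ⊢
  obtain ⟨_, ⟨l, r, hl, rfl, rfl⟩, _, ⟨l2, r2, x, y, hl2, e, rfl⟩, rfl⟩ := h
  obtain ⟨l', x', hl', rfl⟩ := exists_concat hl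
  rw [List.append_assoc] at e
  obtain ⟨rfl, e'⟩ := List.append_inj e (hl'.trans hl2.symm)
  simp only [List.cons_append, List.nil_append, List.cons.injEq] at e'
  obtain ⟨rfl, rfl, rfl⟩ := e'
  exact ⟨_, ⟨l', x' :: r, hl', by simp, rfl⟩, _, ⟨l' ++ [o], r, !o, x', by simp [hl'], by simp,
    rfl⟩, by simp⟩

theorem red_cross_death (i : ℕ) (c : Crossing) :
    Red [cross (i + 1) c, death i] [cross i c.turn, death (i + 1)] :=
  (LocalMove.cross_death i c).red

theorem red_cross_death' (i : ℕ) (c : Crossing) :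
    Red [cross i c, death (i + 1)] [cross (i + 1) c.turn, death i] := by
  have hm := LocalMove.cross_death i c.turn
  rw [turn_turn] at hm
  refine hm.red_symm [] [] fun s t h => ?_
  simp only [List.nil_append, List.append_nil, leads_cons, leads_nil, leads_death, leads_cross] at h ⊢
  obtain ⟨_, ⟨l, r, x, y, hl, rfl, rfl⟩, _, ⟨l2, r2, o, hl2, e, rfl⟩, rfl⟩ := h
  obtain ⟨l', x', hl', rfl⟩ := exists_concat hl2
  rw [List.append_assoc] at e
  obtain ⟨rfl, e'⟩ := List.append_inj e (hl.trans hl'.symm)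
  simp only [List.cons_append, List.nil_append, List.cons.injEq] at e'
  obtain ⟨rfl, rfl, rfl⟩ := e'
  exact ⟨_, ⟨l ++ [x], r2, y, !x, by simp [hl], by simp, rfl⟩, _, ⟨l, y :: r2, x, hl, by simp, rfl⟩,
    by simp⟩

theorem red_bar_death' (i : ℕ) : Red [bar (i + 1), death i] [bar i, death i] := by
  refine (LocalMove.bar_death i).red_symm [] [] fun s t h => ?_
  simp only [List.nil_append, List.append_nil, leads_cons, leads_nil, leads_death, leads_bar] at h ⊢
  obtain ⟨_, ⟨l, r, x, -, rfl, rfl⟩, _, ⟨l2, r2, o, hl2, e, rfl⟩, rfl⟩ := h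
  exact ⟨_, ⟨l2, _, _, hl2, e, rfl⟩, _, ⟨l2, r2, o, hl2, rfl, rfl⟩, rfl⟩

/-- A zigzag inserted on the right leg makes the virtual crossing of the two legs a virtual kink;
removing it leaves a maximum of the opposite orientation. -/
theorem red_birth_virtual (i : ℕ) (o : Bool) :
    Red [birth i o, cross i .virtual] [birth i (!o)] := by
  have h1 : Red [birth i o, cross i .virtual]
      [birth i o, birth (i + 1) (!o), death (i + 2), cross i .virtual] := by
    refine (LocalMove.zigzag_left (i + 1) (!o)).red_symm [birth i o] [cross i .virtual]
      fun s t h => ?_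
    simp only [List.nil_append, List.cons_append, leads_cons (e := birth i o)] at h ⊢
    obtain ⟨m, h1, h2⟩ := h
    refine ⟨m, h1, ?_⟩
    obtain ⟨l, r, hl, rfl, rfl⟩ := leads_birth.1 h1
    refine .cons (leads_birth.2 ⟨l ++ [o], (!o) :: r, by simp [hl], by simp, rfl⟩)
      (.cons (leads_death.2 ⟨l ++ [o, !o], r, o, by simp [hl], by simp, rfl⟩) ?_)
    simpa using h2
  have h2 := ((red_exchange' (cross i .virtual) (death 0)).left
    [birth i o, birth (i + 1) (!o)])
  have h3 := ((red_birth_cross' i (!o) .virtual).within [birth i o] [death (i + 2)])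
  have h4 := ((red_exchange' (birth i (!o)) (birth 0 o)).right
    [cross (i + 1) .virtual, death (i + 2)])
  have h5 := ((LocalMove.virtual_kink_right (i + 1) o).red.left [birth i (!o)])
  simp only [Layer.shift, Layer.pos, Layer.top, Layer.bottom, List.cons_append, List.nil_append,
    zero_add, add_zero, Crossing.turn] at h2 h3 h4 h5
  exact h1.trans (h2.trans (h3.trans (h4.trans h5)))

/-- This uses a zigzag and a virtual kink as for a maximum. The orientation of the zigzag is not
visible in the layers and has to be read off from the surrounding diagram. -/
theorem red_virtual_death (i : ℕ) : Red [cross i .virtual, death i] [death i] := by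
  have key : ∀ o, Red [cross i .virtual, birth (i + 2) o, death (i + 1), death i] [death i] := by
    intro o
    have h1 := ((red_exchange (cross i .virtual) (birth 0 o)).right [death (i + 1), death i])
    have h2 := ((red_cross_death' i .virtual).within [birth (i + 2) o] [death i])
    have h3 := ((red_exchange (death i) (death 0)).left [birth (i + 2) o, cross (i + 1) .virtual])
    have h4 := ((LocalMove.virtual_kink_right (i + 1) o).red.right [death i])
    simp only [Layer.shift, Layer.pos, Layer.top, Layer.bottom, List.cons_append, List.nil_append,
      zero_add, add_zero, Crossing.turn] at h1 h2 h3 h4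
    exact h1.trans (h2.trans (h3.trans h4))
  intro A B hd
  obtain ⟨s, h1, h2⟩ := Leads.of_append hd
  obtain ⟨u, h3, h4⟩ := Leads.of_append h1
  obtain ⟨m, h5, h6⟩ := leads_cons.1 h4
  obtain ⟨k, h7, h8⟩ := leads_cons.1 h6
  obtain ⟨l, r, a, hl, rfl, rfl⟩ := leads_death.1 h7
  have h9 : Leads (A ++ [cross i .virtual, birth (i + 2) a, death (i + 1), death i] ++ B) [] [] := by
    refine (h3.append (.cons h5 (.cons (leads_birth.2 ⟨l ++ [a, !a], r, by simp [hl], by simp, rfl⟩)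
      (.cons (leads_death.2 ⟨l ++ [a], (!a) :: r, !a, by simp [hl], by simp, rfl⟩)
      (.cons (leads_death.2 ⟨l, r, a, hl, by simp, rfl⟩) ?_))))).append h2
    exact h8
  obtain ⟨h10, e⟩ := key a A B h9
  refine ⟨h10, Eq.trans (Quot.sound ⟨A ++ [cross i .virtual], [death i] ++ B, _, _,
    LocalMove.zigzag_right (i + 1) a, ?_, ?_⟩).symm e⟩ <;> simp

end SingTwist

namespace SingTwist

open Layer Crossing

/-! ### Conjugation -/

theorem births_succ (n : ℕ) : births (n + 1) = births n ++ [birth n true] := by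
  simp [births, List.range_succ]

theorem deaths_succ (n : ℕ) : deaths (n + 1) = death n :: deaths n := by
  simp [deaths, List.range_succ]

/-- The layer of a crossing or a bar. -/
def Layer.IsBraid : Layer → Prop
  | cross _ _ => True
  | bar _ => True
  | _ => False

theorem Layer.IsBraid.top_eq {e : Layer} (h : e.IsBraid) : e.top = e.bottom := by
  cases e <;> simp_all [Layer.IsBraid, Layer.top, Layer.bottom]

theorem Gen.isBraid {n : ℕ} (g : Gen n) : g.layer.IsBraid := by
  cases g <;> trivial

theorem Gen.pos_top {n : ℕ} (g : Gen n) : g.layer.pos + g.layer.top ≤ n := by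
  cases g <;> simpa [Gen.layer, Layer.pos, Layer.top] using ‹_›

theorem Layer.exists_shift {f : Layer} {k : ℕ} (h : k ≤ f.pos) : ∃ f' : Layer, f = f'.shift k := by
  cases f with
  | birth i o => exact ⟨.birth (i - k) o, by rw [Layer.shift, Nat.sub_add_cancel (id h : k ≤ i)]⟩
  | death i => exact ⟨.death (i - k), by rw [Layer.shift, Nat.sub_add_cancel (id h : k ≤ i)]⟩
  | cross i c => exact ⟨.cross (i - k) c, by rw [Layer.shift, Nat.sub_add_cancel (id h : k ≤ i)]⟩
  | bar i => exact ⟨.bar (i - k), by rw [Layer.shift, Nat.sub_add_cancel (id h : k ≤ i)]⟩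

section

variable {e f : Layer} {L M : List Layer}

theorem red_swap (he : e.IsBraid) (h : e.pos + e.top ≤ f.pos) : Red [e, f] [f, e] := by
  obtain ⟨f, rfl⟩ := Layer.exists_shift h
  have := red_exchange e f
  rwa [← he.top_eq] at this

theorem red_swap' (he : e.IsBraid) (h : e.pos + e.top ≤ f.pos) : Red [f, e] [e, f] := by
  obtain ⟨f, rfl⟩ := Layer.exists_shift h
  have := red_exchange' e f
  rwa [← he.top_eq] at this

theorem red_swap_list (h : ∀ e ∈ L, e.IsBraid ∧ e.pos + e.top ≤ f.pos) :
    Red (L ++ [f]) (f :: L) := by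
  induction L with
  | nil => exact .refl _
  | cons e L ih =>
    have h1 := h e (by simp)
    exact ((ih fun e he => h e (List.mem_cons_of_mem _ he)).cons e).trans
      ((red_swap h1.1 h1.2).right L)

theorem red_swap_list' (h : ∀ e ∈ L, e.IsBraid ∧ e.pos + e.top ≤ f.pos) :
    Red (f :: L) (L ++ [f]) := by
  induction L with
  | nil => exact .refl _
  | cons e L ih =>
    have h1 := h e (by simp)
    exact ((red_swap' h1.1 h1.2).right L).trans ((ih fun e he => h e (List.mem_cons_of_mem _ he)).cons e)

theorem red_swap_lists (h : ∀ f ∈ M, ∀ e ∈ L, e.IsBraid ∧ e.pos + e.top ≤ f.pos) :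
    Red (L ++ M) (M ++ L) := by
  induction M with
  | nil => simpa using Red.refl L
  | cons f M ih =>
    have h1 := (ih fun f hf => h f (List.mem_cons_of_mem _ hf)).cons f
    have h2 := (red_swap_list (h f (by simp))).right M
    simp only [List.append_assoc, List.cons_append, List.nil_append] at h1 h2 ⊢
    exact h2.trans h1

theorem red_swap_lists' (h : ∀ f ∈ M, ∀ e ∈ L, e.IsBraid ∧ e.pos + e.top ≤ f.pos) :
    Red (M ++ L) (L ++ M) := by
  induction M with
  | nil => simpa using Red.refl L
  | cons f M ih =>
    have h1 := (ih fun f hf => h f (List.mem_cons_of_mem _ hf)).cons f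
    have h2 := (red_swap_list' (h f (by simp))).right M
    simpa using h1.trans h2

end

/-- The elementary piece of a braid on the strand which runs up. -/
def Layer.mirror (n : ℕ) : Layer → Layer
  | cross i c => cross (2 * n - 2 - i) c
  | bar i => bar (2 * n - 1 - i)
  | e => e

/-- The last maximum is the innermost one. A piece that does not touch it is exchanged with it, and
the induction hypothesis applies. Otherwise a bar passes through the innermost maximum and a
crossing through the two innermost ones, where two quarter turns restore its decoration. -/
theorem red_births_mirror : ∀ {n : ℕ} {e : Layer}, e.IsBraid → e.pos + e.top ≤ n →
    Red (births n ++ [e]) (births n ++ [e.mirror n])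
  | 0, e, h, h' => by cases e <;> simp_all [Layer.IsBraid, Layer.top]
  | n + 1, e, h, h' => by
    rw [births_succ, List.append_assoc, List.append_assoc]
    by_cases hn : e.pos + e.top ≤ n
    · have h1 := (red_swap' (f := birth n true) h hn).left (births n)
      have h2 := (red_births_mirror h hn).right [birth n true]
      have h3 : Red [e.mirror n, birth n true] [birth n true, e.mirror (n + 1)] := by
        cases e with
        | cross i c =>
          simp only [Layer.pos, Layer.top] at hn
          have := red_exchange' (birth n true) (cross (n - 2 - i) c)
          simp only [Layer.shift, Layer.pos, Layer.top, Layer.bottom] at this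
          rw [show n - 2 - i + (n + 0) = 2 * n - 2 - i by omega,
            show n - 2 - i + (n + 2) = 2 * (n + 1) - 2 - i by omega] at this
          exact this
        | bar i =>
          simp only [Layer.pos, Layer.top] at hn
          have := red_exchange' (birth n true) (bar (n - 1 - i))
          simp only [Layer.shift, Layer.pos, Layer.top, Layer.bottom] at this
          rw [show n - 1 - i + (n + 0) = 2 * n - 1 - i by omega,
            show n - 1 - i + (n + 2) = 2 * (n + 1) - 1 - i by omega] at this
          exact this
        | _ => cases h
      have h3 := h3.left (births n)
      rw [List.append_assoc, List.append_assoc] at h2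
      exact h1.trans (h2.trans h3)
    · cases e with
      | cross i c =>
        simp only [Layer.pos, Layer.top] at hn h'
        obtain ⟨n, rfl⟩ : ∃ k, n = k + 1 := ⟨n - 1, by omega⟩
        obtain rfl : i = n := by omega
        rw [births_succ, List.append_assoc, List.append_assoc]
        refine Red.left ?_ _
        have h1 := (red_birth_cross' i true c).left [birth i true]
        have h2 := (red_exchange' (birth i true) (birth 0 true)).right [cross (i + 1) c.turn]
        have h3 := (red_birth_cross' (i + 1) true c.turn).left [birth i true]
        simp only [Layer.shift, Layer.pos, Layer.top, Layer.bottom, List.cons_append,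
          List.nil_append, zero_add, add_zero, turn_turn] at h1 h2 h3
        rw [Layer.mirror, show 2 * (i + 1 + 1) - 2 - i = i + 1 + 1 by omega]
        exact h1.trans (h2.trans h3)
      | bar i =>
        simp only [Layer.pos, Layer.top] at hn h'
        obtain rfl : i = n := by omega
        refine Red.left ?_ _
        rw [Layer.mirror, show 2 * (i + 1) - 1 - i = i + 1 by omega]
        exact (LocalMove.birth_bar i true).red
      | _ => cases h

theorem red_mirror_deaths : ∀ {n : ℕ} {e : Layer}, e.IsBraid → e.pos + e.top ≤ n →
    Red (e.mirror n :: deaths n) (e :: deaths n)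
  | 0, e, h, h' => by cases e <;> simp_all [Layer.IsBraid, Layer.top]
  | n + 1, e, h, h' => by
    rw [deaths_succ]
    by_cases hn : e.pos + e.top ≤ n
    · have h1 := (red_swap' (f := death n) h hn).right (deaths n)
      have h2 := (red_mirror_deaths h hn).cons (death n)
      have h3 : Red [e.mirror (n + 1), death n] [death n, e.mirror n] := by
        cases e with
        | cross i c =>
          simp only [Layer.pos, Layer.top] at hn
          have := red_exchange' (death n) (cross (n - 2 - i) c)
          simp only [Layer.shift, Layer.pos, Layer.top, Layer.bottom] at this
          rw [show n - 2 - i + (n + 0) = 2 * n - 2 - i by omega,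
            show n - 2 - i + (n + 2) = 2 * (n + 1) - 2 - i by omega] at this
          exact this
        | bar i =>
          simp only [Layer.pos, Layer.top] at hn
          have := red_exchange' (death n) (bar (n - 1 - i))
          simp only [Layer.shift, Layer.pos, Layer.top, Layer.bottom] at this
          rw [show n - 1 - i + (n + 0) = 2 * n - 1 - i by omega,
            show n - 1 - i + (n + 2) = 2 * (n + 1) - 1 - i by omega] at this
          exact this
        | _ => cases h
      exact (h3.right (deaths n)).trans (h2.trans h1)
    · cases e with
      | cross i c =>
        simp only [Layer.pos, Layer.top] at hn h'
        obtain ⟨n, rfl⟩ : ∃ k, n = k + 1 := ⟨n - 1, by omega⟩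
        obtain rfl : i = n := by omega
        rw [deaths_succ]
        rw [Layer.mirror, show 2 * (i + 1 + 1) - 2 - i = i + 1 + 1 by omega]
        have h1 := (red_cross_death (i + 1) c).right [death i]
        have h2 := (red_exchange' (death i) (death 0)).left [cross (i + 1) c.turn]
        have h3 := (red_cross_death i c.turn).right [death i]
        simp only [Layer.shift, Layer.pos, Layer.top, Layer.bottom, List.cons_append,
          List.nil_append, zero_add, add_zero, turn_turn] at h1 h2 h3
        exact (h1.trans (h2.trans h3)).right (deaths i)
      | bar i =>
        simp only [Layer.pos, Layer.top] at hn h'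
        obtain rfl : i = n := by omega
        rw [Layer.mirror, show 2 * (i + 1) - 1 - i = i + 1 by omega]
        exact (red_bar_death' i).right (deaths i)
      | _ => cases h

/-- The first letter travels once around the closure: through the maxima to the returning strands,
down past all other letters, and through the minima to the bottom of the braid. -/
theorem red_conj {n : ℕ} (g : Gen n) (w : List (Gen n)) :
    Red (closureWord (g :: w)) (closureWord (w ++ [g])) := by
  have h1 := (red_births_mirror g.isBraid g.pos_top).right (w.map Gen.layer ++ deaths n)
  have h2 := (red_swap_list' (f := g.layer.mirror n) (L := w.map Gen.layer) (by
    intro e he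
    obtain ⟨g', -, rfl⟩ := List.mem_map.1 he
    refine ⟨g'.isBraid, g'.pos_top.trans ?_⟩
    have := g.pos_top
    have hb := g.isBraid
    cases hg : g.layer <;> rw [hg] at this hb <;>
      first
      | exact hb.elim
      | (simp only [Layer.mirror, Layer.pos, Layer.top] at this ⊢; omega))).within
    (births n) (deaths n)
  have h3 := (red_mirror_deaths g.isBraid g.pos_top).left (births n ++ w.map Gen.layer)
  simp only [closureWord, List.map_cons, List.map_append, List.map_nil, List.append_assoc,
    List.cons_append, List.nil_append] at h1 h2 h3 ⊢
  exact h1.trans (h2.trans h3)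

theorem Red.link_eq {D D' : Diagram} (h : Red D.1 D'.1) : D.link = D'.link := by
  obtain ⟨h1, e⟩ := h [] [] (by simpa using D.2)
  simp only [List.nil_append, List.append_nil] at e
  exact e

theorem closure_prod {n : ℕ} (w : List (Gen n)) :
    (w.map STVB.of).prod.closure = (closureDiagram w).link := by
  rw [← mk_ofList]
  rfl

theorem STVB.exists_word {n : ℕ} (x : STVB n) : ∃ w : List (Gen n), x = (w.map STVB.of).prod := by
  induction x using Quotient.inductionOn with | _ a =>
  exact ⟨a.toList, mk_ofList a.toList⟩

/-- Applied letter by letter, `red_conj` moves any factor around the closure. This covers the moves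
ST4. -/
theorem closure_mul_comm {n : ℕ} (a b : STVB n) : (a * b).closure = (b * a).closure := by
  obtain ⟨v, rfl⟩ := a.exists_word
  obtain ⟨w, rfl⟩ := b.exists_word
  induction v generalizing w with
  | nil => simp
  | cons g v ih =>
    have h1 := ih (w ++ [g])
    have h2 := (red_conj g (v ++ w)).link_eq (D := closureDiagram _) (D' := closureDiagram _)
    rw [← closure_prod, ← closure_prod] at h2
    simp only [List.map_append, List.prod_append, List.map_cons, List.map_nil, List.prod_cons,
      List.prod_nil, mul_one, mul_assoc] at h1 h2 ⊢
    rw [h2, h1]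

/-! ### Pulled strands -/

theorem map_layer_widen {n : ℕ} (w : List (Gen n)) :
    (w.map Gen.widen).map Gen.layer = w.map Gen.layer := by
  rw [List.map_map]
  refine List.map_congr_left fun g _ => ?_
  cases g <;> rfl

theorem widen_prod {n : ℕ} (w : List (Gen n)) :
    STVB.widen n (w.map STVB.of).prod = ((w.map Gen.widen).map STVB.of).prod := by
  rw [← mk_ofList, ← mk_ofList]
  exact lift_widen_eq _

/-- Part of a braid between the ends of a strand which is cut. -/
theorem red_closure_cut {n : ℕ} (a b : List (Gen n)) (w : List (Gen (n + 1))) :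
    Red (closureWord (a.map Gen.widen ++ w ++ b.map Gen.widen))
      (births n ++ a.map Gen.layer ++ (birth n true :: (w.map Gen.layer ++ [death n])) ++
        (b.map Gen.layer ++ deaths n)) := by
  have key : ∀ (c : List (Gen n)) (f : Layer), f.pos = n → ∀ e ∈ c.map Gen.layer,
      e.IsBraid ∧ e.pos + e.top ≤ f.pos := by
    intro c f hf e he
    obtain ⟨g, -, rfl⟩ := List.mem_map.1 he
    exact ⟨g.isBraid, g.pos_top.trans hf.ge⟩
  have h1 := (red_swap_list' (key a (birth n true) rfl)).within (births n)
    (w.map Gen.layer ++ (b.map Gen.layer ++ (death n :: deaths n)))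
  have h2 := (red_swap_list (key b (death n) rfl)).within
    (births n ++ (a.map Gen.layer ++ (birth n true :: w.map Gen.layer))) (deaths n)
  simp only [closureWord, births_succ, deaths_succ, List.map_append, map_layer_widen,
    List.append_assoc, List.cons_append, List.nil_append] at h1 h2 ⊢
  exact h1.trans h2

/-- The outer runs meet after a cyclic permutation and cancel, so the position `j` of the new ends
is irrelevant for the closure. -/
theorem closure_pulled {n j : ℕ} (p : ℕ) (α K β : STVB (n + 1)) :
    (pulled j p α K β).closure = (α * (runLeft n p * K * runRight n p) * β).closure := by
  rw [pulled, closure_mul_comm]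
  congr 1
  simp only [← mul_assoc]
  rw [runLeft_mul_runRight, one_mul]

/-- The virtual crossings of the strands from `p`, from right to left. -/
def runDown (p : ℕ) : ℕ → List Layer
  | 0 => []
  | k + 1 => runDown (p + 1) k ++ [cross p .virtual]

/-- The virtual crossings of the strands from `p`, from left to right. -/
def runUp (p : ℕ) : ℕ → List Layer
  | 0 => []
  | k + 1 => cross p .virtual :: runUp (p + 1) k

theorem mem_runUp {e : Layer} : ∀ {k p : ℕ}, e ∈ runUp p k → ∃ q, p ≤ q ∧ e = cross q .virtual
  | 0, p, h => by simp [runUp] at h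
  | k + 1, p, h => by
    rcases List.mem_cons.1 h with rfl | h
    · exact ⟨p, le_rfl, rfl⟩
    · obtain ⟨q, hq, rfl⟩ := mem_runUp h
      exact ⟨q, by omega, rfl⟩

theorem mem_runDown {e : Layer} : ∀ {k p : ℕ}, e ∈ runDown p k → ∃ q, p ≤ q ∧ e = cross q .virtual
  | 0, p, h => by simp [runDown] at h
  | k + 1, p, h => by
    rcases List.mem_append.1 h with h | h
    · obtain ⟨q, hq, rfl⟩ := mem_runDown h
      exact ⟨q, by omega, rfl⟩
    · exact ⟨p, le_rfl, List.mem_singleton.1 h⟩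

theorem exists_word_runLeft {n : ℕ} : ∀ {k p : ℕ}, p + k = n → ∃ w : List (Gen (n + 1)),
    w.map Gen.layer = runDown p k ∧ (w.map STVB.of).prod = runLeft n p
  | 0, p, h => ⟨[], rfl, (runLeft_of_ge (by omega)).symm⟩
  | k + 1, p, h => by
    obtain ⟨w, h1, h2⟩ := exists_word_runLeft (k := k) (p := p + 1) (n := n) (by omega)
    refine ⟨w ++ [.virt p (by omega)], by rw [List.map_append, h1]; rfl, ?_⟩
    rw [List.map_append, List.prod_append, h2, runLeft_of_lt (by omega : p < n),
      ← virtGen_eq (by omega)]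
    simp [virtGen]

theorem exists_word_runRight {n : ℕ} : ∀ {k p : ℕ}, p + k = n → ∃ w : List (Gen (n + 1)),
    w.map Gen.layer = runUp p k ∧ (w.map STVB.of).prod = runRight n p
  | 0, p, h => ⟨[], rfl, (runRight_of_ge (by omega)).symm⟩
  | k + 1, p, h => by
    obtain ⟨w, h1, h2⟩ := exists_word_runRight (k := k) (p := p + 1) (n := n) (by omega)
    refine ⟨.virt p (by omega) :: w, by rw [List.map_cons, h1]; rfl, ?_⟩
    rw [List.map_cons, List.prod_cons, h2, runRight_of_lt (by omega : p < n),
      ← virtGen_eq (by omega)]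
    rfl

/-- When the maximum is pulled along with its left leg, it arises at `p`, and its right leg runs
back to the right in place of the left leg running to the left. -/
theorem red_birth_runDown : ∀ (k p : ℕ), Red (birth (p + k) true :: runDown p k)
    (birth p true :: runUp (p + 1) k)
  | 0, p => .refl _
  | k + 1, p => by
    have h1 := (red_birth_runDown k (p + 1)).right [cross p .virtual]
    have h2 := ((red_swap_lists' (L := [cross p .virtual]) (M := runUp (p + 1 + 1) k) (by
      intro f hf e he
      obtain ⟨q, hq, rfl⟩ := mem_runUp hf
      obtain rfl := List.mem_singleton.1 he
      exact ⟨trivial, hq⟩)).cons (birth (p + 1) true))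
    have h3 := (red_birth_cross' p true .virtual).right (runUp (p + 1 + 1) k)
    rw [show p + 1 + k = p + (k + 1) by omega] at h1
    exact h1.trans (h2.trans h3)

theorem red_runUp_death : ∀ (k p : ℕ), Red (runUp p k ++ [death (p + k)])
    (runDown (p + 1) k ++ [death p])
  | 0, p => .refl _
  | k + 1, p => by
    have h1 := (red_runUp_death k (p + 1)).cons (cross p .virtual)
    have h2 := (red_swap_lists (L := [cross p .virtual]) (M := runDown (p + 1 + 1) k) (by
      intro f hf e he
      obtain ⟨q, hq, rfl⟩ := mem_runDown hf
      obtain rfl := List.mem_singleton.1 he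
      exact ⟨trivial, hq⟩)).right [death (p + 1)]
    have h3 := (red_cross_death' p .virtual).left (runDown (p + 1 + 1) k)
    rw [show p + 1 + k = p + (k + 1) by omega] at h1
    simp only [runUp, runDown, Crossing.turn, List.cons_append, List.nil_append,
      List.append_assoc] at h1 h2 h3 ⊢
    exact h1.trans (h2.trans h3)

theorem red_runUp_runDown : ∀ (k p : ℕ), Red (runUp p k ++ runDown p k) []
  | 0, p => .refl _
  | k + 1, p => by
    have h1 := (red_runUp_runDown k (p + 1)).within [cross p .virtual] [cross p .virtual]
    have h2 := (LocalMove.virtual_bigon p).red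
    simp only [runUp, runDown, List.cons_append, List.nil_append, List.append_assoc] at h1 h2 ⊢
    exact h1.trans h2

/-- The ends of a cut strand are pulled to the place of the cut. -/
theorem red_pull (k p : ℕ) (M : List Layer) :
    Red (birth (p + k) true :: (runDown p k ++ (M ++ (runUp p k ++ [death (p + k)]))))
      (birth p true :: (runUp (p + 1) k ++ (M ++ (runDown (p + 1) k ++ [death p])))) := by
  have h1 := (red_birth_runDown k p).right (M ++ (runUp p k ++ [death (p + k)]))
  have h2 := (red_runUp_death k p).left (birth p true :: (runUp (p + 1) k ++ M))
  simp only [List.cons_append, List.append_assoc] at h1 h2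
  exact h1.trans h2

/-- The runs lie entirely to the right of `M`; exchanging one of them with `M` brings them together,
and they cancel. -/
theorem red_pull_far {k p : ℕ} {M : List Layer} (hM : ∀ e ∈ M, e.IsBraid ∧ e.pos + e.top ≤ p) :
    Red (runUp p k ++ (M ++ runDown p k)) M := by
  have h1 := (red_swap_lists' (L := M) (M := runUp p k) (by
    intro f hf e he
    obtain ⟨q, hq, rfl⟩ := mem_runUp hf
    exact ⟨(hM e he).1, (hM e he).2.trans hq⟩)).right (runDown p k)
  have h2 := (red_runUp_runDown k p).left M
  simp only [List.append_assoc, List.append_nil] at h1 h2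
  exact h1.trans h2

end SingTwist

namespace SingTwist

open Layer Crossing

/-! ### The closures of the two sides of an `L_v`-move -/

theorem red_virtual_triangle' (i : ℕ) (c : Crossing) :
    Red [cross (i + 1) .virtual, cross i c, cross (i + 1) .virtual]
      [cross i .virtual, cross (i + 1) c, cross i .virtual] := by
  refine (LocalMove.virtual_triangle i c).red_symm [] [] fun s t h => ?_
  simp only [List.nil_append, List.append_nil, leads_cons, leads_nil, leads_cross] at h ⊢
  obtain ⟨_, ⟨l, r, x, y, hl, rfl, rfl⟩, _, ⟨l2, r2, a, b, hl2, e, rfl⟩, _,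
    ⟨l3, r3, a', b', hl3, e', rfl⟩, rfl⟩ := h
  obtain ⟨l', z, hl', rfl⟩ := exists_concat hl
  obtain ⟨l3', z', hl3', rfl⟩ := exists_concat hl3
  rw [List.append_assoc] at e e'
  obtain ⟨rfl, e1⟩ := List.append_inj e (hl'.trans hl2.symm)
  obtain ⟨rfl, e2⟩ := List.append_inj e' (hl'.trans hl3'.symm)
  simp only [List.cons_append, List.nil_append, List.cons.injEq] at e1 e2
  obtain ⟨rfl, rfl, rfl⟩ := e1
  obtain ⟨rfl, rfl, rfl, rfl⟩ := e2
  exact ⟨_, ⟨l', y :: r, z, x, hl', by simp, rfl⟩, _, ⟨l' ++ [x], r, z, y, by simp [hl'], by simp,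
    rfl⟩, _, ⟨l', z :: r, x, y, hl', by simp, rfl⟩, by simp⟩

/-- The crossings with the thread pass through the maximum and the minimum to the right leg. The
virtual crossing at `i` is disjoint from them there, so they become adjacent and a bigon or flip
move can be applied to them inside a virtual kink. -/
theorem red_thread_right (k i : ℕ) (c d : Crossing) :
    Red (birth (i + 2) true :: (runUp (i + 3) k ++ ([cross (i + 1) c, cross i .virtual,
      cross (i + 1) d] ++ (runDown (i + 3) k ++ [death (i + 2)]))))
      [birth (i + 1) true, cross i .virtual, cross (i + 2) c.turn, cross (i + 2) d.turn,
        death (i + 1)] := by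
  have h1 := (red_pull_far (k := k) (p := i + 3) (M := [cross (i + 1) c, cross i .virtual,
    cross (i + 1) d]) (by simp [Layer.IsBraid, Layer.pos, Layer.top])).within [birth (i + 2) true]
    [death (i + 2)]
  have h2 := (red_birth_cross' (i + 1) true c).right
    [cross i .virtual, cross (i + 1) d, death (i + 2)]
  have h3 := (red_swap' (e := cross i .virtual) (f := cross (i + 2) c.turn) trivial le_rfl).within
    [birth (i + 1) true] [cross (i + 1) d, death (i + 2)]
  have h4 := (red_cross_death' (i + 1) d).left
    [birth (i + 1) true, cross i .virtual, cross (i + 2) c.turn]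
  simp only [List.cons_append, List.nil_append, List.append_assoc] at h1 h2 h3 h4 ⊢
  exact h1.trans (h2.trans (h3.trans h4))

/-- Here the two nearest virtual crossings of each run overlap the box, whence `k + 2`. Virtual
triangles carry the run across the box until the legs of the maximum and of the minimum cross
virtually. Undoing these crossings reverses the two extrema, which accounts for the orientation
`false`. -/
theorem red_thread_left (k i : ℕ) (c d : Crossing) :
    Red (birth i true :: (runUp (i + 1) (k + 2) ++ ([cross i c, cross (i + 1) .virtual,
      cross i d] ++ (runDown (i + 1) (k + 2) ++ [death i]))))
      [birth (i + 1) false, cross (i + 2) .virtual, cross i c.turn, cross i d.turn,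
        death (i + 1)] := by
  have h1 := (red_pull_far (k := k) (p := i + 3) (M := [cross i c, cross (i + 1) .virtual,
    cross i d]) (by simp [Layer.IsBraid, Layer.pos, Layer.top])).within
    [birth i true, cross (i + 1) .virtual, cross (i + 2) .virtual]
    [cross (i + 2) .virtual, cross (i + 1) .virtual, death i]
  have h2 := (red_swap' (e := cross i c) (f := cross (i + 2) .virtual) trivial le_rfl).within
    [birth i true, cross (i + 1) .virtual] [cross (i + 1) .virtual, cross i d,
      cross (i + 2) .virtual, cross (i + 1) .virtual, death i]
  have h3 := (red_swap (e := cross i d) (f := cross (i + 2) .virtual) trivial le_rfl).within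
    [birth i true, cross (i + 1) .virtual, cross i c, cross (i + 2) .virtual,
      cross (i + 1) .virtual] [cross (i + 1) .virtual, death i]
  -- The run passes the virtual crossing of the box, and after it the crossings `c` and `d` with the
  -- thread.
  have h4 := (red_virtual_triangle' (i + 1) .virtual).within
    [birth i true, cross (i + 1) .virtual, cross i c] [cross i d, cross (i + 1) .virtual, death i]
  have h5 := (red_virtual_triangle' i c).within [birth i true]
    [cross (i + 2) .virtual, cross (i + 1) .virtual, cross i d, cross (i + 1) .virtual, death i]
  have h6 := (red_virtual_triangle' i d).within
    [birth i true, cross i .virtual, cross (i + 1) c, cross i .virtual, cross (i + 2) .virtual]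
    [death i]
  have h7 := (red_swap (e := cross i .virtual) (f := cross (i + 2) .virtual) trivial le_rfl).within
    [birth i true, cross i .virtual, cross (i + 1) c]
    [cross i .virtual, cross (i + 1) d, cross i .virtual, death i]
  have h8 := (LocalMove.virtual_bigon i).red.within
    [birth i true, cross i .virtual, cross (i + 1) c, cross (i + 2) .virtual]
    [cross (i + 1) d, cross i .virtual, death i]
  have h9 := (red_birth_virtual i true).right
    [cross (i + 1) c, cross (i + 2) .virtual, cross (i + 1) d, cross i .virtual, death i]
  have h10 := (red_virtual_death i).left
    [birth i false, cross (i + 1) c, cross (i + 2) .virtual, cross (i + 1) d]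
  have h11 := (red_birth_cross i false c).right
    [cross (i + 2) .virtual, cross (i + 1) d, death i]
  have h12 := (red_swap (e := cross i c.turn) (f := cross (i + 2) .virtual) trivial le_rfl).within
    [birth (i + 1) false] [cross (i + 1) d, death i]
  have h13 := (red_cross_death i d).left
    [birth (i + 1) false, cross (i + 2) .virtual, cross i c.turn]
  simp only [List.cons_append, List.nil_append, List.append_assoc, runUp, runDown, Bool.not_true]
    at h1 h2 h3 h4 h5 h6 h7 h8 h9 h10 h11 h12 h13 ⊢
  exact h1.trans (h2.trans (h3.trans (h4.trans (h5.trans (h6.trans (h7.trans (h8.trans (h9.trans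
    (h10.trans (h11.trans (h12.trans h13)))))))))))

/-- The closure of a braid with a cut strand, in terms of the place of the cut. -/
theorem exists_diagram_pulled {n j p k : ℕ} (hp : p + k = n) (a b : List (Gen n))
    (w : List (Gen (n + 1))) {M : List Layer}
    (h : Red (birth p true :: (runUp (p + 1) k ++ (w.map Gen.layer ++
      (runDown (p + 1) k ++ [death p])))) M) :
    ∃ D : Diagram, D.1 = births n ++ (a.map Gen.layer ++ (M ++ (b.map Gen.layer ++ deaths n))) ∧
      (pulled j p (STVB.widen n (a.map STVB.of).prod) (w.map STVB.of).prod
        (STVB.widen n (b.map STVB.of).prod)).closure = D.link := by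
  subst hp
  obtain ⟨l, hl, hl'⟩ := exists_word_runLeft (k := k) (p := p) rfl
  obtain ⟨r, hr, hr'⟩ := exists_word_runRight (k := k) (p := p) rfl
  rw [closure_pulled, widen_prod, widen_prod, ← hl', ← hr']
  have h1 := red_closure_cut a b (l ++ w ++ r)
  have h2 := ((red_pull k p (w.map Gen.layer)).trans h).within
    (births (p + k) ++ a.map Gen.layer) (b.map Gen.layer ++ deaths (p + k))
  simp only [List.map_append, hl, hr, List.append_assoc, List.cons_append] at h1 h2
  obtain ⟨h3, e⟩ := (h1.trans h2) [] [] (by simpa using leads_closureWord _)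
  simp only [List.nil_append, List.append_nil] at h3 e
  refine ⟨⟨_, h3⟩, rfl, ?_⟩
  rw [← e, ← List.prod_append, ← List.prod_append, ← List.prod_append, ← List.prod_append,
    ← List.map_append, ← List.map_append, ← List.map_append, ← List.map_append, closure_prod]
  congr 2
  simp

theorem closure_pulled_eq {n j p k : ℕ} (hp : p + k = n) (α β : STVB n)
    (w : List (Gen (n + 1)))
    (h : Red (birth p true :: (runUp (p + 1) k ++ (w.map Gen.layer ++
      (runDown (p + 1) k ++ [death p])))) []) :
    (pulled j p (STVB.widen n α) (w.map STVB.of).prod (STVB.widen n β)).closure =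
      (α * β).closure := by
  obtain ⟨a, rfl⟩ := α.exists_word
  obtain ⟨b, rfl⟩ := β.exists_word
  obtain ⟨D, hD, e⟩ := exists_diagram_pulled (j := j) hp a b w h
  rw [e, ← List.prod_append, ← List.map_append, closure_prod]
  congr 1
  refine Subtype.ext ?_
  rw [hD]
  simp [closureDiagram, closureWord]

/-- In the moves of type 3 both braids have an additional strand, so their closures are compared
through a common diagram with middle part `M`. -/
theorem closure_pulled_congr {n j p k : ℕ} (hp : p + k = n) (α β : STVB n)
    {w w' : List (Gen (n + 1))} {M : List Layer}
    (h : Red (birth p true :: (runUp (p + 1) k ++ (w.map Gen.layer ++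
      (runDown (p + 1) k ++ [death p])))) M)
    (h' : Red (birth p true :: (runUp (p + 1) k ++ (w'.map Gen.layer ++
      (runDown (p + 1) k ++ [death p])))) M) :
    (pulled j p (STVB.widen n α) (w.map STVB.of).prod (STVB.widen n β)).closure =
      (pulled j p (STVB.widen n α) (w'.map STVB.of).prod (STVB.widen n β)).closure := by
  obtain ⟨a, rfl⟩ := α.exists_word
  obtain ⟨b, rfl⟩ := β.exists_word
  obtain ⟨D, hD, e⟩ := exists_diagram_pulled (j := j) hp a b w h
  obtain ⟨D', hD', e'⟩ := exists_diagram_pulled (j := j) hp a b w' h'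
  rw [e, e']
  exact congrArg _ (Subtype.ext (hD.trans hD'.symm))

theorem red_kink {k i : ℕ} {c : Crossing}
    (h : Red [birth (i + 1) true, cross i c, death (i + 1)] []) :
    Red (birth (i + 1) true :: (runUp (i + 1 + 1) k ++ ([cross i c] ++
      (runDown (i + 1 + 1) k ++ [death (i + 1)])))) [] := by
  have h1 := (red_pull_far (k := k) (p := i + 2) (M := [cross i c])
    (by simp [Layer.IsBraid, Layer.pos, Layer.top])).within [birth (i + 1) true] [death (i + 1)]
  simp only [List.cons_append, List.nil_append, List.append_assoc] at h1 ⊢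
  exact h1.trans h

/-- The real generator with a given sign. -/
def realLetter {n : ℕ} (e : Bool) (i : ℕ) (h : i + 1 < n) : Gen n := crossGen (realCross e) i h

theorem realGen_eq_of {n : ℕ} (e : Bool) (i : ℕ) (h : i + 1 < n) :
    realGen e i h = STVB.of (realLetter e i h) := by
  cases e <;> rfl

theorem realLetter_layer {n : ℕ} (e : Bool) (i : ℕ) (h : i + 1 < n) :
    (realLetter e i h).layer = cross i (realCross e) := by
  cases e <;> rfl

theorem realCross_isReal (e : Bool) : (realCross e).IsReal := by
  cases e
  exacts [.inl rfl, .inr rfl]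

/-- Once the new strand is pulled to the cut, type 1 is the removal of a kink. In type 2 the
crossings with the thread form a bigon, after which a virtual kink remains. In type 3 they are
exchanged by a flip. -/
theorem LvMove.closure_eq {x y : Σ n, STVB n} (h : LvMove x y) : x.2.closure = y.2.closure := by
  cases h with
  | @virtual_one n α β j i hj hi =>
    have := closure_pulled_eq (j := j) (Nat.add_sub_of_le (Nat.lt_succ_iff.1 hi)) α β [.virt i hi]
      (red_kink (LocalMove.virtual_kink_right i true).red)
    simpa [virtGen] using this.symm
  | @real_one n e α β j i hj hi =>
    have := closure_pulled_eq (j := j) (Nat.add_sub_of_le (Nat.lt_succ_iff.1 hi)) α β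
      [realLetter e i hi] (by
        rw [List.map_singleton, realLetter_layer]
        exact red_kink (LocalMove.real_kink_right i true _ (realCross_isReal e)).red)
    simpa [realGen_eq_of] using this.symm
  | @under_right n α β j i hj hi hi' =>
    have h1 := (red_thread_right (n - (i + 2)) i .leftOver .rightOver).trans
      ((LocalMove.real_bigon (i + 2) .rightOver (.inr rfl)).red.within
        [birth (i + 1) true, cross i .virtual] [death (i + 1)])
    have h2 := h1.trans (LocalMove.virtual_kink_right i true).red
    have := closure_pulled_eq (j := j) (Nat.add_sub_of_le (Nat.lt_succ_iff.1 hi')) α β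
      [.sigmaInv (i + 1) hi', .virt i hi, .sigma (i + 1) hi'] h2
    simpa [mul_assoc, virtGen, realGen] using this.symm
  | @under_left n α β j i hj hi hi' =>
    have h1 := (red_thread_left (n - (i + 2)) i .rightOver .leftOver).trans
      ((LocalMove.real_bigon i .leftOver (.inl rfl)).red.within
        [birth (i + 1) false, cross (i + 2) .virtual] [death (i + 1)])
    have h2 := h1.trans (LocalMove.virtual_kink_left (i + 1) false).red
    -- The number `n - i` of virtual crossings is split into the far ones and the two near ones, as
    -- `red_thread_left` requires.
    have := closure_pulled_eq (j := j) (p := i) (k := n - (i + 2) + 2) (by omega) α β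
      [.sigma i hi, .virt (i + 1) hi', .sigmaInv i hi] h2
    simpa [mul_assoc, virtGen, realGen] using this.symm
  | @rs_right n e α β j i hj hi hi' =>
    have h1 := red_thread_right (n - (i + 2)) i .singular (realCross e)
    have h2 := (red_thread_right (n - (i + 2)) i (realCross e) .singular).trans
      ((LocalMove.singular_flip (i + 2) _ (realCross_isReal e).turn).red.within
        [birth (i + 1) true, cross i .virtual] [death (i + 1)])
    have := closure_pulled_congr (j := j) (Nat.add_sub_of_le (Nat.lt_succ_iff.1 hi')) α β
      (w := [.tau (i + 1) hi', .virt i hi, realLetter e (i + 1) hi'])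
      (w' := [realLetter e (i + 1) hi', .virt i hi, .tau (i + 1) hi'])
      (by rw [List.map_cons, List.map_cons, List.map_cons, realLetter_layer]; exact h1)
      (by rw [List.map_cons, realLetter_layer]; exact h2)
    simpa [mul_assoc, virtGen, tauGen, realGen_eq_of] using this
  | @rs_left n e α β j i hj hi hi' =>
    have h1 := red_thread_left (n - (i + 2)) i .singular (realCross e)
    have h2 := (red_thread_left (n - (i + 2)) i (realCross e) .singular).trans
      ((LocalMove.singular_flip i _ (realCross_isReal e).turn).red.within
        [birth (i + 1) false, cross (i + 2) .virtual] [death (i + 1)])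
    have := closure_pulled_congr (j := j) (p := i) (k := n - (i + 2) + 2) (by omega) α β
      (w := [.tau i hi, .virt (i + 1) hi', realLetter e i hi])
      (w' := [realLetter e i hi, .virt (i + 1) hi', .tau i hi])
      (by rw [List.map_cons, List.map_cons, List.map_cons, realLetter_layer]; exact h1)
      (by rw [List.map_cons, realLetter_layer]; exact h2)
    simpa [mul_assoc, virtGen, tauGen, realGen_eq_of] using this
  | real_conj e α i hi => exact closure_mul_comm _ _
  | singular_conj α i hi => exact closure_mul_comm _ _
  | twist_conj α i hi => exact closure_mul_comm _ _

theorem LvEquiv.closure_eq {x y : Σ n, STVB n} (h : LvEquiv x y) : x.2.closure = y.2.closure := by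
  induction h with
  | rel _ _ h => exact h.closure_eq
  | refl => rfl
  | symm _ _ _ ih => exact ih.symm
  | trans _ _ _ _ _ ih ih' => exact ih.trans ih'

end SingTwist

theorem mainTheorem1 (m n : ℕ) (a : SingTwist.STVB m) (b : SingTwist.STVB n) :
    a.closure = b.closure ↔ SingTwist.LvEquiv ⟨m, a⟩ ⟨n, b⟩ :=
  ⟨SingTwist.lvEquiv_of_closure_eq, fun h => h.closure_eq⟩
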